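/- For a string $S = S[1]\cdots S[n]$ and a string $X$ let $\mathrm{occ}_S(X)$ be the number of positions at which $X$ occurs in $S$. A substring $P=S[i..j]$ ($1\le i\le j\le n$) is a \emph{minimal unique palindromic substring} (MUPS) of $S$ if $P$ is a palindrome, $\mathrm{occ}_S(P)=1$, and either $|P|\ge 3$ and $\mathrm{occ}_S(S[i+1..j-1])\ge 2$, or $1\le |P|\le 2$. Let $\mathcal M_S$ be the list of all MUPSs of $S$, given by their intervals $[i,j]$ and sorted in increasing order of their beginning positions $i$. For a non-empty string $S$ over an ordered alphabet $\Sigma=\{0,\dots,\sigma-1\}$, let $\mathrm{RLE}_S=(a_1,e_1),\dots,(a_m,e_m)$ be its run-length encoding ($S=a_1^{e_1}\cdots a_m^{e_m}$, $e_k\ge 1$, $a_k\ne a_{k+1}$), $m$ its size, and $\sigma_{RLE}$ the number of distinct pairs among $(a_1,e_1),\dots,(a_m,e_m)$. \textbf{Lemma.} There is a word-RAM algorithm that, for every non-empty string $S$, computes $\mathcal M_S$ from $\mathrm{RLE}_S$ in $O(m\log\sigma_{RLE})$ time and $O(m)$ words of space. More precisely, there are one word-RAM program and one constant $C$ such that,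 for every $\sigma$, every non-empty $S\in\Sigma^*$ of length $n$, and every word length $w$ with $\sigma\le 2^w$ and $Cn<2^w$, the program, started with $\mathrm{RLE}_S$ in a memory of $Cm$ words of $w$ bits each (input, working space and output included), halts with the list $\mathcal M_S$ in this memory after at most $C\,m\max\{1,\log_2\sigma_{RLE}\}$ steps. (If $m\ge 2$, then $\sigma_{RLE}\ge 2$, and the bound is $C\,m\log_2\sigma_{RLE}$.) -/

import Mathlib

/-! ### Strings, occurrences and minimal unique palindromic substrings

A string over the alphabet `α` is a `List α`.  Positions are counted from `1`, as is usual for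
strings. -/

/-- The substring `S[i..j]` (positions counted from `1`, both ends included); it is the empty
string when `i > j`. -/
def substr {α : Type*} (S : List α) (i j : ℕ) : List α :=
  (S.drop (i - 1)).take (j + 1 - i)

/-- `occ_S(X)`: the number of positions `i` at which `X` occurs in `S`. -/
def occ {α : Type*} [DecidableEq α] (S X : List α) : ℕ :=
  ((Finset.Icc 1 (S.length + 1 - X.length)).filter
    (fun i => substr S i (i + X.length - 1) = X)).card

/-- `S[i..j]` is a minimal unique palindromic substring of `S`. -/
structure IsMUPS {α : Type*} [DecidableEq α] (S : List α) (i j : ℕ) : Prop where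
  one_le : 1 ≤ i
  le : i ≤ j
  le_length : j ≤ S.length
  palindrome : (substr S i j).reverse = substr S i j
  unique : occ S (substr S i j) = 1
  minimal : (3 ≤ (substr S i j).length ∧ 2 ≤ occ S (substr S (i + 1) (j - 1))) ∨
    (1 ≤ (substr S i j).length ∧ (substr S i j).length ≤ 2)

/-- `L` is the list of all the MUPSs of `S`, each given by its interval `(i, j)` of positions,
sorted in increasing order of their beginning positions. -/
structure IsMUPSList {α : Type*} [DecidableEq α] (S : List α) (L : List (ℕ × ℕ)) : Prop where
  sorted : L.Pairwise (fun p q => p.1 < q.1)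
  mem_iff : ∀ i j : ℕ, (i, j) ∈ L ↔ IsMUPS S i j

/-- `R = (a₁, e₁), …, (a_m, e_m)` is the run-length encoding of `S`: every exponent is positive,
consecutive runs have distinct characters, and `S = a₁^e₁ ⋯ a_m^e_m`. -/
structure IsRLE {α : Type*} (R : List (α × ℕ)) (S : List α) : Prop where
  pos : ∀ r ∈ R, 1 ≤ r.2
  chain : R.IsChain (fun r r' => r.1 ≠ r'.1)
  expand : R.flatMap (fun r => List.replicate r.2 r.1) = S

/-! ### The word RAM

Registers and memory cells hold words of `w` bits, that is, natural numbers below `2 ^ w`.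
Programs are structured programs over a fixed finite set of registers (those that occur in the
program) and a random access memory of `M` words.  Every arithmetic, bitwise or comparison
operation, every access to a register, a constant or a memory cell, and every assignment and every
test costs one unit of time.  An access to an address that is not below `M` is an error: the
machine gets stuck, and such an execution does not exist. -/

namespace WordRAM

/-- The binary operations on words. -/
inductive Op
  | add | sub | mul | div | mod | and | or | xor | shl | shr | lt | eq

/-- The result of an operation on two words of `w` bits; the arithmetic is modulo `2 ^ w`, and
comparisons return `1` for true and `0` for false. -/
def Op.eval (w : ℕ) (x y : ℕ) : Op → ℕ
  | .add => (x + y) % 2 ^ w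
  | .sub => (x + (2 ^ w - y)) % 2 ^ w
  | .mul => (x * y) % 2 ^ w
  | .div => (x / y) % 2 ^ w
  | .mod => (x % y) % 2 ^ w
  | .and => (x &&& y) % 2 ^ w
  | .or => (x ||| y) % 2 ^ w
  | .xor => (x ^^^ y) % 2 ^ w
  | .shl => (x <<< y) % 2 ^ w
  | .shr => (x >>> y) % 2 ^ w
  | .lt => (if x < y then 1 else 0) % 2 ^ w
  | .eq => (if x = y then 1 else 0) % 2 ^ w

/-- Expressions: constants, registers, operations, and the content of a memory cell whose address
is computed. -/
inductive Exp
  | lit (c : ℕ)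
  | reg (x : ℕ)
  | bin (o : Op) (a b : Exp)
  | load (a : Exp)

/-- Programs. -/
inductive Prog
  /-- do nothing -/
  | skip
  /-- put the value of an expression into register `x` -/
  | assign (x : ℕ) (e : Exp)
  /-- put the value of `e` into the memory cell with address `a` -/
  | store (a e : Exp)
  /-- run one program after the other -/
  | seq (p q : Prog)
  /-- run `p` if the value of `e` is not `0`, and `q` otherwise -/
  | cond (e : Exp) (p q : Prog)
  /-- run `p` as long as the value of `e` is not `0` -/
  | loop (e : Exp) (p : Prog)

/-- The contents of the registers and of the memory. -/
structure State where
  reg : ℕ → ℕ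
  mem : ℕ → ℕ

/-- The value of an expression on a machine with `w`-bit words and `M` memory cells; `none` if an
address out of range is accessed. -/
def Exp.eval (w M : ℕ) (s : State) : Exp → Option ℕ
  | .lit c => some (c % 2 ^ w)
  | .reg x => some (s.reg x)
  | .bin o a b =>
    (a.eval w M s).bind fun x => (b.eval w M s).bind fun y => some (o.eval w x y)
  | .load a => (a.eval w M s).bind fun i => if i < M then some (s.mem i) else none

/-- The time that the evaluation of an expression takes. -/
def Exp.cost : Exp → ℕ
  | .lit _ => 1
  | .reg _ => 1
  | .bin _ a b => a.cost + b.cost + 1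
  | .load a => a.cost + 1

/-- `Exec w M p s s' t`: on a machine with `w`-bit words and `M` memory cells, the program `p`
started in the state `s` halts in the state `s'` after `t` units of time, and it accesses no memory
cell with an address `≥ M`. -/
inductive Exec (w M : ℕ) : Prog → State → State → ℕ → Prop
  | skip (s : State) : Exec w M .skip s s 1
  | assign (s : State) (x : ℕ) (e : Exp) (v : ℕ) (hv : e.eval w M s = some v) :
      Exec w M (.assign x e) s { s with reg := Function.update s.reg x v } (e.cost + 1)
  | store (s : State) (a e : Exp) (i v : ℕ) (hi : a.eval w M s = some i) (hM : i < M)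
      (hv : e.eval w M s = some v) :
      Exec w M (.store a e) s { s with mem := Function.update s.mem i v } (a.cost + e.cost + 1)
  | seq (p q : Prog) (s s' s'' : State) (t t' : ℕ) (hp : Exec w M p s s' t)
      (hq : Exec w M q s' s'' t') : Exec w M (.seq p q) s s'' (t + t')
  | cond_true (e : Exp) (p q : Prog) (s s' : State) (v t : ℕ) (hv : e.eval w M s = some v)
      (h0 : v ≠ 0) (hp : Exec w M p s s' t) : Exec w M (.cond e p q) s s' (e.cost + 1 + t)
  | cond_false (e : Exp) (p q : Prog) (s s' : State) (t : ℕ) (hv : e.eval w M s = some 0)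
      (hq : Exec w M q s s' t) : Exec w M (.cond e p q) s s' (e.cost + 1 + t)
  | loop_true (e : Exp) (p : Prog) (s s' s'' : State) (v t t' : ℕ)
      (hv : e.eval w M s = some v) (h0 : v ≠ 0) (hp : Exec w M p s s' t)
      (hl : Exec w M (.loop e p) s' s'' t') : Exec w M (.loop e p) s s'' (e.cost + 1 + t + t')
  | loop_false (e : Exp) (p : Prog) (s : State) (hv : e.eval w M s = some 0) :
      Exec w M (.loop e p) s s (e.cost + 1)

/-- The initial state for an input `R = (a₁, e₁), …, (a_m, e_m)` over the ordered alphabet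
`{0, …, σ - 1}`: register `0` holds `m`, the memory holds `a₁, e₁, …, a_m, e_m` from address `0`
on, and all other registers and cells hold `0`. -/
def input {σ : ℕ} (R : List (Fin σ × ℕ)) : State where
  reg := fun x => if x = 0 then R.length else 0
  mem := fun i => (R.flatMap fun r => [(r.1 : ℕ), r.2]).getD i 0

/-- In the state `s` of a machine with `M` memory cells, the list `L = (i₁, j₁), …, (i_k, j_k)` is
the output: register `0` holds `k`, and the memory holds `i₁, j₁, …, i_k, j_k` from the address in
register `1` on. -/
def IsOutput (M : ℕ) (s : State) (L : List (ℕ × ℕ)) : Prop :=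
  s.reg 0 = L.length ∧ s.reg 1 + 2 * L.length ≤ M ∧
    ∀ (t : ℕ) (ht : t < L.length),
      s.mem (s.reg 1 + 2 * t) = L[t].1 ∧ s.mem (s.reg 1 + 2 * t + 1) = L[t].2

end WordRAM

/-! ### A programming language with arrays on top of the word RAM -/

namespace RLEMups

/-! Combinatorial core. Let each run become one letter `U c` naming its pair of character and
exponent. Adjacent runs have different characters, so a palindrome of `S` lies inside one run or
spans `2 * k + 1` runs around a middle run `c`: the runs at distance less than `k` from `c` match in
pairs as letters of `U`, the two outermost runs agree in character, and each contributes an end of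
the same length `l`, at most the smaller of their exponents, `val` (`RD.pal_cases`). Thus a
palindrome is a centre `c`, a level `k` and an end `l`. It occurs elsewhere exactly when another
centre has, at level `k`, the same arm and the same end character (a `Grp`) and a value at least `l`
(`Adm.repeat_iff`).

Palindromes with a common centre are nested, so each centre has at most one minimal unique one. It
belongs to the first level at which the value of `c` strictly exceeds the values of all other
centres of the group; its end is one more than the largest of these other values, or it is the whole
run if the level is `0` (`First.mups`, `MUPS.first`). Beginning positions increase with the centres
(`Res.lt`), so treating the centres from left to right gives a sorted list of at most `m` entries.

Algorithm. The distinct runs are sorted by merging a queue of lists in which duplicates are dropped.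
No list is longer than the number `s` of distinct runs; therefore about `log s` passes cost `O(m)`
each and the later passes decrease geometrically (`queueCost_le`). Binary search then gives every
run its number. The palindromic tree of the word `U`, with a sentinel at either end, is built with
children kept in digital search trees over keys of `O(log s)` bits; amortisation along suffix links
leaves `O(m)` lookups. The same walk yields the node of the maximal palindrome at every centre, by
copying mirror images (`Eer.copy`).

A group of level `k` is a tree node of half-length `k` together with an end character. A member of
the group either continues to a child of this node, where all centres share one value, or has its
maximal palindrome there. A pass from the leaves upwards collects for every group its two largest
values with multiplicity. The second largest is all that is needed: the value of a centre is
uniquely maximal iff it exceeds the second largest, and then the second largest is the maximum over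
the other centres (`GInv.uniq_iff`). A pass downwards finds the first unique level on each root
path.

Machine. Programs are verified in a language with arrays over `ℕ` whose side conditions exclude
overflow; loop invariants carry time credits (`wp_whl`), and the translation to the word RAM costs a
constant factor (`HExec.comp`). The arrays hold: 0 run number, 1 character number, 2 exponent, 3
start of a run; 4 node of the maximal palindrome of a centre; 5 to 9 the dictionary; 10 half-length
and 11 suffix link of a node; 12 counts; 13 and 14 the two largest values of a group; 15 group of a
node, 16 its first unique ancestor, 17 group of a centre; 19 and 20 linked lists and queue; 23 and
24 character number and exponent of a run number; 25 and 27 input characters, indexed by run and by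
run number. -/

/-- States of the array language: registers, arrays (numbered, each indexed by `ℕ`), and the
input/output area. -/
structure HS where
  r : ℕ → ℕ
  A : ℕ → ℕ → ℕ
  io : ℕ → ℕ

/-- Assign the value `v` to the register `x`. -/
def HS.set (h : HS) (x v : ℕ) : HS := { h with r := Function.update h.r x v }

/-- Put the value `v` into the cell `j` of the array `f`. -/
def HS.st (h : HS) (f j v : ℕ) : HS :=
  { h with A := fun f' j' => if f' = f ∧ j' = j then v else h.A f' j' }

/-- Put the value `v` into the cell `i` of the input/output area. -/
def HS.stio (h : HS) (i v : ℕ) : HS := { h with io := Function.update h.io i v }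

section
variable (h : HS) (x v f j y f' j' i i' : ℕ)
@[simp] theorem HS.set_r : (h.set x v).r y = if y = x then v else h.r y := by
  simp [HS.set, Function.update_apply]
@[simp] theorem HS.set_A : (h.set x v).A = h.A := rfl
@[simp] theorem HS.set_io : (h.set x v).io = h.io := rfl
@[simp] theorem HS.st_r : (h.st f j v).r = h.r := rfl
@[simp] theorem HS.st_A :
    (h.st f j v).A f' j' = if f' = f ∧ j' = j then v else h.A f' j' := rfl
@[simp] theorem HS.st_io : (h.st f j v).io = h.io := rfl
@[simp] theorem HS.stio_r : (h.stio i v).r = h.r := rfl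
@[simp] theorem HS.stio_A : (h.stio i v).A = h.A := rfl
@[simp] theorem HS.stio_io : (h.stio i v).io i' = if i' = i then v else h.io i' := by
  simp [HS.stio, Function.update_apply]
end

/-- The arithmetic operations of the array language. -/
inductive HOp
  | add | sub | mul | div | mod | lt | eq

/-- Expressions of the array language. -/
inductive HE
  | lit (c : ℕ)
  | reg (x : ℕ)
  | arr (f j : HE)
  | io (a : HE)
  | bin (o : HOp) (a b : HE)

instance (n : ℕ) : OfNat HE n := ⟨.lit n⟩
instance : Add HE := ⟨.bin .add⟩
instance : Sub HE := ⟨.bin .sub⟩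
instance : Mul HE := ⟨.bin .mul⟩
instance : Div HE := ⟨.bin .div⟩
instance : Mod HE := ⟨.bin .mod⟩

/-- The sizes of a machine: the number of runs, the number of words, the number of records. -/
structure Cx where
  m : ℕ
  B : ℕ
  cap : ℕ

/-- The value of an operation on natural numbers. -/
def HOp.val (x y : ℕ) : HOp → ℕ
  | .add => x + y
  | .sub => x - y
  | .mul => x * y
  | .div => x / y
  | .mod => x % y
  | .lt => if x < y then 1 else 0
  | .eq => if x = y then 1 else 0

/-- The operation does not overflow. -/
def HOp.ok (B x y : ℕ) : HOp → Prop
  | .add => x + y < B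
  -- The machine wraps around where subtraction on `ℕ` truncates, so both must be excluded.
  | .sub => y ≤ x ∧ x < B
  | .mul => x * y < B
  | .div => x < B
  | .mod => x < B
  | .lt => True
  | .eq => True

/-- The value of an expression. -/
def HE.val (h : HS) : HE → ℕ
  | .lit c => c
  | .reg x => h.r x
  | .arr f j => h.A (f.val h) (j.val h)
  | .io a => h.io (a.val h)
  | .bin o a b => o.val (a.val h) (b.val h)

/-- The evaluation of an expression does not overflow and stays inside the arrays. -/
def HE.ok (Γ : Cx) (h : HS) : HE → Prop
  | .lit c => c < 64
  | .reg _ => True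
  | .arr f j => f.ok Γ h ∧ j.ok Γ h ∧ f.val h < 32 ∧ j.val h < Γ.cap
  | .io a => a.ok Γ h ∧ a.val h < 2 * Γ.m
  | .bin o a b => a.ok Γ h ∧ b.ok Γ h ∧ o.ok Γ.B (a.val h) (b.val h)

/-- Less than. -/
def HE.lt (a b : HE) : HE := .bin .lt a b
/-- Equal. -/
def HE.eq (a b : HE) : HE := .bin .eq a b
/-- Different. -/
def HE.ne (a b : HE) : HE := .bin .lt (.bin .eq a b) (.lit 1)

section
variable (Γ : Cx) (h : HS) (a b : HE) (n : ℕ)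
@[simp] theorem HE.val_ofNat : (ofNat(n) : HE).val h = (OfNat.ofNat n : ℕ) := rfl
@[simp] theorem HE.val_reg : (HE.reg n).val h = h.r n := rfl
@[simp] theorem HE.val_arr : (HE.arr a b).val h = h.A (a.val h) (b.val h) := rfl
@[simp] theorem HE.val_io : (HE.io a).val h = h.io (a.val h) := rfl
@[simp] theorem HE.val_add : (a + b).val h = a.val h + b.val h := rfl
@[simp] theorem HE.val_sub : (a - b).val h = a.val h - b.val h := rfl
@[simp] theorem HE.val_mul : (a * b).val h = a.val h * b.val h := rfl
@[simp] theorem HE.val_div : (a / b).val h = a.val h / b.val h := rfl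
@[simp] theorem HE.val_mod : (a % b).val h = a.val h % b.val h := rfl
@[simp] theorem HE.val_lt : (a.lt b).val h = if a.val h < b.val h then 1 else 0 := rfl
@[simp] theorem HE.val_eq : (a.eq b).val h = if a.val h = b.val h then 1 else 0 := rfl
@[simp] theorem HE.val_ne : (a.ne b).val h = if a.val h = b.val h then 0 else 1 := by
  by_cases hh : a.val h = b.val h <;> simp [HE.ne, HE.val, HOp.val, hh]
@[simp] theorem HE.ok_ofNat : (ofNat(n) : HE).ok Γ h ↔ (OfNat.ofNat n : ℕ) < 64 := Iff.rfl
@[simp] theorem HE.ok_reg : (HE.reg n).ok Γ h ↔ True := Iff.rfl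
@[simp] theorem HE.ok_arr : (HE.arr a b).ok Γ h ↔
    a.ok Γ h ∧ b.ok Γ h ∧ a.val h < 32 ∧ b.val h < Γ.cap := Iff.rfl
@[simp] theorem HE.ok_io : (HE.io a).ok Γ h ↔ a.ok Γ h ∧ a.val h < 2 * Γ.m := Iff.rfl
@[simp] theorem HE.ok_add : (a + b).ok Γ h ↔
    a.ok Γ h ∧ b.ok Γ h ∧ a.val h + b.val h < Γ.B := Iff.rfl
@[simp] theorem HE.ok_sub : (a - b).ok Γ h ↔
    a.ok Γ h ∧ b.ok Γ h ∧ b.val h ≤ a.val h ∧ a.val h < Γ.B := Iff.rfl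
@[simp] theorem HE.ok_mul : (a * b).ok Γ h ↔
    a.ok Γ h ∧ b.ok Γ h ∧ a.val h * b.val h < Γ.B := Iff.rfl
@[simp] theorem HE.ok_div : (a / b).ok Γ h ↔ a.ok Γ h ∧ b.ok Γ h ∧ a.val h < Γ.B := Iff.rfl
@[simp] theorem HE.ok_mod : (a % b).ok Γ h ↔ a.ok Γ h ∧ b.ok Γ h ∧ a.val h < Γ.B := Iff.rfl
@[simp] theorem HE.ok_lt : (a.lt b).ok Γ h ↔ a.ok Γ h ∧ b.ok Γ h := by
  simp [HE.lt, HE.ok, HOp.ok]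
@[simp] theorem HE.ok_eq : (a.eq b).ok Γ h ↔ a.ok Γ h ∧ b.ok Γ h := by
  simp [HE.eq, HE.ok, HOp.ok]
@[simp] theorem HE.ok_ne : (a.ne b).ok Γ h ↔ a.ok Γ h ∧ b.ok Γ h := by
  simp [HE.ne, HE.ok, HOp.ok]
end

/-- Programs of the array language. -/
inductive HP
  | skip
  | asg (x : ℕ) (e : HE)
  | sto (f j e : HE)
  | out (a e : HE)
  | seq (p q : HP)
  | ite (e : HE) (p q : HP)
  | whl (e : HE) (p : HP)

infixr:60 " ;; " => HP.seq

/-- The execution of a program of the array language; each elementary step costs one unit of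
time. Register `0` is read-only. -/
inductive HExec (Γ : Cx) : HP → HS → HS → ℕ → Prop
  | skip (h : HS) : HExec Γ .skip h h 1
  | asg (h : HS) (x : ℕ) (e : HE) (hx : x ≠ 0) (he : e.ok Γ h) :
      HExec Γ (.asg x e) h (h.set x (e.val h)) 1
  | sto (h : HS) (f j e : HE) (hf : f.ok Γ h) (hj : j.ok Γ h) (he : e.ok Γ h)
      (hf' : f.val h < 32) (hj' : j.val h < Γ.cap) :
      HExec Γ (.sto f j e) h (h.st (f.val h) (j.val h) (e.val h)) 1
  | out (h : HS) (a e : HE) (ha : a.ok Γ h) (he : e.ok Γ h) (ha' : a.val h < 2 * Γ.m) :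
      HExec Γ (.out a e) h (h.stio (a.val h) (e.val h)) 1
  | seq (p q : HP) (h h' h'' : HS) (t t' : ℕ) (hp : HExec Γ p h h' t) (hq : HExec Γ q h' h'' t') :
      HExec Γ (.seq p q) h h'' (t + t')
  | ite_true (e : HE) (p q : HP) (h h' : HS) (t : ℕ) (he : e.ok Γ h) (h0 : e.val h ≠ 0)
      (hp : HExec Γ p h h' t) : HExec Γ (.ite e p q) h h' (t + 1)
  | ite_false (e : HE) (p q : HP) (h h' : HS) (t : ℕ) (he : e.ok Γ h) (h0 : e.val h = 0)
      (hq : HExec Γ q h h' t) : HExec Γ (.ite e p q) h h' (t + 1)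
  | whl_true (e : HE) (p : HP) (h h' h'' : HS) (t t' : ℕ) (he : e.ok Γ h) (h0 : e.val h ≠ 0)
      (hp : HExec Γ p h h' t) (hl : HExec Γ (.whl e p) h' h'' t') :
      HExec Γ (.whl e p) h h'' (t + 1 + t')
  | whl_false (e : HE) (p : HP) (h : HS) (he : e.ok Γ h) (h0 : e.val h = 0) :
      HExec Γ (.whl e p) h h 1

/-- The program `p`, started in `h`, halts in a state `h'` after `t` steps with `Q h' t`. -/
def wp (Γ : Cx) (p : HP) (h : HS) (Q : HS → ℕ → Prop) : Prop :=
  ∃ h' t, HExec Γ p h h' t ∧ Q h' t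

section
variable {Γ : Cx} {h : HS} {Q Q' : HS → ℕ → Prop}

theorem wp_mono {p : HP} (hp : wp Γ p h Q) (hQ : ∀ h' t, Q h' t → Q' h' t) : wp Γ p h Q' := by
  obtain ⟨h', t, he, hq⟩ := hp
  exact ⟨h', t, he, hQ _ _ hq⟩

@[simp] theorem wp_skip : wp Γ .skip h Q ↔ Q h 1 := by
  constructor
  · rintro ⟨h', t, he, hq⟩; cases he; exact hq
  · intro hq; exact ⟨_, _, .skip h, hq⟩

@[simp] theorem wp_asg {x : ℕ} {e : HE} :
    wp Γ (.asg x e) h Q ↔ x ≠ 0 ∧ e.ok Γ h ∧ Q (h.set x (e.val h)) 1 := by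
  constructor
  · rintro ⟨h', t, he, hq⟩; cases he with | asg _ _ _ a b => exact ⟨a, b, hq⟩
  · rintro ⟨a, b, hq⟩; exact ⟨_, _, .asg h x e a b, hq⟩

@[simp] theorem wp_sto {f j e : HE} :
    wp Γ (.sto f j e) h Q ↔ f.ok Γ h ∧ j.ok Γ h ∧ e.ok Γ h ∧ f.val h < 32 ∧ j.val h < Γ.cap ∧
      Q (h.st (f.val h) (j.val h) (e.val h)) 1 := by
  constructor
  · rintro ⟨h', t, he, hq⟩; cases he with | sto _ _ _ _ a b c d e => exact ⟨a, b, c, d, e, hq⟩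
  · rintro ⟨a, b, c, d, e', hq⟩; exact ⟨_, _, .sto h f j e a b c d e', hq⟩

@[simp] theorem wp_out {a e : HE} :
    wp Γ (.out a e) h Q ↔ a.ok Γ h ∧ e.ok Γ h ∧ a.val h < 2 * Γ.m ∧
      Q (h.stio (a.val h) (e.val h)) 1 := by
  constructor
  · rintro ⟨h', t, he, hq⟩; cases he with | out _ _ _ a b c => exact ⟨a, b, c, hq⟩
  · rintro ⟨a', b, c, hq⟩; exact ⟨_, _, .out h a e a' b c, hq⟩

@[simp] theorem wp_seq {p q : HP} :
    wp Γ (p ;; q) h Q ↔ wp Γ p h (fun h1 t1 => wp Γ q h1 (fun h2 t2 => Q h2 (t1 + t2))) := by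
  constructor
  · rintro ⟨h', t, he, hq⟩
    cases he with | seq _ _ _ h1 _ t1 t2 a b => exact ⟨h1, t1, a, _, _, b, hq⟩
  · rintro ⟨h1, t1, a, h2, t2, b, hq⟩; exact ⟨_, _, .seq p q h h1 h2 t1 t2 a b, hq⟩

@[simp] theorem wp_ite {e : HE} {p q : HP} :
    wp Γ (.ite e p q) h Q ↔ e.ok Γ h ∧
      (e.val h ≠ 0 → wp Γ p h (fun h' t => Q h' (t + 1))) ∧
      (e.val h = 0 → wp Γ q h (fun h' t => Q h' (t + 1))) := by
  constructor
  · rintro ⟨h', t, he, hq⟩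
    cases he with
    | ite_true _ _ _ _ _ t a b c => exact ⟨a, fun _ => ⟨_, _, c, hq⟩, fun hh => absurd hh b⟩
    | ite_false _ _ _ _ _ t a b c => exact ⟨a, fun hh => absurd b hh, fun _ => ⟨_, _, c, hq⟩⟩
  · rintro ⟨a, b, c⟩
    by_cases hh : e.val h = 0
    · obtain ⟨h', t, he, hq⟩ := c hh
      exact ⟨_, _, .ite_false e p q h h' t a hh he, hq⟩
    · obtain ⟨h', t, he, hq⟩ := b hh
      exact ⟨_, _, .ite_true e p q h h' t a hh he, hq⟩

/-- The rule for loops: `I h n` is an invariant, and the number `n` of credits pays for the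
time. -/
theorem wp_whl {e : HE} {p : HP} (I : HS → ℕ → Prop)
    (hI : ∀ h n, I h n → e.ok Γ h ∧
      (e.val h ≠ 0 → wp Γ p h (fun h' t => ∃ n', I h' n' ∧ n' + t + 1 ≤ n)))
    {n : ℕ} (h0 : I h n)
    (hQ : ∀ h' t n', I h' n' → e.val h' = 0 → n' + t ≤ n + 1 → Q h' t) :
    wp Γ (.whl e p) h Q := by
  suffices H : wp Γ (.whl e p) h (fun h' t => ∃ n', I h' n' ∧ e.val h' = 0 ∧ n' + t ≤ n + 1) from
    wp_mono H (fun h' t ⟨n', a, b, c⟩ => hQ h' t n' a b c)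
  clear hQ
  induction n using Nat.strong_induction_on generalizing h with
  | _ n ih =>
    obtain ⟨hok, hstep⟩ := hI h n h0
    by_cases hv : e.val h = 0
    · exact ⟨h, 1, .whl_false e p h hok hv, n, h0, hv, le_refl _⟩
    · obtain ⟨h1, t1, he1, n1, hI1, hn1⟩ := hstep hv
      obtain ⟨h2, t2, he2, n2, hI2, hv2, hn2⟩ := ih n1 (by omega) hI1
      exact ⟨h2, t1 + 1 + t2, .whl_true e p h h1 h2 t1 t2 hok hv he1 he2, n2, hI2, hv2, by omega⟩
end

/-- The rules that reduce a loop-free program to its verification condition, for use with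
`simp only`. -/
theorem vc :
    (∀ (Γ : Cx) h (Q : HS → ℕ → Prop), wp Γ .skip h Q ↔ Q h 1) ∧
    (∀ (Γ : Cx) h (Q : HS → ℕ → Prop) x e, wp Γ (.asg x e) h Q ↔
      x ≠ 0 ∧ e.ok Γ h ∧ Q (h.set x (e.val h)) 1) ∧
    (∀ (Γ : Cx) h (Q : HS → ℕ → Prop) f j e, wp Γ (.sto f j e) h Q ↔
      f.ok Γ h ∧ j.ok Γ h ∧ e.ok Γ h ∧ f.val h < 32 ∧ j.val h < Γ.cap ∧
      Q (h.st (f.val h) (j.val h) (e.val h)) 1) ∧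
    (∀ (Γ : Cx) h (Q : HS → ℕ → Prop) a e, wp Γ (.out a e) h Q ↔ a.ok Γ h ∧ e.ok Γ h ∧
      a.val h < 2 * Γ.m ∧ Q (h.stio (a.val h) (e.val h)) 1) ∧
    (∀ (Γ : Cx) h (Q : HS → ℕ → Prop) p q, wp Γ (p ;; q) h Q ↔
      wp Γ p h (fun h1 t1 => wp Γ q h1 (fun h2 t2 => Q h2 (t1 + t2)))) ∧
    (∀ (Γ : Cx) h (Q : HS → ℕ → Prop) e p q, wp Γ (.ite e p q) h Q ↔ e.ok Γ h ∧
      (e.val h ≠ 0 → wp Γ p h (fun h' t => Q h' (t + 1))) ∧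
      (e.val h = 0 → wp Γ q h (fun h' t => Q h' (t + 1)))) ∧
    (∀ h n, (ofNat(n) : HE).val h = (OfNat.ofNat n : ℕ)) ∧
    (∀ h n, (HE.reg n).val h = h.r n) ∧
    (∀ h a b, (HE.arr a b).val h = h.A (a.val h) (b.val h)) ∧
    (∀ h a, (HE.io a).val h = h.io (a.val h)) ∧
    (∀ h (a b : HE), (a + b).val h = a.val h + b.val h) ∧
    (∀ h (a b : HE), (a - b).val h = a.val h - b.val h) ∧
    (∀ h (a b : HE), (a * b).val h = a.val h * b.val h) ∧
    (∀ h (a b : HE), (a / b).val h = a.val h / b.val h) ∧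
    (∀ h (a b : HE), (a % b).val h = a.val h % b.val h) ∧
    (∀ h (a b : HE), (a.lt b).val h = if a.val h < b.val h then 1 else 0) ∧
    (∀ h (a b : HE), (a.eq b).val h = if a.val h = b.val h then 1 else 0) ∧
    (∀ h (a b : HE), (a.ne b).val h = if a.val h = b.val h then 0 else 1) ∧
    (∀ (Γ : Cx) h n, (ofNat(n) : HE).ok Γ h ↔ (OfNat.ofNat n : ℕ) < 64) ∧
    (∀ (Γ : Cx) h n, (HE.reg n).ok Γ h ↔ True) ∧
    (∀ (Γ : Cx) h a b, (HE.arr a b).ok Γ h ↔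
      a.ok Γ h ∧ b.ok Γ h ∧ a.val h < 32 ∧ b.val h < Γ.cap) ∧
    (∀ (Γ : Cx) h a, (HE.io a).ok Γ h ↔ a.ok Γ h ∧ a.val h < 2 * Γ.m) ∧
    (∀ (Γ : Cx) h (a b : HE), (a + b).ok Γ h ↔ a.ok Γ h ∧ b.ok Γ h ∧ a.val h + b.val h < Γ.B) ∧
    (∀ (Γ : Cx) h (a b : HE), (a - b).ok Γ h ↔ a.ok Γ h ∧ b.ok Γ h ∧ b.val h ≤ a.val h ∧ a.val h < Γ.B) ∧
    (∀ (Γ : Cx) h (a b : HE), (a * b).ok Γ h ↔ a.ok Γ h ∧ b.ok Γ h ∧ a.val h * b.val h < Γ.B) ∧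
    (∀ (Γ : Cx) h (a b : HE), (a / b).ok Γ h ↔ a.ok Γ h ∧ b.ok Γ h ∧ a.val h < Γ.B) ∧
    (∀ (Γ : Cx) h (a b : HE), (a % b).ok Γ h ↔ a.ok Γ h ∧ b.ok Γ h ∧ a.val h < Γ.B) ∧
    (∀ (Γ : Cx) h (a b : HE), (a.lt b).ok Γ h ↔ a.ok Γ h ∧ b.ok Γ h) ∧
    (∀ (Γ : Cx) h (a b : HE), (a.eq b).ok Γ h ↔ a.ok Γ h ∧ b.ok Γ h) ∧
    (∀ (Γ : Cx) h (a b : HE), (a.ne b).ok Γ h ↔ a.ok Γ h ∧ b.ok Γ h) ∧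
    (∀ (h : HS) x v y, (h.set x v).r y = if y = x then v else h.r y) ∧
    (∀ (h : HS) x v, (h.set x v).A = h.A) ∧
    (∀ (h : HS) x v, (h.set x v).io = h.io) ∧
    (∀ (h : HS) f j v, (h.st f j v).r = h.r) ∧
    (∀ (h : HS) f j v f' j', (h.st f j v).A f' j' =
      if f' = f ∧ j' = j then v else h.A f' j') ∧
    (∀ (h : HS) f j v, (h.st f j v).io = h.io) ∧
    (∀ (h : HS) i v, (h.stio i v).r = h.r) ∧
    (∀ (h : HS) i v, (h.stio i v).A = h.A) ∧
    (∀ (h : HS) i v i', (h.stio i v).io i' = if i' = i then v else h.io i') ∧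
    (∀ x, x ≠ 0 ↔ ¬ x = 0) ∧
    (∀ P : Prop, (True ∧ P) = P) ∧ (∀ P : Prop, (P ∧ True) = P) ∧ (∀ P : Prop, (True → P) = P) ∧
    (∀ P : Prop, (False → P) = True) ∧ (∀ P : Prop, (False ∧ P) = False) ∧ ((¬ False) = True) ∧
    ((¬ True) = False) ∧ (∀ P : Prop, (¬ ¬ P) = P) ∧ (∀ P : Prop, (P ∨ False) = P) ∧
    (∀ P : Prop, (False ∨ P) = P) := by
  refine ⟨?_, ?_, ?_, ?_, ?_, ?_, ?_, ?_, ?_, ?_, ?_, ?_, ?_, ?_, ?_, ?_, ?_, ?_, ?_, ?_, ?_, ?_,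
    ?_, ?_, ?_, ?_, ?_, ?_, ?_, ?_, ?_, ?_, ?_, ?_, ?_, ?_, ?_, ?_, ?_, ?_⟩ <;> intros <;>
    simp

/-! ### Translation to the word RAM -/

open WordRAM

/-- The word-RAM operation of an operation. -/
def HOp.comp : HOp → Op
  | .add => .add | .sub => .sub | .mul => .mul | .div => .div | .mod => .mod
  | .lt => .lt | .eq => .eq

/-- The address of the cell `j` of the array `f`, as an expression. -/
def addrExp (f j : Exp) : Exp :=
  -- Register `0` holds `m`, so the arrays begin at `2 * m`, after the input area; they are
  -- interleaved in records of 32 cells, one cell per array.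
  .bin .add (.bin .add (.bin .add (.reg 0) (.reg 0)) (.bin .mul (.lit 32) j)) f

/-- The translation of expressions. -/
def HE.comp : HE → Exp
  | .lit c => .lit c
  | .reg x => .reg x
  | .arr f j => .load (addrExp f.comp j.comp)
  | .io a => .load a.comp
  | .bin o a b => .bin o.comp a.comp b.comp

/-- The translation of programs. -/
def HP.comp : HP → Prog
  | .skip => .skip
  | .asg x e => .assign x e.comp
  | .sto f j e => .store (addrExp f.comp j.comp) e.comp
  | .out a e => .store a.comp e.comp
  | .seq p q => .seq p.comp q.comp
  | .ite e p q => .cond e.comp p.comp q.comp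
  | .whl e p => .loop e.comp p.comp

/-- A bound for the time that one step of a program takes on the word RAM. -/
def HP.stepCost : HP → ℕ
  | .skip => 1
  | .asg _ e => e.comp.cost + 1
  | .sto f j e => (addrExp f.comp j.comp).cost + e.comp.cost + 1
  | .out a e => a.comp.cost + e.comp.cost + 1
  | .seq p q => p.stepCost + q.stepCost
  | .ite e p q => e.comp.cost + 1 + p.stepCost + q.stepCost
  | .whl e p => e.comp.cost + 1 + p.stepCost

/-- The word-RAM state `s` represents the state `h`. -/
structure Rep (Γ : Cx) (h : HS) (s : State) : Prop where
  reg : s.reg = h.r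
  zero : h.r 0 = Γ.m
  io : ∀ i < 2 * Γ.m, s.mem i = h.io i
  arr : ∀ f < 32, ∀ j < Γ.cap, s.mem (2 * Γ.m + 32 * j + f) = h.A f j

section
variable {w M : ℕ} {Γ : Cx} (hB : Γ.B = 2 ^ w) (hM : 2 * Γ.m + 32 * Γ.cap ≤ M) (hMB : M < Γ.B)
  (hB2 : 64 < Γ.B)
include hB hM hMB hB2

theorem addrExp_eval {h : HS} {s : State} (hr : Rep Γ h s) {ef ej : Exp} {f j : ℕ}
    (hf : ef.eval w M s = some f) (hj : ej.eval w M s = some j) (hf' : f < 32)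
    (hj' : j < Γ.cap) :
    (addrExp ef ej).eval w M s = some (2 * Γ.m + 32 * j + f) := by
  have h1 : s.reg 0 = Γ.m := by rw [hr.reg, hr.zero]
  simp only [addrExp, Exp.eval, h1, hf, hj, Option.bind_some, Op.eval, ← hB]
  rw [Nat.mod_eq_of_lt (show Γ.m + Γ.m < Γ.B by omega),
    Nat.mod_eq_of_lt (show 32 < Γ.B by omega), Nat.mod_eq_of_lt (show 32 * j < Γ.B by omega),
    Nat.mod_eq_of_lt (show Γ.m + Γ.m + 32 * j < Γ.B by omega),
    Nat.mod_eq_of_lt (show Γ.m + Γ.m + 32 * j + f < Γ.B by omega)]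
  congr 1; omega

/-- The conditions in `HE.ok` are chosen so that every reduction modulo `2 ^ w` is the identity,
except in the subtraction, where one multiple of `2 ^ w` is removed. -/
theorem HE.comp_eval {h : HS} {s : State} (hr : Rep Γ h s) (e : HE) (he : e.ok Γ h) :
    e.comp.eval w M s = some (e.val h) := by
  induction e with
  | lit c => simp only [HE.comp, Exp.eval, HE.val, ← hB]; rw [Nat.mod_eq_of_lt (lt_trans he hB2)]
  | reg x => simp only [HE.comp, Exp.eval, HE.val, hr.reg]
  | arr f j ihf ihj =>
    obtain ⟨h1, h2, h3, h4⟩ := he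
    simp only [HE.comp, Exp.eval, HE.val]
    rw [addrExp_eval hB hM hMB hB2 hr (ihf h1) (ihj h2) h3 h4]
    simp only [Option.bind_some]
    rw [if_pos (by omega), hr.arr _ h3 _ h4]
  | io a ih =>
    obtain ⟨h1, h2⟩ := he
    simp only [HE.comp, Exp.eval, HE.val, ih h1, Option.bind_some]
    rw [if_pos (by omega), hr.io _ h2]
  | bin o a b iha ihb =>
    obtain ⟨h1, h2, h3⟩ := he
    simp only [HE.comp, Exp.eval, HE.val, iha h1, ihb h2, Option.bind_some]
    generalize a.val h = x at *
    generalize b.val h = y at *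
    congr 1
    cases o <;> simp only [HOp.comp, Op.eval, HOp.val, HOp.ok, ← hB] at h3 ⊢
    · exact Nat.mod_eq_of_lt h3
    · rw [show x + (Γ.B - y) = (x - y) + Γ.B by omega, Nat.add_mod_right]
      exact Nat.mod_eq_of_lt (by omega)
    · exact Nat.mod_eq_of_lt h3
    · exact Nat.mod_eq_of_lt (lt_of_le_of_lt (Nat.div_le_self _ _) h3)
    · exact Nat.mod_eq_of_lt (lt_of_le_of_lt (Nat.mod_le _ _) h3)
    · split_ifs <;> exact Nat.mod_eq_of_lt (by omega)
    · split_ifs <;> exact Nat.mod_eq_of_lt (by omega)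

/-- A simulation, by induction on the execution. One step of any part of `p` costs at most the sum
of the costs of all expressions in the text of `p`; this sum depends on the program only, so the
overhead is a constant factor. -/
theorem HExec.comp {p : HP} {h h' : HS} {t : ℕ} (hx : HExec Γ p h h' t) :
    ∀ {s : State}, Rep Γ h s →
      ∃ s' t', Exec w M p.comp s s' t' ∧ t' ≤ p.stepCost * t ∧ Rep Γ h' s' := by
  have ev : ∀ {h : HS} {s : State} (hr : Rep Γ h s) (e : HE) (he : e.ok Γ h),
    e.comp.eval w M s = some (e.val h) := fun hr e he => HE.comp_eval hB hM hMB hB2 hr e he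
  induction hx with
  | skip h => intro s hr; exact ⟨s, 1, .skip s, by simp [HP.stepCost], hr⟩
  | asg h x e hx he =>
    intro s hr
    refine ⟨_, _, .assign s x e.comp _ (ev hr e he), by simp [HP.stepCost], ?_, ?_, hr.io, hr.arr⟩
    · simp [HS.set, hr.reg]
    · simp [hx.symm, hr.zero]
  | sto h f j e hf hj he hf' hj' =>
    intro s hr
    refine ⟨_, _, .store s _ _ _ _
      (addrExp_eval hB hM hMB hB2 hr (ev hr f hf) (ev hr j hj) hf' hj') (by omega) (ev hr e he),
      by simp [HP.stepCost], hr.reg, hr.zero, ?_, ?_⟩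
    · intro i hi
      simp only [Function.update_apply, HS.st_io]
      rw [if_neg (by omega), hr.io i hi]
    · intro f1 hf1 j1 hj1
      simp only [Function.update_apply, HS.st_A]
      by_cases hc : f1 = f.val h ∧ j1 = j.val h
      · rw [if_pos hc, if_pos (by rw [hc.1, hc.2])]
      · rw [if_neg hc, if_neg (by omega), hr.arr _ hf1 _ hj1]
  | out h a e ha he ha' =>
    intro s hr
    refine ⟨_, _, .store s _ _ _ _ (ev hr a ha) (by omega) (ev hr e he),
      by simp [HP.stepCost], hr.reg, hr.zero, ?_, ?_⟩
    · intro i hi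
      simp only [Function.update_apply, HS.stio_io, hr.io i hi]
    · intro f1 hf1 j1 hj1
      simp only [Function.update_apply, HS.stio_A]
      rw [if_neg (by omega), hr.arr _ hf1 _ hj1]
  | seq p q h h1 h2 t t' _ _ ihp ihq =>
    intro s hr
    obtain ⟨s1, u1, he1, ht1, hr1⟩ := ihp hr
    obtain ⟨s2, u2, he2, ht2, hr2⟩ := ihq hr1
    refine ⟨s2, _, .seq _ _ _ _ _ _ _ he1 he2, ?_, hr2⟩
    simp only [HP.stepCost]; nlinarith
  | ite_true e p q h h' t he h0 _ ih =>
    intro s hr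
    obtain ⟨s1, u1, he1, ht1, hr1⟩ := ih hr
    refine ⟨s1, _, .cond_true _ _ _ _ _ _ _ (ev hr e he) h0 he1, ?_, hr1⟩
    simp only [HP.stepCost]; nlinarith
  | ite_false e p q h h' t he h0 _ ih =>
    intro s hr
    obtain ⟨s1, u1, he1, ht1, hr1⟩ := ih hr
    refine ⟨s1, _, .cond_false _ _ _ _ _ _ (by rw [ev hr e he, h0]) he1, ?_, hr1⟩
    simp only [HP.stepCost]; nlinarith
  | whl_true e p h h1 h2 t t' he h0 _ _ ihp ihq =>
    intro s hr
    obtain ⟨s1, u1, he1, ht1, hr1⟩ := ihp hr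
    obtain ⟨s2, u2, he2, ht2, hr2⟩ := ihq hr1
    refine ⟨s2, _, .loop_true _ _ _ _ _ _ _ _ (ev hr e he) h0 he1 he2, ?_, hr2⟩
    simp only [HP.stepCost] at ht2 ⊢; nlinarith
  | whl_false e p h he h0 =>
    intro s hr
    refine ⟨s, _, .loop_false _ _ _ (by rw [ev hr e he, h0]), ?_, hr⟩
    simp only [HP.stepCost]; omega
end

end RLEMups

/-! ### A dictionary: digital search trees -/

set_option linter.unusedSimpArgs false

namespace RLEMups

/-- Registers as expressions. -/
abbrev R (n : ℕ) : HE := .reg n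
/-- Array cells as expressions. -/
abbrev AR (f j : HE) : HE := .arr f j

/-- `A` holds a dictionary with the entries `1, …, N`.  The entry `v` has the owner `A 9 v` and the
key `A 8 v`, which has at most `b` bits; the entries of an owner `o` form a digital search tree with
the root `A 5 o`, in which `A 6 v` and `A 7 v` are the children of `v` and `dep v` is its depth. -/
structure DictD (A : ℕ → ℕ → ℕ) (N b : ℕ) (dep : ℕ → ℕ) : Prop where
  par_lt : ∀ v, 1 ≤ v → v ≤ N → A 9 v < v
  key_lt : ∀ v, 1 ≤ v → v ≤ N → A 8 v < 2 ^ b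
  root : ∀ o, A 5 o ≠ 0 → A 5 o ≤ N ∧ A 9 (A 5 o) = o ∧ dep (A 5 o) = 0
  -- The tree branches on the lowest bits first: a child shares the lowest `dep v` bits of its
  -- parent's key, and bit number `dep v` of its own key is `β`.
  child : ∀ v, ∀ β < 2, A (6 + β) v ≠ 0 → 1 ≤ v ∧ v ≤ N ∧ A (6 + β) v ≤ N ∧
    A 9 (A (6 + β) v) = A 9 v ∧ dep (A (6 + β) v) = dep v + 1 ∧
    A 8 (A (6 + β) v) % 2 ^ (dep v + 1) = A 8 v % 2 ^ dep v + 2 ^ dep v * β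
  -- Every entry hangs somewhere in the tree; without this a failing search would prove nothing.
  src : ∀ v, 1 ≤ v → v ≤ N → (dep v = 0 ∧ A 5 (A 9 v) = v) ∨ ∃ u, ∃ β < 2, A (6 + β) u = v
  inj : ∀ u v, 1 ≤ u → u ≤ N → 1 ≤ v → v ≤ N → A 9 u = A 9 v → A 8 u = A 8 v → u = v

/-- `A` holds a dictionary with the entries `1, …, N` and keys of at most `b` bits. -/
def Dict (A : ℕ → ℕ → ℕ) (N b : ℕ) : Prop := ∃ dep, DictD A N b dep

section
variable {A : ℕ → ℕ → ℕ} {N b : ℕ} {dep : ℕ → ℕ}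

theorem DictD.congr {A' : ℕ → ℕ → ℕ} (hD : DictD A N b dep)
    (h : ∀ f, 5 ≤ f → f ≤ 9 → A' f = A f) : DictD A' N b dep := by
  have e5 := h 5 (by norm_num) (by norm_num)
  have e8 := h 8 (by norm_num) (by norm_num)
  have e9 := h 9 (by norm_num) (by norm_num)
  have e6 : ∀ β < 2, A' (6 + β) = A (6 + β) := fun β hβ => h _ (by omega) (by omega)
  constructor
  · rw [e9]; exact hD.par_lt
  · rw [e8]; exact hD.key_lt
  · rw [e5, e9]; exact hD.root
  · intro v β hβ; rw [e6 β hβ, e8, e9]; exact hD.child v β hβ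
  · intro v h1 h2; rw [e5, e9]
    rcases hD.src v h1 h2 with h | ⟨u, β, hβ, h⟩
    · exact Or.inl h
    · exact Or.inr ⟨u, β, hβ, by rw [e6 β hβ]; exact h⟩
  · rw [e8, e9]; exact hD.inj

theorem DictD.src_pos (hD : DictD A N b dep) {v d : ℕ} (h1 : 1 ≤ v) (hN : v ≤ N)
    (hd : dep v = d + 1) : ∃ u, ∃ β < 2, A (6 + β) u = v ∧ 1 ≤ u ∧ u ≤ N ∧ dep u = d ∧
      A 9 u = A 9 v ∧ A 8 v % 2 ^ (d + 1) = A 8 u % 2 ^ d + 2 ^ d * β := by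
  rcases hD.src v h1 hN with h | ⟨u, β, hβ, rfl⟩
  · omega
  · obtain ⟨c1, c2, c3, c4, c5, c6⟩ := hD.child u β hβ (by omega)
    have : dep u = d := by omega
    subst this
    exact ⟨u, β, hβ, rfl, c1, c2, rfl, c4.symm, c6⟩

theorem split_bits {a a' d β β' : ℕ} (h : a % 2 ^ d + 2 ^ d * β = a' % 2 ^ d + 2 ^ d * β') :
    a % 2 ^ d = a' % 2 ^ d ∧ β = β' := by
  have hp : 0 < 2 ^ d := by positivity
  have h1 := Nat.mod_lt a hp
  have h2 := Nat.mod_lt a' hp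
  have e1 : (a % 2 ^ d + 2 ^ d * β) % 2 ^ d = a % 2 ^ d := by simp
  have e2 : (a' % 2 ^ d + 2 ^ d * β') % 2 ^ d = a' % 2 ^ d := by simp
  have : a % 2 ^ d = a' % 2 ^ d := by rw [← e1, h, e2]
  refine ⟨this, ?_⟩
  rw [this] at h
  exact Nat.eq_of_mul_eq_mul_left hp (Nat.add_left_cancel h)

/-- Induction on the depth: the parents agree in owner and lower bits, hence coincide, and the next
bit selects the same cell of this parent. -/
theorem DictD.uniq (hD : DictD A N b dep) (d : ℕ) : ∀ u v, 1 ≤ u → u ≤ N → 1 ≤ v → v ≤ N →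
    dep u = d → dep v = d → A 9 u = A 9 v → A 8 u % 2 ^ d = A 8 v % 2 ^ d → u = v := by
  induction d with
  | zero =>
    intro u v hu hu' hv hv' du dv hp _
    have key : ∀ x, 1 ≤ x → x ≤ N → dep x = 0 → A 5 (A 9 x) = x := by
      intro x hx hx' dx
      rcases hD.src x hx hx' with h | ⟨y, β, hβ, rfl⟩
      · exact h.2
      · have := hD.child y β hβ (by omega); omega
    rw [← key u hu hu' du, ← key v hv hv' dv, hp]
  | succ d ih =>
    intro u v hu hu' hv hv' du dv hp hk
    obtain ⟨u1, β1, hβ1, e1, a1, a2, a3, a4, a5⟩ := hD.src_pos hu hu' du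
    obtain ⟨u2, β2, hβ2, e2, b1, b2, b3, b4, b5⟩ := hD.src_pos hv hv' dv
    obtain ⟨s1, s2⟩ := split_bits (a5.symm.trans (hk.trans b5))
    have := ih u1 u2 a1 a2 b1 b2 a3 b3 (by rw [a4, hp, b4]) s1
    rw [← e1, ← e2, this, s2]

/-- Going up to a parent keeps the owner and all key bits below the depth reached. -/
theorem DictD.anc (hD : DictD A N b dep) (d : ℕ) : ∀ n v, 1 ≤ v → v ≤ N → dep v = d + n →
    ∃ u, 1 ≤ u ∧ u ≤ N ∧ dep u = d ∧ A 9 u = A 9 v ∧ A 8 u % 2 ^ d = A 8 v % 2 ^ d := by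
  intro n
  induction n with
  | zero => intro v h1 h2 h3; exact ⟨v, h1, h2, h3, rfl, rfl⟩
  | succ n ih =>
    intro v h1 h2 h3
    obtain ⟨u, β, hβ, e, a1, a2, a3, a4, a5⟩ := hD.src_pos (d := d + n) h1 h2 (by omega)
    obtain ⟨x, x1, x2, x3, x4, x5⟩ := ih u a1 a2 a3
    refine ⟨x, x1, x2, x3, by rw [x4, a4], ?_⟩
    have hdvd : (2 : ℕ) ^ d ∣ 2 ^ (d + n) := pow_dvd_pow 2 (by omega)
    have hdvd' : (2 : ℕ) ^ d ∣ 2 ^ (d + n + 1) := pow_dvd_pow 2 (by omega)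
    rw [x5, ← Nat.mod_mod_of_dvd (A 8 v) hdvd', a5, pow_add, mul_assoc, Nat.add_mul_mod_self_left,
      ← pow_add, Nat.mod_mod_of_dvd _ hdvd]

/-- The cell `(f, y)` is reached by the search for the key `k` of the owner `o` after `d` steps. -/
structure Cell (A : ℕ → ℕ → ℕ) (N : ℕ) (dep : ℕ → ℕ) (o k d f y : ℕ) : Prop where
  pos : (f = 5 ∧ y = o ∧ d = 0) ∨ ∃ d', d = d' + 1 ∧ 1 ≤ y ∧ y ≤ N ∧ A 9 y = o ∧ dep y = d' ∧
    A 8 y % 2 ^ d' = k % 2 ^ d' ∧ f = 6 + (k / 2 ^ d') % 2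
  no : ∀ u, 1 ≤ u → u ≤ N → A 9 u = o → dep u < d → A 8 u ≠ k

theorem Cell.val {o k d f y : ℕ} (hD : DictD A N b dep) (hc : Cell A N dep o k d f y)
    (h0 : A f y ≠ 0) :
    A f y ≤ N ∧ A 9 (A f y) = o ∧ dep (A f y) = d ∧ A 8 (A f y) % 2 ^ d = k % 2 ^ d := by
  rcases hc.pos with ⟨rfl, rfl, rfl⟩ | ⟨d', rfl, h1, h2, h3, h4, h5, rfl⟩
  · obtain ⟨a, b, c⟩ := hD.root y h0
    exact ⟨a, b, c, by simp [Nat.mod_one]⟩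
  · obtain ⟨c1, c2, c3, c4, c5, c6⟩ := hD.child y _ (Nat.mod_lt _ (by norm_num)) h0
    refine ⟨c3, by rw [c4, h3], by omega, ?_⟩
    rw [h4] at c6
    rw [c6, h5, Nat.mod_pow_succ]

/-- An entry met at depth `b` or more agrees with `k` in all bits of both keys, so it has the key
`k`. This bounds a search by `b` steps. -/
theorem Cell.lt {o k d f y : ℕ} (hD : DictD A N b dep) (hc : Cell A N dep o k d f y)
    (hk : k < 2 ^ b) (h0 : A f y ≠ 0) (hne : A 8 (A f y) ≠ k) : d < b := by
  obtain ⟨h1, h2, h3, h4⟩ := hc.val hD h0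
  by_contra hdb
  have hle : 2 ^ b ≤ 2 ^ d := Nat.pow_le_pow_right (by norm_num) (by omega)
  have hx := hD.key_lt _ (Nat.one_le_iff_ne_zero.2 h0) h1
  rw [Nat.mod_eq_of_lt (by omega), Nat.mod_eq_of_lt (by omega)] at h4
  exact hne h4

theorem Cell.next {o k d f y : ℕ} (hD : DictD A N b dep) (hc : Cell A N dep o k d f y)
    (h0 : A f y ≠ 0) (hne : A 8 (A f y) ≠ k) :
    Cell A N dep o k (d + 1) (6 + (k / 2 ^ d) % 2) (A f y) := by
  obtain ⟨h1, h2, h3, h4⟩ := hc.val hD h0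
  refine ⟨Or.inr ⟨d, rfl, Nat.one_le_iff_ne_zero.2 h0, h1, h2, h3, h4, rfl⟩, ?_⟩
  intro u hu hu' ho hd hk
  by_cases hd' : dep u < d
  · exact hc.no u hu hu' ho hd' hk
  · have := hD.uniq d u (A f y) hu hu' (Nat.one_le_iff_ne_zero.2 h0) h1 (by omega) h3
      (by rw [ho, h2]) (by rw [h4, hk])
    exact hne (by rw [← this, hk])

/-- An entry with the key `k` that the search has not met would lie at depth `d` or below; its
ancestor at depth `d` agrees with `k` in the lowest `d` bits and would have to sit in the empty
cell. -/
theorem Cell.null {o k d f y : ℕ} (hD : DictD A N b dep) (hc : Cell A N dep o k d f y)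
    (h0 : A f y = 0) : ∀ v, 1 ≤ v → v ≤ N → A 9 v = o → A 8 v ≠ k := by
  intro v hv hv' ho hk
  by_cases hd : dep v < d
  · exact hc.no v hv hv' ho hd hk
  obtain ⟨u, hu, hu', du, pu, ku⟩ := hD.anc d (dep v - d) v hv hv' (by omega)
  rcases hc.pos with ⟨rfl, rfl, rfl⟩ | ⟨d', rfl, h1, h2, h3, h4, h5, rfl⟩
  · rcases hD.src u hu hu' with h | ⟨x, β, hβ, rfl⟩
    · rw [pu, ho, h0] at h; omega
    · have := hD.child x β hβ (by omega); omega
  · obtain ⟨x, β, hβ, e, a1, a2, a3, a4, a5⟩ := hD.src_pos hu hu' du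
    rw [ku, hk, Nat.mod_pow_succ] at a5
    obtain ⟨s1, s2⟩ := split_bits a5
    have := hD.uniq d' x y a1 a2 h1 h2 a3 h4 (by rw [a4, pu, ho, h3]) (by rw [← s1, h5])
    rw [this, ← s2, h0] at e
    omega

theorem Dict.inj (hD : Dict A N b) {u v : ℕ} (hu : 1 ≤ u) (hu' : u ≤ N) (hv : 1 ≤ v) (hv' : v ≤ N)
    (hp : A 9 u = A 9 v) (hk : A 8 u = A 8 v) : u = v := by
  obtain ⟨dep, hD⟩ := hD
  exact hD.inj u v hu hu' hv hv' hp hk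

theorem Dict.congr {A' : ℕ → ℕ → ℕ} (hD : Dict A N b)
    (h : ∀ f, 5 ≤ f → f ≤ 9 → A' f = A f) : Dict A' N b := by
  obtain ⟨dep, hD⟩ := hD
  exact ⟨dep, hD.congr h⟩

theorem Dict.empty (h5 : ∀ o, A 5 o = 0) (h6 : ∀ o, A 6 o = 0) (h7 : ∀ o, A 7 o = 0) :
    Dict A 0 b := by
  refine ⟨fun _ => 0, ?_, ?_, ?_, ?_, ?_, ?_⟩
  · omega
  · omega
  · intro o ho; exact absurd (h5 o) ho
  · intro v β hβ h0
    interval_cases β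
    · exact absurd (h6 v) h0
    · exact absurd (h7 v) h0
  · omega
  · omega

/-- Adding the entry `N + 1` with the owner `o` and the key `k` at an empty cell reached by the
search for this key. -/
theorem DictD.insert {o k d f y : ℕ} (hD : DictD A N b dep) (hc : Cell A N dep o k d f y)
    (h0 : A f y = 0) (ho : o ≤ N) (hk : k < 2 ^ b) {A' : ℕ → ℕ → ℕ}
    (hcell : ∀ f' j, 5 ≤ f' → f' ≤ 7 → A' f' j = if f' = f ∧ j = y then N + 1 else A f' j)
    (h8 : ∀ j, A' 8 j = if j = N + 1 then k else A 8 j)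
    (h9 : ∀ j, A' 9 j = if j = N + 1 then o else A 9 j) :
    DictD A' (N + 1) b (Function.update dep (N + 1) d) := by
  have hno := hc.null hD h0
  have d8 : ∀ v ≤ N, A' 8 v = A 8 v := fun v hv => by rw [h8, if_neg (by omega)]
  have d9 : ∀ v ≤ N, A' 9 v = A 9 v := fun v hv => by rw [h9, if_neg (by omega)]
  have dd : ∀ v ≤ N, Function.update dep (N + 1) d v = dep v :=
    fun v hv => by rw [Function.update_apply, if_neg (by omega)]
  have n8 : A' 8 (N + 1) = k := by rw [h8, if_pos rfl]
  have n9 : A' 9 (N + 1) = o := by rw [h9, if_pos rfl]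
  have nd : Function.update dep (N + 1) d (N + 1) = d := by simp
  have cases : ∀ v, 1 ≤ v → v ≤ N + 1 → v ≤ N ∨ v = N + 1 := by intros; omega
  refine ⟨?_, ?_, ?_, ?_, ?_, ?_⟩
  · intro v hv hv'
    rcases cases v hv hv' with h | rfl
    · rw [d9 v h]; exact hD.par_lt v hv h
    · rw [n9]; omega
  · intro v hv hv'
    rcases cases v hv hv' with h | rfl
    · rw [d8 v h]; exact hD.key_lt v hv h
    · rw [n8]; exact hk
  · intro p hp
    rw [hcell 5 p (by norm_num) (by norm_num)] at hp ⊢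
    split_ifs at hp ⊢ with hh
    · rw [n9, nd]
      rcases hc.pos with ⟨h1, h2, h3⟩ | ⟨d', h1, h2, h3, h4, h5, h6, h7⟩
      · exact ⟨le_rfl, by omega, h3⟩
      · omega
    · obtain ⟨a1, a2, a3⟩ := hD.root p hp
      rw [d9 _ a1, dd _ a1]
      exact ⟨by omega, a2, a3⟩
  · intro v β hβ hx
    rw [hcell (6 + β) v (by omega) (by omega)] at hx ⊢
    split_ifs at hx ⊢ with hh
    · rw [n9, nd, n8]
      rcases hc.pos with ⟨h1, h2, h3⟩ | ⟨d', h1, h2, h3, h4, h5, h6, h7⟩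
      · omega
      · obtain ⟨hf, rfl⟩ := hh
        rw [d9 _ h3, d8 _ h3, dd _ h3, h5, h6, h4, ← h1, h1, Nat.mod_pow_succ]
        have : β = k / 2 ^ d' % 2 := by omega
        rw [this]
        exact ⟨h2, by omega, le_rfl, rfl, rfl, rfl⟩
    · obtain ⟨c1, c2, c3, c4, c5, c6⟩ := hD.child v β hβ hx
      rw [d9 _ c3, d9 _ c2, d8 _ c3, d8 _ c2, dd _ c3, dd _ c2]
      exact ⟨c1, by omega, by omega, c4, c5, c6⟩
  · intro v hv hv'
    rcases cases v hv hv' with h | rfl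
    · rw [d9 v h, dd v h]
      rcases hD.src v hv h with ⟨a1, a2⟩ | ⟨u, β, hβ, a1⟩
      · refine Or.inl ⟨a1, ?_⟩
        rw [hcell 5 _ (by norm_num) (by norm_num), if_neg, a2]
        rintro ⟨rfl, rfl⟩
        omega
      · refine Or.inr ⟨u, β, hβ, ?_⟩
        rw [hcell _ _ (by omega) (by omega), if_neg, a1]
        rintro ⟨rfl, rfl⟩
        omega
    · rw [nd, n9]
      rcases hc.pos with ⟨rfl, rfl, rfl⟩ | ⟨d', h1, h2, h3, h4, h5, h6, h7⟩
      · left; exact ⟨rfl, by rw [hcell 5 _ (by norm_num) (by norm_num), if_pos ⟨rfl, rfl⟩]⟩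
      · right
        refine ⟨y, k / 2 ^ d' % 2, Nat.mod_lt _ (by norm_num), ?_⟩
        rw [hcell _ _ (by omega) (by omega), if_pos ⟨h7.symm, rfl⟩]
  · intro u v hu hu' hv hv'
    rcases cases u hu hu' with h | rfl <;> rcases cases v hv hv' with h' | rfl
    · rw [d9 _ h, d9 _ h', d8 _ h, d8 _ h']; exact hD.inj u v hu h hv h'
    · rw [d9 _ h, d8 _ h, n9, n8]; intro a1 a2; exact absurd a2 (hno u hu h a1)
    · rw [d9 _ h', d8 _ h', n9, n8]; intro a1 a2; exact absurd a2.symm (hno v hv h' a1.symm)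
    · intros; rfl
end

/-- Look up the entry with the owner in register `20` and the key in register `21`, and create it if
it does not exist.  Register `2` holds the number of entries, register `25` receives the entry. -/
def findIns : HP :=
  .asg 22 5 ;; .asg 23 (R 20) ;; .asg 24 (R 21) ;;
  .whl ((HE.lt 0 (AR (R 22) (R 23))) * ((AR 8 (AR (R 22) (R 23))).ne (R 21)))
    (.asg 23 (AR (R 22) (R 23)) ;; .asg 22 (6 + R 24 % 2) ;; .asg 24 (R 24 / 2)) ;;
  .ite ((AR (R 22) (R 23)).eq 0)
    (.asg 2 (R 2 + 1) ;; .sto (R 22) (R 23) (R 2) ;; .sto 8 (R 2) (R 21) ;; .sto 9 (R 2) (R 20))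
    .skip ;;
  .asg 25 (AR (R 22) (R 23))

/-- The effect of `findIns` for the owner `o` and the key `k`. -/
structure FindPost (b o k : ℕ) (h h' : HS) : Prop where
  pos : 1 ≤ h'.r 25
  le : h'.r 25 ≤ h'.r 2
  par : h'.A 9 (h'.r 25) = o
  key : h'.A 8 (h'.r 25) = k
  dict : Dict h'.A (h'.r 2) b
  reg : ∀ y, y ≠ 2 → y < 22 ∨ 25 < y → h'.r y = h.r y
  arr : ∀ f, f < 5 ∨ 9 < f → h'.A f = h.A f
  io : h'.io = h.io
  old : ∀ v ≤ h.r 2, h'.A 8 v = h.A 8 v ∧ h'.A 9 v = h.A 9 v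
  new : (h'.r 2 = h.r 2) ∨ (h'.r 2 = h.r 2 + 1 ∧ h'.r 25 = h.r 2 + 1 ∧
    ∀ v, 1 ≤ v → v ≤ h.r 2 → h.A 9 v = o → h.A 8 v ≠ k)

theorem findIns_wp {Γ : Cx} {h : HS} {b o k : ℕ} (hD : Dict h.A (h.r 2) b) (ho : o ≤ h.r 2)
    (hk : k < 2 ^ b) (h20 : h.r 20 = o) (h21 : h.r 21 = k) (hcap : h.r 2 + 1 < Γ.cap)
    (hB : Γ.cap + 64 < Γ.B) (hkB : k < Γ.B) :
    wp Γ findIns h (fun h' t => t ≤ 4 * b + 15 ∧ FindPost b o k h h') := by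
  obtain ⟨dep, hD⟩ := hD
  simp only [findIns, vc, ↓reduceIte, Nat.reduceEqDiff, Nat.reduceLT]
  -- `d` counts the steps made. At most `b - d` remain, and each consists of three assignments and
  -- one test.
  refine wp_whl (fun h1 n => ∃ d, Cell h1.A (h.r 2) dep o k d (h1.r 22) (h1.r 23) ∧
    h1.r 24 = k / 2 ^ d ∧ n = 4 * (b - d) ∧ h1.A = h.A ∧ h1.io = h.io ∧
    ∀ y, y < 22 ∨ 24 < y → h1.r y = h.r y) (n := 4 * b) ?_ ?_ ?_
  · rintro h1 n ⟨d, hc, e24, rfl, eA, eio, er⟩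
    rw [eA] at hc
    have hy : h1.r 23 ≤ h.r 2 := by
      rcases hc.pos with ⟨_, h2, _⟩ | ⟨d', _, _, h2, _⟩ <;> omega
    have hf : h1.r 22 < 8 := by
      rcases hc.pos with ⟨h2, _, _⟩ | ⟨d', _, _, _, _, _, _, h2⟩ <;> omega
    have hx : h.A (h1.r 22) (h1.r 23) ≤ h.r 2 := by
      by_cases hx : h.A (h1.r 22) (h1.r 23) = 0
      · omega
      · exact (hc.val hD hx).1
    have e21 : h1.r 21 = k := by rw [er 21 (by omega), h21]
    have hk2 : k / 2 ^ d ≤ k := Nat.div_le_self _ _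
    refine ⟨?_, ?_⟩
    · simp only [vc, ↓reduceIte, Nat.reduceEqDiff, Nat.reduceLT, eA]
      refine ⟨⟨by omega, by omega⟩, ⟨⟨by omega, by omega⟩, by omega⟩, ?_⟩
      split_ifs <;> omega
    · intro hv
      simp only [vc, ↓reduceIte, Nat.reduceEqDiff, Nat.reduceLT, eA, e21] at hv
      have hx0 : h.A (h1.r 22) (h1.r 23) ≠ 0 := by
        intro h0; simp [h0] at hv
      have hne : h.A 8 (h.A (h1.r 22) (h1.r 23)) ≠ k := by
        intro h0; simp [h0] at hv
      have hlt := hc.lt hD hk hx0 hne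
      have hnext := hc.next hD hx0 hne
      simp only [vc, ↓reduceIte, Nat.reduceEqDiff, Nat.reduceLT, eA, e24]
      refine ⟨⟨by omega, by omega⟩, ⟨by omega, by omega⟩, by omega, 4 * (b - (d + 1)),
        ⟨d + 1, hnext, ?_, rfl, eio, ?_⟩, by omega⟩
      · rw [pow_succ, Nat.div_div_eq_div_mul]
      · intro y hy'
        rw [if_neg (by omega), if_neg (by omega), if_neg (by omega)]
        exact er y hy'
  · refine ⟨0, ⟨Or.inl ⟨by simp, by simp [h20], rfl⟩, by intro u _ _ _ hu; omega⟩, by simp [h21],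
      by simp, rfl, rfl, ?_⟩
    intro y hy
    simp only [HS.set_r]
    rw [if_neg (by omega), if_neg (by omega), if_neg (by omega)]
  · rintro h1 t n ⟨d, hc, e24, rfl, eA, eio, er⟩ hv ht
    rw [eA] at hc
    have hy : h1.r 23 ≤ h.r 2 := by
      rcases hc.pos with ⟨_, h2, _⟩ | ⟨d', _, _, h2, _⟩ <;> omega
    have hf : 5 ≤ h1.r 22 ∧ h1.r 22 < 8 := by
      rcases hc.pos with ⟨h2, _, _⟩ | ⟨d', _, _, _, _, _, _, h2⟩ <;> omega
    have e21 : h1.r 21 = k := by rw [er 21 (by omega), h21]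
    have e20 : h1.r 20 = o := by rw [er 20 (by omega), h20]
    have e2 : h1.r 2 = h.r 2 := er 2 (by omega)
    simp only [vc, ↓reduceIte, Nat.reduceEqDiff, Nat.reduceLT, eA, e21] at hv
    by_cases h0 : h.A (h1.r 22) (h1.r 23) = 0
    · have hno := hc.null hD h0
      have n8 : h1.r 22 ≠ 8 := by omega
      have n9 : h1.r 22 ≠ 9 := by omega
      simp only [vc, ↓reduceIte, Nat.reduceEqDiff, Nat.reduceLT, eA, e2, e20, e21, h0, n8, n9]
      refine ⟨⟨by omega, by omega⟩, by omega, by omega, by omega, by omega, by omega,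
        ⟨by omega, by omega⟩, by omega, ?_⟩
      refine ⟨by simp, by simp, by simp, by simp, ?_, ?_, ?_, by simpa using eio, ?_, ?_⟩
      · refine ⟨_, hD.insert hc h0 ho hk (A' := _) ?_ ?_ ?_⟩
        · intro f' j a1 a2
          have : f' ≠ 8 := by omega
          have : f' ≠ 9 := by omega
          simp [*]
        · intro j
          have : 8 ≠ h1.r 22 := by omega
          simp [*]
        · intro j
          have : 9 ≠ h1.r 22 := by omega
          simp [*]
      · intro y a1 a2
        have : y ≠ 25 := by omega
        simp only [vc, ↓reduceIte, Nat.reduceEqDiff, Nat.reduceLT, a1, this]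
        exact er y (by omega)
      · intro f a1
        have : f ≠ 8 := by omega
        have : f ≠ 9 := by omega
        have : f ≠ h1.r 22 := by omega
        funext j
        simp [*]
      · intro v hv
        have a1 : v ≠ h.r 2 + 1 := by omega
        have a2 : 8 ≠ h1.r 22 := by omega
        have a3 : 9 ≠ h1.r 22 := by omega
        simp [a1, a2, a3, eA]
      · right
        exact ⟨by simp, by simp, hno⟩
    · simp only [vc, ↓reduceIte, Nat.reduceEqDiff, Nat.reduceLT, eA, e2, e20, e21, h0]
      have hkey : h.A 8 (h.A (h1.r 22) (h1.r 23)) = k := by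
        by_contra hh
        simp [hh, Nat.pos_of_ne_zero h0] at hv
      obtain ⟨v1, v2, v3, v4⟩ := hc.val hD h0
      refine ⟨⟨by omega, by omega⟩, ⟨by omega, by omega⟩, by omega, ?_⟩
      refine ⟨?_, ?_, ?_, ?_, ?_, ?_, ?_, by simpa using eio, ?_, ?_⟩
      · simp; omega
      · simp; omega
      · simp [eA, v2]
      · simp [eA, hkey]
      · exact ⟨dep, by simpa [eA, e2] using hD⟩
      · intro y a1 a2
        have : y ≠ 25 := by omega
        simp only [vc, ↓reduceIte, Nat.reduceEqDiff, Nat.reduceLT, this]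
        exact er y (by omega)
      · intro f _; simp [eA]
      · intro v hv; simp [eA]
      · left; simpa using e2
end RLEMups

/-! ### Palindromes in words with sentinels -/


namespace RLEMups

/-- The `2 * k - 1` letters of `U` that end at the position `r` are a palindrome. -/
def IsP (U : ℕ → ℕ) (r k : ℕ) : Prop :=
  2 * k ≤ r + 1 ∧ ∀ i < k, U (r - i) = U (r + 2 + i - 2 * k)

/-- The `k` letters of `U` that end at the position `r`, read backwards. -/
def W (U : ℕ → ℕ) (r k : ℕ) : List ℕ := (List.range k).map (fun i => U (r - i))

section
variable {U : ℕ → ℕ}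

theorem W_succ (r k : ℕ) : W U r (k + 1) = U r :: W U (r - 1) k := by
  simp only [W, List.range_succ_eq_map, List.map_cons, List.map_map, Nat.sub_zero]
  congr 1
  apply List.map_congr_left
  intro i _
  simp only [Function.comp]
  congr 1; omega

theorem W_eq_iff {r1 r2 k : ℕ} : W U r1 k = W U r2 k ↔ ∀ i < k, U (r1 - i) = U (r2 - i) := by
  simp [W]

theorem IsP.zero (r : ℕ) : IsP U r 0 := ⟨by omega, by omega⟩

/-- The definition compares only offsets below `k`; an offset beyond the centre is reflected to one
of these. -/
theorem IsP.full {r k : ℕ} (h : IsP U r k) {j : ℕ} (hj : j + 2 ≤ 2 * k) :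
    U (r - j) = U (r + 2 + j - 2 * k) := by
  obtain ⟨h1, h2⟩ := h
  by_cases hjk : j < k
  · exact h2 j hjk
  · have := h2 (2 * k - 2 - j) (by omega)
    rw [show r - (2 * k - 2 - j) = r + 2 + j - 2 * k by omega,
      show r + 2 + (2 * k - 2 - j) - 2 * k = r - j by omega] at this
    exact this.symm

theorem IsP.one {r : ℕ} (hr : 1 ≤ r) : IsP U r 1 :=
  ⟨by omega, fun i hi => by congr 1; omega⟩

/-- This strips the outermost pair of letters. If a palindrome would start before position `1`, the
index `r - 2 * k` is `0`, and the sentinel `U 0` makes the comparison fail. -/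
theorem isP_succ {r k : ℕ} (hr : 1 ≤ r) (h0 : U 0 ≠ U r) :
    IsP U r (k + 1) ↔ IsP U (r - 1) k ∧ U (r - 2 * k) = U r := by
  constructor
  · rintro ⟨h1, h2⟩
    refine ⟨⟨by omega, fun i hi => ?_⟩, ?_⟩
    · have := h2 (i + 1) (by omega)
      rw [show r - 1 - i = r - (i + 1) by omega, this]
      congr 1; omega
    · have := h2 0 (by omega)
      rw [Nat.sub_zero] at this
      rw [this]; congr 1; omega
  · rintro ⟨⟨h1, h2⟩, h3⟩
    have hne : r - 2 * k ≠ 0 := by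
      intro h; rw [h] at h3; exact h0 h3
    refine ⟨by omega, fun i hi => ?_⟩
    rcases i with _ | i
    · rw [Nat.sub_zero, ← h3]; congr 1; omega
    · rw [show r - (i + 1) = r - 1 - i by omega, h2 i (by omega)]; congr 1; omega

/-- A palindromic suffix of a palindrome also occurs as a prefix of it. -/
theorem IsP.mirror {r K k : ℕ} (hK : IsP U r K) (hk : IsP U r k) (h : k ≤ K) :
    IsP U (r - 2 * (K - k)) k ∧ W U (r - 2 * (K - k)) k = W U r k := by
  have hK1 := hK.1
  have key : ∀ j, j + 2 ≤ 2 * k → U (r - 2 * (K - k) - j) = U (r - j) := by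
    intro j hj
    have h1 := hK.full (j := 2 * k - 2 - j) (by omega)
    have h2 := hk.full (j := j) (by omega)
    rw [h2, show r - 2 * (K - k) - j = r + 2 + (2 * k - 2 - j) - 2 * K by omega, ← h1]
    congr 1; omega
  refine ⟨⟨by omega, fun i hi => ?_⟩, W_eq_iff.2 fun i hi => ?_⟩
  · rw [show r - 2 * (K - k) + 2 + i - 2 * k = r - 2 * (K - k) - (2 * k - 2 - i) by omega,
      key _ (by omega), key _ (by omega), hk.2 i hi]
    congr 1; omega
  · rcases Nat.lt_or_ge (i + 1) (2 * k) with h | h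
    · exact key i (by omega)
    · omega

/-- Equal palindromes have the same palindromic suffixes. -/
theorem IsP.transfer {r1 r2 K k : ℕ} (h1 : IsP U r1 K) (h2 : IsP U r2 K)
    (hW : W U r1 K = W U r2 K) (hk : k ≤ K) (h : IsP U r1 k) :
    IsP U r2 k ∧ W U r2 k = W U r1 k := by
  have hw := W_eq_iff.1 hW
  have a1 := h1.1
  have a2 := h2.1
  have key : ∀ j, j + 2 ≤ 2 * K → U (r1 - j) = U (r2 - j) := by
    intro j hj
    by_cases hjK : j < K
    · exact hw j hjK
    · rw [show r1 - j = r1 + 2 + (2 * K - 2 - j) - 2 * K by omega, ← h1.2 _ (by omega),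
        hw _ (by omega), h2.2 _ (by omega)]
      congr 1; omega
  refine ⟨⟨by omega, fun i hi => ?_⟩, W_eq_iff.2 fun i hi => (hw i (by omega)).symm⟩
  rw [← key i (by omega), h.2 i hi, show r1 + 2 + i - 2 * k = r1 - (2 * k - 2 - i) by omega,
    key _ (by omega)]
  congr 1; omega
end

/-- The half word `w` (outermost letter first) is that of a palindrome ending at `r`. -/
def Occ (U : ℕ → ℕ) (w : List ℕ) (r : ℕ) : Prop := IsP U r w.length ∧ w = W U r w.length

/-- The palindromic tree of `U[1..r-1]`: the node `v` stands for the palindrome with the half word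
`hw v`, whose length is `A 10 v`, and `A 11 v` is its longest proper palindromic suffix. -/
structure Eer (U : ℕ → ℕ) (A : ℕ → ℕ → ℕ) (N r : ℕ) (hw : ℕ → List ℕ) : Prop where
  hw_zero : hw 0 = []
  hw_cons : ∀ v, 1 ≤ v → v ≤ N → hw v = A 8 v :: hw (A 9 v)
  len : ∀ v ≤ N, A 10 v = (hw v).length
  par_lt : ∀ v, 1 ≤ v → v ≤ N → A 9 v < v
  inj : ∀ u v, 1 ≤ u → u ≤ N → 1 ≤ v → v ≤ N → A 9 u = A 9 v → A 8 u = A 8 v → u = v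
  sound : ∀ v, 1 ≤ v → v ≤ N → ∃ r', 1 ≤ r' ∧ r' < r ∧ Occ U (hw v) r'
  compl : ∀ r', 1 ≤ r' → r' < r → ∀ k, 1 ≤ k → IsP U r' k →
    ∃ v, 1 ≤ v ∧ v ≤ N ∧ hw v = W U r' k
  link_zero : A 11 0 = 0
  link_le : ∀ v ≤ N, A 11 v ≤ N
  link_lt : ∀ v, 1 ≤ v → v ≤ N → A 10 (A 11 v) < A 10 v
  link : ∀ v, 1 ≤ v → v ≤ N → ∀ r', Occ U (hw v) r' → Occ U (hw (A 11 v)) r' ∧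
    ∀ k, k < A 10 v → IsP U r' k → k ≤ A 10 (A 11 v)

section
variable {U : ℕ → ℕ} {A A' : ℕ → ℕ → ℕ} {N r : ℕ} {hw : ℕ → List ℕ}

/-- A half word is read along the chain of parents, and a node is determined by its parent and its
letter. -/
theorem Eer.hw_inj (h : Eer U A N r hw) : ∀ u ≤ N, ∀ v ≤ N, hw u = hw v → u = v := by
  intro u
  induction u using Nat.strong_induction_on with
  | _ u ih =>
    intro hu v hv he
    rcases Nat.eq_zero_or_pos u with rfl | hu0 <;> rcases Nat.eq_zero_or_pos v with rfl | hv0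
    · rfl
    · rw [h.hw_zero, h.hw_cons v hv0 hv] at he; simp at he
    · rw [h.hw_zero, h.hw_cons u hu0 hu] at he; simp at he
    · rw [h.hw_cons u hu0 hu, h.hw_cons v hv0 hv] at he
      simp only [List.cons.injEq] at he
      have p1 := h.par_lt u hu0 hu
      have p2 := h.par_lt v hv0 hv
      have := ih _ p1 (by omega) _ (by omega) he.2
      exact h.inj u v hu0 hu hv0 hv this he.1

theorem Eer.len_pos (h : Eer U A N r hw) {v : ℕ} (hv : 1 ≤ v) (hv' : v ≤ N) : 1 ≤ A 10 v := by
  rw [h.len v hv', h.hw_cons v hv hv']; simp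

theorem Eer.len_zero (h : Eer U A N r hw) : A 10 0 = 0 := by
  rw [h.len 0 (by omega), h.hw_zero]; rfl

/-- Every palindromic suffix of `U[1..r]` that is shorter than a palindromic suffix has a node. -/
theorem Eer.compl_of_lt (h : Eer U A N r hw) {K k : ℕ} (hK : IsP U r K) (hk : IsP U r k)
    (h1 : 1 ≤ k) (hlt : k < K) : ∃ v, 1 ≤ v ∧ v ≤ N ∧ hw v = W U r k := by
  -- The shorter suffix recurs as a prefix of the longer one, so it ends before `r` and is already
  -- in the tree. Hence each letter creates at most one node.
  obtain ⟨a, b⟩ := hK.mirror hk hlt.le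
  have := hK.1
  obtain ⟨v, v1, v2, v3⟩ := h.compl (r - 2 * (K - k)) (by omega) (by omega) k h1 a
  exact ⟨v, v1, v2, by rw [v3, b]⟩

/-- One step along the suffix links. -/
theorem Eer.walk (h : Eer U A N r hw) (hr : 1 ≤ r) (h0 : U 0 ≠ U r) {cur : ℕ} (hc : cur ≤ N)
    (ho : Occ U (hw cur) (r - 1)) (hne : U (r - 2 * A 10 cur) ≠ U r) :
    1 ≤ cur ∧ Occ U (hw (A 11 cur)) (r - 1) ∧
      ∀ k, k ≤ A 10 cur → IsP U r (k + 1) → k ≤ A 10 (A 11 cur) := by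
  have hc1 : 1 ≤ cur := by
    -- Node `0` plays the role of the palindrome of length `-1`: at half-length `0` the letter `U r`
    -- is compared with itself, so every walk stops there at the latest.
    rcases Nat.eq_zero_or_pos cur with rfl | h'
    · rw [h.len_zero] at hne; exact absurd rfl hne
    · exact h'
  obtain ⟨a, b⟩ := h.link cur hc1 hc _ ho
  have key : ∀ k, k ≤ A 10 cur → IsP U r (k + 1) → k ≤ A 10 (A 11 cur) := by
    intro k hk hp
    obtain ⟨p1, p2⟩ := (isP_succ hr h0).1 hp
    rcases Nat.lt_or_ge k (A 10 cur) with hlt | hge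
    · exact b k hlt p1
    · have : k = A 10 cur := by omega
      rw [this] at p2; exact absurd p2 hne
  exact ⟨hc1, a, key⟩

/-- The node that extends `cur` by the letter `U r`. -/
theorem Eer.extend (h : Eer U A N r hw) (hr : 1 ≤ r) (h0 : U 0 ≠ U r) {cur : ℕ} (hc : cur ≤ N)
    (ho : Occ U (hw cur) (r - 1)) (he : U (r - 2 * A 10 cur) = U r) :
    IsP U r (A 10 cur + 1) ∧ U r :: hw cur = W U r (A 10 cur + 1) := by
  obtain ⟨a, b⟩ := ho
  rw [← h.len cur hc] at a b
  exact ⟨(isP_succ hr h0).2 ⟨a, he⟩, by rw [W_succ, ← b]⟩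

/-- An existing node with the half word `U r :: hw z` is the child of `z`. -/
theorem Eer.child (h : Eer U A N r hw) {z u a : ℕ} (hz : z ≤ N) (hu : 1 ≤ u) (hu' : u ≤ N)
    (he : hw u = a :: hw z) : A 9 u = z ∧ A 8 u = a := by
  rw [h.hw_cons u hu hu'] at he
  simp only [List.cons.injEq] at he
  have := h.par_lt u hu hu'
  exact ⟨h.hw_inj _ (by omega) _ hz he.2, he.1⟩

theorem Eer.congr (h : Eer U A N r hw) (h8 : ∀ v ≤ N, A' 8 v = A 8 v ∧ A' 9 v = A 9 v)
    (h10 : ∀ v ≤ N, A' 10 v = A 10 v) (h11 : ∀ v ≤ N, A' 11 v = A 11 v) : Eer U A' N r hw := by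
  refine ⟨h.hw_zero, ?_, ?_, ?_, ?_, h.sound, h.compl, ?_, ?_, ?_, ?_⟩
  · intro v a b; rw [(h8 v b).1, (h8 v b).2]; exact h.hw_cons v a b
  · intro v a; rw [h10 v a]; exact h.len v a
  · intro v a b; rw [(h8 v b).2]; exact h.par_lt v a b
  · intro u v a b c d; rw [(h8 u b).1, (h8 u b).2, (h8 v d).1, (h8 v d).2]; exact h.inj u v a b c d
  · rw [h11 0 (by omega)]; exact h.link_zero
  · intro v a; rw [h11 v a]; exact h.link_le v a
  · intro v a b; rw [h11 v b, h10 v b, h10 _ (h.link_le v b)]; exact h.link_lt v a b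
  · intro v a b; rw [h11 v b, h10 v b, h10 _ (h.link_le v b)]; exact h.link v a b

/-- The next letter gives no new node. -/
theorem Eer.same (h : Eer U A N r hw) {v : ℕ} (hv : 1 ≤ v) (hv' : v ≤ N)
    (hp : IsP U r (A 10 v)) (hW : hw v = W U r (A 10 v))
    (hmax : ∀ k, IsP U r k → k ≤ A 10 v) : Eer U A N (r + 1) hw := by
  refine ⟨h.hw_zero, h.hw_cons, h.len, h.par_lt, h.inj, ?_, ?_, h.link_zero, h.link_le, h.link_lt,
    h.link⟩
  · intro u a b
    obtain ⟨r', c, d, e⟩ := h.sound u a b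
    exact ⟨r', c, by omega, e⟩
  · intro r' a b k hk hpk
    rcases Nat.lt_or_ge r' r with hlt | hge
    · exact h.compl r' a hlt k hk hpk
    · obtain rfl : r' = r := by omega
      have := hmax k hpk
      rcases Nat.lt_or_ge k (A 10 v) with h1 | h1
      · exact h.compl_of_lt hp hpk hk h1
      · obtain rfl : k = A 10 v := by omega
        exact ⟨v, hv, hv', hW⟩

/-- The next letter gives a new node. -/
theorem Eer.insert (h : Eer U A N r hw) (hr : 1 ≤ r) {cur x : ℕ} (hc : cur ≤ N)
    (hp : IsP U r (A 10 cur + 1)) (hW : U r :: hw cur = W U r (A 10 cur + 1))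
    (hmax : ∀ k, IsP U r k → k ≤ A 10 cur + 1)
    (h8 : ∀ v ≤ N, A' 8 v = A 8 v ∧ A' 9 v = A 9 v) (h10 : ∀ v ≤ N, A' 10 v = A 10 v)
    (h11 : ∀ v ≤ N, A' 11 v = A 11 v) (n8 : A' 8 (N + 1) = U r) (n9 : A' 9 (N + 1) = cur)
    (n10 : A' 10 (N + 1) = A 10 cur + 1) (n11 : A' 11 (N + 1) = x) (hx : x ≤ N)
    (hxlt : A 10 x < A 10 cur + 1) (hxo : Occ U (hw x) r)
    (hxm : ∀ k, k < A 10 cur + 1 → IsP U r k → k ≤ A 10 x)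
    (hno : ∀ v, 1 ≤ v → v ≤ N → A 9 v = cur → A 8 v ≠ U r) :
    Eer U A' (N + 1) (r + 1) (Function.update hw (N + 1) (U r :: hw cur)) := by
  have uo : ∀ v ≤ N, Function.update hw (N + 1) (U r :: hw cur) v = hw v :=
    fun v hv => Function.update_of_ne (by omega) _ _
  have un : Function.update hw (N + 1) (U r :: hw cur) (N + 1) = U r :: hw cur :=
    Function.update_self _ _ _
  have cases : ∀ v, v ≤ N + 1 → v ≤ N ∨ v = N + 1 := by intros; omega
  have h0 := h.congr h8 h10 h11
  have hlen : (hw cur).length = A 10 cur := (h.len cur hc).symm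
  have e10c := h10 cur hc
  have e10x := h10 x hx
  refine ⟨?_, ?_, ?_, ?_, ?_, ?_, ?_, h0.link_zero, ?_, ?_, ?_⟩
  · rw [uo 0 (by omega)]; exact h.hw_zero
  · intro v a b
    rcases cases v b with b | rfl
    · have := h0.par_lt v a b
      rw [uo v b, uo _ (by omega)]; exact h0.hw_cons v a b
    · rw [un, n9, uo _ hc, n8]
  · intro v b
    rcases cases v b with b | rfl
    · rw [uo v b]; exact h0.len v b
    · rw [un, n10]; simp [hlen]
  · intro v a b
    rcases cases v b with b | rfl
    · exact h0.par_lt v a b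
    · omega
  · intro u v a b c d
    rcases cases u b with b | rfl <;> rcases cases v d with d | rfl
    · exact h0.inj u v a b c d
    · rw [n8, n9, (h8 u b).1, (h8 u b).2]
      intro p q; exact absurd q (hno u a b p)
    · rw [n8, n9, (h8 v d).1, (h8 v d).2]
      intro p q; exact absurd q.symm (hno v c d p.symm)
    · intros; rfl
  · intro v a b
    rcases cases v b with b | rfl
    · obtain ⟨r', c, d, e⟩ := h.sound v a b
      exact ⟨r', c, by omega, by rw [uo v b]; exact e⟩
    · refine ⟨r, hr, by omega, ?_, ?_⟩
      · rw [un]; simpa [hlen] using hp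
      · rw [un]; simpa [hlen] using hW
  · intro r' a b k hk hpk
    have old : ∀ w, (∃ v, 1 ≤ v ∧ v ≤ N ∧ hw v = w) →
        ∃ v, 1 ≤ v ∧ v ≤ N + 1 ∧ Function.update hw (N + 1) (U r :: hw cur) v = w := by
      rintro w ⟨v, a, b, c⟩
      exact ⟨v, a, by omega, by rw [uo v b, c]⟩
    rcases Nat.lt_or_ge r' r with hlt | hge
    · exact old _ (h.compl r' a hlt k hk hpk)
    · obtain rfl : r' = r := by omega
      have := hmax k hpk
      rcases Nat.lt_or_ge k (A 10 cur + 1) with h1 | h1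
      · exact old _ (h.compl_of_lt hp hpk hk h1)
      · obtain rfl : k = A 10 cur + 1 := by omega
        exact ⟨N + 1, by omega, le_rfl, by rw [un, hW]⟩
  · intro v b
    rcases cases v b with b | rfl
    · have := h0.link_le v b; omega
    · omega
  · intro v a b
    rcases cases v b with b | rfl
    · exact h0.link_lt v a b
    · rw [n10, n11, e10x]; exact hxlt
  · intro v a b r' ho
    rcases cases v b with b | rfl
    · rw [uo v b] at ho
      rw [uo _ (h0.link_le v b)]
      exact h0.link v a b r' ho
    · rw [un] at ho
      rw [n10, n11, e10x, uo x hx]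
      obtain ⟨o1, o2⟩ := ho
      simp only [List.length_cons, hlen] at o1 o2
      -- The palindromic suffixes depend on the palindrome only, so the suffix link found at `r` is
      -- right for every other occurrence `r'`.
      have hWW : W U r (A 10 cur + 1) = W U r' (A 10 cur + 1) := by rw [← hW, o2]
      constructor
      · obtain ⟨x1, x2⟩ := hxo
        have hxl := h.len x hx
        obtain ⟨y1, y2⟩ := hp.transfer o1 hWW (k := (hw x).length) (by omega) x1
        exact ⟨y1, by rw [y2]; exact x2⟩
      · intro k hk hpk
        obtain ⟨y1, y2⟩ := o1.transfer hp hWW.symm (k := k) (by omega) hpk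
        exact hxm k hk y1
end

/-- `v` is the node of the maximal palindrome with the centre `c`. -/
def NodOK (U : ℕ → ℕ) (A : ℕ → ℕ → ℕ) (N : ℕ) (hw : ℕ → List ℕ) (c v : ℕ) : Prop :=
  1 ≤ v ∧ v ≤ N ∧ Occ U (hw v) (c + A 10 v - 1) ∧ U (c - A 10 v) ≠ U (c + A 10 v)

/-- The maximal palindrome at a centre inside a palindrome is that of the mirror image of the
centre. -/
theorem Eer.copy {U : ℕ → ℕ} {A : ℕ → ℕ → ℕ} {N r : ℕ} {hw : ℕ → List ℕ} (h : Eer U A N r hw)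
    (hr : 1 ≤ r) {cur v c : ℕ} (hc : 1 ≤ cur) (hcN : cur ≤ N) (ho : Occ U (hw cur) (r - 1))
    (h1 : r - A 10 cur < c) (h2 : c < r - A 10 (A 11 cur))
    (hv : NodOK U A N hw (2 * (r - A 10 cur) - c) v) : NodOK U A N hw c v := by
  obtain ⟨v1, v2, ⟨v3, v4⟩, v5⟩ := hv
  obtain ⟨o1, o2⟩ := ho
  have hl := h.link cur hc hcN (r - 1) ⟨o1, o2⟩
  rw [← h.len cur hcN] at o1 o2
  have hvl := h.len v v2
  rw [← hvl] at v3 v4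
  set K := A 10 cur
  set k := A 10 v
  have hk1 : 1 ≤ k := h.len_pos v1 v2
  have hK1 : 1 ≤ K := h.len_pos hc hcN
  have oK := o1.1
  have v31 := v3.1
  set C := r - K
  set c' := 2 * C - c with hc'
  -- mirror images with respect to the centre `C`
  have mir : ∀ i, r - 2 * K + 1 ≤ i → i ≤ r - 1 → U i = U (2 * C - i) := by
    intro i a b
    have := o1.full (j := r - 1 - i) (by omega)
    rw [show r - 1 - (r - 1 - i) = i by omega] at this
    rw [this]; congr 1; omega
  -- the maximal palindrome at `c'` lies strictly inside
  have hin : r - 2 * K + 1 + k ≤ c' := by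
    by_contra hcon
    -- If the palindrome at `c'` reached the left end of the suffix palindrome, its mirror image at
    -- `c` would reach `r - 1`. This would be a proper palindromic suffix longer than the suffix
    -- link, since `c` lies to the left of the centre of the link.
    have hq : IsP U (r - 1) (r - c) := by
      refine ⟨by omega, fun i hi => ?_⟩
      rw [mir (r - 1 - i) (by omega) (by omega), mir (r - 1 + 2 + i - 2 * (r - c)) (by omega)
        (by omega)]
      have := v3.full (j := c' + k - 1 - (2 * C - (r - 1 - i))) (by omega)
      rw [show c' + k - 1 - (c' + k - 1 - (2 * C - (r - 1 - i))) = 2 * C - (r - 1 - i) by omega]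
        at this
      rw [this]; congr 1; omega
    have := hl.2 (r - c) (by omega) hq
    omega
  refine ⟨v1, v2, ⟨?_, ?_⟩, ?_⟩
  · rw [← hvl]
    refine ⟨by omega, fun i hi => ?_⟩
    change U (c + k - 1 - i) = U (c + k - 1 + 2 + i - 2 * k)
    rw [mir _ (by omega) (by omega), mir (c + k - 1 + 2 + i - 2 * k) (by omega) (by omega)]
    have := v3.2 i hi
    rw [show 2 * C - (c + k - 1 - i) = c' + k - 1 + 2 + i - 2 * k by omega, ← this]
    congr 1; omega
  · rw [← hvl, v4]
    apply W_eq_iff.2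
    intro i hi
    change U (c' + k - 1 - i) = U (c + k - 1 - i)
    rw [mir (c + k - 1 - i) (by omega) (by omega), v3.2 i hi]
    congr 1; omega
  · change U (c - k) ≠ U (c + k)
    rw [mir (c - k) (by omega) (by omega), mir (c + k) (by omega) (by omega)]
    rw [show 2 * C - (c - k) = c' + k by omega, show 2 * C - (c + k) = c' - k by omega]
    exact v5.symm
end RLEMups

/-! ### Construction of the palindromic tree -/


namespace RLEMups

/-- Follow the suffix links from the node in register `6` until the node can be extended by the
letter in register `7`, and store the maximal palindromes of the centres that are passed. -/
def walk : HP :=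
  .whl ((AR 0 (R 5 - 2 * AR 10 (R 6))).ne (R 7))
    (.asg 9 (AR 11 (R 6)) ;; .asg 13 (R 5 - AR 10 (R 6)) ;; .sto 4 (R 13) (R 6) ;;
      .asg 8 (R 13 + 1) ;;
      .whl ((R 8).lt (R 5 - AR 10 (R 9)))
        (.sto 4 (R 8) (AR 4 (2 * R 13 - R 8)) ;; .asg 8 (R 8 + 1)) ;;
      .asg 6 (R 9))

/-- Follow the suffix links from the node in register `10` until the node can be extended by the
letter in register `7`. -/
def linkWalk : HP :=
  .whl ((AR 0 (R 5 - 2 * AR 10 (R 10))).ne (R 7)) (.asg 10 (AR 11 (R 10)))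

/-- Process the letter at the position in register `5`. -/
def eerStep : HP :=
  .asg 7 (AR 0 (R 5)) ;; walk ;;
  .asg 12 (R 2) ;; .asg 20 (R 6) ;; .asg 21 (R 7) ;; findIns ;; .asg 11 (R 25) ;;
  .ite ((R 12).lt (R 2))
    (.sto 10 (R 11) (AR 10 (R 6) + 1) ;;
      .ite ((R 6).eq 0) (.sto 11 (R 11) 0)
        (.asg 10 (AR 11 (R 6)) ;; linkWalk ;; .asg 20 (R 10) ;; .asg 21 (R 7) ;; findIns ;;
          .sto 11 (R 11) (R 25)))
    .skip ;;
  .asg 6 (R 11) ;; .asg 5 (R 5 + 1)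

/-- Build the palindromic tree. -/
def eer : HP := .asg 5 1 ;; .asg 6 0 ;; .whl ((R 5).lt (R 0 + 2)) eerStep

/-- The sizes suffice for words over the letters `U` with sentinels. -/
structure ECtx (Γ : Cx) (U : ℕ → ℕ) (b : ℕ) : Prop where
  cap : 4 * Γ.m + 8 ≤ Γ.cap
  B : 2 * Γ.cap + 64 < Γ.B
  u0 : ∀ j, 1 ≤ j → j ≤ Γ.m + 1 → U 0 ≠ U j
  u1 : ∀ j, 1 ≤ j → j ≤ Γ.m → U j ≠ U (Γ.m + 1)
  ub : ∀ j, j ≤ Γ.m + 1 → U j < 2 ^ b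
  uB : ∀ j, j ≤ Γ.m + 1 → U j < Γ.B

section
variable {Γ : Cx} {U : ℕ → ℕ} {b : ℕ} {hw : ℕ → List ℕ}

theorem NodOK.congr {A A' : ℕ → ℕ → ℕ} {N c v : ℕ} (h : NodOK U A N hw c v)
    (h10 : A' 10 v = A 10 v) : NodOK U A' N hw c v := by
  obtain ⟨a, b, c, d⟩ := h
  rw [← h10] at c d
  exact ⟨a, b, c, d⟩

/-- The state of the walk: `walk` changes only the array `4` and the registers `6`, `8`, `9`,
`13`. -/
structure WalkInv (Γ : Cx) (U : ℕ → ℕ) (hw : ℕ → List ℕ) (r : ℕ) (h h1 : HS) : Prop where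
  le : h1.r 6 ≤ h.r 2
  occ : Occ U (hw (h1.r 6)) (r - 1)
  max : ∀ k, IsP U r (k + 1) → k ≤ h.A 10 (h1.r 6)
  nod : ∀ c, 1 ≤ c → c < r - h.A 10 (h1.r 6) → NodOK U h.A (h.r 2) hw c (h1.A 4 c)
  link : h.A 10 (h.A 11 (h1.r 6)) ≤ h.A 10 (h.A 11 (h.r 6))
  arr : ∀ f, f ≠ 4 → h1.A f = h.A f
  reg : ∀ y, y ≠ 6 → y ≠ 8 → y ≠ 9 → y ≠ 13 → h1.r y = h.r y
  io : h1.io = h.io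

/-- Passing from half-length `K` to the half-length `k` of the link moves the centre from `r - K` to
`r - k`. The palindrome at `r - K` cannot be extended, hence is maximal; the centres strictly
between are settled by `Eer.copy`. The work is `O(K - k)` and is paid by a potential of 20 per unit
of half-length. -/
theorem walk_wp (hE : ECtx Γ U b) {h : HS} {r : ℕ} (hr : 1 ≤ r) (hrm : r ≤ Γ.m + 1)
    (hN : h.r 2 + 1 < Γ.cap)
    (h5 : h.r 5 = r) (h7 : h.r 7 = U r) (hU : ∀ j, j ≤ Γ.m + 1 → h.A 0 j = U j)
    (he : Eer U h.A (h.r 2) r hw) (hi : WalkInv Γ U hw r h h) :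
    wp Γ walk h (fun h' t => t + 20 * h.A 10 (h'.r 6) ≤ 20 * h.A 10 (h.r 6) + 1 ∧
      U (r - 2 * h.A 10 (h'.r 6)) = U r ∧ WalkInv Γ U hw r h h') := by
  have hcap := hE.cap
  have hB := hE.B
  refine wp_whl (fun h1 n => n = 20 * h.A 10 (h1.r 6) ∧ WalkInv Γ U hw r h h1) ?_ ⟨rfl, hi⟩ ?_
  · rintro h1 n ⟨rfl, hi⟩
    have e5 := hi.reg 5 (by omega) (by omega) (by omega) (by omega)
    have e7 := hi.reg 7 (by omega) (by omega) (by omega) (by omega)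
    have e0 := hi.arr 0 (by omega)
    have e10 := hi.arr 10 (by omega)
    have e11 := hi.arr 11 (by omega)
    have hle := hi.le
    have ho := hi.occ
    have ho1 := ho.1.1
    rw [← he.len _ hle] at ho1
    simp only [vc, ↓reduceIte, Nat.reduceEqDiff, Nat.reduceLT, e5, e7, e0, e10, e11, h5, h7]
    refine ⟨⟨⟨by omega, by omega, by omega⟩, by omega⟩, ?_⟩
    rw [hU _ (by omega)]
    intro hne
    have hne' : U (r - 2 * h.A 10 (h1.r 6)) ≠ U r := by
      intro h; simp [h] at hne
    obtain ⟨w1, w2, w3⟩ := he.walk hr (hE.u0 r hr hrm) hle ho hne'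
    have hlk := he.link_lt _ w1 hle
    have hll := he.link_le _ hle
    set cur := h1.r 6 with hcur
    set K := h.A 10 cur with hK
    set k := h.A 10 (h.A 11 cur) with hk
    refine ⟨by omega, ⟨by omega, by omega⟩, by omega, by omega, ?_⟩
    refine wp_whl (fun h2 n => n = 4 * (r - k - h2.r 8) ∧ r - K < h2.r 8 ∧ h2.r 8 ≤ r - k ∧
      (∀ c, 1 ≤ c → c < h2.r 8 → NodOK U h.A (h.r 2) hw c (h2.A 4 c)) ∧
      (∀ f, f ≠ 4 → h2.A f = h.A f) ∧ h2.io = h.io ∧ h2.r 9 = h.A 11 cur ∧ h2.r 13 = r - K ∧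
      ∀ y, y ≠ 6 → y ≠ 8 → y ≠ 9 → y ≠ 13 → h2.r y = h.r y) (n := 4 * (r - k - (r - K + 1)))
      ?_ ?_ ?_
    · rintro h2 n ⟨rfl, i1, i2, i3, i4, i5, i6, i7, i8⟩
      have j5 := i8 5 (by omega) (by omega) (by omega) (by omega)
      have j10 := i4 10 (by omega)
      simp only [vc, ↓reduceIte, Nat.reduceEqDiff, Nat.reduceLT, j5, j10, i6, i7, h5]
      refine ⟨⟨by omega, by omega, by omega⟩, ?_⟩
      intro hlt
      have hlt' : h2.r 8 < r - k := by
        by_contra hcon; rw [if_neg hcon] at hlt; exact hlt rfl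
      refine ⟨⟨⟨by omega, by omega, by omega⟩, by omega⟩, by omega, by omega,
        4 * (r - k - (h2.r 8 + 1)), ⟨rfl, by omega, by omega, ?_, ?_, i5, ?_⟩, by omega⟩
      · intro c c1 c2
        by_cases hc : c = h2.r 8
        · rw [if_pos hc, hc]
          -- The mirror image lies to the left of `r - K`, so its entry is already final.
          have := i3 (2 * (r - K) - h2.r 8) (by omega) (by omega)
          exact he.copy hr w1 hle ho i1 hlt' this
        · rw [if_neg hc]; exact i3 c c1 (by omega)
      · intro f hf
        funext j
        simp only [vc, hf, ↓reduceIte]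
        rw [i4 f hf]
      · intro y y6 y8 y9 y13
        rw [if_neg y8]; exact i8 y y6 y8 y9 y13
    · refine ⟨?_, ?_, ?_, ?_, ?_, ?_, ?_, ?_, ?_⟩
      all_goals simp only [vc, ↓reduceIte, Nat.reduceEqDiff, Nat.reduceLT]
      · omega
      · omega
      · intro c c1 c2
        by_cases hc : c = r - K
        · rw [if_pos hc, hc]
          refine ⟨w1, hle, ?_, ?_⟩
          · rw [← hK, show r - K + K - 1 = r - 1 by omega]; exact ho
          · rw [← hK, show r - K - K = r - 2 * K by omega, show r - K + K = r by omega]; exact hne'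
        · rw [if_neg hc]
          have hn := hi.nod c c1
          rw [← hcur, ← hK] at hn; exact hn (by omega)
      · intro f hf
        funext j
        simp only [vc, hf, ↓reduceIte]
        rw [hi.arr f hf]
      · exact hi.io
      · intro y y6 y8 y9 y13
        rw [if_neg y8, if_neg y13, if_neg y9]; exact hi.reg y y6 y8 y9 y13
    · rintro h2 t n ⟨rfl, i1, i2, i3, i4, i5, i6, i7, i8⟩ hv ht
      have j5 := i8 5 (by omega) (by omega) (by omega) (by omega)
      have j10 := i4 10 (by omega)
      simp only [vc, ↓reduceIte, Nat.reduceEqDiff, Nat.reduceLT, j5, j10, i6, i7, h5] at hv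
      have hge : ¬ h2.r 8 < r - k := by
        intro hcon; rw [if_pos hcon] at hv; exact one_ne_zero hv
      refine ⟨20 * k, ⟨by rw [i6], ?_, ?_, ?_, ?_, ?_, ?_, ?_, ?_⟩, by omega⟩
      all_goals simp only [vc, ↓reduceIte, Nat.reduceEqDiff, Nat.reduceLT, i6]
      · exact hll
      · exact w2
      · exact fun k hk => w3 k (hi.max k hk) hk
      · intro c c1 c2; exact i3 c c1 (by omega)
      · have hl2 : k ≤ h.A 10 (h.A 11 (h.r 6)) := hi.link
        rcases Nat.eq_zero_or_pos (h.A 11 cur) with h0 | h0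
        · rw [h0, he.link_zero, he.len_zero]; omega
        · have := he.link_lt _ h0 hll
          omega
      · exact i4
      · intro y y6 y8 y9 y13
        rw [if_neg y6]; exact i8 y y6 y8 y9 y13
      · exact i5
  · rintro h1 t n ⟨rfl, hi⟩ hv ht
    have e5 := hi.reg 5 (by omega) (by omega) (by omega) (by omega)
    have e7 := hi.reg 7 (by omega) (by omega) (by omega) (by omega)
    have e0 := hi.arr 0 (by omega)
    have e10 := hi.arr 10 (by omega)
    simp only [vc, ↓reduceIte, Nat.reduceEqDiff, Nat.reduceLT, e5, e7, e0, e10, h5, h7] at hv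
    rw [hU _ (by omega)] at hv
    refine ⟨by omega, ?_, hi⟩
    by_contra hcon
    simp [hcon] at hv

/-- The search for the suffix link of a new node. The palindrome being extended to the new one has
half-length `K`; restricting to `k < K` leaves exactly the proper palindromic suffixes of the new
palindrome. -/
theorem linkWalk_wp (hE : ECtx Γ U b) {h : HS} {N r K : ℕ} (hr : 1 ≤ r) (hrm : r ≤ Γ.m + 1)
    (hN : N + 1 < Γ.cap)
    (h5 : h.r 5 = r) (h7 : h.r 7 = U r) (hU : ∀ j, j ≤ Γ.m + 1 → h.A 0 j = U j)
    (he : Eer U h.A N r hw) (hz : h.r 10 ≤ N) (ho : Occ U (hw (h.r 10)) (r - 1))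
    (hm : ∀ k, k < K → IsP U r (k + 1) → k ≤ h.A 10 (h.r 10)) (hK : h.A 10 (h.r 10) < K) :
    wp Γ linkWalk h (fun h' t => t + 2 * h.A 10 (h'.r 10) ≤ 2 * h.A 10 (h.r 10) + 1 ∧
      h'.r 10 ≤ N ∧ Occ U (hw (h'.r 10)) (r - 1) ∧ U (r - 2 * h.A 10 (h'.r 10)) = U r ∧
      (∀ k, k < K → IsP U r (k + 1) → k ≤ h.A 10 (h'.r 10)) ∧ h.A 10 (h'.r 10) < K ∧
      h' = h.set 10 (h'.r 10)) := by
  have hcap := hE.cap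
  have hB := hE.B
  refine wp_whl (fun h1 n => n = 2 * h.A 10 (h1.r 10) ∧ h1.r 10 ≤ N ∧
      Occ U (hw (h1.r 10)) (r - 1) ∧
      (∀ k, k < K → IsP U r (k + 1) → k ≤ h.A 10 (h1.r 10)) ∧ h.A 10 (h1.r 10) < K ∧
      h1 = h.set 10 (h1.r 10)) ?_ ⟨rfl, hz, ho, hm, hK, ?_⟩ ?_
  · rintro h1 n ⟨rfl, hle, ho, hm, hK, e1⟩
    generalize h1.r 10 = z at *
    subst e1
    have ho1 := ho.1.1
    rw [← he.len _ hle] at ho1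
    simp only [linkWalk, vc, ↓reduceIte, Nat.reduceEqDiff, Nat.reduceLT, h5, h7]
    refine ⟨⟨⟨by omega, by omega, by omega⟩, by omega⟩, ?_⟩
    rw [hU _ (by omega)]
    intro hne
    have hne' : U (r - 2 * h.A 10 z) ≠ U r := by
      intro h; simp [h] at hne
    obtain ⟨w1, w2, w3⟩ := he.walk hr (hE.u0 r hr hrm) hle ho hne'
    have hlk := he.link_lt _ w1 hle
    have hll := he.link_le _ hle
    refine ⟨by omega, 2 * h.A 10 (h.A 11 z), ⟨rfl, hll, w2, ?_, by omega, ?_⟩, by omega⟩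
    · exact fun k hk hp => w3 k (hm k hk hp) hp
    · simp only [HS.set]; congr 1; funext y; by_cases hy : y = 10 <;> simp [hy]
  · simp only [HS.set, Function.update_eq_self]
  · rintro h1 t n ⟨rfl, hle, ho, hm, hK, e1⟩ hv ht
    have e0 : h1.A = h.A := by rw [e1]; rfl
    have e5 : h1.r 5 = h.r 5 := by rw [e1]; simp
    have e7 : h1.r 7 = h.r 7 := by rw [e1]; simp
    have ho1 := ho.1.1
    rw [← he.len _ hle] at ho1
    simp only [vc, ↓reduceIte, Nat.reduceEqDiff, Nat.reduceLT, h5, h7, e0, e5, e7] at hv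
    rw [hU _ (by omega)] at hv
    refine ⟨by omega, hle, ho, ?_, hm, hK, e1⟩
    by_contra hcon
    simp [hcon] at hv
end
end RLEMups

/-! ### One letter of the palindromic tree, with amortised cost -/

namespace RLEMups

section
variable {Γ : Cx} {U : ℕ → ℕ} {b : ℕ} {hw : ℕ → List ℕ}

theorem NodOK.mono {A A' : ℕ → ℕ → ℕ} {N N' c v : ℕ} {hw' : ℕ → List ℕ}
    (h : NodOK U A N hw c v) (h10 : A' 10 v = A 10 v) (hN : N ≤ N') (hh : hw' v = hw v) :
    NodOK U A' N' hw' c v := by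
  obtain ⟨a, b, c, d⟩ := h
  rw [← h10] at c d
  rw [← hh] at c
  exact ⟨a, by omega, c, d⟩

/-- The state after the letters at the positions `1, …, r - 1` have been processed. -/
structure EInv (Γ : Cx) (U : ℕ → ℕ) (b r : ℕ) (hw : ℕ → List ℕ) (h0 h : HS) : Prop where
  one_le : 1 ≤ r
  r0 : h.r 0 = Γ.m
  r5 : h.r 5 = r
  dict : Dict h.A (h.r 2) b
  eer : Eer U h.A (h.r 2) r hw
  le : h.r 6 ≤ h.r 2
  occ : Occ U (hw (h.r 6)) (r - 1)
  max : ∀ k, IsP U (r - 1) k → k ≤ h.A 10 (h.r 6)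
  nod : ∀ c, 1 ≤ c → c < r - h.A 10 (h.r 6) → NodOK U h.A (h.r 2) hw c (h.A 4 c)
  card : h.r 2 + 1 ≤ r
  arr : ∀ f, f < 4 ∨ 11 < f → h.A f = h0.A f
  io : h.io = h0.io

/-- The potential is 20 times the half-length of the current palindrome plus twice that of its
suffix link. The main walk is paid by the first summand and never raises the second, the walk for
the new link is paid by the second, and one letter raises either half-length by at most one. What
remains are two dictionary lookups and a constant. -/
theorem eerStep_wp (hE : ECtx Γ U b) {h0 h : HS} {r : ℕ} (hrm : r ≤ Γ.m + 1)
    (hU : ∀ j, j ≤ Γ.m + 1 → h0.A 0 j = U j) (hi : EInv Γ U b r hw h0 h) :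
    wp Γ eerStep h (fun h' t => (∃ hw', EInv Γ U b (r + 1) hw' h0 h') ∧
      t + 20 * h'.A 10 (h'.r 6) + 2 * h'.A 10 (h'.A 11 (h'.r 6)) ≤
        20 * h.A 10 (h.r 6) + 2 * h.A 10 (h.A 11 (h.r 6)) + (8 * b + 90)) := by
  have hcap := hE.cap
  have hB := hE.B
  have hcard := hi.card
  have hr := hi.one_le
  have hN : h.r 2 + 1 < Γ.cap := by omega
  have hU0 := hE.u0 r hr hrm
  have eA0 : h.A 0 = h0.A 0 := hi.arr 0 (by omega)
  have hEer := hi.eer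
  set N := h.r 2 with hNdef
  simp only [eerStep, vc, ↓reduceIte, Nat.reduceEqDiff, Nat.reduceLT, hi.r5, eA0, hU r hrm]
  refine ⟨by omega, ?_⟩
  have hwi : WalkInv Γ U hw r (h.set 7 (U r)) (h.set 7 (U r)) := by
    refine ⟨?_, ?_, ?_, ?_, le_rfl, fun _ _ => rfl, fun _ _ _ _ _ => rfl, rfl⟩
    all_goals try simp only [vc, ↓reduceIte, Nat.reduceEqDiff]
    · exact hi.le
    · exact hi.occ
    · intro k hk
      exact hi.max k ((isP_succ hr hU0).1 hk).1
    · exact hi.nod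
  refine wp_mono (walk_wp hE hr hrm (by simpa using hN) (by simpa using hi.r5) (by simp)
    (by intro j hj; simp [eA0, hU j hj]) (by simpa using hEer) hwi) ?_
  rintro h1 t1 ⟨ht1, hm1, hw1⟩
  simp only [vc, ↓reduceIte, Nat.reduceEqDiff, Nat.reduceLT] at ht1 hm1
  have hle1 := hw1.le
  have hocc1 := hw1.occ
  have hmax1 := hw1.max
  have hnod1 := hw1.nod
  have hlink1 := hw1.link
  have harr1 : ∀ f, f ≠ 4 → h1.A f = h.A f := hw1.arr
  have hreg1 := hw1.reg
  simp only [vc, ↓reduceIte, Nat.reduceEqDiff, Nat.reduceLT] at hle1 hocc1 hmax1 hnod1 hlink1 hreg1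
  have hio1 : h1.io = h.io := hw1.io
  have r2 := hreg1 2 (by omega) (by omega) (by omega) (by omega)
  have r7 := hreg1 7 (by omega) (by omega) (by omega) (by omega)
  have r5 := hreg1 5 (by omega) (by omega) (by omega) (by omega)
  have r0 := hreg1 0 (by omega) (by omega) (by omega) (by omega)
  simp only [↓reduceIte, Nat.reduceEqDiff] at r2 r7 r5 r0
  clear hwi hw1
  set cur := h1.r 6 with hcur
  set H := h.A 10 cur with hH
  obtain ⟨hp, hW⟩ := hEer.extend hr hU0 hle1 hocc1 hm1
  have hmaxr : ∀ k, IsP U r k → k ≤ H + 1 := by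
    intro k hk
    rcases k with _ | k
    · omega
    · have := hmax1 k hk; omega
  have hHr : 2 * H ≤ r := by
    have := hocc1.1.1
    rw [← hEer.len _ hle1] at this
    omega
  simp only [r2, r7]
  refine wp_mono (findIns_wp (b := b) (o := cur) (k := U r) ?_ ?_ (hE.ub r hrm) ?_ ?_ ?_ (by omega)
    (hE.uB r hrm)) ?_
  · simp only [vc, ↓reduceIte, Nat.reduceEqDiff, r2]
    exact hi.dict.congr (fun f a b => harr1 f (by omega))
  · simp only [vc, ↓reduceIte, Nat.reduceEqDiff, r2]; exact hle1
  · simp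
  · simp
  · simp only [vc, ↓reduceIte, Nat.reduceEqDiff, r2]; exact hN
  rintro h3 t3 ⟨ht3, FP⟩
  have f0 := FP.reg 0 (by omega) (by omega)
  have f5 := FP.reg 5 (by omega) (by omega)
  have f6 := FP.reg 6 (by omega) (by omega)
  have f7 := FP.reg 7 (by omega) (by omega)
  have f12 := FP.reg 12 (by omega) (by omega)
  have farr := FP.arr
  have fold := FP.old
  have fnew := FP.new
  have fio := FP.io
  have f25 := FP.le
  simp only [vc, ↓reduceIte, Nat.reduceEqDiff, r2, r5, r7, r0, hi.r5] at f0 f5 f6 f7 f12 farr fold fnew fio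
  have g10 : h3.A 10 = h.A 10 := by rw [farr 10 (by omega), harr1 10 (by omega)]
  have g11 : h3.A 11 = h.A 11 := by rw [farr 11 (by omega), harr1 11 (by omega)]
  have g4 : h3.A 4 = h1.A 4 := farr 4 (by omega)
  have gold : ∀ v ≤ N, h3.A 8 v = h.A 8 v ∧ h3.A 9 v = h.A 9 v := by
    intro v hv
    rw [← harr1 8 (by omega), ← harr1 9 (by omega)]
    exact fold v hv
  have gio : h3.io = h0.io := by rw [fio, hio1, hi.io]
  have garr : ∀ f, f < 4 ∨ 11 < f → h3.A f = h0.A f := by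
    intro f hf
    rw [farr f (by omega), harr1 f (by omega), hi.arr f hf]
  have hE3 : Eer U h3.A N r hw := hEer.congr gold (by simp [g10]) (by simp [g11])
  simp only [vc, ↓reduceIte, Nat.reduceEqDiff, Nat.reduceLT, f12, f6, f5, f7, g10, g11]
  rw [← hcur]
  rcases fnew with fn | ⟨fn, fv, fno⟩
  · -- the node exists
    rw [fn] at f25
    have hv : hw (h3.r 25) = U r :: hw cur := by
      rw [hE3.hw_cons _ FP.pos f25, FP.key, FP.par]
    have hv10 : h.A 10 (h3.r 25) = H + 1 := by
      rw [← g10, hE3.len _ f25, hv, List.length_cons, hH, ← g10, hE3.len cur hle1]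
    have hS : Eer U h3.A N (r + 1) hw := by
      refine hE3.same (v := h3.r 25) FP.pos f25 ?_ ?_ ?_
      · rw [g10, hv10]; exact hp
      · rw [g10, hv10, hv, hW]
      · rw [g10, hv10]; exact hmaxr
    -- Stripping the outer letters from the suffix link of the new current palindrome leaves a
    -- proper palindromic suffix of the old one, to which the suffix link of `cur` is an upper
    -- bound.
    have hl : h.A 10 (h.A 11 (h3.r 25)) ≤ h.A 10 (h.A 11 cur) + 1 := by
      have hoc : Occ U (hw (h3.r 25)) r := by
        have : (hw (h3.r 25)).length = H + 1 := by rw [← hE3.len _ f25, g10, hv10]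
        refine ⟨by rw [this]; exact hp, by rw [this, hv, hW]⟩
      have hl1 := (hE3.link _ FP.pos f25 r hoc).1
      have hl2 := hE3.link_lt _ FP.pos f25
      have hl3 := hE3.link_le _ f25
      rw [g10, g11, hv10] at hl2
      have hq := hl1.1
      rw [← hE3.len _ hl3, g10, g11] at hq
      rcases hk : h.A 10 (h.A 11 (h3.r 25)) with _ | k
      · omega
      · rw [hk] at hq hl2
        have hq1 := ((isP_succ hr hU0).1 hq).1
        rcases Nat.eq_zero_or_pos cur with h0' | h0'
        · have : H = 0 := by rw [hH, h0', hEer.len_zero]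
          omega
        · have := (hEer.link cur h0' hle1 _ hocc1).2 k (by omega) hq1
          omega
    simp only [fn, lt_irrefl, if_false, vc, ↓reduceIte]
    refine ⟨by omega, ⟨hw, by omega, ?_, ?_, ?_, ?_, ?_, ?_, ?_, ?_, ?_, ?_, ?_⟩, ?_⟩
    all_goals try simp only [vc, ↓reduceIte, Nat.reduceEqDiff, Nat.reduceLT, fn, g10, g11, hv10]
    · rw [f0, hi.r0]
    · have := FP.dict; rwa [fn] at this
    · exact hS
    · exact f25
    · rw [Nat.add_sub_cancel]
      have : (hw (h3.r 25)).length = H + 1 := by rw [← hE3.len _ f25, g10, hv10]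
      refine ⟨by rw [this]; exact hp, by rw [this, hv, hW]⟩
    · rw [Nat.add_sub_cancel]; exact hmaxr
    · intro c c1 c2
      rw [g4]
      exact (hnod1 c c1 (by omega)).congr (by rw [g10])
    · omega
    · exact garr
    · exact gio
    · omega
  · -- a new node
    have fno' : ∀ v, 1 ≤ v → v ≤ N → h.A 9 v = cur → h.A 8 v ≠ U r := by
      intro v v1 v2
      rw [← harr1 9 (by omega), ← harr1 8 (by omega)]
      exact fno v v1 v2
    have lt1 : h.r 2 < h.r 2 + 1 := by omega
    -- The common end of both cases with a new node: `x` is its suffix link, which is `0` for a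
    -- single letter and the result of the second lookup otherwise.
    have HL : ∀ (h4 : HS) (x : ℕ), h4.r 0 = Γ.m → h4.r 2 = N + 1 → h4.r 5 = r → h4.r 11 = N + 1 →
        Dict h4.A (N + 1) b → (∀ f, f < 4 ∨ 11 < f → h4.A f = h0.A f) →
        h4.io = h0.io → h4.A 4 = h3.A 4 →
        (∀ v ≤ N + 1, h4.A 8 v = h3.A 8 v ∧ h4.A 9 v = h3.A 9 v) →
        (∀ v, h4.A 10 v = if v = N + 1 then H + 1 else h.A 10 v) →
        (∀ v, h4.A 11 v = if v = N + 1 then x else h.A 11 v) →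
        x ≤ N → h.A 10 x < H + 1 → Occ U (hw x) r →
        (∀ k, k < H + 1 → IsP U r k → k ≤ h.A 10 x) →
        EInv Γ U b (r + 1) (Function.update hw (N + 1) (U r :: hw cur)) h0
          ((h4.set 6 (N + 1)).set 5 (r + 1)) := by
      intro h4 x q0 q2 q5 q11 qd qf qio q4 q8 q10 q11 hx hxlt hxo hxm
      have p10 : ∀ v ≤ N, h4.A 10 v = h.A 10 v := fun v hv => by rw [q10, if_neg (by omega)]
      have p11 : ∀ v ≤ N, h4.A 11 v = h.A 11 v := fun v hv => by rw [q11, if_neg (by omega)]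
      have n10 : h4.A 10 (N + 1) = H + 1 := by rw [q10, if_pos rfl]
      have n11 : h4.A 11 (N + 1) = x := by rw [q11, if_pos rfl]
      have p8 : ∀ v ≤ N, h4.A 8 v = h.A 8 v ∧ h4.A 9 v = h.A 9 v := by
        intro v hv
        rw [(q8 v (by omega)).1, (q8 v (by omega)).2]; exact gold v hv
      have n8 : h4.A 8 (N + 1) = U r := by rw [(q8 _ le_rfl).1, ← fv]; exact FP.key
      have n9 : h4.A 9 (N + 1) = cur := by rw [(q8 _ le_rfl).2, ← fv]; exact FP.par
      have hI := hEer.insert (A' := h4.A) hr hle1 hp hW hmaxr p8 p10 p11 n8 n9 n10 n11 hx hxlt hxo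
        hxm fno'
      have hlw : (U r :: hw cur).length = H + 1 := by
        rw [List.length_cons, hH, hEer.len cur hle1]
      refine ⟨by omega, ?_, ?_, ?_, ?_, ?_, ?_, ?_, ?_, ?_, ?_, ?_⟩
      all_goals try simp only [vc, ↓reduceIte, Nat.reduceEqDiff, Nat.reduceLT, q0, q2, n10,
        Function.update_self, Nat.add_sub_cancel]
      · exact qd
      · exact hI
      · omega
      · exact ⟨by rw [hlw]; exact hp, by rw [hlw, hW]⟩
      · exact hmaxr
      · intro c c1 c2
        rw [q4, g4]
        have := hnod1 c c1 (by omega)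
        exact this.mono (p10 _ this.2.1) (by omega)
          (Function.update_of_ne (by have := this.2.1; omega) _ _)
      · omega
      · exact qf
      · exact qio
    simp only [fn, fv, lt1, if_true, vc, ↓reduceIte, Nat.reduceLT, Nat.reduceEqDiff, f5, f6, g10,
      ← hcur, ← hH]
    refine ⟨⟨by omega, by omega⟩, by omega, ?_, ?_⟩
    · intro hc0
      have hc0' : cur = 0 := by
        by_contra hh; rw [if_neg hh] at hc0; exact hc0 rfl
      have hH0 : H = 0 := by rw [hH, hc0', hEer.len_zero]
      have hz0 := hEer.len_zero
      refine ⟨by omega, by omega, ⟨_, HL _ 0 ?_ ?_ ?_ ?_ ?_ ?_ ?_ ?_ ?_ ?_ ?_ ?_ ?_ ?_ ?_⟩, by omega⟩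
      all_goals try simp only [vc, ↓reduceIte, Nat.reduceEqDiff, Nat.reduceLT]
      · rw [f0, hi.r0]
      · exact fn
      · exact f5
      · rfl
      · have := FP.dict
        rw [fn] at this
        refine this.congr ?_
        intro f a1 a2
        have : f ≠ 10 := by omega
        have : f ≠ 11 := by omega
        funext j; simp [*]
      · intro f hf
        have : f ≠ 10 := by omega
        have : f ≠ 11 := by omega
        funext j; simp only [vc, *, ↓reduceIte, garr f hf]
      · exact gio
      · funext j; simp
      · intro v _; simp
      · intro v; simp [g10, N]
      · intro v; simp [g11, N]
      · omega
      · omega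
      · rw [hEer.hw_zero]; exact ⟨IsP.zero r, rfl⟩
      · intro k hk _; omega
    · intro hc0
      have hc1 : 1 ≤ cur := by
        by_contra hh; rw [if_pos (by omega)] at hc0; exact one_ne_zero hc0
      have hlt := hEer.link_lt cur hc1 hle1
      have hll := hEer.link_le cur hle1
      obtain ⟨hlo, hlm⟩ := hEer.link cur hc1 hle1 _ hocc1
      refine ⟨by omega, ?_⟩
      have hA4 : ∀ f, f ≠ 10 → (((h3.set 11 (N + 1)).st 10 (N + 1) (H + 1)).set 10
          (h.A 11 cur)).A f = h3.A f := by
        intro f hf; funext j; simp [hf]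
      have hA10 : ∀ v, (((h3.set 11 (N + 1)).st 10 (N + 1) (H + 1)).set 10
          (h.A 11 cur)).A 10 v = if v = N + 1 then H + 1 else h.A 10 v := by
        intro v; simp [g10]
      have hA10' : ∀ v ≤ N, (((h3.set 11 (N + 1)).st 10 (N + 1) (H + 1)).set 10
          (h.A 11 cur)).A 10 v = h.A 10 v := by
        intro v hv; rw [hA10, if_neg (by omega)]
      have hEer4 : Eer U (((h3.set 11 (N + 1)).st 10 (N + 1) (H + 1)).set 10
          (h.A 11 cur)).A N r hw := by
        refine hEer.congr ?_ hA10' ?_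
        · intro v hv; rw [hA4 8 (by omega), hA4 9 (by omega)]; exact gold v hv
        · intro v hv; rw [hA4 11 (by omega), g11]
      refine wp_mono (linkWalk_wp (N := N) (K := H) hE hr hrm hN (by simpa using f5)
        (by simpa using f7) ?_ hEer4 (by simpa using hll) (by simpa using hlo) ?_ ?_) ?_
      · intro j hj; rw [hA4 0 (by omega), garr 0 (by omega), hU j hj]
      · intro k hk hpk
        simp only [vc, ↓reduceIte]
        have := hA10' _ hll
        simp only [vc] at this
        rw [this]
        exact hlm k hk ((isP_succ hr hU0).1 hpk).1
      · simp only [vc, ↓reduceIte]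
        have := hA10' _ hll
        simp only [vc] at this
        rw [this]
        exact hlt
      rintro h5 t5 ⟨ht5, hz, hzo, hzm, hzx, hzlt, hz5⟩
      simp only [HS.set_r, ↓reduceIte] at ht5
      rw [hA10' _ hll] at ht5
      have hz10 : ((h3.set 11 (h.r 2 + 1)).st 10 (h.r 2 + 1) (H + 1)).A 10 (h5.r 10) =
        h.A 10 (h5.r 10) := hA10' _ hz
      simp only [HS.set_A, hz10] at ht5 hzm hzlt hzx
      generalize h5.r 10 = z at *
      obtain ⟨hp2, hW2⟩ := hEer.extend hr hU0 hz hzo hzm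
      -- the target of the suffix link exists
      obtain ⟨u, u1, u2, u3⟩ := hEer.compl_of_lt hp hp2 (by omega) (by omega)
      rw [← hW2] at u3
      obtain ⟨u4, u5⟩ := hEer.child hz u1 u2 u3
      subst hz5
      have hd5 : Dict (((h3.set 11 (N + 1)).st 10 (N + 1) (H + 1)).set 10
          (h.A 11 cur)).A (N + 1) b := by
        have := FP.dict
        rw [fn] at this
        exact this.congr (fun f a1 a2 => hA4 f (by omega))
      simp only [vc, ↓reduceIte, Nat.reduceLT, Nat.reduceEqDiff, f7]
      refine wp_mono (findIns_wp (b := b) (o := z) (k := U r) ?_ ?_ (hE.ub r hrm) ?_ ?_ ?_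
        (by omega) (hE.uB r hrm)) ?_
      · simp only [vc, ↓reduceIte, Nat.reduceEqDiff, fn]; exact hd5
      · simp only [vc, ↓reduceIte, Nat.reduceEqDiff, fn]; omega
      · simp
      · simp
      · simp only [vc, ↓reduceIte, Nat.reduceEqDiff, fn]; omega
      rintro h6 t6 ⟨ht6, FP2⟩
      have w0 := FP2.reg 0 (by omega) (by omega)
      have w5 := FP2.reg 5 (by omega) (by omega)
      have w11 := FP2.reg 11 (by omega) (by omega)
      have warr := FP2.arr
      have wold := FP2.old
      have wnew := FP2.new
      have wio := FP2.io
      have w25 := FP2.le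
      simp only [HS.set_r, HS.set_A, HS.set_io, HS.st_r, HS.st_io, ↓reduceIte, Nat.reduceEqDiff, f0,
        f5, fn] at w0 w5 w11 warr wold wnew wio
      have old8 : ∀ v ≤ N, h6.A 8 v = h.A 8 v ∧ h6.A 9 v = h.A 9 v := by
        intro v hv
        obtain ⟨c1, c2⟩ := wold v (by omega)
        rw [c1, c2]
        have := gold v hv
        simpa using this
      rcases wnew with wn | ⟨wn, wv, wno⟩
      swap
      -- The second lookup cannot create an entry, because the target `u` of the link already is the
      -- child of `z` with this letter.
      · exfalso
        refine wno u u1 (by omega) ?_ ?_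
        · have := (gold u u2).2; simp [this, u4]
        · have := (gold u u2).1; simp [this, u5]
      have hxu : h6.r 25 = u := by
        refine FP2.dict.inj FP2.pos FP2.le u1 (by omega) ?_ ?_
        · rw [FP2.par, (old8 u u2).2, u4]
        · rw [FP2.key, (old8 u u2).1, u5]
      have hul : (hw u).length = h.A 10 z + 1 := by
        rw [u3, List.length_cons, hEer.len z hz]
      have hul' : h.A 10 u = h.A 10 z + 1 := by rw [hEer.len u u2, hul]
      have w10 : h6.A 10 (h.r 2 + 1) = H + 1 := by rw [warr 10 (by omega)]; simp
      have w10' : ∀ v ≤ N, h6.A 10 v = h.A 10 v := by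
        intro v hv; rw [warr 10 (by omega)]
        have : v ≠ h.r 2 + 1 := by omega
        simp [this, g10]
      simp only [w11, w5, w0, hxu, w10, w10' u u2, hul']
      refine ⟨by omega, by omega, ⟨_, HL _ u ?_ ?_ ?_ ?_ ?_ ?_ ?_ ?_ ?_ ?_ ?_ ?_ ?_ ?_ ?_⟩, by omega⟩
      all_goals try simp only [vc, ↓reduceIte, Nat.reduceEqDiff, Nat.reduceLT]
      · rw [w0, hi.r0]
      · exact wn
      · exact w5
      · exact w11
      · have := FP2.dict
        rw [wn] at this
        refine this.congr ?_
        intro f a1 a2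
        have : f ≠ 11 := by omega
        funext j; simp [*]
      · intro f hf
        have : f ≠ 10 := by omega
        have : f ≠ 11 := by omega
        have w := warr f (by omega)
        funext j; simp [*, garr f hf]
      · rw [wio]; exact gio
      · funext j; simp [warr 4]
      · intro v hv
        obtain ⟨c1, c2⟩ := wold v hv
        rw [c1, c2]; simp
      · intro v; simp [warr 10, g10, N]
      · intro v; simp [warr 11, g11, N]
      · exact u2
      · omega
      · exact ⟨by rw [hul]; exact hp2, by rw [hul, u3, hW2]⟩
      · intro k hk hpk
        rcases k with _ | k
        · omega
        · have := hzx k (by omega) hpk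
          omega

/-- The word is processed up to the closing sentinel at `m + 1`. As this letter occurs nowhere else,
the last walk falls back to half-length `1` and thereby settles all centres up to `m`. -/
theorem eer_wp (hE : ECtx Γ U b) {h0 : HS} (hm : h0.r 0 = Γ.m) (h2 : h0.r 2 = 0)
    (hU : ∀ j, j ≤ Γ.m + 1 → h0.A 0 j = U j) (hz : ∀ f, 4 ≤ f → f ≤ 11 → ∀ j, h0.A f j = 0) :
    wp Γ eer h0 (fun h' t => (∃ hw, EInv Γ U b (Γ.m + 2) hw h0 h' ∧ h'.A 10 (h'.r 6) = 1) ∧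
      t ≤ (Γ.m + 1) * (8 * b + 92) + 5) := by
  have hcap := hE.cap
  have hB := hE.B
  simp only [eer, vc, ↓reduceIte, Nat.reduceEqDiff, Nat.reduceLT]
  refine wp_whl (fun h n => ∃ r hw, EInv Γ U b r hw h0 h ∧ r ≤ Γ.m + 2 ∧
    n = (Γ.m + 2 - r) * (8 * b + 92) + 20 * h.A 10 (h.r 6) + 2 * h.A 10 (h.A 11 (h.r 6)))
    (n := (Γ.m + 1) * (8 * b + 92)) ?_ ?_ ?_
  · rintro h n ⟨r, hw, hi, hr, rfl⟩
    simp only [vc, ↓reduceIte, Nat.reduceEqDiff, Nat.reduceLT, hi.r0, hi.r5]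
    refine ⟨by omega, fun hlt => ?_⟩
    have hlt' : r < Γ.m + 2 := by
      by_contra hcon; rw [if_neg hcon] at hlt; exact hlt rfl
    refine wp_mono (eerStep_wp hE (by omega) hU hi) ?_
    rintro h' t ⟨⟨hw', hi'⟩, ht⟩
    refine ⟨_, ⟨r + 1, hw', hi', by omega, rfl⟩, ?_⟩
    have : (Γ.m + 2 - r) * (8 * b + 92) = (Γ.m + 2 - (r + 1)) * (8 * b + 92) + (8 * b + 92) := by
      rw [show Γ.m + 2 - r = (Γ.m + 2 - (r + 1)) + 1 by omega]; ring
    omega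
  · refine ⟨1, fun _ => [], ⟨le_rfl, ?_, ?_, ?_, ?_, ?_, ?_, ?_, ?_, ?_, ?_, ?_⟩, by omega, ?_⟩
    all_goals try simp only [vc, ↓reduceIte, Nat.reduceEqDiff, Nat.reduceLT, hm, h2]
    · exact Dict.empty (hz 5 (by omega) (by omega)) (hz 6 (by omega) (by omega))
        (hz 7 (by omega) (by omega))
    · refine ⟨rfl, by omega, ?_, by omega, by omega, by omega, by omega,
        hz 11 (by omega) (by omega) 0, ?_, by omega, by omega⟩
      · intro v _; simp [hz 10 (by omega) (by omega)]
      · intro v _; rw [hz 11 (by omega) (by omega)]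
    · omega
    · exact ⟨IsP.zero _, rfl⟩
    · intro k hk; have := hk.1; omega
    · intro c c1 c2; omega
    · omega
    · intros; trivial
    · rw [hz 10 (by omega) (by omega), hz 10 (by omega) (by omega),
        show Γ.m + 2 - 1 = Γ.m + 1 by omega]; omega
  · rintro h t n ⟨r, hw, hi, hr, rfl⟩ hv ht
    simp only [vc, ↓reduceIte, Nat.reduceEqDiff, Nat.reduceLT, hi.r0, hi.r5] at hv
    have : ¬ r < Γ.m + 2 := by
      intro hcon; rw [if_pos hcon] at hv; exact one_ne_zero hv
    obtain rfl : r = Γ.m + 2 := by omega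
    have hone := hi.max 1 (IsP.one (by omega))
    have hocc := hi.occ.1
    rw [← hi.eer.len _ hi.le] at hocc
    -- A longer palindromic suffix would match the closing sentinel with an earlier letter.
    have hle : h.A 10 (h.r 6) = 1 := by
      by_contra hcon
      have h1 := hocc.1
      have h2 := hocc.2 0 (by omega)
      exact hE.u1 _ (by omega) (by omega) h2.symm
    exact ⟨⟨hw, hi, hle⟩, by omega⟩
end
end RLEMups

/-! ### Minimal unique palindromic substrings in terms of runs -/

namespace RLEMups

/-- The word `a` of length `n` consists of `m` runs; the run `c` has the letter `ch c` and the length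
`ex c`, and is preceded by `P c` letters; `U c` identifies the pair of `ch c` and `ex c`. -/
structure RD (n m : ℕ) (a ch ex P U : ℕ → ℕ) : Prop where
  P_one : P 1 = 0
  P_succ : ∀ c, 1 ≤ c → c ≤ m → P (c + 1) = P c + ex c
  P_last : P (m + 1) = n
  ex_pos : ∀ c, 1 ≤ c → c ≤ m → 1 ≤ ex c
  letter : ∀ c, 1 ≤ c → c ≤ m → ∀ p, P c < p → p ≤ P (c + 1) → a p = ch c
  adj : ∀ c, 1 ≤ c → c < m → ch c ≠ ch (c + 1)
  U_iff : ∀ c c', 1 ≤ c → c ≤ m → 1 ≤ c' → c' ≤ m → (U c = U c' ↔ ch c = ch c' ∧ ex c = ex c')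

/-- The centre `c` has a palindrome that contains the runs `c - k + 1, …, c + k - 1` and parts of
the next runs on both sides. -/
structure Valid (m : ℕ) (ch U : ℕ → ℕ) (c k : ℕ) : Prop where
  lt : k < c
  le : c + k ≤ m
  arm : ∀ i < k, U (c - i) = U (c + i)
  ends : ch (c - k) = ch (c + k)

/-- The largest possible length of these parts. -/
def val (ex : ℕ → ℕ) (c k : ℕ) : ℕ := min (ex (c - k)) (ex (c + k))

/-- The centres `c` and `c'` have the same palindromes at the level `k`. -/
structure Grp (m : ℕ) (ch U : ℕ → ℕ) (c c' k : ℕ) : Prop where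
  left : Valid m ch U c k
  right : Valid m ch U c' k
  arm : ∀ i < k, U (c + i) = U (c' + i)
  ends : ch (c + k) = ch (c' + k)

/-- The longest palindrome of `c` at the level `k` is unique. -/
def Uniq (m : ℕ) (ch ex U : ℕ → ℕ) (c k : ℕ) : Prop :=
  Valid m ch U c k ∧ ∀ c', c' ≠ c → Grp m ch U c c' k → val ex c' k < val ex c k

/-- `k` is the first level at which a palindrome with the centre `c` is unique. -/
def First (m : ℕ) (ch ex U : ℕ → ℕ) (c k : ℕ) : Prop :=
  Uniq m ch ex U c k ∧ ∀ k' < k, ¬ Uniq m ch ex U c k'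

/-- `x` is the largest value of the other centres at the level `k`. -/
def IsTop (m : ℕ) (ch ex U : ℕ → ℕ) (c k x : ℕ) : Prop :=
  (∀ c', c' ≠ c → Grp m ch U c c' k → val ex c' k ≤ x) ∧
    (x = 0 ∨ ∃ c', c' ≠ c ∧ Grp m ch U c c' k ∧ val ex c' k = x)

/-- The substring of length `L` at the position `i` also occurs at the position `q`. -/
def Match (n : ℕ) (a : ℕ → ℕ) (i L q : ℕ) : Prop :=
  1 ≤ q ∧ q + L ≤ n + 1 ∧ ∀ t < L, a (q + t) = a (i + t)

/-- Minimal unique palindromic substrings of words given as functions on positions. -/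
structure MUPS (n : ℕ) (a : ℕ → ℕ) (i j : ℕ) : Prop where
  one_le : 1 ≤ i
  le : i ≤ j
  le_n : j ≤ n
  pal : ∀ t, i + t ≤ j → a (i + t) = a (j - t)
  uniq : ∀ q, Match n a i (j + 1 - i) q → q = i
  min : (i + 2 ≤ j ∧ ∃ q, q ≠ i + 1 ∧ Match n a (i + 1) (j - 1 - i) q) ∨ j ≤ i + 1

section
variable {n m : ℕ} {a ch ex P U : ℕ → ℕ}

theorem RD.mono (h : RD n m a ch ex P U) {c : ℕ} (hc : 1 ≤ c) : ∀ c', c ≤ c' → c' ≤ m + 1 →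
    P c + (c' - c) ≤ P c' := by
  intro c' h1
  induction c', h1 using Nat.le_induction with
  | base => intro _; simp
  | succ d hd ih =>
    intro h2
    have := h.P_succ d (by omega) (by omega)
    have := h.ex_pos d (by omega) (by omega)
    have := ih (by omega)
    omega

theorem RD.run (h : RD n m a ch ex P U) {p : ℕ} (h1 : 1 ≤ p) (hp : p ≤ n) :
    ∃ c, 1 ≤ c ∧ c ≤ m ∧ P c < p ∧ p ≤ P (c + 1) := by
  by_contra hcon
  push Not at hcon
  have key : ∀ c, 1 ≤ c → c ≤ m + 1 → P c < p := by
    intro c hc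
    induction c, hc using Nat.le_induction with
    | base => intro _; rw [h.P_one]; omega
    | succ d hd ih => intro h2; exact hcon d hd (by omega) (ih (by omega))
  have := key (m + 1) (by omega) le_rfl
  rw [h.P_last] at this
  omega

/-- Equal words have their run boundaries at the same positions. -/
theorem RD.shift (h : RD n m a ch ex P U) {x y p q : ℕ} (hx : 1 ≤ x) (hxm : x + 1 ≤ m)
    (hy : 1 ≤ y) (hym : y ≤ m) (hp1 : P x < p) (hp2 : p ≤ P (x + 1)) (hq1 : P y < q)
    (hq2 : q ≤ P (y + 1)) (hn : q + (P (x + 1) + 1 - p) ≤ n)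
    (he : ∀ t, t ≤ P (x + 1) + 1 - p → a (p + t) = a (q + t)) :
    P (y + 1) + p = P (x + 1) + q ∧ y + 1 ≤ m ∧ ch x = ch y ∧ ch (x + 1) = ch (y + 1) := by
  have ex1 := h.ex_pos (x + 1) (by omega) (by omega)
  have exs := h.P_succ (x + 1) (by omega) (by omega)
  have c0 : ch x = ch y := by
    rw [← h.letter x hx (by omega) p hp1 hp2, ← h.letter y hy hym q hq1 hq2]
    simpa using he 0 (by omega)
  have cx : ch (x + 1) = a (q + (P (x + 1) + 1 - p)) := by
    rw [← he _ le_rfl, ← h.letter (x + 1) (by omega) (by omega) (P (x + 1) + 1) (by omega)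
      (by omega)]
    congr 1; omega
  -- If the run `y` ended before the copy of the end of `x`, its successor would repeat its
  -- character; if it ended later (`b2`), the successor of `x` would repeat that of `x`.
  have b1 : q + (P (x + 1) - p) ≤ P (y + 1) := by
    by_contra hcon
    have hym' : y + 1 ≤ m := by
      by_contra hh
      obtain rfl : y = m := by omega
      rw [h.P_last] at hcon; omega
    have e1 := h.ex_pos (y + 1) (by omega) hym'
    have e2 := h.P_succ (y + 1) (by omega) hym'
    have a1 := h.letter (y + 1) (by omega) hym' (P (y + 1) + 1) (by omega) (by omega)
    have a2 := he (P (y + 1) + 1 - q) (by omega)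
    rw [show q + (P (y + 1) + 1 - q) = P (y + 1) + 1 by omega, a1,
      h.letter x hx (by omega) _ (by omega) (by omega)] at a2
    exact h.adj y hy (by omega) (by rw [← a2, c0])
  have b2 : P (y + 1) < q + (P (x + 1) + 1 - p) := by
    by_contra hcon
    rw [h.letter y hy hym _ (by omega) (by omega)] at cx
    exact h.adj x hx (by omega) (by rw [cx, c0])
  have hP : P (y + 1) + p = P (x + 1) + q := by omega
  have hym' : y + 1 ≤ m := by
    by_contra hh
    obtain rfl : y = m := by omega
    rw [h.P_last] at hP; omega
  refine ⟨hP, hym', c0, ?_⟩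
  have e1 := h.ex_pos (y + 1) (by omega) hym'
  have e2 := h.P_succ (y + 1) (by omega) hym'
  rw [cx, h.letter (y + 1) (by omega) hym' _ (by omega) (by omega)]

/-- The mirror image of a word has its run boundaries at the mirror images of the positions. -/
theorem RD.shift_mirror (h : RD n m a ch ex P U) {x y p q : ℕ} (hx : 1 ≤ x) (hxm : x + 1 ≤ m)
    (hy : 1 ≤ y) (hym : y ≤ m) (hp1 : P x < p) (hp2 : p ≤ P (x + 1)) (hq1 : P y < q)
    (hq2 : q ≤ P (y + 1)) (hn : P (x + 1) + 1 - p < q)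
    (he : ∀ t, t ≤ P (x + 1) + 1 - p → a (p + t) = a (q - t)) :
    P (x + 1) + P y + 1 = p + q ∧ 2 ≤ y ∧ ch x = ch y ∧ ch (x + 1) = ch (y - 1) := by
  have ex1 := h.ex_pos (x + 1) (by omega) (by omega)
  have exs := h.P_succ (x + 1) (by omega) (by omega)
  have c0 : ch x = ch y := by
    rw [← h.letter x hx (by omega) p hp1 hp2, ← h.letter y hy hym q hq1 hq2]
    simpa using he 0 (by omega)
  have cx : ch (x + 1) = a (q - (P (x + 1) + 1 - p)) := by
    rw [← he _ le_rfl, ← h.letter (x + 1) (by omega) (by omega) (P (x + 1) + 1) (by omega)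
      (by omega)]
    congr 1; omega
  have prev : 2 ≤ y → P y = P (y - 1) + ex (y - 1) ∧ 1 ≤ ex (y - 1) ∧
      ∀ p, P (y - 1) < p → p ≤ P y → a p = ch (y - 1) := by
    intro h2
    have := h.P_succ (y - 1) (by omega) (by omega)
    have h3 := h.letter (y - 1) (by omega) (by omega)
    rw [show y - 1 + 1 = y by omega] at this h3
    exact ⟨this, h.ex_pos (y - 1) (by omega) (by omega), h3⟩
  have adj : 2 ≤ y → ch (y - 1) ≠ ch y := by
    intro h2
    have := h.adj (y - 1) (by omega) (by omega)
    rwa [show y - 1 + 1 = y by omega] at this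
  have one : y = 1 → P y = 0 := fun h1 => by rw [h1, h.P_one]
  have b1 : P y < q - (P (x + 1) - p) := by
    by_contra hcon
    have h2 : 2 ≤ y := by
      by_contra hh
      have := one (by omega); omega
    obtain ⟨e1, e2, e3⟩ := prev h2
    have a1 := e3 (P y) (by omega) le_rfl
    have a2 := he (q - P y) (by omega)
    rw [show q - (q - P y) = P y by omega, a1,
      h.letter x hx (by omega) _ (by omega) (by omega)] at a2
    exact adj h2 (by rw [← a2, c0])
  have b2 : q - (P (x + 1) + 1 - p) ≤ P y := by
    by_contra hcon
    rw [h.letter y hy hym _ (by omega) (by omega)] at cx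
    exact h.adj x hx (by omega) (by rw [cx, c0])
  have hP : P (x + 1) + P y + 1 = p + q := by omega
  have h2 : 2 ≤ y := by
    by_contra hh
    have := one (by omega); omega
  refine ⟨hP, h2, c0, ?_⟩
  obtain ⟨e1, e2, e3⟩ := prev h2
  rw [cx, e3 _ (by omega) (by omega)]

theorem Valid.left_iff (h : RD n m a ch ex P U) {c k : ℕ} (hv : Valid m ch U c k) {i : ℕ}
    (hi : i < k) : ch (c - i) = ch (c + i) ∧ ex (c - i) = ex (c + i) := by
  have h1 := hv.lt
  have h2 := hv.le
  exact (h.U_iff _ _ (by omega) (by omega) (by omega) (by omega)).1 (hv.arm i hi)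

/-- Only right arms are compared in `Grp`; the symmetry of both palindromes carries the equality
over to the left arms. -/
theorem Grp.both (h : RD n m a ch ex P U) {c c' k : ℕ} (hg : Grp m ch U c c' k) {u : ℕ}
    (h1 : 1 ≤ u) (hu : u < 2 * k) :
    ch (c - k + u) = ch (c' - k + u) ∧ ex (c - k + u) = ex (c' - k + u) := by
  have a1 := hg.left.lt
  have a2 := hg.left.le
  have a3 := hg.right.lt
  have a4 := hg.right.le
  by_cases hk : k ≤ u
  · rw [show c - k + u = c + (u - k) by omega, show c' - k + u = c' + (u - k) by omega]
    exact (h.U_iff _ _ (by omega) (by omega) (by omega) (by omega)).1 (hg.arm _ (by omega))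
  · rw [show c - k + u = c - (k - u) by omega, show c' - k + u = c' - (k - u) by omega]
    obtain ⟨b1, b2⟩ := hg.left.left_iff h (i := k - u) (by omega)
    obtain ⟨b3, b4⟩ := hg.right.left_iff h (i := k - u) (by omega)
    obtain ⟨b5, b6⟩ := (h.U_iff _ _ (by omega) (by omega) (by omega) (by omega)).1
      (hg.arm (k - u) (by omega))
    rw [b1, b2, b3, b4]
    exact ⟨b5, b6⟩

/-- The interior runs have equal lengths, so the run boundaries lie at equal distances from the
first of them. -/
theorem Grp.offset (h : RD n m a ch ex P U) {c c' k : ℕ} (hg : Grp m ch U c c' k) {u : ℕ}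
    (h1 : 1 ≤ u) : u ≤ 2 * k → P (c - k + u) + P (c' - k + 1) = P (c' - k + u) + P (c - k + 1) := by
  have a1 := hg.left.lt
  have a2 := hg.left.le
  have a3 := hg.right.lt
  have a4 := hg.right.le
  induction u, h1 using Nat.le_induction with
  | base => intro _; omega
  | succ u hu ih =>
    intro h2
    have := ih (by omega)
    have e1 := h.P_succ (c - k + u) (by omega) (by omega)
    have e2 := h.P_succ (c' - k + u) (by omega) (by omega)
    have e3 := (hg.both h hu (by omega)).2
    rw [← add_assoc, ← add_assoc, e1, e2]
    omega

theorem val_le {c k : ℕ} : val ex c k ≤ ex (c - k) ∧ val ex c k ≤ ex (c + k) :=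
  ⟨min_le_left _ _, min_le_right _ _⟩

/-- The bounds of the palindrome with the centre `c` at the level `k` with ends of length `l`. -/
theorem Valid.bounds (h : RD n m a ch ex P U) {c k l : ℕ} (hv : Valid m ch U c k)
    (hl : l ≤ val ex c k) (hk : 1 ≤ k) :
    P (c - k) + l ≤ P (c - k + 1) ∧ P (c + k) + l ≤ P (c + k + 1) ∧
      P (c + k + 1) ≤ n ∧ P (c - k + 1) < P (c + k) := by
  have a1 := hv.lt
  have a2 := hv.le
  have v := val_le (ex := ex) (c := c) (k := k)
  have e1 := h.P_succ (c - k) (by omega) (by omega)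
  have e2 := h.P_succ (c + k) (by omega) (by omega)
  have e3 := h.mono (c := c + k + 1) (by omega) (m + 1) (by omega) le_rfl
  have e4 := h.mono (c := c - k + 1) (by omega) (c + k) (by omega) (by omega)
  have := h.P_last
  refine ⟨by omega, by omega, by omega, by omega⟩

/-- The occurrences of a palindrome that spans at least three runs. -/
theorem Grp.match (h : RD n m a ch ex P U) {c c' k l : ℕ} (hg : Grp m ch U c c' k) (hk : 1 ≤ k)
    (hl : l ≤ val ex c k) (hl' : l ≤ val ex c' k) :
    Match n a (P (c - k + 1) + 1 - l) (2 * l + P (c + k) - P (c - k + 1))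
      (P (c' - k + 1) + 1 - l) := by
  have a1 := hg.left.lt
  have a2 := hg.left.le
  have a3 := hg.right.lt
  have a4 := hg.right.le
  obtain ⟨b1, b2, b3, b4⟩ := hg.left.bounds h hl hk
  obtain ⟨d1, d2, d3, d4⟩ := hg.right.bounds h hl' hk
  have o := hg.offset h (u := 2 * k) (by omega) le_rfl
  rw [show c - k + 2 * k = c + k by omega, show c' - k + 2 * k = c' + k by omega] at o
  refine ⟨by omega, by omega, fun t ht => ?_⟩
  obtain ⟨x, x1, x2, x3, x4⟩ := h.run (p := P (c - k + 1) + 1 - l + t) (by omega) (by omega)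
  rw [h.letter x x1 x2 _ x3 x4]
  have hx1 : c - k ≤ x := by
    by_contra hcon
    have := h.mono (c := x + 1) (by omega) (c - k) (by omega) (by omega)
    omega
  have hx2 : x ≤ c + k := by
    by_contra hcon
    have := h.mono (c := c + k + 1) (by omega) x (by omega) (by omega)
    omega
  obtain ⟨u, rfl⟩ : ∃ u, x = c - k + u := ⟨x - (c - k), by omega⟩
  rcases Nat.eq_zero_or_pos u with rfl | hu
  · simp only [Nat.add_zero] at x3 x4
    have x5 := h.P_succ (c' - k) (by omega) (by omega)
    have x6 := h.P_succ (c - k) (by omega) (by omega)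
    rw [h.letter (c' - k) (by omega) (by omega) _ (by omega) (by omega)]
    rw [Nat.add_zero, hg.right.ends, hg.left.ends]
    exact hg.ends.symm
  · have o1 := hg.offset h (u := u) hu (by omega)
    rcases Nat.lt_or_ge u (2 * k) with hlt | hge
    · have o2 := hg.offset h (u := u + 1) (by omega) (by omega)
      rw [← add_assoc, ← add_assoc] at o2
      rw [h.letter (c' - k + u) (by omega) (by omega) _ (by omega) (by omega)]
      exact (hg.both h hu hlt).1.symm
    · obtain rfl : u = 2 * k := by omega
      rw [show c - k + 2 * k = c + k by omega] at *
      rw [show c' - k + 2 * k = c' + k by omega] at *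
      rw [h.letter (c' + k) (by omega) (by omega) _ (by omega) (by omega)]
      exact hg.ends.symm

/-- `RD.shift` is applied to the `2 * k` run boundaries inside the palindrome one after the other.
It shows that the interior runs of the occurrence are complete and equal to the original ones. The
two end runs may be longer than `l`, so only `l ≤ val` results. -/
theorem Valid.of_match (h : RD n m a ch ex P U) {c k l q : ℕ} (hv : Valid m ch U c k) (hk : 1 ≤ k)
    (hl1 : 1 ≤ l) (hl : l ≤ val ex c k)
    (hm : Match n a (P (c - k + 1) + 1 - l) (2 * l + P (c + k) - P (c - k + 1)) q) :
    ∃ c', Grp m ch U c c' k ∧ l ≤ val ex c' k ∧ q = P (c' - k + 1) + 1 - l := by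
  have a1 := hv.lt
  have a2 := hv.le
  obtain ⟨b1, b2, b3, b4⟩ := hv.bounds h hl hk
  obtain ⟨m1, m2, m3⟩ := hm
  set i := P (c - k + 1) + 1 - l with hi
  obtain ⟨e, e1, e2, e3, e4⟩ := h.run (p := q) m1 (by omega)
  have main : ∀ u, u + 1 ≤ 2 * k → e + u + 1 ≤ m ∧ P (e + u + 1) + i = P (c - k + u + 1) + q ∧
      ch (c - k + u) = ch (e + u) ∧ ch (c - k + u + 1) = ch (e + u + 1) := by
    intro u
    induction u with
    | zero =>
      intro _
      obtain ⟨s1, s2, s3, s4⟩ := h.shift (x := c - k) (y := e) (p := i) (q := q) (by omega)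
        (by omega) e1 e2 (by omega) (by omega) e3 e4 (by omega)
        (fun t ht => (m3 t (by omega)).symm)
      exact ⟨s2, s1, s3, s4⟩
    | succ u ih =>
      intro h2
      obtain ⟨i1, i2, i3, i4⟩ := ih (by omega)
      have g1 := h.mono (c := c - k + u + 1 + 1) (by omega) (c + k) (by omega) (by omega)
      have g2 := h.mono (c := c - k + 1) (by omega) (c - k + u + 1) (by omega) (by omega)
      have g3 := h.mono (c := c - k + u + 1) (by omega) (c - k + u + 1 + 1) (by omega) (by omega)
      have g4 := h.mono (c := e + u + 1) (by omega) (e + u + 1 + 1) (by omega) (by omega)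
      obtain ⟨s1, s2, s3, s4⟩ := h.shift (x := c - k + u + 1) (y := e + u + 1)
        (p := P (c - k + u + 1) + 1) (q := P (e + u + 1) + 1) (by omega) (by omega) (by omega) i1
        (by omega) (by omega) (by omega) (by omega) (by omega)
        (fun t ht => by
          have := m3 (P (c - k + u + 1) + 1 + t - i) (by omega)
          rw [show i + (P (c - k + u + 1) + 1 + t - i) = P (c - k + u + 1) + 1 + t by omega,
            show q + (P (c - k + u + 1) + 1 + t - i) = P (e + u + 1) + 1 + t by omega] at this
          exact this.symm)
      have q1 : c - k + (u + 1) = c - k + u + 1 := by omega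
      have q2 : e + (u + 1) = e + u + 1 := by omega
      rw [q1, q2]
      exact ⟨s2, by omega, s3, s4⟩
  have hch : ∀ u, u ≤ 2 * k → ch (c - k + u) = ch (e + u) := by
    intro u hu
    rcases Nat.lt_or_ge u (2 * k) with hlt | hge
    · exact (main u (by omega)).2.2.1
    · have := (main (u - 1) (by omega)).2.2.2
      rwa [show c - k + (u - 1) + 1 = c - k + u by omega,
        show e + (u - 1) + 1 = e + u by omega] at this
  have hem : e + 2 * k ≤ m := by
    have := (main (2 * k - 1) (by omega)).1; omega
  have hex : ∀ u, 1 ≤ u → u < 2 * k → ex (c - k + u) = ex (e + u) := by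
    intro u hu hu'
    have r1 := (main u (by omega)).2.1
    have r2 := (main (u - 1) (by omega)).2.1
    rw [show c - k + (u - 1) + 1 = c - k + u by omega,
      show e + (u - 1) + 1 = e + u by omega] at r2
    have r3 := h.P_succ (c - k + u) (by omega) (by omega)
    have r4 := h.P_succ (e + u) (by omega) (by omega)
    omega
  have hU : ∀ u, 1 ≤ u → u < 2 * k → U (c - k + u) = U (e + u) := by
    intro u hu hu'
    exact (h.U_iff _ _ (by omega) (by omega) (by omega) (by omega)).2 ⟨hch u (by omega), hex u hu hu'⟩
  refine ⟨e + k, ⟨hv, ⟨by omega, by omega, ?_, ?_⟩, ?_, ?_⟩, ?_, ?_⟩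
  · intro i hi
    have r1 := hU (k - i) (by omega) (by omega)
    have r2 := hU (k + i) (by omega) (by omega)
    rw [show c - k + (k - i) = c - i by omega] at r1
    rw [show c - k + (k + i) = c + i by omega] at r2
    rw [show e + k - i = e + (k - i) by omega, show e + k + i = e + (k + i) by omega, ← r1, ← r2]
    exact hv.arm i hi
  · have r1 := hch 0 (by omega)
    have r2 := hch (2 * k) le_rfl
    rw [show c - k + 2 * k = c + k by omega] at r2
    rw [show e + k - k = e + 0 by omega, show e + k + k = e + 2 * k by omega, ← r1, ← r2]
    exact hv.ends
  · intro i hi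
    have r2 := hU (k + i) (by omega) (by omega)
    rw [show c - k + (k + i) = c + i by omega] at r2
    rw [show e + k + i = e + (k + i) by omega, ← r2]
  · have r2 := hch (2 * k) le_rfl
    rw [show c - k + 2 * k = c + k by omega] at r2
    rw [show e + k + k = e + 2 * k by omega, ← r2]
  · have r0 := (main 0 (by omega)).2.1
    simp only [Nat.add_zero] at r0
    have r1 := h.P_succ e e1 e2
    have r2 := h.P_succ (e + 2 * k) (by omega) hem
    refine le_min ?_ ?_
    · rw [show e + k - k = e by omega]; omega
    · rw [show e + k + k = e + 2 * k by omega]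
      -- If the last run were shorter than `l`, the next run would begin inside the occurrence with
      -- the same character.
      by_contra hcon
      have r3 := (main (2 * k - 1) (by omega)).2.1
      rw [show c - k + (2 * k - 1) + 1 = c + k by omega,
        show e + (2 * k - 1) + 1 = e + 2 * k by omega] at r3
      have hem' : e + 2 * k + 1 ≤ m := by
        by_contra hh
        obtain rfl : m = e + 2 * k := by omega
        have := h.P_last; omega
      have r4 := h.ex_pos (e + 2 * k + 1) (by omega) hem'
      have r5 := h.P_succ (e + 2 * k + 1) (by omega) hem'
      have r6 := m3 (P (e + 2 * k + 1) + 1 - q) (by omega)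
      rw [show q + (P (e + 2 * k + 1) + 1 - q) = P (e + 2 * k + 1) + 1 by omega,
        h.letter (e + 2 * k + 1) (by omega) hem' _ (by omega) (by omega),
        h.letter (c + k) (by omega) (by omega) _ (by omega) (by omega)] at r6
      have r7 := hch (2 * k) le_rfl
      rw [show c - k + 2 * k = c + k by omega] at r7
      exact h.adj (e + 2 * k) (by omega) (by omega) (by rw [r6, r7])
  · have r0 := (main 0 (by omega)).2.1
    simp only [Nat.add_zero] at r0
    rw [show e + k - k + 1 = e + 1 by omega]
    omega
end
end RLEMups

/-! ### The minimal unique palindromic substrings of a word of runs -/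

namespace RLEMups

/-- The parameters of a palindrome: its centre, its level and the length of its ends; at the level
`0` it is a whole run. -/
structure Adm (m : ℕ) (ch ex U : ℕ → ℕ) (c k l : ℕ) : Prop where
  valid : Valid m ch U c k
  one_le : 1 ≤ l
  le : l ≤ val ex c k
  zero : k = 0 → l = ex c

theorem Match.sub {n : ℕ} {a : ℕ → ℕ} {i L q d L' : ℕ} (h : Match n a i L q) (hd : d + L' ≤ L) :
    Match n a (i + d) L' (q + d) := by
  obtain ⟨h1, h2, h3⟩ := h
  refine ⟨by omega, by omega, fun t ht => ?_⟩
  have := h3 (d + t) (by omega)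
  rwa [← add_assoc, ← add_assoc] at this

/-- Otherwise `[i, j]` lies inside the palindrome `[i', j']` off its centre, and its mirror image
there is a second occurrence of it. -/
theorem MUPS.lt_of_add_lt {n : ℕ} {a : ℕ → ℕ} {i j i' j' : ℕ} (h : MUPS n a i j)
    (h' : MUPS n a i' j') (hlt : i + j < i' + j') : i < i' := by
  by_contra hcon
  have a1 := h.le
  have a2 := h'.le_n
  have a3 := h'.one_le
  have := h.uniq (i' + j' - j) ⟨by omega, by omega, fun t ht => by
    have p1 := h.pal t (by omega)
    have p2 := h'.pal (j - t - i') (by omega)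
    rw [p1, show i' + j' - j + t = j' - (j - t - i') by omega, ← p2]
    congr 1; omega⟩
  omega

section
variable {n m : ℕ} {a ch ex P U : ℕ → ℕ}

/-- Runs at equal distances below `k` have equal exponents, so the boundaries are symmetric about
the run `c`. -/
theorem Valid.sym (h : RD n m a ch ex P U) {c k : ℕ} (hv : Valid m ch U c k) : ∀ d ≤ k,
    P (c + d) + P (c - d + 1) = P c + P (c + 1) := by
  have a1 := hv.lt
  have a2 := hv.le
  intro d
  induction d with
  | zero => intro _; simp
  | succ d ih =>
    intro hd
    have := ih (by omega)
    have e1 := h.P_succ (c + d) (by omega) (by omega)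
    have e2 := h.P_succ (c - d) (by omega) (by omega)
    have e3 := (hv.left_iff h (i := d) (by omega)).2
    rw [show c - (d + 1) + 1 = c - d by omega, ← add_assoc, e1]
    omega

theorem Adm.bounds (h : RD n m a ch ex P U) {c k l : ℕ} (hv : Adm m ch ex U c k l) :
    P (c - k) + l ≤ P (c - k + 1) ∧ P (c + k) + l ≤ P (c + k + 1) ∧ P (c + k + 1) ≤ n ∧
      P (c - k + 1) ≤ P (c + k) + l ∧ P (c + k) + P (c - k + 1) = P c + P (c + 1) := by
  have a1 := hv.valid.lt
  have a2 := hv.valid.le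
  have v := val_le (ex := ex) (c := c) (k := k)
  have v1 := hv.le
  have e1 := h.P_succ (c - k) (by omega) (by omega)
  have e2 := h.P_succ (c + k) (by omega) (by omega)
  have e3 := h.mono (c := c + k + 1) (by omega) (m + 1) (by omega) le_rfl
  have e4 := h.mono (c := c - k + 1) (by omega) (c + 1) (by omega) (by omega)
  have e6 := h.mono (c := c) (by omega) (c + k) (by omega) (by omega)
  have e5 := h.P_succ c (by omega) (by omega)
  have := h.P_last
  have h0 := hv.zero
  refine ⟨by omega, by omega, by omega, ?_, hv.valid.sym h k le_rfl⟩
  rcases Nat.eq_zero_or_pos k with rfl | hk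
  · simp only [Nat.sub_zero, Nat.add_zero]; omega
  · have := (hv.valid.bounds h hv.le hk).2.2.2; omega

theorem Adm.lt (h : RD n m a ch ex P U) {c k l : ℕ} (hv : Adm m ch ex U c k l) (hk : 1 ≤ k) :
    P (c - k + 1) < P (c + k) := (hv.valid.bounds h hv.le hk).2.2.2

/-- The interval of an admissible triple is a palindrome. -/
theorem Adm.pal (h : RD n m a ch ex P U) {c k l : ℕ} (hv : Adm m ch ex U c k l) {p q : ℕ}
    (hp : P (c - k + 1) + 1 ≤ p + l) (hq : p ≤ P (c + k) + l) (hpq : p + q = P c + P (c + 1) + 1) :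
    a p = a q := by
  have a1 := hv.valid.lt
  have a2 := hv.valid.le
  obtain ⟨b1, b2, b3, b4, b5⟩ := hv.bounds h
  obtain ⟨x, x1, x2, x3, x4⟩ := h.run (p := p) (by omega) (by omega)
  have hx1 : c - k ≤ x := by
    by_contra hcon
    have := h.mono (c := x + 1) (by omega) (c - k) (by omega) (by omega)
    omega
  have hx2 : x ≤ c + k := by
    by_contra hcon
    have := h.mono (c := c + k + 1) (by omega) x (by omega) (by omega)
    omega
  rw [h.letter x x1 x2 _ x3 x4]
  have chd : ∀ d ≤ k, ch (c - d) = ch (c + d) := by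
    intro d hd
    rcases Nat.lt_or_ge d k with hlt | hge
    · exact (hv.valid.left_iff h hlt).1
    · obtain rfl : d = k := by omega
      exact hv.valid.ends
  rcases Nat.le_total x c with hxc | hxc
  · obtain ⟨d, hd, rfl⟩ : ∃ d ≤ k, x = c - d := ⟨c - x, by omega, by omega⟩
    have s1 := hv.valid.sym h d hd
    rw [chd d hd, h.letter (c + d) (by omega) (by omega) q (by omega)]
    rcases Nat.lt_or_ge d k with hlt | hge
    · have s2 := hv.valid.sym h (d + 1) hlt
      rw [show c - (d + 1) + 1 = c - d by omega, ← add_assoc] at s2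
      omega
    · obtain rfl : d = k := by omega
      omega
  · obtain ⟨d, hd, rfl⟩ : ∃ d ≤ k, x = c + d := ⟨x - c, by omega, by omega⟩
    have s1 := hv.valid.sym h d hd
    rw [← chd d hd, h.letter (c - d) (by omega) (by omega) q _ (by omega)]
    rcases Nat.lt_or_ge d k with hlt | hge
    · have s2 := hv.valid.sym h (d + 1) hlt
      rw [show c - (d + 1) + 1 = c - d by omega, ← add_assoc] at s2
      omega
    · obtain rfl : d = k := by omega
      omega

/-- A block of one letter cannot leave its run, since the next run starts with another letter. -/
theorem RD.inside (h : RD n m a ch ex P U) {c q L : ℕ} (hc : 1 ≤ c) (hcm : c ≤ m) (h1 : P c < q)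
    (h2 : q ≤ P (c + 1)) (hn : q + L ≤ n + 1) (he : ∀ t < L, a (q + t) = ch c) :
    q + L ≤ P (c + 1) + 1 := by
  by_contra hcon
  have hm : c + 1 ≤ m := by
    by_contra hh
    obtain rfl : c = m := by omega
    have := h.P_last; omega
  have e1 := h.ex_pos (c + 1) (by omega) hm
  have e2 := h.P_succ (c + 1) (by omega) hm
  have := he (P (c + 1) + 1 - q) (by omega)
  rw [show q + (P (c + 1) + 1 - q) = P (c + 1) + 1 by omega,
    h.letter (c + 1) (by omega) hm _ (by omega) (by omega)] at this
  exact h.adj c hc (by omega) this.symm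

theorem RD.P_inj (h : RD n m a ch ex P U) {c c' : ℕ} (h1 : 1 ≤ c) (h2 : c ≤ m + 1) (h3 : 1 ≤ c')
    (h4 : c' ≤ m + 1) (he : P c = P c') : c = c' := by
  rcases lt_trichotomy c c' with hlt | heq | hgt
  · have := h.mono h1 c' (by omega) h4; omega
  · exact heq
  · have := h.mono h3 c (by omega) h2; omega

/-- A palindrome occurs more than once if and only if another centre in its group has it. -/
theorem Adm.repeat_iff (h : RD n m a ch ex P U) {c k l i L : ℕ} (hv : Adm m ch ex U c k l)
    (hi : i = P (c - k + 1) + 1 - l) (hL : L = 2 * l + P (c + k) - P (c - k + 1)) :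
    (∃ q, q ≠ i ∧ Match n a i L q) ↔
      ∃ c', c' ≠ c ∧ Grp m ch U c c' k ∧ l ≤ val ex c' k := by
  have a1 := hv.valid.lt
  have a2 := hv.valid.le
  subst hi hL
  rcases Nat.eq_zero_or_pos k with rfl | hk
  · obtain rfl := hv.zero rfl
    simp only [Nat.sub_zero, Nat.add_zero]
    have e1 := h.P_succ c (by omega) (by omega)
    have e2 := h.ex_pos c (by omega) (by omega)
    have el := h.letter c (by omega) (by omega)
    constructor
    · rintro ⟨q, hq, m1, m2, m3⟩
      obtain ⟨c', c1, c2, c3, c4⟩ := h.run (p := q) m1 (by omega)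
      have m4 : ∀ t < ex c, a (q + t) = ch c := fun t ht => by
        rw [m3 t (by omega), el _ (by omega) (by omega)]
      have hcc : ch c' = ch c := by
        rw [← h.letter c' c1 c2 q c3 c4]; exact m4 0 (by omega)
      have := h.inside c1 c2 c3 c4 (L := ex c) (by omega) (by rw [hcc]; exact m4)
      have e3 := h.P_succ c' c1 c2
      refine ⟨c', ?_, ⟨hv.valid, ⟨by omega, by omega, by simp, rfl⟩, by simp, hcc.symm⟩, ?_⟩
      · rintro rfl; omega
      · simp only [val, Nat.sub_zero, Nat.add_zero, min_self]; omega
    · rintro ⟨c', hne, hg, hl⟩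
      have a3 := hg.right.lt
      have a4 := hg.right.le
      simp only [val, Nat.sub_zero, Nat.add_zero, min_self] at hl
      have e3 := h.P_succ c' (by omega) (by omega)
      have e4 := h.mono (c := c' + 1) (by omega) (m + 1) (by omega) le_rfl
      have := h.P_last
      refine ⟨P c' + 1, fun he => hne (h.P_inj (by omega) (by omega) (by omega) (by omega)
        (by omega)), by omega, by omega, fun t ht => ?_⟩
      rw [h.letter c' (by omega) (by omega) (P c' + 1 + t) (by omega) (by omega),
        el _ (by omega) (by omega)]
      simpa using hg.ends.symm
  · constructor
    · rintro ⟨q, hq, hm⟩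
      obtain ⟨c', g1, g2, g3⟩ := hv.valid.of_match h hk hv.one_le hv.le hm
      refine ⟨c', ?_, g1, g2⟩
      rintro rfl; exact hq g3
    · rintro ⟨c', hne, hg, hl⟩
      have a3 := hg.right.lt
      have a4 := hg.right.le
      refine ⟨_, fun he => hne ?_, hg.match h hk hv.le hl⟩
      have b1 := (hv.valid.bounds h hv.le hk).1
      have b2 := (hg.right.bounds h hl hk).1
      have := h.P_inj (c := c' - k + 1) (c' := c - k + 1) (by omega) (by omega) (by omega)
        (by omega) (by omega)
      omega

theorem Adm.top (h : RD n m a ch ex P U) {c k : ℕ} (hv : Valid m ch U c k) :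
    Adm m ch ex U c k (val ex c k) := by
  have a1 := hv.lt
  have a2 := hv.le
  refine ⟨hv, ?_, le_rfl, ?_⟩
  · exact le_min (h.ex_pos _ (by omega) (by omega)) (h.ex_pos _ (by omega) (by omega))
  · rintro rfl; simp [val]

theorem IsTop.lt (h : RD n m a ch ex P U) {c k x : ℕ} (hu : Uniq m ch ex U c k)
    (ht : IsTop m ch ex U c k x) : x < val ex c k := by
  rcases ht.2 with rfl | ⟨c', h1, h2, rfl⟩
  · exact (Adm.top h hu.1).one_le
  · exact hu.2 c' h1 h2

/-- A second occurrence would give another centre of the group with a value of at least `l`, but at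
a positive level the others have at most `x`, and at level `0` less than the whole run. The interior
repeats for one of three reasons: inside a run (of length at least three) it can be shifted; for `x
> 0` a centre with the value `x` has it; for `x = 0` it is the longest palindrome of level `k - 1`,
which is not unique because `k` is the first unique level. -/
theorem First.mups (h : RD n m a ch ex P U) {c k x i j l : ℕ} (hf : First m ch ex U c k)
    (ht : IsTop m ch ex U c k x) (hl : l = if k = 0 then ex c else x + 1)
    (hi : i = P (c - k + 1) + 1 - l) (hj : j = P (c + k) + l) : MUPS n a i j := by
  have a1 := hf.1.1.lt
  have a2 := hf.1.1.le
  have hx := ht.lt h hf.1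
  have hA : Adm m ch ex U c k l := by
    refine ⟨hf.1.1, ?_, ?_, ?_⟩
    · split_ifs at hl
      · have := h.ex_pos c (by omega) (by omega); omega
      · omega
    · split_ifs at hl with h0
      · subst h0; simp [val, hl]
      · omega
    · intro h0; rw [hl, if_pos h0]
  obtain ⟨b1, b2, b3, b4, b5⟩ := hA.bounds h
  have b6 := hA.one_le
  have b7 := h.P_succ c (by omega) (by omega)
  have hk0 : k = 0 → i = P c + 1 ∧ j = P (c + 1) := by
    rintro rfl
    simp only [Nat.sub_zero, Nat.add_zero, if_true] at *
    omega
  have hk1 : 1 ≤ k → i + 2 ≤ j ∧ l = x + 1 := fun hk => by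
    have := hA.lt h hk
    rw [if_neg (by omega)] at hl
    omega
  have hij : i ≤ j := by
    rcases Nat.eq_zero_or_pos k with h0 | h0
    · have := hk0 h0
      have := h.ex_pos c (by omega) (by omega); omega
    · have := hk1 h0; omega
  refine ⟨by omega, hij, by omega, fun t ht => ?_, fun q hq => ?_, ?_⟩
  · exact hA.pal h (by omega) (by omega) (by omega)
  · by_contra hne
    obtain ⟨c', c1, c2, c3⟩ := (hA.repeat_iff h hi (L := j + 1 - i) (by omega)).1 ⟨q, hne, hq⟩
    rcases Nat.eq_zero_or_pos k with h0 | h0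
    · have := hf.1.2 c' c1 c2
      have := hA.zero h0
      subst h0
      simp only [val, Nat.sub_zero, Nat.add_zero, min_self] at *
      omega
    · have := ht.1 c' c1 c2
      have := hk1 h0
      omega
  · rcases Nat.eq_zero_or_pos k with h0 | h0
    · obtain ⟨r1, r2⟩ := hk0 h0
      by_cases h3 : i + 2 ≤ j
      · left
        refine ⟨h3, i, by omega, by omega, by omega, fun t ht => ?_⟩
        have := h.letter c (by omega) (by omega)
        rw [this _ (by omega) (by omega), this _ (by omega) (by omega)]
      · right; omega
    · obtain ⟨r1, r2⟩ := hk1 h0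
      left
      refine ⟨r1, ?_⟩
      by_cases hx0 : x = 0
      · have hv' : Valid m ch U c (k - 1) := by
          refine ⟨by omega, by omega, fun i hi => hf.1.1.arm i (by omega), ?_⟩
          exact (hf.1.1.left_iff h (by omega)).1
        have e3 := (hf.1.1.left_iff h (i := k - 1) (by omega)).2
        have hA' := Adm.top h hv'
        -- The end runs of level `k - 1` are interior runs at level `k`, so they are equal and the
        -- longest palindrome of level `k - 1` uses them completely.
        have hval : val ex c (k - 1) = ex (c - (k - 1)) := by simp [val, e3]
        have e4 := h.P_succ (c - (k - 1)) (by omega) (by omega)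
        have e5 := h.P_succ (c + (k - 1)) (by omega) (by omega)
        rw [show c - (k - 1) = c - k + 1 by omega] at e4
        rw [show c - (k - 1) = c - k + 1 by omega] at e3 hval
        rw [show c + (k - 1) + 1 = c + k by omega] at e5
        refine (hA'.repeat_iff h (i := i + 1) (L := j - 1 - i) ?_ ?_).2 ?_
        · rw [show c - (k - 1) + 1 = c - k + 1 + 1 by omega]; omega
        · rw [show c - (k - 1) + 1 = c - k + 1 + 1 by omega]; omega
        · by_contra hcon
          push Not at hcon
          exact hf.2 (k - 1) (by omega) ⟨hv', hcon⟩
      · have hA' : Adm m ch ex U c k x := ⟨hf.1.1, by omega, by omega, by omega⟩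
        refine (hA'.repeat_iff h (i := i + 1) (L := j - 1 - i) (by omega) (by omega)).2 ?_
        rcases ht.2 with h0 | ⟨c', c1, c2, c3⟩
        · exact absurd h0 hx0
        · exact ⟨c', c1, c2, c3.ge⟩

/-- A palindrome is contained in a run, or it spans an odd number of runs. -/
theorem RD.pal_cases (h : RD n m a ch ex P U) {i j : ℕ} (h1 : 1 ≤ i) (hij : i ≤ j) (hj : j ≤ n)
    (hp : ∀ t, i + t ≤ j → a (i + t) = a (j - t)) :
    (∃ c, 1 ≤ c ∧ c ≤ m ∧ P c < i ∧ j ≤ P (c + 1)) ∨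
      ∃ c k l, 1 ≤ k ∧ Adm m ch ex U c k l ∧ i = P (c - k + 1) + 1 - l ∧ j = P (c + k) + l := by
  obtain ⟨x, x1, x2, x3, x4⟩ := h.run (p := i) h1 (by omega)
  obtain ⟨y, y1, y2, y3, y4⟩ := h.run (p := j) (by omega) hj
  have hxy : x ≤ y := by
    by_contra hcon
    have := h.mono (c := y + 1) (by omega) x (by omega) (by omega)
    omega
  rcases Nat.eq_or_lt_of_le hxy with rfl | hlt
  · exact Or.inl ⟨x, x1, x2, x3, y4⟩
  right
  have main : ∀ u, x + u + 1 ≤ y → P (x + u + 1) + P (y - u) + 1 = i + j ∧ 2 ≤ y - u ∧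
      ch (x + u) = ch (y - u) ∧ ch (x + u + 1) = ch (y - u - 1) := by
    intro u
    induction u with
    | zero =>
      intro _
      have := h.mono (c := x + 1) (by omega) y (by omega) (by omega)
      exact h.shift_mirror x1 (by omega) y1 y2 x3 x4 y3 y4 (by omega) (fun t ht => hp t (by omega))
    | succ u ih =>
      intro h2
      obtain ⟨i1, i2, i3, i4⟩ := ih (by omega)
      have g1 := h.mono (c := x + u + 1 + 1) (by omega) y (by omega) (by omega)
      have g2 := h.mono (c := x + 1) (by omega) (x + u + 1) (by omega) (by omega)
      have g3 := h.mono (c := x + u + 1) (by omega) (x + u + 1 + 1) (by omega) (by omega)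
      have g4 := h.mono (c := y - u - 1) (by omega) (y - u) (by omega) (by omega)
      obtain ⟨s1, s2, s3, s4⟩ := h.shift_mirror (x := x + u + 1) (y := y - u - 1)
        (p := P (x + u + 1) + 1) (q := P (y - u)) (by omega) (by omega) (by omega) (by omega)
        (by omega) (by omega) (by omega) (by rw [show y - u - 1 + 1 = y - u by omega]) (by omega)
        (fun t ht => by
          have := hp (P (x + u + 1) + 1 + t - i) (by omega)
          rw [show i + (P (x + u + 1) + 1 + t - i) = P (x + u + 1) + 1 + t by omega] at this
          rw [this]; congr 1; omega)
      have q1 : x + (u + 1) = x + u + 1 := by omega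
      have q2 : y - (u + 1) = y - u - 1 := by omega
      rw [q1, q2]
      exact ⟨by omega, s2, s3, s4⟩
  have hch : ∀ u, x + u ≤ y → ch (x + u) = ch (y - u) := by
    intro u hu
    rcases Nat.lt_or_ge (x + u) y with hlt' | hge
    · exact (main u (by omega)).2.2.1
    · have := (main (u - 1) (by omega)).2.2.2
      rwa [show x + (u - 1) + 1 = x + u by omega, show y - (u - 1) - 1 = y - u by omega] at this
  -- With an even number of runs the two middle ones would be neighbours with the same character.
  have hodd : ∃ k, y = x + 2 * k := by
    by_contra hcon
    have hv : y = x + 2 * ((y - x) / 2) + 1 := by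
      by_contra hh
      exact hcon ⟨(y - x) / 2, by omega⟩
    set v := (y - x) / 2
    have := hch v (by omega)
    rw [show y - v = x + v + 1 by omega] at this
    exact h.adj (x + v) (by omega) (by omega) this
  obtain ⟨k, rfl⟩ := hodd
  have hU : ∀ u, 1 ≤ u → u < 2 * k → U (x + u) = U (x + 2 * k - u) := by
    intro u hu hu2
    refine (h.U_iff _ _ (by omega) (by omega) (by omega) (by omega)).2 ⟨hch u (by omega), ?_⟩
    have r1 := (main u (by omega)).1
    have r2 := (main (u - 1) (by omega)).1
    rw [show x + (u - 1) + 1 = x + u by omega,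
      show x + 2 * k - (u - 1) = x + 2 * k - u + 1 by omega] at r2
    have r3 := h.P_succ (x + u) (by omega) (by omega)
    have r4 := h.P_succ (x + 2 * k - u) (by omega) (by omega)
    omega
  have r0 := (main 0 (by omega)).1
  simp only [Nat.add_zero, Nat.sub_zero] at r0
  have e1 := h.P_succ x x1 x2
  have e2 := h.P_succ (x + 2 * k) y1 y2
  refine ⟨x + k, k, P (x + 1) + 1 - i, by omega,
    ⟨⟨by omega, by omega, fun u hu => ?_, ?_⟩, by omega, le_min ?_ ?_, by omega⟩, ?_, ?_⟩
  · have := hU (k - u) (by omega) (by omega)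
    rwa [show x + (k - u) = x + k - u by omega, show x + 2 * k - (k - u) = x + k + u by omega]
      at this
  · have := hch 0 (by omega)
    rwa [show x + k - k = x + 0 by omega, show x + k + k = x + 2 * k - 0 by omega]
  · rw [show x + k - k = x by omega]; omega
  · rw [show x + k + k = x + 2 * k by omega]; omega
  · rw [show x + k - k = x by omega]; omega
  · rw [show x + k + k = x + 2 * k by omega]; omega

/-- A proper part of a run can be shifted by one position, so inside a run only the whole run is
unique. If a level below `k` were unique, its longest palindrome would lie in the interior of `[i,
j]` and would repeat along with it. If the end were longer than `x + 1`, the interior, with the end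
`l - 1 > x`, would repeat, against the choice of `x`. -/
theorem MUPS.first (h : RD n m a ch ex P U) {i j : ℕ} (hM : MUPS n a i j) :
    ∃ c k, First m ch ex U c k ∧ ∀ x l, IsTop m ch ex U c k x →
      l = (if k = 0 then ex c else x + 1) → i = P (c - k + 1) + 1 - l ∧ j = P (c + k) + l := by
  have a1 := hM.one_le
  have a2 := hM.le
  have a3 := hM.le_n
  have key : ∃ c k l, Adm m ch ex U c k l ∧ i = P (c - k + 1) + 1 - l ∧ j = P (c + k) + l := by
    rcases h.pal_cases hM.one_le hM.le hM.le_n hM.pal with ⟨c, c1, c2, c3, c4⟩ |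
      ⟨c, k, l, hk, hA, hi, hj⟩
    · have e1 := h.P_succ c c1 c2
      have e2 := h.ex_pos c c1 c2
      have e3 := h.mono (c := c + 1) (by omega) (m + 1) (by omega) le_rfl
      have e4 := h.P_last
      have el := h.letter c c1 c2
      refine ⟨c, 0, ex c, ⟨⟨by omega, by omega, by simp, rfl⟩, e2, by simp [val], fun _ => rfl⟩, ?_⟩
      simp only [Nat.sub_zero, Nat.add_zero]
      have hi : i = P c + 1 := by
        by_contra hne
        have := hM.uniq (i - 1) ⟨by omega, by omega, fun t ht => by
          rw [el _ (by omega) (by omega), el _ (by omega) (by omega)]⟩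
        omega
      have hj : j = P (c + 1) := by
        by_contra hne
        have := hM.uniq (i + 1) ⟨by omega, by omega, fun t ht => by
          rw [el _ (by omega) (by omega), el _ (by omega) (by omega)]⟩
        omega
      omega
    · exact ⟨c, k, l, hA, hi, hj⟩
  obtain ⟨c, k, l, hA, hi, hj⟩ := key
  have v1 := hA.valid.lt
  have v2 := hA.valid.le
  obtain ⟨b1, b2, b3, b4, b5⟩ := hA.bounds h
  have b6 := hA.one_le
  have hno : ∀ c', c' ≠ c → Grp m ch U c c' k → val ex c' k < l := by
    intro c' h1 h2
    by_contra hcon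
    obtain ⟨q, hq, hm⟩ := (hA.repeat_iff h hi (L := j + 1 - i) (by omega)).2
      ⟨c', h1, h2, by omega⟩
    exact hq (hM.uniq q hm)
  have hinner : 1 ≤ k → ∃ q, q ≠ i + 1 ∧ Match n a (i + 1) (j - 1 - i) q := by
    intro hk
    have := hA.lt h hk
    rcases hM.min with hh | hh
    · exact hh.2
    · omega
  refine ⟨c, k, ⟨⟨hA.valid, fun c' h1 h2 => lt_of_lt_of_le (hno c' h1 h2) hA.le⟩, ?_⟩, ?_⟩
  · intro k' hk' hu
    obtain ⟨q, hq, hm⟩ := hinner (by omega)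
    clear hinner
    have hA' := Adm.top h hu.1
    obtain ⟨d1, d2, d3, d4, d5⟩ := hA'.bounds h
    have d6 := h.mono (c := c - k + 1) (by omega) (c - k') (by omega) (by omega)
    have hd : P (c - k' + 1) + 1 - val ex c k' - (i + 1) +
        (2 * val ex c k' + P (c + k') - P (c - k' + 1)) ≤ j - 1 - i := by omega
    have hs := hm.sub hd
    rw [show i + 1 + (P (c - k' + 1) + 1 - val ex c k' - (i + 1)) =
      P (c - k' + 1) + 1 - val ex c k' by omega] at hs
    have hq' : q + (P (c - k' + 1) + 1 - val ex c k' - (i + 1)) ≠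
        P (c - k' + 1) + 1 - val ex c k' := by omega
    obtain ⟨c', c1, c2, c3⟩ := (hA'.repeat_iff h rfl rfl).1 ⟨_, hq', hs⟩
    have := hu.2 c' c1 c2
    omega
  · intro x l' ht hl'
    suffices l = l' by subst this; exact ⟨hi, hj⟩
    by_cases hk : k = 0
    · rw [if_pos hk] at hl'; rw [hl', hA.zero hk]
    · rw [if_neg hk] at hl'
      have hxl : x < l := by
        rcases ht.2 with rfl | ⟨c', h1, h2, rfl⟩
        · omega
        · exact hno c' h1 h2
      by_contra hne
      obtain ⟨q, hq, hm⟩ := hinner (by omega)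
      clear hinner
      have hA' : Adm m ch ex U c k (l - 1) := ⟨hA.valid, by omega, by have := hA.le; omega, by omega⟩
      have hi' : i + 1 = P (c - k + 1) + 1 - (l - 1) := by omega
      have hL' : j - 1 - i = 2 * (l - 1) + P (c + k) - P (c - k + 1) := by omega
      obtain ⟨c', c1, c2, c3⟩ := (hA'.repeat_iff h hi' hL').1 ⟨q, hq, hm⟩
      have := ht.1 c' c1 c2
      omega

theorem First.unique {c k k' : ℕ} (hf : First m ch ex U c k) (hf' : First m ch ex U c k') :
    k = k' := by
  rcases lt_trichotomy k k' with hlt | heq | hgt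
  · exact absurd hf.1 (hf'.2 k hlt)
  · exact heq
  · exact absurd hf'.1 (hf.2 k' hgt)

/-- The sum of the bounds of the interval of a minimal unique palindromic substring increases with
its centre. -/
theorem Valid.add_lt (h : RD n m a ch ex P U) {c c' k k' l l' : ℕ} (hv : Valid m ch U c k)
    (hv' : Valid m ch U c' k') (hcc : c < c') (hl : l ≤ P (c - k + 1) + 1)
    (hl' : l' ≤ P (c' - k' + 1) + 1) :
    P (c - k + 1) + 1 - l + (P (c + k) + l) < P (c' - k' + 1) + 1 - l' + (P (c' + k') + l') := by
  have s1 := hv.sym h k le_rfl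
  have s2 := hv'.sym h k' le_rfl
  have a1 := hv.lt
  have a3 := hv'.lt
  have a4 := hv'.le
  have e1 := h.mono (c := c) (by omega) c' (by omega) (by omega)
  have e2 := h.mono (c := c + 1) (by omega) (c' + 1) (by omega) (by omega)
  omega
end
end RLEMups

/-! ### Strings as words of runs -/

namespace RLEMups

section
variable {α : Type*}

theorem substr_getElem? (S : List α) (i j t : ℕ) :
    (substr S i j)[t]? = if t < j + 1 - i then S[i - 1 + t]? else none := by
  simp only [substr, List.getElem?_take, List.getElem?_drop]

theorem substr_length (S : List α) {i j : ℕ} (h1 : 1 ≤ i) (h2 : j ≤ S.length) :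
    (substr S i j).length = j + 1 - i := by
  simp only [substr, List.length_take, List.length_drop]; omega

/-- The function `a` represents the letters of the string `S`. -/
def Letters (S : List α) (a : ℕ → ℕ) : Prop :=
  ∀ p q, 1 ≤ p → p ≤ S.length → 1 ≤ q → q ≤ S.length → (a p = a q ↔ S[p - 1]? = S[q - 1]?)

variable {S : List α} {a : ℕ → ℕ}

theorem Letters.substr_eq_iff (ha : Letters S a) {i j q L : ℕ} (h1 : 1 ≤ i) (hj : j ≤ S.length)
    (hL : L = j + 1 - i) (hq : 1 ≤ q) (hqL : q + L ≤ S.length + 1) :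
    substr S q (q + L - 1) = substr S i j ↔ ∀ t < L, a (q + t) = a (i + t) := by
  constructor
  · intro he t ht
    rw [ha _ _ (by omega) (by omega) (by omega) (by omega)]
    have := congrArg (fun l => l[t]?) he
    simp only [substr_getElem?] at this
    rw [if_pos (by omega), if_pos (by omega)] at this
    rwa [show q + t - 1 = q - 1 + t by omega, show i + t - 1 = i - 1 + t by omega]
  · intro he
    apply List.ext_getElem?
    intro t
    simp only [substr_getElem?]
    by_cases ht : t < L
    · rw [if_pos (by omega), if_pos (by omega)]
      have := (ha _ _ (by omega) (by omega) (by omega) (by omega)).1 (he t ht)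
      rwa [show q + t - 1 = q - 1 + t by omega, show i + t - 1 = i - 1 + t by omega] at this
    · rw [if_neg (by omega), if_neg (by omega)]

variable [DecidableEq α]

theorem Letters.mem_occ_iff (ha : Letters S a) {i j : ℕ} (h1 : 1 ≤ i) (hj : j ≤ S.length) (q : ℕ) :
    q ∈ ((Finset.Icc 1 (S.length + 1 - (substr S i j).length)).filter
      (fun q => substr S q (q + (substr S i j).length - 1) = substr S i j)) ↔
      Match S.length a i (j + 1 - i) q := by
  rw [Finset.mem_filter, Finset.mem_Icc, substr_length S h1 hj]
  constructor
  · rintro ⟨⟨h2, h3⟩, h4⟩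
    exact ⟨h2, by omega, (ha.substr_eq_iff h1 hj rfl h2 (by omega)).1 h4⟩
  · rintro ⟨h2, h3, h4⟩
    exact ⟨⟨h2, by omega⟩, (ha.substr_eq_iff h1 hj rfl h2 (by omega)).2 h4⟩

theorem Letters.occ_eq_one_iff (ha : Letters S a) {i j : ℕ} (h1 : 1 ≤ i) (hij : i ≤ j + 1)
    (hj : j ≤ S.length) :
    occ S (substr S i j) = 1 ↔ ∀ q, Match S.length a i (j + 1 - i) q → q = i := by
  rw [occ, Finset.card_eq_one]
  have hself : Match S.length a i (j + 1 - i) i := ⟨h1, by omega, fun _ _ => rfl⟩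
  constructor
  · rintro ⟨b, hb⟩ q hq
    rw [← ha.mem_occ_iff h1 hj, hb, Finset.mem_singleton] at hq hself
    rw [hq, hself]
  · intro h
    refine ⟨i, Finset.ext fun q => ?_⟩
    rw [ha.mem_occ_iff h1 hj, Finset.mem_singleton]
    exact ⟨h q, fun hq => hq ▸ hself⟩

theorem Letters.two_le_occ_iff (ha : Letters S a) {i j : ℕ} (h1 : 1 ≤ i) (hij : i ≤ j + 1)
    (hj : j ≤ S.length) :
    2 ≤ occ S (substr S i j) ↔ ∃ q, q ≠ i ∧ Match S.length a i (j + 1 - i) q := by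
  have hself : Match S.length a i (j + 1 - i) i := ⟨h1, by omega, fun _ _ => rfl⟩
  have h1' := ha.occ_eq_one_iff h1 hij hj
  have hpos : 0 < occ S (substr S i j) :=
    Finset.card_pos.2 ⟨i, (ha.mem_occ_iff h1 hj i).2 hself⟩
  constructor
  · intro h
    by_contra hcon
    push Not at hcon
    have := h1'.2 (fun q hq => by by_contra hne; exact hcon q hne hq)
    omega
  · rintro ⟨q, hq, hm⟩
    by_contra hcon
    exact hq (h1'.1 (by omega) q hm)

/-- Every clause of the definition depends only on which positions carry equal letters, and this is
what `Letters` preserves. -/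
theorem Letters.isMUPS_iff (ha : Letters S a) (i j : ℕ) :
    IsMUPS S i j ↔ MUPS S.length a i j := by
  have pal : 1 ≤ i → i ≤ j → j ≤ S.length →
      ((substr S i j).reverse = substr S i j ↔ ∀ t, i + t ≤ j → a (i + t) = a (j - t)) := by
    intro h1 h2 h3
    have hl := substr_length S h1 h3
    have get : ∀ t, i + t ≤ j →
        ((substr S i j).reverse[t]? = (substr S i j)[t]? ↔ a (i + t) = a (j - t)) := by
      intro t ht
      rw [List.getElem?_reverse (by omega), hl, substr_getElem?, substr_getElem?,
        if_pos (by omega), if_pos (by omega), ha _ _ (by omega) (by omega) (by omega) (by omega),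
        show i - 1 + (j + 1 - i - 1 - t) = j - t - 1 by omega,
        show i - 1 + t = i + t - 1 by omega]
      exact eq_comm
    constructor
    · intro he t ht
      exact (get t ht).1 (by rw [he])
    · intro he
      apply List.ext_getElem?
      intro t
      by_cases ht : i + t ≤ j
      · exact (get t ht).2 (he t ht)
      · rw [List.getElem?_eq_none (by rw [List.length_reverse]; omega),
          List.getElem?_eq_none (by omega)]
  constructor
  · rintro ⟨h1, h2, h3, h4, h5, h6⟩
    rw [substr_length S h1 h3] at h6
    refine ⟨h1, h2, h3, (pal h1 h2 h3).1 h4, (ha.occ_eq_one_iff h1 (by omega) h3).1 h5, ?_⟩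
    rcases h6 with ⟨h6, h7⟩ | h6
    · left
      have := (ha.two_le_occ_iff (by omega) (by omega) (by omega)).1 h7
      rw [show j - 1 + 1 - (i + 1) = j - 1 - i by omega] at this
      exact ⟨by omega, this⟩
    · right; omega
  · rintro ⟨h1, h2, h3, h4, h5, h6⟩
    refine ⟨h1, h2, h3, (pal h1 h2 h3).2 h4, (ha.occ_eq_one_iff h1 (by omega) h3).2 h5, ?_⟩
    rw [substr_length S h1 h3]
    rcases h6 with ⟨h6, h7⟩ | h6
    · left
      refine ⟨by omega, (ha.two_le_occ_iff (by omega) (by omega) (by omega)).2 ?_⟩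
      rwa [show j - 1 + 1 - (i + 1) = j - 1 - i by omega]
    · right; omega
end

/-! ### From a run-length encoding to the data of its runs -/

section
variable {α : Type*} {R : List (α × ℕ)} {S : List α}

/-- The number of letters in the first `c` runs. -/
def preLen (R : List (α × ℕ)) (c : ℕ) : ℕ := ((R.take c).map Prod.snd).sum

theorem preLen_succ {c : ℕ} {r : α × ℕ} (h : R[c]? = some r) :
    preLen R (c + 1) = preLen R c + r.2 := by
  obtain ⟨hc, rfl⟩ := List.getElem?_eq_some_iff.1 h
  rw [preLen, List.take_add_one, h]
  simp only [Option.toList_some, List.map_append, List.sum_append, List.map_cons, List.map_nil,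
    List.sum_cons, List.sum_nil, Nat.add_zero, preLen]

theorem getElem?_expand : ∀ (R : List (α × ℕ)) {c t : ℕ} {r : α × ℕ}, R[c]? = some r → t < r.2 →
    (R.flatMap (fun r => List.replicate r.2 r.1))[preLen R c + t]? = some r.1
  | [], c, t, r, h, _ => by simp at h
  | r0 :: R, 0, t, r, h, ht => by
    obtain rfl : r0 = r := by simpa using h
    simp only [preLen, List.take_zero, List.map_nil, List.sum_nil, Nat.zero_add, List.flatMap_cons]
    rw [List.getElem?_append_left (by simpa using ht)]
    simp [List.getElem?_replicate, ht]
  | r0 :: R, c + 1, t, r, h, ht => by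
    have h' : R[c]? = some r := by simpa using h
    have ih := getElem?_expand R h' ht
    simp only [List.flatMap_cons]
    have e : preLen (r0 :: R) (c + 1) = r0.2 + preLen R c := by simp [preLen]
    rw [e, List.getElem?_append_right (by simp; omega), List.length_replicate, ← ih]
    congr 1; omega

/-- The machine replaces characters and runs by numbers. Any numbering serves that identifies equal
characters and equal runs and nothing else. -/
theorem IsRLE.exists_rd (h : IsRLE R S) {m : ℕ} (hm : R.length = m) {ch ex P U : ℕ → ℕ}
    (hex : ∀ c (r : α × ℕ), R[c]? = some r → ex (c + 1) = r.2)
    (hP : ∀ c ≤ m, P (c + 1) = preLen R c)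
    (hch : ∀ c c' (r r' : α × ℕ), R[c]? = some r → R[c']? = some r' →
      (ch (c + 1) = ch (c' + 1) ↔ r.1 = r'.1))
    (hU : ∀ c c' (r r' : α × ℕ), R[c]? = some r → R[c']? = some r' → (U (c + 1) = U (c' + 1) ↔ r = r')) :
    ∃ a, RD S.length m a ch ex P U ∧ Letters S a := by
  classical
  subst hm
  have get : ∀ c, 1 ≤ c → c ≤ R.length → ∃ r, R[c - 1]? = some r ∧ r ∈ R := fun c h1 h2 =>
    ⟨R[c - 1], List.getElem?_eq_getElem (by omega), List.getElem_mem _⟩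
  -- Any run with the character found at `p` may be chosen, since by `hch` the code depends only on
  -- the character.
  let a : ℕ → ℕ := fun p =>
    if hh : ∃ (c : ℕ) (r : α × ℕ), R[c]? = some r ∧ S[p - 1]? = some r.1 then ch (hh.choose + 1) else 0
  have aval : ∀ p c r, R[c]? = some r → S[p - 1]? = some r.1 → a p = ch (c + 1) := by
    intro p c r h1 h2
    have hh : ∃ (c : ℕ) (r : α × ℕ), R[c]? = some r ∧ S[p - 1]? = some r.1 := ⟨c, r, h1, h2⟩
    simp only [a, dif_pos hh]
    obtain ⟨r', h3, h4⟩ := hh.choose_spec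
    rw [hch _ _ _ _ h3 h1]
    rw [h2] at h4
    exact (Option.some.inj h4).symm
  have letS : ∀ c r, R[c]? = some r → ∀ p, P (c + 1) < p → p ≤ P (c + 2) →
      S[p - 1]? = some r.1 := by
    intro c r hr p h1 h2
    have hc := (List.getElem?_eq_some_iff.1 hr).1
    rw [hP c (by omega)] at h1
    rw [show c + 2 = (c + 1) + 1 by omega, hP (c + 1) (by omega), preLen_succ hr] at h2
    rw [← h.expand, ← getElem?_expand R hr (t := p - 1 - preLen R c) (by omega)]
    congr 1; omega
  have hR : RD S.length R.length a ch ex P U := by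
    refine ⟨?_, ?_, ?_, ?_, ?_, ?_, ?_⟩
    · rw [hP 0 (by omega)]; simp [preLen]
    · intro c h1 h2
      obtain ⟨r, hr, -⟩ := get c h1 h2
      obtain ⟨c, rfl⟩ : ∃ d, c = d + 1 := ⟨c - 1, by omega⟩
      rw [Nat.add_sub_cancel] at hr
      rw [hP _ h2, hP _ (by omega), preLen_succ hr, hex _ _ hr]
    · rw [hP _ le_rfl, ← h.expand]
      simp [preLen, List.length_flatMap]
    · intro c h1 h2
      obtain ⟨r, hr, hm⟩ := get c h1 h2
      have := hex _ _ hr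
      rw [Nat.sub_add_cancel h1] at this
      rw [this]; exact h.pos r hm
    · intro c h1 h2 p h3 h4
      obtain ⟨r, hr, -⟩ := get c h1 h2
      obtain ⟨c, rfl⟩ : ∃ d, c = d + 1 := ⟨c - 1, by omega⟩
      rw [Nat.add_sub_cancel] at hr
      exact aval p c r hr (letS c r hr p h3 h4)
    · intro c h1 h2
      obtain ⟨r, hr, -⟩ := get c h1 (by omega)
      obtain ⟨r', hr', -⟩ := get (c + 1) (by omega) h2
      obtain ⟨c, rfl⟩ : ∃ d, c = d + 1 := ⟨c - 1, by omega⟩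
      rw [Nat.add_sub_cancel] at hr hr'
      rw [Ne, hch _ _ _ _ hr hr']
      obtain ⟨g1, rfl⟩ := List.getElem?_eq_some_iff.1 hr
      obtain ⟨g2, rfl⟩ := List.getElem?_eq_some_iff.1 hr'
      exact List.isChain_iff_getElem.1 h.chain c g2
    · intro c c' h1 h2 h3 h4
      obtain ⟨r, hr, -⟩ := get c h1 h2
      obtain ⟨r', hr', -⟩ := get c' h3 h4
      obtain ⟨c, rfl⟩ : ∃ d, c = d + 1 := ⟨c - 1, by omega⟩
      obtain ⟨c', rfl⟩ : ∃ d, c' = d + 1 := ⟨c' - 1, by omega⟩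
      rw [Nat.add_sub_cancel] at hr hr'
      rw [hU _ _ _ _ hr hr', hch _ _ _ _ hr hr', hex _ _ hr, hex _ _ hr', Prod.ext_iff]
  refine ⟨a, hR, fun p q h1 h2 h3 h4 => ?_⟩
  obtain ⟨c, c1, c2, c3, c4⟩ := hR.run h1 h2
  obtain ⟨d, d1, d2, d3, d4⟩ := hR.run h3 h4
  obtain ⟨r, hr, -⟩ := get c c1 c2
  obtain ⟨r', hr', -⟩ := get d d1 d2
  obtain ⟨c, rfl⟩ : ∃ e, c = e + 1 := ⟨c - 1, by omega⟩
  obtain ⟨d, rfl⟩ : ∃ e, d = e + 1 := ⟨d - 1, by omega⟩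
  rw [Nat.add_sub_cancel] at hr hr'
  have s1 := letS c r hr p c3 c4
  have s2 := letS d r' hr' q d3 d4
  rw [aval p c r hr s1, aval q d r' hr' s2, hch _ _ _ _ hr hr', s1, s2, Option.some_inj]
end
end RLEMups

/-! ### Groups of palindromes in the palindromic tree -/

namespace RLEMups

/-- The arrays after the construction of the palindromic tree of the word of runs. -/
structure Base (Γ : Cx) (n : ℕ) (a U ch ex P : ℕ → ℕ) (b s N : ℕ) (hw : ℕ → List ℕ)
    (A : ℕ → ℕ → ℕ) : Prop where
  ectx : ECtx Γ U b
  rd : RD n Γ.m a ch ex P U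
  eer : Eer U A N (Γ.m + 2) hw
  dict : Dict A N b
  N_le : N ≤ Γ.m + 1
  nod : ∀ c, 1 ≤ c → c ≤ Γ.m → NodOK U A N hw c (A 4 c)
  U_lt : ∀ c, 1 ≤ c → c ≤ Γ.m → U c < s
  U_last : U (Γ.m + 1) = s
  ch_lt : ∀ c, 1 ≤ c → c ≤ Γ.m → ch c < s
  ch_zero : ch 0 = s + 1
  ch_last : ch (Γ.m + 1) = s
  a1 : ∀ c ≤ Γ.m + 1, A 1 c = ch c
  a2 : ∀ c, 1 ≤ c → c ≤ Γ.m → A 2 c = ex c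
  a3 : ∀ c, 1 ≤ c → c ≤ Γ.m + 1 → A 3 c = P c
  a23 : ∀ c, 1 ≤ c → c ≤ Γ.m → A 23 (U c) = ch c
  a23_lt : ∀ j, A 23 j < s
  a24 : ∀ c, 1 ≤ c → c ≤ Γ.m → A 24 (U c) = ex c
  bits : 2 * s + 2 ≤ 2 ^ b
  s_le : s ≤ Γ.m
  zero : ∀ f, 12 ≤ f → f ≤ 17 → ∀ j, A f j = 0
  n_lt : n + 1 < Γ.B

/-- The palindrome of the node `v` has an occurrence with the centre `c`. -/
def At (U : ℕ → ℕ) (hw : ℕ → List ℕ) (A : ℕ → ℕ → ℕ) (v c : ℕ) : Prop :=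
  A 10 v ≤ A 10 (A 4 c) ∧ hw v = W U (c + A 10 v - 1) (A 10 v)

/-- The centres whose palindrome at the level of the node `o` has the ends encoded by `κ`. -/
structure InGrp (m : ℕ) (U ch : ℕ → ℕ) (hw : ℕ → List ℕ) (A : ℕ → ℕ → ℕ) (s o κ c : ℕ) :
    Prop where
  one_le : 1 ≤ c
  le : c ≤ m
  at_node : At U hw A o c
  valid : Valid m ch U c (A 10 o)
  key : κ = s + 2 + ch (c + A 10 o)

section
variable {Γ : Cx} {n : ℕ} {a U ch ex P : ℕ → ℕ} {b s N : ℕ} {hw : ℕ → List ℕ} {A : ℕ → ℕ → ℕ}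

/-- The keys of tree nodes are letters of `U`, the closing sentinel `s` included. The group keys
start at `s + 2`, so trees and groups can share one dictionary. -/
theorem Base.key_le (H : Base Γ n a U ch ex P b s N hw A) {v : ℕ} (h1 : 1 ≤ v) (h2 : v ≤ N) :
    A 8 v ≤ s := by
  obtain ⟨r, r1, r2, r3, r4⟩ := H.eer.sound v h1 h2
  rw [H.eer.hw_cons v h1 h2, List.length_cons, W_succ, List.cons.injEq] at r4
  rw [r4.1]
  rcases Nat.lt_or_ge r (Γ.m + 1) with hlt | hge
  · exact (H.U_lt r r1 (by omega)).le
  · rw [show r = Γ.m + 1 by omega, H.U_last]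

theorem Base.par_le (H : Base Γ n a U ch ex P b s N hw A) {v : ℕ} (h1 : 1 ≤ v) (h2 : v ≤ N) :
    A 9 v < v ∧ A 10 v = A 10 (A 9 v) + 1 := by
  have hp := H.eer.par_lt v h1 h2
  refine ⟨hp, ?_⟩
  rw [H.eer.len v h2, H.eer.len _ (by omega), H.eer.hw_cons v h1 h2, List.length_cons]

theorem Base.arm (H : Base Γ n a U ch ex P b s N hw A) {c : ℕ} (h1 : 1 ≤ c) (h2 : c ≤ Γ.m) :
    1 ≤ A 4 c ∧ A 4 c ≤ N ∧ 1 ≤ A 10 (A 4 c) ∧ A 10 (A 4 c) ≤ c ∧ c + A 10 (A 4 c) ≤ Γ.m + 1 ∧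
      (∀ i < A 10 (A 4 c), U (c - i) = U (c + i)) ∧
      U (c - A 10 (A 4 c)) ≠ U (c + A 10 (A 4 c)) := by
  obtain ⟨v1, v2, ⟨⟨o1, o2⟩, -⟩, v4⟩ := H.nod c h1 h2
  have hl := H.eer.len_pos v1 v2
  rw [← H.eer.len _ v2] at o1 o2
  have harm : ∀ i < A 10 (A 4 c), U (c - i) = U (c + i) := by
    intro i hi
    have := o2 (A 10 (A 4 c) - 1 - i) (by omega)
    rw [show c + A 10 (A 4 c) - 1 - (A 10 (A 4 c) - 1 - i) = c + i by omega,
      show c + A 10 (A 4 c) - 1 + 2 + (A 10 (A 4 c) - 1 - i) - 2 * A 10 (A 4 c) = c - i by omega]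
      at this
    exact this.symm
  refine ⟨v1, v2, hl, by omega, ?_, harm, v4⟩
  by_contra hcon
  have := harm (Γ.m + 1 - c) (by omega)
  rw [show c + (Γ.m + 1 - c) = Γ.m + 1 by omega] at this
  exact H.ectx.u1 _ (by omega) (by omega) this

/-- Below the half-length of the maximal palindrome the end runs even coincide; at this half-length
they differ as runs, so only their characters may agree. The character numbers of the two sentinels
differ from each other and from all others, so an end cannot fall outside the word. -/
theorem Base.valid_iff (H : Base Γ n a U ch ex P b s N hw A) {c k : ℕ} (h1 : 1 ≤ c)
    (h2 : c ≤ Γ.m) :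
    Valid Γ.m ch U c k ↔ k < A 10 (A 4 c) ∨ k = A 10 (A 4 c) ∧ ch (c - k) = ch (c + k) := by
  obtain ⟨-, -, a3, a4, a5, a6, a7⟩ := H.arm h1 h2
  constructor
  · intro hv
    rcases lt_trichotomy k (A 10 (A 4 c)) with hlt | heq | hgt
    · exact Or.inl hlt
    · exact Or.inr ⟨heq, hv.ends⟩
    · exact absurd (hv.arm _ hgt) a7
  · rintro (hlt | ⟨rfl, he⟩)
    · refine ⟨by omega, by omega, fun i hi => a6 i (by omega), ?_⟩
      exact ((H.rd.U_iff _ _ (by omega) (by omega) (by omega) (by omega)).1 (a6 k hlt)).1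
    · set K := A 10 (A 4 c) with hK
      have c0 : c - K ≠ 0 := by
        intro h0
        rw [h0, H.ch_zero] at he
        rcases Nat.lt_or_ge (c + K) (Γ.m + 1) with hlt | hge
        · have := H.ch_lt (c + K) (by omega) (by omega); omega
        · rw [show c + K = Γ.m + 1 by omega, H.ch_last] at he; omega
      refine ⟨by omega, ?_, a6, he⟩
      by_contra hcon
      rw [show c + K = Γ.m + 1 by omega, H.ch_last] at he
      have := H.ch_lt (c - K) (by omega) (by omega)
      omega

theorem Base.at_nod (H : Base Γ n a U ch ex P b s N hw A) {c : ℕ} (h1 : 1 ≤ c) (h2 : c ≤ Γ.m) :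
    At U hw A (A 4 c) c := by
  obtain ⟨v1, v2, ⟨-, o2⟩, -⟩ := H.nod c h1 h2
  rw [← H.eer.len _ v2] at o2
  exact ⟨le_rfl, o2⟩

theorem Base.at_par (H : Base Γ n a U ch ex P b s N hw A) {v c : ℕ} (h1 : 1 ≤ v) (h2 : v ≤ N)
    (ha : At U hw A v c) :
    At U hw A (A 9 v) c ∧ A 8 v = U (c + A 10 (A 9 v)) := by
  obtain ⟨p1, p2⟩ := H.par_le h1 h2
  obtain ⟨a1, a2⟩ := ha
  rw [p2, H.eer.hw_cons v h1 h2, W_succ, List.cons.injEq] at a2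
  rw [show c + (A 10 (A 9 v) + 1) - 1 = c + A 10 (A 9 v) by omega] at a2
  exact ⟨⟨by omega, a2.2⟩, a2.1⟩

theorem Base.at_eq (H : Base Γ n a U ch ex P b s N hw A) {u v c : ℕ} (hu : u ≤ N) (hv : v ≤ N)
    (h1 : At U hw A u c) (h2 : At U hw A v c) (hl : A 10 u = A 10 v) : u = v :=
  H.eer.hw_inj u hu v hv (by rw [h1.2, h2.2, hl])

/-- The nodes that occur at one centre form a chain of ancestors, and parents have smaller numbers;
at a fixed centre the order of the numbers is therefore that of the lengths. -/
theorem Base.at_lt (H : Base Γ n a U ch ex P b s N hw A) {u c : ℕ} (hu : u ≤ N)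
    (h1 : At U hw A u c) : ∀ v ≤ N, At U hw A v c → A 10 u < A 10 v → u < v := by
  intro v
  induction v using Nat.strong_induction_on with
  | _ v ih =>
    intro hv h2 hl
    rcases Nat.eq_zero_or_pos v with rfl | hpos
    · rw [H.eer.len_zero] at hl; omega
    · obtain ⟨p1, p2⟩ := H.par_le hpos hv
      obtain ⟨q1, -⟩ := H.at_par hpos hv h2
      rcases Nat.lt_or_ge (A 10 u) (A 10 (A 9 v)) with hlt | hge
      · have := ih _ p1 (by omega) q1 hlt; omega
      · have := H.at_eq hu (by omega) h1 q1 (by omega); omega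

theorem Base.exists_at (H : Base Γ n a U ch ex P b s N hw A) {c : ℕ} (h1 : 1 ≤ c) (h2 : c ≤ Γ.m) :
    ∀ d ≤ A 10 (A 4 c), ∃ v ≤ N, At U hw A v c ∧ A 10 v = A 10 (A 4 c) - d := by
  intro d
  induction d with
  | zero => intro _; exact ⟨A 4 c, (H.nod c h1 h2).2.1, H.at_nod h1 h2, rfl⟩
  | succ d ih =>
    intro hd
    obtain ⟨v, v1, v2, v3⟩ := ih (by omega)
    have hpos : 1 ≤ v := by
      by_contra h0
      rw [show v = 0 by omega, H.eer.len_zero] at v3; omega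
    obtain ⟨p1, p2⟩ := H.par_le hpos v1
    exact ⟨A 9 v, by omega, (H.at_par hpos v1 v2).1, by omega⟩

/-- The half word of `o` is the right arm read from the outside to the centre, so equality of arms
is occurrence of the same node. -/
theorem Base.grp_iff (H : Base Γ n a U ch ex P b s N hw A) {o c c' : ℕ} (ho : o ≤ N) (h1 : 1 ≤ c)
    (h2 : c ≤ Γ.m) (hat : At U hw A o c) (hv : Valid Γ.m ch U c (A 10 o)) :
    Grp Γ.m ch U c c' (A 10 o) ↔
      InGrp Γ.m U ch hw A s o (s + 2 + ch (c + A 10 o)) c' := by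
  constructor
  · intro hg
    have b1 := hg.right.lt
    have b2 := hg.right.le
    have hk : A 10 o ≤ A 10 (A 4 c') := by
      rcases (H.valid_iff (by omega) (by omega)).1 hg.right with h | h <;> omega
    refine ⟨by omega, by omega, ⟨hk, ?_⟩, hg.right, by rw [hg.ends]⟩
    rw [hat.2, W_eq_iff]
    intro i hi
    have := hg.arm (A 10 o - 1 - i) (by omega)
    rwa [show c + (A 10 o - 1 - i) = c + A 10 o - 1 - i by omega,
      show c' + (A 10 o - 1 - i) = c' + A 10 o - 1 - i by omega] at this
  · intro hg
    refine ⟨hv, hg.valid, fun i hi => ?_, by have := hg.key; omega⟩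
    have := W_eq_iff.1 (hat.2.symm.trans hg.at_node.2) (A 10 o - 1 - i) (by omega)
    rwa [show c + A 10 o - 1 - (A 10 o - 1 - i) = c + i by omega,
      show c' + A 10 o - 1 - (A 10 o - 1 - i) = c' + i by omega] at this

/-- The centres of a node are in the group of this node. -/
theorem Base.ingrp_node (H : Base Γ n a U ch ex P b s N hw A) {v c : ℕ} (hv1 : 1 ≤ v) (hv2 : v ≤ N)
    (h1 : 1 ≤ c) (h2 : c ≤ Γ.m) (hat : At U hw A v c) :
    InGrp Γ.m U ch hw A s (A 9 v) (s + 2 + A 23 (A 8 v)) c ∧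
      val ex c (A 10 (A 9 v)) = A 24 (A 8 v) := by
  obtain ⟨q1, q2⟩ := H.at_par hv1 hv2 hat
  obtain ⟨p1, p2⟩ := H.par_le hv1 hv2
  have hk : A 10 (A 9 v) < A 10 (A 4 c) := by have := hat.1; omega
  have hV := (H.valid_iff h1 h2).2 (Or.inl hk)
  have l1 := hV.lt
  have l2 := hV.le
  obtain ⟨-, -, a3, a4, a5, a6, a7⟩ := H.arm h1 h2
  refine ⟨⟨h1, h2, q1, hV, ?_⟩, ?_⟩
  · rw [q2, H.a23 _ (by omega) (by omega)]
  · rw [q2, H.a24 _ (by omega) (by omega), val,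
      ((H.rd.U_iff _ _ (by omega) (by omega) (by omega) (by omega)).1 (a6 _ hk)).2, min_self]
end

/-! ### The two largest values of a function on a set -/

/-- `t1` and `t2` are the largest and the second largest value of `f` on `S`. -/
def Top (S : ℕ → Prop) (f : ℕ → ℕ) (t1 t2 : ℕ) : Prop :=
  -- Describing a value by the numbers below it makes it `0` when the set has too few elements, and
  -- keeps track of multiplicities.
  (∀ x, x ≤ t1 ↔ x = 0 ∨ ∃ c, S c ∧ x ≤ f c) ∧
    ∀ x, x ≤ t2 ↔ x = 0 ∨ ∃ c c', c ≠ c' ∧ S c ∧ S c' ∧ x ≤ f c ∧ x ≤ f c'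

/-- `D` has `n` elements, where all `n ≥ 2` are identified. -/
structure Few (D : ℕ → Prop) (n : ℕ) : Prop where
  zero : n = 0 → ∀ c, ¬ D c
  one : n = 1 → ∃ d, ∀ c, D c ↔ c = d
  two : 2 ≤ n → ∃ c c', c ≠ c' ∧ D c ∧ D c'

theorem Top.empty {f : ℕ → ℕ} {S : ℕ → Prop} (h : ∀ c, ¬ S c) : Top S f 0 0 := by
  refine ⟨fun x => ?_, fun x => ?_⟩
  · constructor
    · intro hx; left; omega
    · rintro (h0 | ⟨c, h1, -⟩)
      · omega
      · exact absurd h1 (h c)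
  · constructor
    · intro hx; left; omega
    · rintro (h0 | ⟨c, -, -, h1, -⟩)
      · omega
      · exact absurd h1 (h c)

theorem Top.congr {S S' : ℕ → Prop} {f : ℕ → ℕ} {t1 t2 : ℕ} (h : Top S f t1 t2)
    (hS : ∀ c, S' c ↔ S c) : Top S' f t1 t2 := by
  obtain rfl : S' = S := funext fun c => propext (hS c)
  exact h

/-- All new elements share the value `y`. If there is just one, it displaces or follows the old
maximum, whence `min t1 y`; if there are several, `y` itself is a candidate for the second place. -/
theorem Top.insert {S D : ℕ → Prop} {f : ℕ → ℕ} {t1 t2 y n : ℕ} (h : Top S f t1 t2)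
    (hn : Few D n) (hy : ∀ c, D c → f c = y) (hd : ∀ c, D c → ¬ S c) :
    Top (fun c => S c ∨ D c) f (if 0 < n then max t1 y else t1)
      (if 1 < n then max t2 y else if n = 1 then max t2 (min t1 y) else t2) := by
  obtain ⟨h1, h2⟩ := h
  rcases Nat.eq_zero_or_pos n with h0 | hpos
  · have := hn.zero h0
    subst h0
    simp only [lt_irrefl, if_false, this, or_false, zero_ne_one, Nat.not_lt_zero]
    exact ⟨h1, h2⟩
  rw [if_pos hpos]
  have hex : ∃ d, D d := by
    rcases Nat.lt_or_ge n 2 with hlt | hge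
    · obtain ⟨d, hd⟩ := hn.one (by omega)
      exact ⟨d, (hd d).2 rfl⟩
    · obtain ⟨d, -, -, hd, -⟩ := hn.two hge
      exact ⟨d, hd⟩
  obtain ⟨d, hD⟩ := hex
  constructor
  · intro x
    rw [le_max_iff, h1]
    constructor
    · rintro ((h0 | ⟨c, c1, c2⟩) | hx)
      · exact Or.inl h0
      · exact Or.inr ⟨c, Or.inl c1, c2⟩
      · exact Or.inr ⟨d, Or.inr hD, by rw [hy d hD]; exact hx⟩
    · rintro (h0 | ⟨c, c1 | c1, c2⟩)
      · exact Or.inl (Or.inl h0)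
      · exact Or.inl (Or.inr ⟨c, c1, c2⟩)
      · exact Or.inr (by rw [← hy c c1]; exact c2)
  · intro x
    rcases Nat.lt_or_ge n 2 with hlt | hge
    · obtain rfl : n = 1 := by omega
      obtain ⟨d', hd'⟩ := hn.one rfl
      rw [if_neg (by omega), if_pos rfl, le_max_iff, le_min_iff, h1, h2]
      constructor
      · rintro ((h0 | ⟨c, c', c1, c2, c3, c4, c5⟩) | ⟨h0 | ⟨c, c1, c2⟩, hx⟩)
        · exact Or.inl h0
        · exact Or.inr ⟨c, c', c1, Or.inl c2, Or.inl c3, c4, c5⟩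
        · exact Or.inl h0
        · refine Or.inr ⟨c, d, ?_, Or.inl c1, Or.inr hD, c2, by rw [hy d hD]; exact hx⟩
          rintro rfl; exact hd _ hD c1
      · rintro (h0 | ⟨c, c', c1, c2 | c2, c3 | c3, c4, c5⟩)
        · exact Or.inl (Or.inl h0)
        · exact Or.inl (Or.inr ⟨c, c', c1, c2, c3, c4, c5⟩)
        · exact Or.inr ⟨Or.inr ⟨c, c2, c4⟩, by rw [← hy _ c3]; exact c5⟩
        · exact Or.inr ⟨Or.inr ⟨c', c3, c5⟩, by rw [← hy _ c2]; exact c4⟩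
        · exact absurd (((hd' c).1 c2).trans ((hd' c').1 c3).symm) c1
    · obtain ⟨e, e', e1, e2, e3⟩ := hn.two hge
      rw [if_pos (by omega), le_max_iff, h2]
      constructor
      · rintro ((h0 | ⟨c, c', c1, c2, c3, c4, c5⟩) | hx)
        · exact Or.inl h0
        · exact Or.inr ⟨c, c', c1, Or.inl c2, Or.inl c3, c4, c5⟩
        · exact Or.inr ⟨e, e', e1, Or.inr e2, Or.inr e3, by rw [hy _ e2]; exact hx,
            by rw [hy _ e3]; exact hx⟩
      · rintro (h0 | ⟨c, c', c1, c2 | c2, c3 | c3, c4, c5⟩)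
        · exact Or.inl (Or.inl h0)
        · exact Or.inl (Or.inr ⟨c, c', c1, c2, c3, c4, c5⟩)
        · exact Or.inr (by rw [← hy _ c3]; exact c5)
        · exact Or.inr (by rw [← hy _ c2]; exact c4)
        · exact Or.inr (by rw [← hy _ c2]; exact c4)
end RLEMups

/-! ### The two largest values in each group -/


namespace RLEMups

/-- Insert the value in register `8`, with the multiplicity in register `9`, into the second largest
value of the group in register `25`. -/
def insSnd : HP :=
  .ite (HE.lt 1 (R 9)) (.asg 10 (R 8))
    (.ite ((R 9).eq 1)
      (.ite ((AR 13 (R 25)).lt (R 8)) (.asg 10 (AR 13 (R 25))) (.asg 10 (R 8)))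
      (.asg 10 0)) ;;
  .ite ((AR 14 (R 25)).lt (R 10)) (.sto 14 (R 25) (R 10)) .skip

/-- Insert this value into the largest value of the group. -/
def insFst : HP :=
  .ite (HE.lt 0 (R 9)) (.ite ((AR 13 (R 25)).lt (R 8)) (.sto 13 (R 25) (R 8)) .skip) .skip

/-- Look up the group with the owner in register `20` and the key in register `21`, and insert the
value in register `8` with the multiplicity in register `9`. -/
def grpIns : HP := findIns ;; insSnd ;; insFst

/-- The new second largest value. -/
def newSnd (n y t1 t2 : ℕ) : ℕ :=
  if 1 < n then max t2 y else if n = 1 then max t2 (min t1 y) else t2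

/-- The new largest value. -/
def newFst (n y t1 : ℕ) : ℕ := if 0 < n then max t1 y else t1

theorem insSnd_wp {Γ : Cx} {h : HS} (hg : h.r 25 < Γ.cap) :
    wp Γ insSnd h (fun h' t => t ≤ 6 ∧ (∀ f j, h'.A f j = if f = 14 ∧ j = h.r 25 then
      newSnd (h.r 9) (h.r 8) (h.A 13 (h.r 25)) (h.A 14 (h.r 25)) else h.A f j) ∧
      (∀ y, y ≠ 10 → h'.r y = h.r y) ∧ h'.io = h.io) := by
  have fin : ∀ (v t0 : ℕ), t0 ≤ 4 → max (h.A 14 (h.r 25)) v =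
      newSnd (h.r 9) (h.r 8) (h.A 13 (h.r 25)) (h.A 14 (h.r 25)) →
      wp Γ (.ite ((AR 14 (R 25)).lt (R 10)) (.sto 14 (R 25) (R 10)) .skip) (h.set 10 v)
        (fun h' t => t0 + t ≤ 6 ∧ (∀ f j, h'.A f j = if f = 14 ∧ j = h.r 25 then
          newSnd (h.r 9) (h.r 8) (h.A 13 (h.r 25)) (h.A 14 (h.r 25)) else h.A f j) ∧
          (∀ y, y ≠ 10 → h'.r y = h.r y) ∧ h'.io = h.io) := by
    intro v t0 ht hv
    rw [← hv]
    by_cases c : h.A 14 (h.r 25) < v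
    · simp only [vc, ↓reduceIte, Nat.reduceEqDiff, Nat.reduceLT, c, one_ne_zero]
      refine ⟨hg, hg, by omega, fun f j => ?_, fun y hy => by simp [hy]⟩
      rw [max_eq_right c.le]
    · simp only [vc, ↓reduceIte, Nat.reduceEqDiff, Nat.reduceLT, c, one_ne_zero]
      refine ⟨hg, by omega, fun f j => ?_, fun y hy => by simp [hy]⟩
      rw [max_eq_left (by omega)]
      split_ifs with hh
      · rw [hh.1, hh.2]
      · rfl
  rw [insSnd, wp_seq]
  refine wp_mono (Q := fun h1 t1 => t1 ≤ 4 ∧ ∃ v, h1 = h.set 10 v ∧ max (h.A 14 (h.r 25)) v =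
    newSnd (h.r 9) (h.r 8) (h.A 13 (h.r 25)) (h.A 14 (h.r 25))) ?_ ?_
  · by_cases c1 : 1 < h.r 9
    · simp only [vc, ↓reduceIte, Nat.reduceEqDiff, Nat.reduceLT, c1, one_ne_zero]
      exact ⟨by omega, _, rfl, by simp [newSnd, c1]⟩
    by_cases c2 : h.r 9 = 1
    · by_cases c3 : h.A 13 (h.r 25) < h.r 8
      · simp only [vc, ↓reduceIte, Nat.reduceEqDiff, Nat.reduceLT, c2, c3, one_ne_zero, lt_irrefl]
        exact ⟨hg, hg, by omega, _, rfl, by simp [newSnd, c2, c3.le]⟩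
      · simp only [vc, ↓reduceIte, Nat.reduceEqDiff, Nat.reduceLT, c2, c3, one_ne_zero, lt_irrefl]
        exact ⟨hg, by omega, _, rfl, by simp [newSnd, c2, le_of_not_gt c3]⟩
    · simp only [vc, ↓reduceIte, Nat.reduceEqDiff, Nat.reduceLT, c1, c2, one_ne_zero]
      exact ⟨by omega, _, rfl, by simp [newSnd, c1, c2]⟩
  · rintro h1 t1 ⟨ht, v, rfl, hv⟩
    exact fin v t1 ht hv

theorem insFst_wp {Γ : Cx} {h : HS} (hg : h.r 25 < Γ.cap) :
    wp Γ insFst h (fun h' t => t ≤ 3 ∧ (∀ f j, h'.A f j = if f = 13 ∧ j = h.r 25 then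
      newFst (h.r 9) (h.r 8) (h.A 13 (h.r 25)) else h.A f j) ∧
      (∀ y, h'.r y = h.r y) ∧ h'.io = h.io) := by
  have same : newFst (h.r 9) (h.r 8) (h.A 13 (h.r 25)) = h.A 13 (h.r 25) →
      ∀ f j, h.A f j = if f = 13 ∧ j = h.r 25 then
      newFst (h.r 9) (h.r 8) (h.A 13 (h.r 25)) else h.A f j := by
    intro he f j
    split_ifs with hh
    · rw [he, hh.1, hh.2]
    · rfl
  by_cases c1 : 0 < h.r 9
  · by_cases c2 : h.A 13 (h.r 25) < h.r 8
    · simp only [insFst, vc, ↓reduceIte, Nat.reduceEqDiff, Nat.reduceLT, c1, c2, one_ne_zero]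
      refine ⟨hg, hg, by omega, fun f j => ?_, fun _ => trivial⟩
      simp [newFst, c1, c2.le]
    · simp only [insFst, vc, ↓reduceIte, Nat.reduceEqDiff, Nat.reduceLT, c1, c2, one_ne_zero]
      exact ⟨hg, by omega, same (by simp [newFst, c1, le_of_not_gt c2]), fun _ => trivial⟩
  · simp only [insFst, vc, ↓reduceIte, Nat.reduceEqDiff, Nat.reduceLT, c1, one_ne_zero]
    exact ⟨by omega, same (by simp [newFst, c1]), fun _ => trivial⟩

/-- The entries `N + 1, …, h.r 2` of the dictionary are groups of centres; the relation `S o κ c`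
tells which centres have been put into the group with the owner `o` and the key `κ` so far. -/
structure TInv (Γ : Cx) (ex : ℕ → ℕ) (b s N : ℕ) (A : ℕ → ℕ → ℕ) (S : ℕ → ℕ → ℕ → Prop)
    (h : HS) : Prop where
  dict : Dict h.A (h.r 2) b
  le : N ≤ h.r 2
  old : ∀ v ≤ N, h.A 8 v = A 8 v ∧ h.A 9 v = A 9 v
  new : ∀ g, N < g → g ≤ h.r 2 → h.A 9 g ≤ N
  top : ∀ g, N < g → g ≤ h.r 2 → Top (S (h.A 9 g) (h.A 8 g))
    (fun c => val ex c (A 10 (h.A 9 g))) (h.A 13 g) (h.A 14 g)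
  some : ∀ o κ c, S o κ c → ∃ g, N < g ∧ g ≤ h.r 2 ∧ h.A 9 g = o ∧ h.A 8 g = κ
  zero : ∀ g, h.r 2 < g → h.A 13 g = 0 ∧ h.A 14 g = 0

/-- The effect of `grpIns`. -/
structure GrpPost (o κ N : ℕ) (h h' : HS) : Prop where
  lt : N < h'.r 25
  le : h'.r 25 ≤ h'.r 2
  par : h'.A 9 (h'.r 25) = o
  key : h'.A 8 (h'.r 25) = κ
  mono : h.r 2 ≤ h'.r 2
  card : h'.r 2 ≤ h.r 2 + 1
  old : ∀ v ≤ h.r 2, h'.A 8 v = h.A 8 v ∧ h'.A 9 v = h.A 9 v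
  arr : ∀ f, f < 5 ∨ 9 < f → f ≠ 13 → f ≠ 14 → h'.A f = h.A f
  reg : ∀ y, y ≠ 2 → y ≠ 10 → y < 22 ∨ 25 < y → h'.r y = h.r y
  io : h'.io = h.io

section
variable {Γ : Cx} {n : ℕ} {a U ch ex P : ℕ → ℕ} {b s N : ℕ} {hw : ℕ → List ℕ} {A : ℕ → ℕ → ℕ}

/-- The second largest value is updated before the largest, because it depends on the old maximum.
The set `D` is new to the group and constant in value, as `Top.insert` requires. -/
theorem grpIns_wp (H : Base Γ n a U ch ex P b s N hw A) {S : ℕ → ℕ → ℕ → Prop} {h : HS}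
    (hT : TInv Γ ex b s N A S h) {o κ : ℕ} {D : ℕ → Prop} (h20 : h.r 20 = o) (h21 : h.r 21 = κ)
    (ho : o ≤ N) (hκ : s < κ) (hκb : κ < 2 * s + 2) (hcard : h.r 2 + 1 < Γ.cap)
    (hF : Few D (h.r 9)) (hy : ∀ c, D c → val ex c (A 10 o) = h.r 8)
    (hd : ∀ c, D c → ¬ S o κ c) :
    wp Γ grpIns h (fun h' t => t ≤ 4 * b + 24 ∧ GrpPost o κ N h h' ∧
      TInv Γ ex b s N A (fun o' κ' c => S o' κ' c ∨ (o' = o ∧ κ' = κ) ∧ D c) h') := by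
  have hB := H.ectx.B
  have hcap := H.ectx.cap
  have hb := H.bits
  have hs := H.s_le
  rw [grpIns, wp_seq]
  refine wp_mono (findIns_wp hT.dict (le_trans ho hT.le) (by omega) h20 h21 hcard (by omega)
    (by omega)) ?_
  rintro h1 t1 ⟨ht1, hP⟩
  have hmono : h.r 2 ≤ h1.r 2 ∧ h1.r 2 ≤ h.r 2 + 1 := by
    rcases hP.new with hh | ⟨hh, -⟩ <;> omega
  -- A key above `s` cannot belong to a tree node.
  have hgN : N < h1.r 25 := by
    by_contra hcon
    have := hP.pos
    have k1 := (hP.old _ (le_trans (not_lt.1 hcon) hT.le)).1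
    have k2 := (hT.old _ (not_lt.1 hcon)).1
    have := H.key_le hP.pos (not_lt.1 hcon)
    rw [hP.key, k2] at k1
    omega
  have hgle := hP.le
  have hg : h1.r 25 < Γ.cap := by omega
  rw [wp_seq]
  refine wp_mono (insSnd_wp hg) ?_
  rintro h2 t2 ⟨ht2, hA2, hr2, hio2⟩
  have e25 : h2.r 25 = h1.r 25 := hr2 25 (by omega)
  refine wp_mono (insFst_wp (by omega)) ?_
  rintro h3 t3 ⟨ht3, hA3, hr3, hio3⟩
  have r9 : h1.r 9 = h.r 9 := hP.reg 9 (by omega) (by omega)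
  have r8 : h1.r 8 = h.r 8 := hP.reg 8 (by omega) (by omega)
  have a13 : h1.A 13 = h.A 13 := hP.arr 13 (by omega)
  have a14 : h1.A 14 = h.A 14 := hP.arr 14 (by omega)
  rw [e25, hr2 9 (by omega), hr2 8 (by omega), hA2 13 (h1.r 25), r9, r8, a13] at hA3
  rw [r9, r8, a13, a14] at hA2
  simp only [Nat.reduceEqDiff, false_and, if_false] at hA3
  have r25 : h3.r 25 = h1.r 25 := by rw [hr3, e25]
  have r2 : h3.r 2 = h1.r 2 := by rw [hr3, hr2 2 (by omega)]
  have arr : ∀ f, f ≠ 13 → f ≠ 14 → h3.A f = h1.A f := by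
    intro f f1 f2; funext j
    rw [hA3, if_neg (by tauto), hA2, if_neg (by tauto)]
  have arr13 : ∀ j, h3.A 13 j = if j = h1.r 25 then
      newFst (h.r 9) (h.r 8) (h.A 13 (h1.r 25)) else h.A 13 j := by
    intro j
    rw [hA3, hA2, a13]; simp
  have arr14 : ∀ j, h3.A 14 j = if j = h1.r 25 then
      newSnd (h.r 9) (h.r 8) (h.A 13 (h1.r 25)) (h.A 14 (h1.r 25)) else h.A 14 j := by
    intro j
    rw [hA3, hA2, a14]; simp
  have e8 := arr 8 (by omega) (by omega)
  have e9 := arr 9 (by omega) (by omega)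
  have old : ∀ v ≤ h.r 2, h3.A 8 v = h.A 8 v ∧ h3.A 9 v = h.A 9 v := by
    rw [e8, e9]; exact hP.old
  have hDict : Dict h3.A (h3.r 2) b := by
    rw [r2]
    exact hP.dict.congr fun f f1 f2 => arr f (by omega) (by omega)
  refine ⟨by omega, ⟨?_, ?_, ?_, ?_, ?_, ?_, old, ?_, ?_, ?_⟩, ⟨hDict, ?_, ?_, ?_, ?_, ?_, ?_⟩⟩
  · omega
  · omega
  · rw [e9, r25]; exact hP.par
  · rw [e8, r25]; exact hP.key
  · omega
  · omega
  · intro f f1 f2 f3; rw [arr f f2 f3, hP.arr f f1]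
  · intro y y1 y2 y3; rw [hr3, hr2 y y2, hP.reg y y1 y3]
  · rw [hio3, hio2, hP.io]
  · have := hT.le; omega
  · intro v hv
    have := hT.le
    rw [(old v (by omega)).1, (old v (by omega)).2]
    exact hT.old v hv
  · intro g g1 g2
    rw [r2] at g2
    by_cases hgg : g ≤ h.r 2
    · rw [(old g hgg).2]; exact hT.new g g1 hgg
    · rcases hP.new with hh | ⟨hh1, hh2, -⟩
      · omega
      · rw [e9, show g = h1.r 25 by omega, hP.par]; exact ho
  · intro g g1 g2
    rw [r2] at g2
    by_cases hgg : g = h1.r 25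
    · subst hgg
      rw [e8, e9, hP.par, hP.key, arr13, arr14, if_pos rfl, if_pos rfl]
      simp only [true_and, and_true]
      refine Top.insert ?_ hF hy hd
      rcases hP.new with hh | ⟨hh1, hh2, hh3⟩
      · have o1 := hP.old (h1.r 25) (by omega)
        rw [hP.par, hP.key] at o1
        have := hT.top _ g1 (by omega)
        rw [← o1.1, ← o1.2] at this
        exact this
      -- A group just created starts from the untouched cells, whose value `0` describes the empty
      -- set.
      · obtain ⟨z1, z2⟩ := hT.zero (h1.r 25) (by omega)
        rw [z1, z2]
        refine Top.empty fun c hc => ?_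
        obtain ⟨g, g1, g2, g3, g4⟩ := hT.some o κ c hc
        exact hh3 g (by omega) g2 g3 g4
    · have hgo : g ≤ h.r 2 := by
        rcases hP.new with hh | ⟨hh1, hh2, -⟩ <;> omega
      rw [(old g hgo).1, (old g hgo).2, arr13, arr14, if_neg hgg, if_neg hgg]
      refine (hT.top g g1 hgo).congr fun c => ?_
      constructor
      · rintro (hc | ⟨⟨c1, c2⟩, -⟩)
        · exact hc
        · exfalso
          have o1 := hP.old g hgo
          exact hgg (hP.dict.inj (by omega) g2 hP.pos hP.le (by rw [o1.2, c1, hP.par])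
            (by rw [o1.1, c2, hP.key]))
      · exact Or.inl
  · rintro o' κ' c (hc | ⟨⟨rfl, rfl⟩, -⟩)
    · obtain ⟨g, g1, g2, g3, g4⟩ := hT.some o' κ' c hc
      exact ⟨g, g1, by omega, by rw [(old g g2).2, g3], by rw [(old g g2).1, g4]⟩
    · exact ⟨h1.r 25, hgN, by omega, by rw [e9, hP.par], by rw [e8, hP.key]⟩
  · intro g hg
    rw [arr13, arr14, if_neg (by omega), if_neg (by omega)]
    exact hT.zero g (by omega)
end
end RLEMups

/-! ### The groups of all centres -/


namespace RLEMups

/-- Count the centre in register `5` at its node, and put its maximal palindrome that ends with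
parts of runs into its group. -/
def centreStep : HP :=
  .asg 6 (AR 4 (R 5)) ;; .asg 7 (AR 10 (R 6)) ;; .sto 12 (R 6) (AR 12 (R 6) + 1) ;;
  .ite ((AR 1 (R 5 - R 7)).eq (AR 1 (R 5 + R 7)))
    (.asg 20 (R 6) ;; .asg 21 (R 3 + 2 + AR 1 (R 5 + R 7)) ;; .asg 9 1 ;;
      .ite ((AR 2 (R 5 - R 7)).lt (AR 2 (R 5 + R 7)))
        (.asg 8 (AR 2 (R 5 - R 7))) (.asg 8 (AR 2 (R 5 + R 7))) ;;
      grpIns ;; .sto 17 (R 5) (R 25))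
    .skip ;;
  .asg 5 (R 5 + 1)

/-- Treat all centres in this way. -/
def centres : HP := .asg 4 (R 2) ;; .asg 5 1 ;; .whl ((R 5).lt (R 0 + 1)) centreStep

/-- Put the palindromes of the node in register `5` into their group. -/
def nodeStep : HP :=
  .asg 20 (AR 9 (R 5)) ;; .asg 9 (AR 12 (R 5)) ;; .sto 12 (R 20) (AR 12 (R 20) + R 9) ;;
  .asg 8 (AR 24 (AR 8 (R 5))) ;; .asg 21 (R 3 + 2 + AR 23 (AR 8 (R 5))) ;; grpIns ;;
  .sto 15 (R 5) (R 25) ;; .asg 5 (R 5 - 1)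

/-- Treat all nodes in this way. -/
def nodes : HP := .asg 5 (R 4) ;; .whl (HE.lt 0 (R 5)) nodeStep

/-- The groups when the centres before `c0` have been treated. -/
def CSet (m : ℕ) (U ch : ℕ → ℕ) (hw : ℕ → List ℕ) (A : ℕ → ℕ → ℕ) (s N c0 o κ c : ℕ) : Prop :=
  o ≤ N ∧ InGrp m U ch hw A s o κ c ∧ A 10 o = A 10 (A 4 c) ∧ c < c0

/-- The groups when the centres and the nodes after `v0` have been treated. -/
def NSet (m : ℕ) (U ch : ℕ → ℕ) (hw : ℕ → List ℕ) (A : ℕ → ℕ → ℕ) (s N v0 o κ c : ℕ) : Prop :=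
  o ≤ N ∧ InGrp m U ch hw A s o κ c ∧
    -- The first kind of member stops at `o` and was entered by the loop over the centres; the
    -- second continues to a child `v` of `o` and is entered together with `v`.
    (A 10 o = A 10 (A 4 c) ∨ ∃ v, v0 < v ∧ v ≤ N ∧ At U hw A v c ∧ A 10 v = A 10 o + 1)

/-- `g` is the group with the owner `o` and the key `κ`. -/
structure IsGrp (N : ℕ) (h : HS) (o κ g : ℕ) : Prop where
  lt : N < g
  le : g ≤ h.r 2
  par : h.A 9 g = o
  key : h.A 8 g = κ

/-- The array `17` contains the groups of the centres before `c0`. -/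
def PG (A : ℕ → ℕ → ℕ) (ch : ℕ → ℕ) (s N c0 : ℕ) (h : HS) : Prop :=
  ∀ c, 1 ≤ c → c < c0 → (ch (c - A 10 (A 4 c)) = ch (c + A 10 (A 4 c)) →
    IsGrp N h (A 4 c) (s + 2 + ch (c + A 10 (A 4 c))) (h.A 17 c)) ∧
    (ch (c - A 10 (A 4 c)) ≠ ch (c + A 10 (A 4 c)) → h.A 17 c = 0)

/-- The invariant of the loop over the centres. -/
structure CInv (Γ : Cx) (U ch ex : ℕ → ℕ) (b s N : ℕ) (hw : ℕ → List ℕ) (A : ℕ → ℕ → ℕ)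
    (io : ℕ → ℕ) (c0 : ℕ) (h : HS) : Prop where
  one_le : 1 ≤ c0
  le : c0 ≤ Γ.m + 1
  r0 : h.r 0 = Γ.m
  r3 : h.r 3 = s
  r4 : h.r 4 = N
  r5 : h.r 5 = c0
  top : TInv Γ ex b s N A (CSet Γ.m U ch hw A s N c0) h
  cnt : ∀ u, h.A 12 u = ((Finset.Ico 1 c0).filter (fun c => A 4 c = u)).card
  pg : PG A ch s N c0 h
  zero : ∀ c, c0 ≤ c → h.A 17 c = 0
  card : h.r 2 + 1 ≤ N + c0
  arr : ∀ f, f < 5 ∨ 9 < f → f ≠ 12 → f ≠ 13 → f ≠ 14 → f ≠ 17 → h.A f = A f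
  io : h.io = io

/-- The invariant of the loop over the nodes. -/
structure NInv (Γ : Cx) (U ch ex : ℕ → ℕ) (b s N : ℕ) (hw : ℕ → List ℕ) (A : ℕ → ℕ → ℕ)
    (io : ℕ → ℕ) (v0 : ℕ) (h : HS) : Prop where
  le : v0 ≤ N
  r0 : h.r 0 = Γ.m
  r4 : h.r 4 = N
  r3 : h.r 3 = s
  r5 : h.r 5 = v0
  top : TInv Γ ex b s N A (NSet Γ.m U ch hw A s N v0) h
  -- `F c` is the deepest unprocessed node at the centre `c`. When the turn of a node comes, its
  -- count thus covers all centres at which it occurs.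
  cnt : ∃ F : ℕ → ℕ, (∀ c, 1 ≤ c → c ≤ Γ.m → F c ≤ v0 ∧ At U hw A (F c) c ∧
    ∀ u ≤ v0, At U hw A u c → A 10 u ≤ A 10 (F c)) ∧
    ∀ u ≤ v0, h.A 12 u = ((Finset.Icc 1 Γ.m).filter (fun c => F c = u)).card
  grp : ∀ v, v0 < v → v ≤ N → IsGrp N h (A 9 v) (s + 2 + A 23 (A 8 v)) (h.A 15 v)
  pg : PG A ch s N (Γ.m + 1) h
  card : h.r 2 + v0 ≤ 2 * N + Γ.m
  arr : ∀ f, f < 5 ∨ 9 < f → f ≠ 12 → f ≠ 13 → f ≠ 14 → f ≠ 15 → f ≠ 17 → h.A f = A f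
  io : h.io = io

section
variable {Γ : Cx} {n : ℕ} {a U ch ex P : ℕ → ℕ} {b s N : ℕ} {hw : ℕ → List ℕ} {A : ℕ → ℕ → ℕ}
  {io : ℕ → ℕ}

theorem TInv.congr {S S' : ℕ → ℕ → ℕ → Prop} {h h' : HS} (hT : TInv Γ ex b s N A S h)
    (hS : ∀ o κ c, S' o κ c ↔ S o κ c) (h2 : h'.r 2 = h.r 2)
    (hA : ∀ f, 5 ≤ f → f ≤ 14 → f < 10 ∨ 12 < f → h'.A f = h.A f) : TInv Γ ex b s N A S' h' := by
  obtain rfl : S' = S := funext fun o => funext fun κ => funext fun c => propext (hS o κ c)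
  have a8 := hA 8 (by omega) (by omega) (by omega)
  have a9 := hA 9 (by omega) (by omega) (by omega)
  have a13 := hA 13 (by omega) (by omega) (by omega)
  have a14 := hA 14 (by omega) (by omega) (by omega)
  obtain ⟨t1, t2, t3, t4, t5, t6, t7⟩ := hT
  constructor
  · rw [h2]; exact t1.congr fun f f1 f2 => hA f f1 (by omega) (by omega)
  all_goals (try rw [h2]); (try rw [a8]); (try rw [a9]); (try rw [a13]); (try rw [a14])
  all_goals assumption

theorem IsGrp.mono {h h' : HS} {o κ g : ℕ} (hg : IsGrp N h o κ g) (h2 : h.r 2 ≤ h'.r 2)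
    (hold : ∀ v ≤ h.r 2, h'.A 8 v = h.A 8 v ∧ h'.A 9 v = h.A 9 v) : IsGrp N h' o κ g := by
  obtain ⟨h8, h9⟩ := hold g hg.le
  exact ⟨hg.lt, le_trans hg.le h2, by rw [h9, hg.par], by rw [h8, hg.key]⟩

theorem PG.mono {h h' : HS} {c0 : ℕ} (hp : PG A ch s N c0 h) (h2 : h.r 2 ≤ h'.r 2)
    (hold : ∀ v ≤ h.r 2, h'.A 8 v = h.A 8 v ∧ h'.A 9 v = h.A 9 v)
    (h17 : ∀ c < c0, h'.A 17 c = h.A 17 c) : PG A ch s N c0 h' := by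
  intro c c1 c2
  rw [h17 c c2]
  exact ⟨fun he => ((hp c c1 c2).1 he).mono h2 hold, (hp c c1 c2).2⟩

/-- A centre has a value of its own only at the level of its maximal palindrome, and only if the end
runs agree in character; as runs they differ there, so the value is the smaller exponent. At all
lower levels its value is that of a node and is entered with that node. -/
theorem centreStep_wp (H : Base Γ n a U ch ex P b s N hw A) {c0 : ℕ} {h : HS}
    (hi : CInv Γ U ch ex b s N hw A io c0 h) (hlt : c0 < Γ.m + 1) :
    wp Γ centreStep h (fun h' t => t ≤ 4 * b + 38 ∧ CInv Γ U ch ex b s N hw A io (c0 + 1) h') := by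
  have hB := H.ectx.B
  have hcap := H.ectx.cap
  have hN := H.N_le
  have hcard := hi.card
  have hc1 := hi.one_le
  obtain ⟨k1, k2, k3, k4, k5, k6, k7⟩ := H.arm hc1 (show c0 ≤ Γ.m by omega)
  have e1 := hi.arr 1 (by omega) (by omega) (by omega) (by omega) (by omega)
  have e2 := hi.arr 2 (by omega) (by omega) (by omega) (by omega) (by omega)
  have e4 := hi.arr 4 (by omega) (by omega) (by omega) (by omega) (by omega)
  have e10 := hi.arr 10 (by omega) (by omega) (by omega) (by omega) (by omega)
  have hcnt : h.A 12 (A 4 c0) ≤ Γ.m := by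
    rw [hi.cnt]
    refine le_trans (Finset.card_filter_le _ _) ?_
    rw [Nat.card_Ico]; omega
  have cnt' : ∀ u, (if u = A 4 c0 then h.A 12 (A 4 c0) + 1 else h.A 12 u) =
      ((Finset.Ico 1 (c0 + 1)).filter (fun c => A 4 c = u)).card := by
    intro u
    have hins : Finset.Ico 1 (c0 + 1) = insert c0 (Finset.Ico 1 c0) := by
      ext x; simp only [Finset.mem_insert, Finset.mem_Ico]; omega
    rw [hins, Finset.filter_insert]
    by_cases hu : u = A 4 c0
    · subst hu
      rw [if_pos rfl, if_pos rfl, Finset.card_insert_of_notMem (by simp), hi.cnt]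
    · rw [if_neg hu, if_neg (fun hh => hu hh.symm), hi.cnt]
  set K := A 10 (A 4 c0) with hK
  have hs3 := hi.r3
  have hch1 := H.a1 (c0 - K) (by omega)
  have hch2 := H.a1 (c0 + K) (by omega)
  have hself := H.at_nod hc1 (show c0 ≤ Γ.m by omega)
  have hV := H.valid_iff hc1 (show c0 ≤ Γ.m by omega) (k := K)
  have hbits := H.bits
  have hsm := H.s_le
  simp only [centreStep, vc, ↓reduceIte, Nat.reduceEqDiff, Nat.reduceLT, hi.r5, hi.r0, e1, e2, e4,
    e10, ← hK, hs3, hch1, hch2]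
  refine ⟨by omega, by omega, ⟨by omega, by omega⟩, by omega, ⟨⟨⟨by omega, by omega⟩, by omega⟩,
    by omega, by omega⟩, fun hv => ?_, fun hv => ?_⟩
  · have he : ch (c0 - K) = ch (c0 + K) := by
      by_contra hcon; rw [if_neg hcon] at hv; exact hv rfl
    have hVal := hV.2 (Or.inr ⟨rfl, he⟩)
    have l1 := hVal.lt
    have l2 := hVal.le
    have hch3 := H.ch_lt (c0 + K) (by omega) (by omega)
    have hx1 := H.a2 (c0 - K) (by omega) (by omega)
    have hx2 := H.a2 (c0 + K) (by omega) (by omega)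
    have fin : ∀ (h1 : HS), h1.r 20 = A 4 c0 → h1.r 21 = s + 2 + ch (c0 + K) → h1.r 9 = 1 →
        h1.r 8 = val ex c0 K → h1.r 2 = h.r 2 → h1.r 0 = Γ.m → h1.r 3 = s → h1.r 4 = N →
        h1.r 5 = c0 → h1.io = h.io →
        (∀ f, f ≠ 12 → h1.A f = h.A f) →
        (∀ u, h1.A 12 u = if u = A 4 c0 then h.A 12 (A 4 c0) + 1 else h.A 12 u) → 
        wp Γ grpIns h1 (fun h' t => h'.r 5 < Γ.cap ∧ h'.r 5 + 1 < Γ.B ∧ t ≤ 4 * b + 24 ∧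
          CInv Γ U ch ex b s N hw A io (c0 + 1)
            ((h'.st 17 (h'.r 5) (h'.r 25)).set 5 (h'.r 5 + 1))) := by
      intro h1 g20 g21 g9 g8 g2 g0 g3 g4 g5 gio ga g12
      refine wp_mono (grpIns_wp H (S := CSet Γ.m U ch hw A s N c0) (D := fun c => c = c0)
        (hi.top.congr (fun _ _ _ => Iff.rfl) g2 fun f f1 f2 f3 => ga f (by omega)) g20 g21 k2
        (by omega) (by omega) (by omega) ?_ ?_ ?_) ?_
      · exact ⟨by omega, fun _ => ⟨c0, fun c => Iff.rfl⟩, by omega⟩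
      · rintro c rfl; exact g8.symm
      · rintro c rfl ⟨-, -, -, h4⟩; omega
      · rintro h2 t2 ⟨ht2, hp, hT⟩
        have r5 : h2.r 5 = c0 := by rw [hp.reg 5 (by omega) (by omega) (by omega), g5]
        have q1 := hp.le
        have q2 := hp.card
        rw [r5]
        refine ⟨by omega, by omega, by omega, ?_⟩
        have q3 := hp.mono
        have old : ∀ v ≤ h.r 2, h2.A 8 v = h.A 8 v ∧ h2.A 9 v = h.A 9 v := by
          intro v hv
          have := hp.old v (by omega)
          rwa [ga 8 (by omega), ga 9 (by omega)] at this
        have z17 : h2.A 17 = h.A 17 := by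
          rw [hp.arr 17 (by omega) (by omega) (by omega), ga 17 (by omega)]
        refine ⟨by omega, by omega, ?_, ?_, ?_, ?_, ?_, ?_, ?_, ?_, ?_, ?_, ?_⟩
        · simp [hp.reg 0, g0]
        · simp [hp.reg 3, g3]
        · simp [hp.reg 4, g4]
        · simp
        · refine hT.congr (fun o κ c => ?_) (by simp) ?_
          · constructor
            · rintro ⟨a1, a2, a3, a4⟩
              rcases Nat.lt_or_ge c c0 with hcc | hcc
              · exact Or.inl ⟨a1, a2, a3, hcc⟩
              · obtain rfl : c = c0 := by omega
                obtain rfl := H.at_eq a1 k2 a2.at_node hself a3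
                exact Or.inr ⟨⟨rfl, a2.key⟩, rfl⟩
            · rintro (⟨a1, a2, a3, a4⟩ | ⟨⟨rfl, rfl⟩, rfl⟩)
              · exact ⟨a1, a2, a3, by omega⟩
              · exact ⟨k2, ⟨hc1, by omega, hself, hVal, rfl⟩, rfl, by omega⟩
          · intro f f1 f2 f3
            funext j
            have : f ≠ 17 := by omega
            simp [this]
        · intro u
          rw [← cnt' u, ← g12 u, ← hp.arr 12 (by omega) (by omega) (by omega)]
          simp
        · intro c c1 c2
          rcases Nat.lt_or_ge c c0 with hcc | hcc
          · have := (PG.mono hi.pg (h' := h2) (by omega) old (fun c _ => by rw [z17])) c c1 hcc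
            have hne : c ≠ c0 := by omega
            simpa [hne] using ⟨fun he => ⟨(this.1 he).lt, (this.1 he).le, (this.1 he).par,
              (this.1 he).key⟩, this.2⟩
          · obtain rfl : c = c0 := by omega
            refine ⟨fun _ => ⟨?_, ?_, ?_, ?_⟩, fun hne => absurd he hne⟩
            · simpa using hp.lt
            · simpa using hp.le
            · simpa using hp.par
            · simpa using hp.key
        · intro c hc
          have hne : c ≠ c0 := by omega
          simp only [HS.set_A, HS.st_A, hne, and_false, if_false, z17]
          exact hi.zero c (by omega)
        · simp only [vc, ↓reduceIte, Nat.reduceEqDiff]; omega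
        · intro f f1 f2 f3 f4 f5
          funext j
          simp only [HS.set_A, HS.st_A, f5, false_and, if_false]
          rw [hp.arr f f1 f3 f4, ga f f2, hi.arr f f1 f2 f3 f4 f5]
        · simp [hp.io, gio, hi.io]
    refine ⟨by omega, ⟨⟨by omega, by omega⟩, by omega⟩, fun hw => ⟨⟨⟨by omega, by omega⟩, by omega⟩,
      ?_⟩, fun hw => ⟨⟨by omega, by omega⟩, ?_⟩⟩
    all_goals
      refine wp_mono (fin _ ?_ ?_ ?_ ?_ ?_ ?_ ?_ ?_ ?_ ?_ ?_ ?_)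
        (fun h' t ⟨q1, q2, q3, q4⟩ => ⟨q1, q2, by omega, q4⟩)
      all_goals try simp [hi.r0, hi.r3, hi.r4, hi.r5]
    · have : A 2 (c0 - K) < A 2 (c0 + K) := by
        by_contra hcon; rw [if_neg hcon] at hw; exact hw rfl
      rw [val, ← hx1, ← hx2]; omega
    · intro f hf; funext j; simp [hf]
    · have : ¬ A 2 (c0 - K) < A 2 (c0 + K) := by
        intro hcon; rw [if_pos hcon] at hw; exact one_ne_zero hw
      rw [val, ← hx1, ← hx2]; omega
    · intro f hf; funext j; simp [hf]
  · have hne : ch (c0 - K) ≠ ch (c0 + K) := by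
      intro hcon; rw [if_pos hcon] at hv; exact one_ne_zero hv
    refine ⟨by omega, by omega, ?_⟩
    refine ⟨by omega, by omega, ?_, ?_, ?_, ?_, ?_, ?_, ?_, ?_, ?_, ?_, ?_⟩
    all_goals try simp only [vc, ↓reduceIte, Nat.reduceEqDiff]
    · exact hi.r0
    · exact hs3
    · exact hi.r4
    · refine hi.top.congr (fun o κ c => ?_) (by simp) ?_
      · constructor
        · rintro ⟨a1, a2, a3, a4⟩
          refine ⟨a1, a2, a3, ?_⟩
          by_contra hcc
          obtain rfl : c = c0 := by omega
          have := a2.valid.ends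
          rw [a3] at this
          exact hne this
        · rintro ⟨a1, a2, a3, a4⟩
          exact ⟨a1, a2, a3, by omega⟩
      · intro f f1 f2 f3
        funext j
        have : f ≠ 12 := by omega
        simp [this]
    · intro u
      rw [← cnt' u]
    · intro c c1 c2
      rcases Nat.lt_or_ge c c0 with hcc | hcc
      · have := hi.pg c c1 hcc
        simpa using ⟨fun he => ⟨(this.1 he).lt, (this.1 he).le, (this.1 he).par,
              (this.1 he).key⟩, this.2⟩
      · obtain rfl : c = c0 := by omega
        exact ⟨fun he => absurd he hne, fun _ => by simpa using hi.zero c le_rfl⟩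
    · intro c hc
      simpa using hi.zero c (by omega)
    · omega
    · intro f f1 f2 f3 f4 f5
      funext j
      simp only [HS.set_A, HS.st_A, f2, false_and, if_false]
      rw [hi.arr f f1 f2 f3 f4 f5]
    · exact hi.io

theorem centres_wp (H : Base Γ n a U ch ex P b s N hw A) {h : HS} (hA : h.A = A)
    (h0 : h.r 0 = Γ.m) (h2 : h.r 2 = N) (h3 : h.r 3 = s) :
    wp Γ centres h (fun h' t => t ≤ Γ.m * (4 * b + 39) + 3 ∧
      CInv Γ U ch ex b s N hw A h.io (Γ.m + 1) h') := by
  have hB := H.ectx.B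
  have hcap := H.ectx.cap
  subst hA
  simp only [centres, vc, ↓reduceIte, Nat.reduceEqDiff, Nat.reduceLT]
  refine wp_whl (fun h1 k => ∃ c0, CInv Γ U ch ex b s N hw h.A h.io c0 h1 ∧
    k = (Γ.m + 1 - c0) * (4 * b + 39)) (n := Γ.m * (4 * b + 39)) ?_ ?_ ?_
  · rintro h1 k ⟨c0, hi, rfl⟩
    have hle := hi.le
    simp only [vc, ↓reduceIte, Nat.reduceEqDiff, Nat.reduceLT, hi.r5, hi.r0]
    refine ⟨by omega, fun hv => ?_⟩
    have hlt : c0 < Γ.m + 1 := by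
      by_contra hcon; rw [if_neg hcon] at hv; exact hv rfl
    refine wp_mono (centreStep_wp H hi hlt) ?_
    rintro h' t ⟨ht, hi'⟩
    refine ⟨_, ⟨c0 + 1, hi', rfl⟩, ?_⟩
    rw [show Γ.m + 1 - c0 = (Γ.m + 1 - (c0 + 1)) + 1 by omega, Nat.add_mul]
    omega
  · refine ⟨1, ⟨le_rfl, by omega, ?_, ?_, ?_, ?_, ⟨?_, ?_, ?_, ?_, ?_, ?_, ?_⟩, ?_, ?_, ?_, ?_, ?_,
      ?_⟩, by rw [Nat.add_sub_cancel]⟩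
    all_goals try simp only [vc, ↓reduceIte, Nat.reduceEqDiff, h0, h2, h3]
    · exact H.dict
    · exact le_rfl
    · intro v _; trivial
    · intro g g1 g2; omega
    · intro g g1 g2; omega
    · rintro o κ c ⟨-, h5, -, h6⟩
      have := h5.one_le; omega
    · intro g _
      exact ⟨H.zero 13 (by omega) (by omega) g, H.zero 14 (by omega) (by omega) g⟩
    · intro u; rw [H.zero 12 (by omega) (by omega)]; simp
    · intro c c1 c2; omega
    · intro c _; exact H.zero 17 (by omega) (by omega) c
    · omega
    · intros; trivial
  · rintro h1 t k ⟨c0, hi, rfl⟩ hv ht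
    have hle := hi.le
    simp only [vc, ↓reduceIte, Nat.reduceEqDiff, Nat.reduceLT, hi.r5, hi.r0] at hv
    have : ¬ c0 < Γ.m + 1 := by
      intro hcon; rw [if_pos hcon] at hv; exact one_ne_zero hv
    obtain rfl : c0 = Γ.m + 1 := by omega
    exact ⟨by omega, hi⟩
end
end RLEMups

/-! ### The groups of all nodes -/


namespace RLEMups

section
variable {Γ : Cx} {n : ℕ} {a U ch ex P : ℕ → ℕ} {b s N : ℕ} {hw : ℕ → List ℕ} {A : ℕ → ℕ → ℕ}
  {io : ℕ → ℕ}

theorem CInv.nInv (H : Base Γ n a U ch ex P b s N hw A) {h : HS}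
    (hi : CInv Γ U ch ex b s N hw A io (Γ.m + 1) h) :
    NInv Γ U ch ex b s N hw A io N (h.set 5 N) := by
  have hcard := hi.card
  refine ⟨le_rfl, ?_, ?_, ?_, ?_, ?_, ⟨A 4, fun c c1 c2 => ?_, fun u _ => ?_⟩, ?_, ?_, ?_, ?_, ?_⟩
  all_goals try simp only [vc, ↓reduceIte, Nat.reduceEqDiff]
  · exact hi.r0
  · exact hi.r4
  · exact hi.r3
  · refine hi.top.congr (fun o κ c => ?_) (by simp) (fun _ _ _ _ => rfl)
    constructor
    · rintro ⟨a1, a2, a3 | ⟨v, v1, v2, -⟩⟩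
      · exact ⟨a1, a2, a3, by have := a2.le; omega⟩
      · omega
    · rintro ⟨a1, a2, a3, -⟩
      exact ⟨a1, a2, Or.inl a3⟩
  · exact ⟨(H.arm c1 c2).2.1, H.at_nod c1 c2, fun u _ hu => hu.1⟩
  · rw [hi.cnt]
    rfl
  · intro v v1 v2; omega
  · intro c c1 c2
    have := hi.pg c c1 c2
    exact ⟨fun he => ⟨(this.1 he).lt, (this.1 he).le, (this.1 he).par, (this.1 he).key⟩, this.2⟩
  · omega
  · intro f f1 f2 f3 f4 f5 f6
    exact hi.arr f f1 f2 f3 f4 f6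
  · exact hi.io

/-- Decreasing numbers treat children before parents. The centres of `v0` enter the group of its
parent with one common value, the exponent of the outermost run, and with their number as
multiplicity; then this number is added to the count of the parent. -/
theorem nodeStep_wp (H : Base Γ n a U ch ex P b s N hw A) {v0 : ℕ} {h : HS}
    (hi : NInv Γ U ch ex b s N hw A io v0 h) (hv0 : 1 ≤ v0) :
    wp Γ nodeStep h (fun h' t => t ≤ 4 * b + 31 ∧
      NInv Γ U ch ex b s N hw A io (v0 - 1) h') := by
  have hB := H.ectx.B
  have hcap := H.ectx.cap
  have hN := H.N_le
  have hcard := hi.card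
  have hle := hi.le
  obtain ⟨p1, p2⟩ := H.par_le hv0 hle
  have hTle := hi.top.le
  obtain ⟨o8, o9⟩ := hi.top.old v0 hle
  have e23 := hi.arr 23 (by omega) (by omega) (by omega) (by omega) (by omega) (by omega)
  have e24 := hi.arr 24 (by omega) (by omega) (by omega) (by omega) (by omega) (by omega)
  have h23 := H.a23_lt (A 8 v0)
  have hs := H.s_le
  have hkey := H.key_le hv0 hle
  obtain ⟨F, hF, hcnt⟩ := hi.cnt
  -- `v0` is the largest node left, and at a fixed centre larger numbers mean longer palindromes; so
  -- where `v0` occurs it is the deepest.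
  have hFv : ∀ c, 1 ≤ c → c ≤ Γ.m → (F c = v0 ↔ At U hw A v0 c) := by
    intro c c1 c2
    obtain ⟨f1, f2, f3⟩ := hF c c1 c2
    constructor
    · rintro rfl; exact f2
    · intro hat
      have := f3 v0 le_rfl hat
      rcases Nat.eq_or_lt_of_le this with heq | hlt
      · exact H.at_eq (by omega) hle f2 hat heq.symm
      · have := H.at_lt hle hat _ (by omega) f2 hlt; omega
  have hc1 : h.A 12 v0 ≤ Γ.m := by
    rw [hcnt v0 le_rfl]
    exact le_trans (Finset.card_filter_le _ _) (by simp)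
  have hc2 : h.A 12 (A 9 v0) ≤ Γ.m := by
    rw [hcnt _ (by omega)]
    exact le_trans (Finset.card_filter_le _ _) (by simp)
  simp only [nodeStep, vc, ↓reduceIte, Nat.reduceEqDiff, Nat.reduceLT, hi.r5, hi.r3, o8, o9, e23, e24]
  refine ⟨by omega, by omega, ⟨by omega, by omega⟩, by omega, by omega, ⟨by omega, by omega,
    by omega⟩, ?_⟩
  refine wp_mono (grpIns_wp H (S := NSet Γ.m U ch hw A s N v0) (o := A 9 v0)
    (κ := s + 2 + A 23 (A 8 v0)) (D := fun c => 1 ≤ c ∧ c ≤ Γ.m ∧ At U hw A v0 c)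
    (hi.top.congr (fun _ _ _ => Iff.rfl) (by simp) fun f f1 f2 f3 => ?_) (by simp) (by simp) (by omega)
    (by omega) (by omega) ?_ ?_ ?_ ?_) ?_
  · funext j
    have : f ≠ 12 := by omega
    simp [this]
  · simp only [vc, ↓reduceIte, Nat.reduceEqDiff]; omega
  · simp only [vc, ↓reduceIte, Nat.reduceEqDiff]
    rw [hcnt v0 le_rfl]
    have hmem : ∀ c, c ∈ (Finset.Icc 1 Γ.m).filter (fun c => F c = v0) ↔
        1 ≤ c ∧ c ≤ Γ.m ∧ At U hw A v0 c := by
      intro c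
      rw [Finset.mem_filter, Finset.mem_Icc]
      constructor
      · rintro ⟨⟨c1, c2⟩, c3⟩; exact ⟨c1, c2, (hFv c c1 c2).1 c3⟩
      · rintro ⟨c1, c2, c3⟩; exact ⟨⟨c1, c2⟩, (hFv c c1 c2).2 c3⟩
    refine ⟨fun h0 c => ?_, fun h1 => ?_, fun h2 => ?_⟩
    · rw [Finset.card_eq_zero] at h0
      rw [← hmem, h0]; simp
    · obtain ⟨d, hd⟩ := Finset.card_eq_one.1 h1
      exact ⟨d, fun c => by rw [← hmem, hd, Finset.mem_singleton]⟩
    · obtain ⟨c, hc, c', hc', hne⟩ := Finset.one_lt_card.1 h2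
      exact ⟨c, c', hne, (hmem c).1 hc, (hmem c').1 hc'⟩
  · rintro c ⟨c1, c2, c3⟩
    simp only [vc, ↓reduceIte, Nat.reduceEqDiff]
    exact (H.ingrp_node hv0 hle c1 c2 c3).2
  · rintro c ⟨c1, c2, c3⟩ ⟨d1, d2, d3 | ⟨v, v1, v2, v3, v4⟩⟩
    · have := c3.1; omega
    · have := H.at_eq v2 hle v3 c3 (by omega); omega
  · rintro h2 t2 ⟨ht2, hp, hT⟩
    have r5 : h2.r 5 = v0 := by
      rw [hp.reg 5 (by omega) (by omega) (by omega)]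
      simp [hi.r5]
    have q1 := hp.le
    have q2 := hp.card
    have q3 := hp.mono
    have q4 := hp.old
    simp only [vc, ↓reduceIte, Nat.reduceEqDiff] at q2 q3 q4
    rw [r5]
    refine ⟨by omega, by omega, by omega, ?_⟩
    refine ⟨by omega, ?_, ?_, ?_, ?_, ?_, ?_, ?_, ?_, ?_, ?_, ?_⟩
    · simp [hp.reg 0, hi.r0]
    · simp [hp.reg 4, hi.r4]
    · simp [hp.reg 3, hi.r3]
    · simp
    · refine hT.congr (fun o κ c => ?_) (by simp) ?_
      · constructor
        · rintro ⟨d1, d2, d3 | ⟨v, v1, v2, v3, v4⟩⟩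
          · exact Or.inl ⟨d1, d2, Or.inl d3⟩
          · rcases Nat.lt_or_ge v0 v with hlt | hge
            · exact Or.inl ⟨d1, d2, Or.inr ⟨v, hlt, v2, v3, v4⟩⟩
            · obtain rfl : v = v0 := by omega
              have g := (H.ingrp_node hv0 hle d2.one_le d2.le v3).1
              obtain rfl := H.at_eq d1 (by omega) d2.at_node g.at_node (by omega)
              exact Or.inr ⟨⟨rfl, by rw [d2.key, g.key]⟩, d2.one_le, d2.le, v3⟩
        · rintro (⟨d1, d2, d3 | ⟨v, v1, v2, v3, v4⟩⟩ | ⟨⟨rfl, rfl⟩, c1, c2, c3⟩)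
          · exact ⟨d1, d2, Or.inl d3⟩
          · exact ⟨d1, d2, Or.inr ⟨v, by omega, v2, v3, v4⟩⟩
          · exact ⟨by omega, (H.ingrp_node hv0 hle c1 c2 c3).1,
              Or.inr ⟨v0, by omega, hle, c3, p2⟩⟩
      · intro f f1 f2 f3
        funext j
        have : f ≠ 15 := by omega
        simp [this]
    -- Once `v0` is done, the deepest remaining node at its centres is its parent.
    · refine ⟨fun c => if F c = v0 then A 9 v0 else F c, fun c c1 c2 => ?_, fun u hu => ?_⟩
      · obtain ⟨f1, f2, f3⟩ := hF c c1 c2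
        by_cases hc : F c = v0
        · simp only [hc, if_true]
          rw [hc] at f2 f3
          refine ⟨by omega, (H.at_par hv0 hle f2).1, fun u hu hat => ?_⟩
          have h1 := f3 u (by omega) hat
          by_contra hcon
          have := H.at_eq (by omega) hle hat f2 (by omega)
          omega
        · simp only [hc, if_false]
          exact ⟨by omega, f2, fun u hu hat => f3 u (by omega) hat⟩
      · have harr : h2.A 12 u = if u = A 9 v0 then h.A 12 (A 9 v0) + h.A 12 v0 else h.A 12 u := by
          rw [hp.arr 12 (by omega) (by omega) (by omega)]
          simp
        simp only [HS.set_A, HS.st_A, Nat.reduceEqDiff, false_and, if_false]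
        rw [harr]
        split_ifs with hu'
        · subst hu'
          rw [hcnt _ (by omega), hcnt v0 le_rfl, ← Finset.card_union_of_disjoint]
          · congr 1
            ext c
            simp only [Finset.mem_union, Finset.mem_filter]
            constructor
            · rintro (⟨c1, c2⟩ | ⟨c1, c2⟩)
              · refine ⟨c1, ?_⟩
                rw [if_neg (by omega)]; exact c2
              · exact ⟨c1, by rw [if_pos c2]⟩
            · rintro ⟨c1, c2⟩
              split_ifs at c2 with c3
              · exact Or.inr ⟨c1, c3⟩
              · exact Or.inl ⟨c1, c2⟩
          · rw [Finset.disjoint_left]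
            intro c hc hc'
            rw [Finset.mem_filter] at hc hc'
            omega
        · rw [hcnt u (by omega)]
          congr 1
          ext c
          simp only [Finset.mem_filter]
          constructor
          · rintro ⟨c1, c2⟩
            refine ⟨c1, ?_⟩
            rw [if_neg (by omega)]; exact c2
          · rintro ⟨c1, c2⟩
            split_ifs at c2 with c3
            · omega
            · exact ⟨c1, c2⟩
    · intro v v1 v2
      by_cases hvv : v = v0
      · subst hvv
        refine ⟨?_, ?_, ?_, ?_⟩
        · simpa using hp.lt
        · simpa using hp.le
        · simpa using hp.par
        · simpa using hp.key
      · obtain ⟨g1, g2, g3, g4⟩ := hi.grp v (by omega) v2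
        have e15 : h2.A 15 v = h.A 15 v := by
          rw [hp.arr 15 (by omega) (by omega) (by omega)]; simp
        obtain ⟨k1, k2⟩ := q4 _ g2
        refine ⟨?_, ?_, ?_, ?_⟩ <;> simp [hvv, e15]
        · exact g1
        · omega
        · rw [k2]; simpa using g3
        · rw [k1]; simpa using g4
    · refine PG.mono hi.pg ?_ ?_ ?_
      · simpa using q3
      · intro v hv
        simpa using q4 v hv
      · intro c _
        have e17 : h2.A 17 c = h.A 17 c := by
          rw [hp.arr 17 (by omega) (by omega) (by omega)]; simp
        simpa using e17
    · simp only [vc, ↓reduceIte, Nat.reduceEqDiff]; omega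
    · intro f f1 f2 f3 f4 f5 f6
      funext j
      simp only [HS.set_A, HS.st_A, f5, false_and, if_false]
      rw [hp.arr f f1 f3 f4]
      simp only [HS.set_A, HS.st_A, f2, false_and, if_false]
      rw [hi.arr f f1 f2 f3 f4 f5 f6]
    · simp [hp.io, hi.io]

theorem nodes_wp (H : Base Γ n a U ch ex P b s N hw A) {h : HS}
    (hi : CInv Γ U ch ex b s N hw A io (Γ.m + 1) h) :
    wp Γ nodes h (fun h' t => t ≤ N * (4 * b + 32) + 2 ∧
      NInv Γ U ch ex b s N hw A io 0 h') := by
  simp only [nodes, vc, ↓reduceIte, Nat.reduceEqDiff, Nat.reduceLT, hi.r4]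
  refine wp_whl (fun h1 k => ∃ v0, NInv Γ U ch ex b s N hw A io v0 h1 ∧
    k = v0 * (4 * b + 32)) (n := N * (4 * b + 32)) ?_ ⟨N, hi.nInv H, rfl⟩ ?_
  · rintro h1 k ⟨v0, hi, rfl⟩
    simp only [vc, ↓reduceIte, Nat.reduceEqDiff, Nat.reduceLT, hi.r5]
    refine fun hv => ?_
    have hlt : 0 < v0 := by
      by_contra hcon; rw [if_neg hcon] at hv; exact hv rfl
    refine wp_mono (nodeStep_wp H hi hlt) ?_
    rintro h' t ⟨ht, hi'⟩
    refine ⟨_, ⟨v0 - 1, hi', rfl⟩, ?_⟩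
    obtain ⟨v, rfl⟩ : ∃ v, v0 = v + 1 := ⟨v0 - 1, by omega⟩
    rw [Nat.add_sub_cancel, Nat.add_mul v]
    omega
  · rintro h1 t k ⟨v0, hi, rfl⟩ hv ht
    simp only [vc, ↓reduceIte, Nat.reduceEqDiff, Nat.reduceLT, hi.r5] at hv
    have : ¬ 0 < v0 := by
      intro hcon; rw [if_pos hcon] at hv; exact one_ne_zero hv
    obtain rfl : v0 = 0 := by omega
    exact ⟨by omega, hi⟩
end
end RLEMups

/-! ### The output -/


namespace RLEMups

/-- Find the first ancestor of the node in register `5` whose palindrome becomes unique. -/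
def firstStep : HP :=
  .asg 6 (AR 9 (R 5)) ;;
  .ite (AR 16 (R 6)) (.sto 16 (R 5) (AR 16 (R 6)))
    (.ite ((AR 14 (AR 15 (R 5))).lt (AR 24 (AR 8 (R 5)))) (.sto 16 (R 5) (R 5)) .skip) ;;
  .asg 5 (R 5 + 1)

/-- Do this for all nodes. -/
def firsts : HP := .asg 5 1 ;; .whl ((R 5).lt (R 4 + 1)) firstStep

/-- Compute the level and the length of the ends of the minimal unique palindrome with the centre in
register `5`; the length `0` means that there is none. -/
def select : HP :=
  .asg 6 (AR 4 (R 5)) ;; .asg 7 (AR 16 (R 6)) ;; .asg 9 0 ;;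
  .ite (R 7)
    (.asg 8 (AR 10 (R 7) - 1) ;;
      .ite (R 8) (.asg 9 (AR 14 (AR 15 (R 7)) + 1)) (.asg 9 (AR 2 (R 5))))
    (.asg 8 (AR 10 (R 6)) ;;
      .ite (AR 17 (R 5))
        (.ite ((AR 14 (AR 17 (R 5))).lt (AR 2 (R 5 - R 8)))
          (.ite ((AR 14 (AR 17 (R 5))).lt (AR 2 (R 5 + R 8)))
            (.asg 9 (AR 14 (AR 17 (R 5)) + 1)) .skip) .skip) .skip)

/-- Output this palindrome. -/
def emit : HP :=
  .ite (R 9)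
    (.out (2 * R 10) (AR 3 (R 5 - R 8 + 1) + 1 - R 9) ;;
      .out (2 * R 10 + 1) (AR 3 (R 5 + R 8) + R 9) ;; .asg 10 (R 10 + 1))
    .skip ;;
  .asg 5 (R 5 + 1)

/-- Output the minimal unique palindromes of all centres. -/
def outputs : HP := .asg 10 0 ;; .asg 5 1 ;; .whl ((R 5).lt (R 0 + 1)) (select ;; emit)

/-- The palindrome of the node `v` extends uniquely. -/
def UniqNode (A : ℕ → ℕ → ℕ) (h : HS) (v : ℕ) : Prop := h.A 14 (h.A 15 v) < A 24 (A 8 v)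

/-- The arrays after the construction of the groups. -/
structure GInv (Γ : Cx) (U ch ex : ℕ → ℕ) (b s N : ℕ) (hw : ℕ → List ℕ) (A : ℕ → ℕ → ℕ)
    (h : HS) : Prop where
  r0 : h.r 0 = Γ.m
  r4 : h.r 4 = N
  top : TInv Γ ex b s N A (NSet Γ.m U ch hw A s N 0) h
  grp : ∀ v, 0 < v → v ≤ N → IsGrp N h (A 9 v) (s + 2 + A 23 (A 8 v)) (h.A 15 v)
  pg : PG A ch s N (Γ.m + 1) h
  card : h.r 2 ≤ 2 * N + Γ.m
  arr : ∀ f, f < 5 ∨ 9 < f → f ≠ 12 → f ≠ 13 → f ≠ 14 → f ≠ 15 → f ≠ 16 → f ≠ 17 → h.A f = A f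

/-- `f` is the first node above `v` that extends uniquely. -/
structure FirstNode (m : ℕ) (U : ℕ → ℕ) (hw : ℕ → List ℕ) (N : ℕ) (A : ℕ → ℕ → ℕ) (h : HS)
    (v f : ℕ) : Prop where
  le : f ≤ N
  pos : f ≠ 0 → UniqNode A h f ∧ A 10 f ≤ A 10 v ∧ ∀ c, 1 ≤ c → c ≤ m → At U hw A v c → At U hw A f c ∧
    ∀ u, 1 ≤ u → u ≤ N → At U hw A u c → A 10 u ≤ A 10 v → UniqNode A h u → A 10 f ≤ A 10 u
  zero : f = 0 → ∀ c, 1 ≤ c → c ≤ m → At U hw A v c →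
    ∀ u, 1 ≤ u → u ≤ N → At U hw A u c → A 10 u ≤ A 10 v → ¬ UniqNode A h u

/-- `[i, j]` is the minimal unique palindrome with the centre `c`. -/
def Res (m : ℕ) (ch ex P U : ℕ → ℕ) (c i j : ℕ) : Prop :=
  ∃ k x l, First m ch ex U c k ∧ IsTop m ch ex U c k x ∧ l = (if k = 0 then ex c else x + 1) ∧
    i = P (c - k + 1) + 1 - l ∧ j = P (c + k) + l

section
variable {Γ : Cx} {n : ℕ} {a U ch ex P : ℕ → ℕ} {b s N : ℕ} {hw : ℕ → List ℕ} {A : ℕ → ℕ → ℕ}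
  {io : ℕ → ℕ}

theorem NInv.gInv (H : Base Γ n a U ch ex P b s N hw A) {h : HS}
    (hi : NInv Γ U ch ex b s N hw A io 0 h) :
    GInv Γ U ch ex b s N hw A h :=
  ⟨hi.r0, hi.r4, hi.top, hi.grp, hi.pg, hi.card, fun f f1 f2 f3 f4 f5 _ f6 => hi.arr f f1 f2 f3 f4 f5 f6⟩

theorem GInv.congr {h h' : HS} (hi : GInv Γ U ch ex b s N hw A h) (h0 : h'.r 0 = h.r 0)
    (h2 : h'.r 2 = h.r 2) (h4 : h'.r 4 = h.r 4) (hA : ∀ f, f ≠ 16 → h'.A f = h.A f) :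
    GInv Γ U ch ex b s N hw A h' := by
  have old : ∀ v ≤ h.r 2, h'.A 8 v = h.A 8 v ∧ h'.A 9 v = h.A 9 v := by
    intro v _; rw [hA 8 (by omega), hA 9 (by omega)]; exact ⟨rfl, rfl⟩
  refine ⟨by rw [h0, hi.r0], by rw [h4, hi.r4],
    hi.top.congr (fun _ _ _ => Iff.rfl) h2 (fun f f1 f2 f3 => hA f (by omega)), ?_, ?_, ?_, ?_⟩
  · intro v v1 v2
    rw [hA 15 (by omega)]
    exact (hi.grp v v1 v2).mono h2.ge old
  · exact hi.pg.mono h2.ge old (fun c _ => by rw [hA 17 (by omega)])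
  · rw [h2]; exact hi.card
  · intro f f1 f2 f3 f4 f5 f6 f7
    rw [hA f f6]; exact hi.arr f f1 f2 f3 f4 f5 f6 f7

/-- After both loops the groups are complete: the maximal palindrome of a member either is that of
`o`, or it is longer and has an ancestor one level beyond `o`. -/
theorem Base.nset_iff (H : Base Γ n a U ch ex P b s N hw A) {o κ c : ℕ} (ho : o ≤ N) :
    NSet Γ.m U ch hw A s N 0 o κ c ↔ InGrp Γ.m U ch hw A s o κ c := by
  refine ⟨fun hh => hh.2.1, fun hh => ⟨ho, hh, ?_⟩⟩
  rcases (H.valid_iff hh.one_le hh.le).1 hh.valid with hlt | ⟨heq, -⟩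
  · right
    obtain ⟨v, v1, v2, v3⟩ := H.exists_at hh.one_le hh.le (A 10 (A 4 c) - (A 10 o + 1)) (by omega)
    refine ⟨v, ?_, v1, v2, by omega⟩
    by_contra h0
    rw [show v = 0 by omega, H.eer.len_zero] at v3
    omega
  · exact Or.inl heq

/-- If `c` is the only centre with the largest value, the second largest is the maximum over the
others. If another centre reaches the value of `c`, two centres have at least this value, and so
does the second largest. One number per group thus decides the question for all its centres. -/
theorem GInv.uniq_iff (H : Base Γ n a U ch ex P b s N hw A) {h : HS}
    (hi : GInv Γ U ch ex b s N hw A h) {o c g : ℕ} (ho : o ≤ N) (h1 : 1 ≤ c) (h2 : c ≤ Γ.m)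
    (hat : At U hw A o c) (hv : Valid Γ.m ch U c (A 10 o))
    (hg : IsGrp N h o (s + 2 + ch (c + A 10 o)) g) :
    (Uniq Γ.m ch ex U c (A 10 o) ↔ h.A 14 g < val ex c (A 10 o)) ∧
      (Uniq Γ.m ch ex U c (A 10 o) → IsTop Γ.m ch ex U c (A 10 o) (h.A 14 g)) := by
  obtain ⟨-, t2⟩ := hi.top.top g hg.lt hg.le
  rw [hg.par, hg.key] at t2
  have hS : ∀ c', NSet Γ.m U ch hw A s N 0 o (s + 2 + ch (c + A 10 o)) c' ↔
      Grp Γ.m ch U c c' (A 10 o) := fun c' => by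
    rw [H.nset_iff ho, H.grp_iff ho h1 h2 hat hv]
  simp only [hS] at t2
  have hself : Grp Γ.m ch U c c (A 10 o) := ⟨hv, hv, fun _ _ => rfl, rfl⟩
  have hpos := (Adm.top H.rd hv).one_le
  have other : ∀ x, x ≤ h.A 14 g → x ≠ 0 → ∃ c', c' ≠ c ∧ Grp Γ.m ch U c c' (A 10 o) ∧
      x ≤ val ex c' (A 10 o) := by
    intro x hx hx0
    rcases (t2 x).1 hx with h0 | ⟨c1, c2, d1, d2, d3, d4, d5⟩
    · exact absurd h0 hx0
    · by_cases hc : c1 = c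
      · exact ⟨c2, by rw [← hc]; exact d1.symm, d3, d5⟩
      · exact ⟨c1, hc, d2, d4⟩
  constructor
  · constructor
    · rintro ⟨-, hu⟩
      by_contra hcon
      obtain ⟨c', e1, e2, e3⟩ := other _ (not_lt.1 hcon) (by omega)
      have := hu c' e1 e2
      omega
    · intro hlt
      refine ⟨hv, fun c' e1 e2 => ?_⟩
      by_contra hcon
      have := (t2 (val ex c (A 10 o))).2 (Or.inr ⟨c, c', e1.symm, hself, e2, le_rfl, by omega⟩)
      omega
  · rintro ⟨-, hu⟩
    have hle : ∀ c', c' ≠ c → Grp Γ.m ch U c c' (A 10 o) → val ex c' (A 10 o) ≤ h.A 14 g := by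
      intro c' e1 e2
      exact (t2 _).2 (Or.inr ⟨c, c', e1.symm, hself, e2, (hu c' e1 e2).le, le_rfl⟩)
    refine ⟨hle, ?_⟩
    by_cases h0 : h.A 14 g = 0
    · exact Or.inl h0
    · obtain ⟨c', e1, e2, e3⟩ := other _ le_rfl h0
      exact Or.inr ⟨c', e1, e2, le_antisymm (hle c' e1 e2) e3⟩

/-- A node of half-length `k + 1` stands for level `k`: its outermost letter is the end run, taken
completely on both sides. The answer is therefore the same for all centres at which it occurs. -/
theorem GInv.uniqNode_iff (H : Base Γ n a U ch ex P b s N hw A) {h : HS}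
    (hi : GInv Γ U ch ex b s N hw A h) {v c : ℕ} (hv1 : 1 ≤ v) (hv2 : v ≤ N) (h1 : 1 ≤ c)
    (h2 : c ≤ Γ.m) (hat : At U hw A v c) :
    (UniqNode A h v ↔ Uniq Γ.m ch ex U c (A 10 v - 1)) ∧
      (UniqNode A h v → IsTop Γ.m ch ex U c (A 10 v - 1) (h.A 14 (h.A 15 v))) := by
  obtain ⟨p1, p2⟩ := H.par_le hv1 hv2
  obtain ⟨g1, g2⟩ := H.ingrp_node hv1 hv2 h1 h2 hat
  have hg := hi.grp v hv1 hv2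
  rw [g1.key] at hg
  obtain ⟨u1, u2⟩ := hi.uniq_iff H (show A 9 v ≤ N by omega) h1 h2 g1.at_node g1.valid hg
  rw [show A 10 v - 1 = A 10 (A 9 v) by omega, UniqNode, ← g2]
  exact ⟨u1.symm, fun hh => u2 (u1.2 hh)⟩

/-- The result for a centre whose node has a first node that extends uniquely. -/
theorem FirstNode.first (H : Base Γ n a U ch ex P b s N hw A) {h : HS}
    (hi : GInv Γ U ch ex b s N hw A h) {c f : ℕ} (h1 : 1 ≤ c) (h2 : c ≤ Γ.m)
    (hf : FirstNode Γ.m U hw N A h (A 4 c) f) :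
    (f ≠ 0 → First Γ.m ch ex U c (A 10 f - 1) ∧
      IsTop Γ.m ch ex U c (A 10 f - 1) (h.A 14 (h.A 15 f))) ∧
      (f = 0 → ∀ k < A 10 (A 4 c), ¬ Uniq Γ.m ch ex U c k) := by
  have hat := H.at_nod h1 h2
  have node : ∀ k < A 10 (A 4 c), Uniq Γ.m ch ex U c k → ∃ u, 1 ≤ u ∧ u ≤ N ∧ At U hw A u c ∧
      A 10 u = k + 1 ∧ UniqNode A h u := by
    intro k hk hu
    obtain ⟨u, u1, u2, u3⟩ := H.exists_at h1 h2 (A 10 (A 4 c) - (k + 1)) (by omega)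
    have hpos : 1 ≤ u := by
      by_contra h0
      rw [show u = 0 by omega, H.eer.len_zero] at u3
      omega
    refine ⟨u, hpos, u1, u2, by omega, ((hi.uniqNode_iff H hpos u1 h1 h2 u2).1).2 ?_⟩
    rwa [show A 10 u - 1 = k by omega]
  constructor
  · intro h0
    obtain ⟨q1, -, q2⟩ := hf.pos h0
    obtain ⟨q3, q4⟩ := q2 c h1 h2 hat
    obtain ⟨r1, r2⟩ := hi.uniqNode_iff H (by omega) hf.le h1 h2 q3
    refine ⟨⟨r1.1 q1, fun k hk hu => ?_⟩, r2 q1⟩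
    have := q3.1
    obtain ⟨u, u1, u2, u3, u4, u5⟩ := node k (by omega) hu
    have := q4 u u1 u2 u3 (by omega) u5
    omega
  · intro h0 k hk hu
    obtain ⟨u, u1, u2, u3, u4, u5⟩ := node k hk hu
    exact hf.zero h0 c h1 h2 hat u u1 u2 u3 (by omega) u5

theorem FirstNode.congr {h h' : HS} {v f : ℕ} (hf : FirstNode Γ.m U hw N A h v f)
    (h14 : h'.A 14 = h.A 14) (h15 : h'.A 15 = h.A 15) : FirstNode Γ.m U hw N A h' v f := by
  have : UniqNode A h' = UniqNode A h := by funext v; simp only [UniqNode, h14, h15]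
  obtain ⟨a, b, c⟩ := hf
  rw [← this] at b c
  exact ⟨a, b, c⟩

/-- The invariant of the loop that computes the first nodes. -/
structure FInv (Γ : Cx) (U ch ex : ℕ → ℕ) (b s N : ℕ) (hw : ℕ → List ℕ) (A : ℕ → ℕ → ℕ)
    (v0 : ℕ) (h : HS) : Prop where
  one_le : 1 ≤ v0
  le : v0 ≤ N + 1
  r5 : h.r 5 = v0
  g : GInv Γ U ch ex b s N hw A h
  first : ∀ v < v0, FirstNode Γ.m U hw N A h v (h.A 16 v)
  zero : ∀ v, v0 ≤ v → h.A 16 v = 0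

/-- Increasing numbers treat parents before children, so a node inherits the answer of its parent
and tests itself only if there is none. -/
theorem firstStep_wp (H : Base Γ n a U ch ex P b s N hw A) {v0 : ℕ} {h : HS}
    (hi : FInv Γ U ch ex b s N hw A v0 h) (hlt : v0 < N + 1) :
    wp Γ firstStep h (fun h' t => t ≤ 6 ∧ FInv Γ U ch ex b s N hw A (v0 + 1) h') := by
  have hB := H.ectx.B
  have hcap := H.ectx.cap
  have hN := H.N_le
  have h1 := hi.one_le
  obtain ⟨p1, p2⟩ := H.par_le h1 (show v0 ≤ N by omega)
  obtain ⟨o8, o9⟩ := hi.g.top.old v0 (by omega)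
  have e24 := hi.g.arr 24 (by omega) (by omega) (by omega) (by omega) (by omega) (by omega) (by omega)
  have hg := hi.g.grp v0 h1 (by omega)
  have hg1 := hg.lt
  have hg2 := hg.le
  have hcard := hi.g.card
  have hs := H.s_le
  have hkey := H.key_le h1 (show v0 ≤ N by omega)
  have hpf := hi.first (A 9 v0) p1
  have fin : ∀ f, FirstNode Γ.m U hw N A h v0 f →
      FInv Γ U ch ex b s N hw A (v0 + 1) (((h.set 6 (A 9 v0)).st 16 v0 f).set 5 (v0 + 1)) := by
    intro f hf
    refine ⟨by omega, by omega, by simp, ?_, ?_, ?_⟩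
    · refine hi.g.congr (by simp) (by simp) (by simp) ?_
      intro f' hf'; funext j; simp [hf']
    · intro v hv
      by_cases hvv : v = v0
      · subst hvv
        have : FirstNode Γ.m U hw N A (((h.set 6 (A 9 v)).st 16 v f).set 5 (v + 1)) v f :=
          hf.congr (by funext j; simp) (by funext j; simp)
        simpa using this
      · have := (hi.first v (by omega)).congr
          (h' := ((h.set 6 (A 9 v0)).st 16 v0 f).set 5 (v0 + 1))
          (by funext j; simp) (by funext j; simp)
        simpa [hvv] using this
    · intro v hv
      have : v ≠ v0 := by omega
      simpa [this] using hi.zero v (by omega)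
  -- At a fixed centre a node that is no longer than `v0` is `v0` itself or no longer than its
  -- parent.
  have split : ∀ u c, u ≤ N → At U hw A u c → At U hw A v0 c → A 10 u ≤ A 10 v0 →
      u = v0 ∨ A 10 u ≤ A 10 (A 9 v0) := by
    intro u c u1 u2 u3 u4
    rcases Nat.eq_or_lt_of_le u4 with heq | hlt'
    · exact Or.inl (H.at_eq u1 (by omega) u2 u3 heq)
    · right; omega
  simp only [firstStep, vc, ↓reduceIte, Nat.reduceEqDiff, Nat.reduceLT, hi.r5, o8, o9, e24]
  refine ⟨by omega, by omega, fun hv => ⟨by omega, by omega, by omega, by omega, fin _ ?_⟩,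
    fun hv => ⟨⟨⟨by omega, by omega⟩, by omega, by omega⟩, fun hq => ⟨by omega, by omega, by omega,
      fin _ ?_⟩, fun hq => ⟨by omega, by omega, ?_⟩⟩⟩
  · obtain ⟨q1, q0, q2⟩ := hpf.pos hv
    refine ⟨hpf.le, fun _ => ⟨q1, by omega, fun c c1 c2 hat => ?_⟩, fun h0 => absurd h0 hv⟩
    obtain ⟨r1, r2⟩ := q2 c c1 c2 (H.at_par h1 (by omega) hat).1
    refine ⟨r1, fun u u1 u2 u3 u4 u5 => ?_⟩
    rcases split u c u2 u3 hat u4 with rfl | hle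
    · omega
    · exact r2 u u1 u2 u3 hle u5
  · have hlt' : h.A 14 (h.A 15 v0) < A 24 (A 8 v0) := by
      by_contra hcon; rw [if_neg hcon] at hq; exact hq rfl
    refine ⟨by omega, fun _ => ⟨hlt', le_rfl, fun c c1 c2 hat => ⟨hat, fun u u1 u2 u3 u4 u5 => ?_⟩⟩,
      fun h0 => by omega⟩
    rcases split u c u2 u3 hat u4 with rfl | hle
    · exact le_rfl
    · exact absurd u5 (hpf.zero hv c c1 c2 (H.at_par h1 (by omega) hat).1 u u1 u2 u3 hle)
  · have hlt' : ¬ h.A 14 (h.A 15 v0) < A 24 (A 8 v0) := by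
      intro hcon; rw [if_pos hcon] at hq; exact one_ne_zero hq
    have hz := hi.zero v0 le_rfl
    have hF : FirstNode Γ.m U hw N A h v0 0 := by
      refine ⟨by omega, fun h0 => absurd rfl h0, fun _ c c1 c2 hat u u1 u2 u3 u4 u5 => ?_⟩
      rcases split u c u2 u3 hat u4 with rfl | hle
      · exact hlt' u5
      · exact hpf.zero hv c c1 c2 (H.at_par h1 (by omega) hat).1 u u1 u2 u3 hle u5
    have := fin 0 hF
    -- Nothing is stored in this case; the cell still holds `0`, which means that there is no unique
    -- ancestor.
    have e : ((h.set 6 (A 9 v0)).st 16 v0 0).set 5 (v0 + 1) = (h.set 6 (A 9 v0)).set 5 (v0 + 1) := by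
      have : ((h.set 6 (A 9 v0)).st 16 v0 0) = h.set 6 (A 9 v0) := by
        simp only [HS.st, HS.set]
        congr 1
        funext f' j'
        split_ifs with hh
        · rw [hh.1, hh.2, hz]
        · rfl
      rw [this]
    rwa [e] at this

theorem firsts_wp (H : Base Γ n a U ch ex P b s N hw A) {h : HS}
    (hi : GInv Γ U ch ex b s N hw A h) (hz : ∀ v, h.A 16 v = 0) (hio : h.io = io) :
    wp Γ firsts h (fun h' t => t ≤ 7 * N + 2 ∧ FInv Γ U ch ex b s N hw A (N + 1) h') := by
  have hB := H.ectx.B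
  have hcap := H.ectx.cap
  have hN := H.N_le
  simp only [firsts, vc, ↓reduceIte, Nat.reduceEqDiff, Nat.reduceLT]
  refine wp_whl (fun h1 k => ∃ v0, FInv Γ U ch ex b s N hw A v0 h1 ∧
    k = (N + 1 - v0) * 7) (n := N * 7) ?_ ⟨1, ⟨le_rfl, by omega, by simp, ?_, ?_, ?_⟩, by omega⟩ ?_
  · rintro h1 k ⟨v0, hi, rfl⟩
    have hle := hi.le
    simp only [vc, ↓reduceIte, Nat.reduceEqDiff, Nat.reduceLT, hi.r5, hi.g.r4]
    refine ⟨by omega, fun hv => ?_⟩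
    have hlt : v0 < N + 1 := by
      by_contra hcon; rw [if_neg hcon] at hv; exact hv rfl
    refine wp_mono (firstStep_wp H hi hlt) ?_
    rintro h' t ⟨ht, hi'⟩
    exact ⟨_, ⟨v0 + 1, hi', rfl⟩, by omega⟩
  · exact hi.congr (by simp) (by simp) (by simp) (fun _ _ => rfl)
  · intro v hv
    obtain rfl : v = 0 := by omega
    simp only [HS.set_A, hz]
    refine ⟨by omega, fun h0 => absurd rfl h0, fun _ c c1 c2 hat u u1 u2 u3 u4 u5 => ?_⟩
    rw [H.eer.len_zero] at u4
    have := H.eer.len_pos u1 u2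
    omega
  · intro v _; exact hz v
  · rintro h1 t k ⟨v0, hi, rfl⟩ hv ht
    have hle := hi.le
    simp only [vc, ↓reduceIte, Nat.reduceEqDiff, Nat.reduceLT, hi.r5, hi.g.r4] at hv
    have : ¬ v0 < N + 1 := by
      intro hcon; rw [if_pos hcon] at hv; exact one_ne_zero hv
    obtain rfl : v0 = N + 1 := by omega
    exact ⟨by omega, hi⟩

/-- Levels below the half-length of the maximal palindrome correspond to its ancestors in the tree
(the node itself included), and their first unique one is known. If there is none, only the level of
the maximal palindrome remains; its group is in array `17`, and being below the minimum of two
exponents is tested against each of them. -/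
theorem select_wp (H : Base Γ n a U ch ex P b s N hw A) {h : HS}
    (hi : GInv Γ U ch ex b s N hw A h) (hf : ∀ v ≤ N, FirstNode Γ.m U hw N A h v (h.A 16 v))
    {c : ℕ} (h1 : 1 ≤ c) (h2 : c ≤ Γ.m) (h5 : h.r 5 = c) :
    wp Γ select h (fun h' t => t ≤ 9 ∧ h'.A = h.A ∧ h'.io = h.io ∧
      (∀ y, y < 6 ∨ 9 < y → h'.r y = h.r y) ∧
      ((h'.r 9 = 0 ∧ ∀ k, ¬ First Γ.m ch ex U c k) ∨
        (h'.r 9 ≠ 0 ∧ First Γ.m ch ex U c (h'.r 8) ∧ ∃ x, IsTop Γ.m ch ex U c (h'.r 8) x ∧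
          h'.r 9 = if h'.r 8 = 0 then ex c else x + 1))) := by
  have hB := H.ectx.B
  have hcap := H.ectx.cap
  have hN := H.N_le
  obtain ⟨k1, k2, k3, k4, k5, k6, k7⟩ := H.arm h1 h2
  have e2 := hi.arr 2 (by omega) (by omega) (by omega) (by omega) (by omega) (by omega) (by omega)
  have e4 := hi.arr 4 (by omega) (by omega) (by omega) (by omega) (by omega) (by omega) (by omega)
  have e10 := hi.arr 10 (by omega) (by omega) (by omega) (by omega) (by omega) (by omega) (by omega)
  have hF := hf (A 4 c) k2
  obtain ⟨f1, f2⟩ := hF.first H hi h1 h2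
  have hfle := hF.le
  have hcard := hi.card
  have hx := H.a2 c h1 h2
  have hexc := H.rd.ex_pos c h1 h2
  have hex : ∀ c, 1 ≤ c → c ≤ Γ.m → ex c ≤ n := by
    intro c c1 c2
    have := H.rd.P_succ c c1 c2
    have := H.rd.mono (c := c + 1) (by omega) (Γ.m + 1) (by omega) le_rfl
    have := H.rd.P_last
    omega
  have hnB := H.n_lt
  set K := A 10 (A 4 c) with hK
  set f := h.A 16 (A 4 c) with hfdef
  by_cases h0 : f = 0
  · have hno := f2 h0
    have nofirst : ¬ Uniq Γ.m ch ex U c K → ∀ k, ¬ First Γ.m ch ex U c k := by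
      intro hu k hk
      rcases (H.valid_iff h1 h2).1 hk.1.1 with hlt | ⟨rfl, -⟩
      · exact hno k hlt hk.1
      · exact hu hk.1
    have hpg := hi.pg c h1 (by omega)
    by_cases he : ch (c - K) = ch (c + K)
    · have hg := hpg.1 he
      have hg1 := hg.lt
      have hg2 := hg.le
      have hV := (H.valid_iff h1 h2 (k := K)).2 (Or.inr ⟨rfl, he⟩)
      have l1 := hV.lt
      have l2 := hV.le
      have hx1 := H.a2 (c - K) (by omega) (by omega)
      have hx2 := H.a2 (c + K) (by omega) (by omega)
      have hn1 := hex (c - K) (by omega) (by omega)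
      obtain ⟨u1, u2⟩ := hi.uniq_iff H k2 h1 h2 (H.at_nod h1 h2) hV hg
      rw [← hK, val, ← hx1, ← hx2] at u1
      have hne : ¬ h.A 17 c = 0 := by omega
      by_cases b1 : h.A 14 (h.A 17 c) < A 2 (c - K)
      · by_cases b2 : h.A 14 (h.A 17 c) < A 2 (c + K)
        · have hu := u1.2 (lt_min b1 b2)
          simp only [select, vc, ↓reduceIte, Nat.reduceEqDiff, Nat.reduceLT, h5, e2, e4, e10, ← hfdef,
            ← hK, h0, hne, b1, b2, one_ne_zero]
          refine ⟨by omega, by omega, by omega, by omega, ⟨⟨by omega, by omega⟩, ⟨by omega, by omega⟩, by omega⟩,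
            ⟨⟨by omega, by omega⟩, by omega, by omega⟩, ⟨⟨by omega, by omega⟩, by omega⟩, by omega,
            fun y hy => by split_ifs <;> omega, ?_⟩
          refine ⟨⟨hu, fun k hk => hno k hk⟩, _, u2 hu, ?_⟩
          rw [if_neg (by omega)]
        · have hu : ¬ Uniq Γ.m ch ex U c K := fun hu => b2 (lt_min_iff.1 (u1.1 hu)).2
          simp only [select, vc, ↓reduceIte, Nat.reduceEqDiff, Nat.reduceLT, h5, e2, e4, e10, ← hfdef,
            ← hK, h0, hne, b1, b2, one_ne_zero]
          exact ⟨by omega, by omega, by omega, by omega, ⟨⟨by omega, by omega⟩, ⟨by omega, by omega⟩, by omega⟩,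
            ⟨⟨by omega, by omega⟩, by omega, by omega⟩, by omega, fun y hy => by split_ifs <;> omega, nofirst hu⟩
      · have hu : ¬ Uniq Γ.m ch ex U c K := fun hu => b1 (lt_min_iff.1 (u1.1 hu)).1
        simp only [select, vc, ↓reduceIte, Nat.reduceEqDiff, Nat.reduceLT, h5, e2, e4, e10, ← hfdef,
          ← hK, h0, hne, b1, one_ne_zero]
        exact ⟨by omega, by omega, by omega, by omega, ⟨⟨by omega, by omega⟩, ⟨by omega, by omega⟩, by omega⟩, by omega,
          fun y hy => by split_ifs <;> omega, nofirst hu⟩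
    · have hu : ¬ Uniq Γ.m ch ex U c K := fun hu => he hu.1.ends
      simp only [select, vc, ↓reduceIte, Nat.reduceEqDiff, Nat.reduceLT, h5, e2, e4, e10, ← hfdef,
        ← hK, h0, hpg.2 he]
      exact ⟨by omega, by omega, by omega, by omega, by omega, fun y hy => by split_ifs <;> omega, nofirst hu⟩
  · obtain ⟨f3, f4⟩ := f1 h0
    have hpos := H.eer.len_pos (v := f) (by omega) hfle
    have hfK := (hF.pos h0).2.1
    have hlt := f4.lt H.rd f3.1
    have hv2 := (val_le (ex := ex) (c := c) (k := A 10 f - 1)).2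
    have hv3 := f3.1.1.le
    have hn1 := hex (c + (A 10 f - 1)) (by omega) (by omega)
    have hg := hi.grp f (by omega) hfle
    have hg1 := hg.lt
    have hg2 := hg.le
    by_cases hk0 : A 10 f - 1 = 0
    · simp only [select, vc, ↓reduceIte, Nat.reduceEqDiff, Nat.reduceLT, h5, e2, e4, e10, ← hfdef,
        ← hK, h0, hk0]
      rw [hk0] at f3 f4
      exact ⟨by omega, by omega, ⟨by omega, by omega, by omega⟩, by omega, by omega,
        fun y hy => by split_ifs <;> omega, Or.inr ⟨by omega, f3, _, f4, hx⟩⟩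
    · simp only [select, vc, ↓reduceIte, Nat.reduceEqDiff, Nat.reduceLT, h5, e2, e4, e10, ← hfdef,
        ← hK, h0, hk0]
      exact ⟨by omega, by omega, ⟨by omega, by omega, by omega⟩, ⟨⟨by omega, by omega⟩, by omega⟩,
        by omega, fun y hy => by split_ifs <;> omega, f3, _, f4, rfl⟩

/-- The result is the only one for its centre. -/
theorem Res.bounds (H : Base Γ n a U ch ex P b s N hw A) {c k x l : ℕ}
    (hf : First Γ.m ch ex U c k) (ht : IsTop Γ.m ch ex U c k x)
    (hl : l = if k = 0 then ex c else x + 1) :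
    1 ≤ c ∧ k < c ∧ c + k ≤ Γ.m ∧ l ≤ P (c - k + 1) ∧ P (c - k + 1) ≤ n ∧ P (c + k) + l ≤ n := by
  have a1 := hf.1.1.lt
  have a2 := hf.1.1.le
  have hx := ht.lt H.rd hf.1
  have hv := val_le (ex := ex) (c := c) (k := k)
  have e1 := H.rd.P_succ (c - k) (by omega) (by omega)
  have e2 := H.rd.P_succ (c + k) (by omega) (by omega)
  have e3 := H.rd.mono (c := c + k + 1) (by omega) (Γ.m + 1) (by omega) le_rfl
  have e4 := H.rd.mono (c := c - k + 1) (by omega) (Γ.m + 1) (by omega) le_rfl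
  have := H.rd.P_last
  have hlv : l ≤ val ex c k := by
    split_ifs at hl with h0
    · subst h0; simp [val, hl]
    · omega
  refine ⟨by omega, a1, a2, by omega, by omega, by omega⟩

/-- The sum of the end points grows with the centre by `Valid.add_lt`, and unique palindromes are
ordered by this sum by `MUPS.lt_of_add_lt`. -/
theorem Res.lt (H : Base Γ n a U ch ex P b s N hw A) {c c' i j i' j' : ℕ}
    (h : Res Γ.m ch ex P U c i j) (h' : Res Γ.m ch ex P U c' i' j') (hc : c < c') : i < i' := by
  obtain ⟨k, x, l, h1, h2, h3, rfl, rfl⟩ := h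
  obtain ⟨k', x', l', h1', h2', h3', rfl, rfl⟩ := h'
  have b := Res.bounds H h1 h2 h3
  have b' := Res.bounds H h1' h2' h3'
  refine (h1.mups H.rd h2 h3 rfl rfl).lt_of_add_lt (h1'.mups H.rd h2' h3' rfl rfl) ?_
  exact h1.1.1.add_lt H.rd h1'.1.1 hc (by omega) (by omega)

/-- The invariant of the output loop. -/
structure OInv (Γ : Cx) (U ch ex P : ℕ → ℕ) (b s N : ℕ) (hw : ℕ → List ℕ) (A : ℕ → ℕ → ℕ)
    (c0 : ℕ) (L : List (ℕ × ℕ)) (h : HS) : Prop where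
  one_le : 1 ≤ c0
  le : c0 ≤ Γ.m + 1
  r5 : h.r 5 = c0
  r10 : h.r 10 = L.length
  len : L.length + 1 ≤ c0
  g : GInv Γ U ch ex b s N hw A h
  first : ∀ v ≤ N, FirstNode Γ.m U hw N A h v (h.A 16 v)
  out : ∀ t (ht : t < L.length), h.io (2 * t) = L[t].1 ∧ h.io (2 * t + 1) = L[t].2
  sorted : L.Pairwise (fun p q => p.1 < q.1)
  sound : ∀ p ∈ L, ∃ c < c0, Res Γ.m ch ex P U c p.1 p.2
  compl : ∀ c < c0, (∃ p ∈ L, Res Γ.m ch ex P U c p.1 p.2) ∨ ∀ k, ¬ First Γ.m ch ex U c k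

/-- The results overwrite the input, which has been copied to the arrays; each centre contributes at
most one pair, so the `2 * m` cells suffice. -/
theorem output_wp (H : Base Γ n a U ch ex P b s N hw A) {c0 : ℕ} {L : List (ℕ × ℕ)} {h : HS}
    (hi : OInv Γ U ch ex P b s N hw A c0 L h) (hlt : c0 < Γ.m + 1) :
    wp Γ (select ;; emit) h (fun h' t => t ≤ 14 ∧
      ∃ L', OInv Γ U ch ex P b s N hw A (c0 + 1) L' h') := by
  have hB := H.ectx.B
  have hcap := H.ectx.cap
  have hnB := H.n_lt
  have hc1 := hi.one_le
  rw [wp_seq]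
  refine wp_mono (select_wp H hi.g hi.first hc1 (by omega) hi.r5) ?_
  rintro h1 t1 ⟨ht1, hA, hio, hr, hres⟩
  have e3 := hi.g.arr 3 (by omega) (by omega) (by omega) (by omega) (by omega) (by omega) (by omega)
  have r5 : h1.r 5 = c0 := by rw [hr 5 (by omega), hi.r5]
  have r10 : h1.r 10 = L.length := by rw [hr 10 (by omega), hi.r10]
  have hlen := hi.len
  have g' : ∀ h2 : HS, h2.A = h.A → (∀ y < 5, h2.r y = h.r y) → GInv Γ U ch ex b s N hw A h2 ∧
      ∀ v ≤ N, FirstNode Γ.m U hw N A h2 v (h2.A 16 v) := by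
    intro h2 e er
    refine ⟨hi.g.congr (er 0 (by omega)) (er 2 (by omega)) (er 4 (by omega))
      (fun f _ => by rw [e]), fun v hv => ?_⟩
    rw [e]
    exact (hi.first v hv).congr (by rw [e]) (by rw [e])
  rcases hres with ⟨h9, hno⟩ | ⟨h9, hf, x, hx, hl⟩
  · simp only [emit, vc, ↓reduceIte, Nat.reduceEqDiff, Nat.reduceLT, h9, r5]
    obtain ⟨g1, g2⟩ := g' (h1.set 5 (c0 + 1)) hA (fun y hy => by
      rw [HS.set_r, if_neg (by omega), hr y (by omega)])
    refine ⟨by omega, by omega, L, ⟨by omega, by omega, by simp, by simpa using r10, by omega, g1, g2,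
      ?_, hi.sorted, ?_, ?_⟩⟩
    · intro t ht
      have := hi.out t ht
      rw [← hio] at this
      exact this
    · intro p hp
      obtain ⟨c, c1, c2⟩ := hi.sound p hp
      exact ⟨c, by omega, c2⟩
    · intro c hc
      rcases Nat.lt_or_ge c c0 with hcc | hcc
      · exact hi.compl c hcc
      · obtain rfl : c = c0 := by omega
        exact Or.inr hno
  · set k := h1.r 8 with hk
    set l := h1.r 9 with hl9
    obtain ⟨b1, b2, b3, b4, b5, b6⟩ := Res.bounds H hf hx hl
    have p1 := H.a3 (c0 - k + 1) (by omega) (by omega)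
    have p2 := H.a3 (c0 + k) (by omega) (by omega)
    have hR : Res Γ.m ch ex P U c0 (P (c0 - k + 1) + 1 - l) (P (c0 + k) + l) :=
      ⟨k, x, l, hf, hx, hl, rfl, rfl⟩
    simp only [emit, vc, ↓reduceIte, Nat.reduceEqDiff, Nat.reduceLT, ← hk, ← hl9, r5, hA, e3, p1, p2,
      r10, h9]
    refine ⟨by omega, ⟨⟨⟨⟨⟨by omega, by omega⟩, by omega⟩, by omega⟩, by omega⟩, by omega, by omega⟩,
      by omega, ⟨by omega, by omega⟩, ⟨⟨by omega, by omega⟩, by omega⟩, by omega, by omega, by omega,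
      by omega,
      L ++ [(P (c0 - k + 1) + 1 - l, P (c0 + k) + l)], ?_⟩
    obtain ⟨g1, g2⟩ := g' ((((h1.stio (2 * L.length) (P (c0 - k + 1) + 1 - l)).stio
      (2 * L.length + 1) (P (c0 + k) + l)).set 10 (L.length + 1)).set 5 (c0 + 1)) hA (fun y hy => by
        rw [HS.set_r, if_neg (by omega), HS.set_r, if_neg (by omega)]
        exact hr y (by omega))
    refine ⟨by omega, by omega, by simp, by simp, ?_, g1, g2, ?_, ?_, ?_, ?_⟩
    · rw [List.length_append, List.length_singleton]; omega
    · intro t ht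
      rw [List.length_append, List.length_singleton] at ht
      simp only [HS.set_io, HS.stio_io]
      rcases Nat.lt_or_ge t L.length with hlt' | hge
      · rw [if_neg (by omega), if_neg (by omega), if_neg (by omega), if_neg (by omega),
          List.getElem_append_left hlt', hio]
        exact hi.out t hlt'
      · obtain rfl : t = L.length := by omega
        rw [if_neg (by omega), if_pos rfl, if_pos rfl, List.getElem_concat_length rfl]
        exact ⟨rfl, rfl⟩
    · rw [List.pairwise_append]
      refine ⟨hi.sorted, List.pairwise_singleton _ _, fun p hp q hq => ?_⟩
      obtain rfl := List.mem_singleton.1 hq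
      obtain ⟨c, c1, c2⟩ := hi.sound p hp
      exact c2.lt H hR c1
    · intro p hp
      rcases List.mem_append.1 hp with hp | hp
      · obtain ⟨c, c1, c2⟩ := hi.sound p hp
        exact ⟨c, by omega, c2⟩
      · obtain rfl := List.mem_singleton.1 hp
        exact ⟨c0, by omega, hR⟩
    · intro c hc
      rcases Nat.lt_or_ge c c0 with hcc | hcc
      · rcases hi.compl c hcc with ⟨p, p1, p2⟩ | hno
        · exact Or.inl ⟨p, List.mem_append_left _ p1, p2⟩
        · exact Or.inr hno
      · obtain rfl : c = c0 := by omega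
        exact Or.inl ⟨_, List.mem_append_right _ (List.mem_singleton.2 rfl), hR⟩

theorem outputs_wp (H : Base Γ n a U ch ex P b s N hw A) {h : HS}
    (hi : FInv Γ U ch ex b s N hw A (N + 1) h) :
    wp Γ outputs h (fun h' t => t ≤ 15 * Γ.m + 3 ∧
      ∃ L, OInv Γ U ch ex P b s N hw A (Γ.m + 1) L h') := by
  have hB := H.ectx.B
  have hcap := H.ectx.cap
  simp only [outputs, vc, ↓reduceIte, Nat.reduceEqDiff, Nat.reduceLT]
  refine wp_whl (fun h1 k => ∃ c0 L, OInv Γ U ch ex P b s N hw A c0 L h1 ∧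
    k = (Γ.m + 1 - c0) * 15) (n := Γ.m * 15) ?_ ⟨1, [], ⟨le_rfl, by omega, by simp, by simp, by simp,
      ?_, ?_, by simp, by simp, by simp, ?_⟩, by omega⟩ ?_
  · rintro h1 k ⟨c0, L, hi, rfl⟩
    have hle := hi.le
    simp only [vc, ↓reduceIte, Nat.reduceEqDiff, Nat.reduceLT, hi.r5, hi.g.r0]
    refine ⟨by omega, fun hv => ?_⟩
    have hlt : c0 < Γ.m + 1 := by
      by_contra hcon; rw [if_neg hcon] at hv; exact hv rfl
    have := output_wp H hi hlt
    simp only [wp_seq] at this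
    refine wp_mono this ?_
    rintro h' t hh
    refine wp_mono hh ?_
    rintro h'' t' ⟨ht, L', hi'⟩
    exact ⟨_, ⟨c0 + 1, L', hi', rfl⟩, by omega⟩
  · exact hi.g.congr (by simp) (by simp) (by simp) (fun _ _ => rfl)
  · intro v hv
    exact (hi.first v (by omega)).congr rfl rfl
  · intro c hc
    right
    intro k hk
    have := hk.1.1.lt
    omega
  · rintro h1 t k ⟨c0, L, hi, rfl⟩ hv ht
    have hle := hi.le
    simp only [vc, ↓reduceIte, Nat.reduceEqDiff, Nat.reduceLT, hi.r5, hi.g.r0] at hv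
    have : ¬ c0 < Γ.m + 1 := by
      intro hcon; rw [if_pos hcon] at hv; exact one_ne_zero hv
    obtain rfl : c0 = Γ.m + 1 := by omega
    exact ⟨by omega, L, hi⟩

/-- The output is the sorted list of the minimal unique palindromes. -/
theorem OInv.mem_iff (H : Base Γ n a U ch ex P b s N hw A) {L : List (ℕ × ℕ)} {h : HS}
    (hi : OInv Γ U ch ex P b s N hw A (Γ.m + 1) L h) (i j : ℕ) : (i, j) ∈ L ↔ MUPS n a i j := by
  constructor
  · intro hp
    obtain ⟨c, -, k, x, l, h1, h2, h3, h4, h5⟩ := hi.sound _ hp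
    exact h1.mups H.rd h2 h3 h4 h5
  · intro hM
    obtain ⟨c, k, hf, hk⟩ := hM.first H.rd
    have := hf.1.1.le
    rcases hi.compl c (by omega) with ⟨⟨i', j'⟩, hp, k', x, l, h1, h2, h3, h4, h5⟩ | hno
    · obtain rfl := h1.unique hf
      obtain ⟨q1, q2⟩ := hk x l h2 h3
      simp only at h4 h5
      rw [← q1] at h4
      rw [← q2] at h5
      rwa [← h4, ← h5]
    · exact absurd hf (hno k)
end
end RLEMups

/-! ### Merging sorted linked lists without duplicates -/


namespace RLEMups

/-- The linked list that starts at `a` has the nodes `l`; the end is marked by `0`. -/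
def Lst (nx : ℕ → ℕ) : ℕ → List ℕ → Prop
  | a, [] => a = 0
  | a, x :: l => a = x ∧ x ≠ 0 ∧ Lst nx (nx x) l

/-- The nodes that are reached from `p` are `l`, and the last one (or `p`) is `t`. -/
def Seg (nx : ℕ → ℕ) : ℕ → List ℕ → ℕ → Prop
  | p, [], t => p = t
  | p, x :: l, t => nx p = x ∧ Seg nx x l t

theorem Lst.congr {nx nx' : ℕ → ℕ} : ∀ {l : List ℕ} {a : ℕ}, Lst nx a l →
    (∀ x ∈ l, nx' x = nx x) → Lst nx' a l
  | [], _, h, _ => h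
  | x :: l, a, ⟨h1, h2, h3⟩, he => by
    refine ⟨h1, h2, ?_⟩
    rw [he x (by simp)]
    exact h3.congr fun y hy => he y (by simp [hy])

theorem Lst.ne_zero {nx : ℕ → ℕ} : ∀ {l : List ℕ} {a : ℕ}, Lst nx a l → ∀ x ∈ l, x ≠ 0
  | [], _, _ => by simp
  | x :: l, a, ⟨_, h2, h3⟩ => by
    intro y hy
    rcases List.mem_cons.1 hy with rfl | hy
    · exact h2
    · exact h3.ne_zero y hy

theorem Seg.mem {nx : ℕ → ℕ} : ∀ {l : List ℕ} {p t : ℕ}, Seg nx p l t → t ∈ p :: l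
  | [], p, t, h => by rw [Seg] at h; simp [h]
  | x :: l, p, t, ⟨_, h2⟩ => List.mem_cons_of_mem _ h2.mem

theorem Seg.snoc {nx nx' : ℕ → ℕ} {y : ℕ} : ∀ {l : List ℕ} {p t : ℕ}, Seg nx p l t →
    (p :: l).Nodup → (∀ x ∈ p :: l, x ≠ t → nx' x = nx x) → nx' t = y → Seg nx' p (l ++ [y]) y
  | [], p, t, h, _, _, hy => by rw [Seg] at h; subst h; exact ⟨hy, rfl⟩
  | x :: l, p, t, ⟨h1, h2⟩, hd, he, hy => by
    have hp : p ≠ t := by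
      rintro rfl
      exact (List.nodup_cons.1 hd).1 h2.mem
    refine ⟨by rw [he p (by simp) hp, h1], ?_⟩
    exact h2.snoc (List.nodup_cons.1 hd).2 (fun z hz => he z (List.mem_cons_of_mem _ hz)) hy

theorem Seg.close {nx : ℕ → ℕ} {r : List ℕ} : ∀ {l : List ℕ} {p t : ℕ}, Seg nx p l t →
    (∀ x ∈ l, x ≠ 0) → Lst nx (nx t) r → Lst nx (nx p) (l ++ r)
  | [], p, t, h, _, hr => by rw [Seg] at h; subst h; exact hr
  | x :: l, p, t, ⟨h1, h2⟩, h0, hr => by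
    refine ⟨h1, h0 x (by simp), ?_⟩
    exact h2.close (fun y hy => h0 y (List.mem_cons_of_mem _ hy)) hr

theorem Seg.congr {nx nx' : ℕ → ℕ} : ∀ {l : List ℕ} {p t : ℕ}, Seg nx p l t →
    (p :: l).Nodup → (∀ x ∈ p :: l, x ≠ t → nx' x = nx x) → Seg nx' p l t
  | [], _, _, h, _, _ => h
  | x :: l, p, t, ⟨h1, h2⟩, hd, he => by
    have hp : p ≠ t := by
      rintro rfl
      exact (List.nodup_cons.1 hd).1 h2.mem
    exact ⟨by rw [he p (by simp) hp, h1],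
      h2.congr (List.nodup_cons.1 hd).2 (fun z hz => he z (List.mem_cons_of_mem _ hz))⟩

/-- Sorted without repetitions. -/
def Srt (key : ℕ → ℕ ×ₗ ℕ) (l : List ℕ) : Prop := l.Pairwise (fun x y => key x < key y)

/-- The keys of runs. -/
def runKey (raw ex : ℕ → ℕ) (d : ℕ) : ℕ ×ₗ ℕ := toLex (raw d, ex d)

/-- Append the node in register `x` to the list with the last node in register `10`. -/
def takeNode (x : ℕ) : HP :=
  .sto 19 (R 10) (R x) ;; .asg 10 (R x) ;; .asg x (AR 19 (R x))

/-- Merge the lists that start in the registers `8` and `9`; the result starts at the successor of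
the node `0`. -/
def merge : HP :=
  .asg 10 0 ;;
  .whl ((HE.lt 0 (R 8)) * (HE.lt 0 (R 9)))
    (.ite ((AR 25 (R 8)).eq (AR 25 (R 9)))
      (.ite ((AR 2 (R 8)).eq (AR 2 (R 9))) (.asg 9 (AR 19 (R 9)))
        (.ite ((AR 2 (R 8)).lt (AR 2 (R 9))) (takeNode 8) (takeNode 9)))
      (.ite ((AR 25 (R 8)).lt (AR 25 (R 9))) (takeNode 8) (takeNode 9))) ;;
  .ite (R 8) (.sto 19 (R 10) (R 8)) (.sto 19 (R 10) (R 9))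

/-- The invariant of the merge loop. -/
structure MInv (key : ℕ → ℕ ×ₗ ℕ) (la0 lb0 ld la lb : List ℕ) (h0 h : HS) : Prop where
  seg : Seg (h.A 19) 0 ld (h.r 10)
  lst_a : Lst (h.A 19) (h.r 8) la
  lst_b : Lst (h.A 19) (h.r 9) lb
  -- Node `0` is a dummy head: the tail of the merged part is `0` at the beginning, and writing a
  -- successor to the tail must not damage the remaining lists.
  nodup : (0 :: ld ++ (la ++ lb)).Nodup
  srt_a : Srt key (ld ++ la)
  srt_b : Srt key (ld ++ lb)
  sub : ∀ x ∈ ld ++ (la ++ lb), x ∈ la0 ∨ x ∈ lb0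
  cover : ∀ x, x ∈ la0 ∨ x ∈ lb0 → ∃ y ∈ ld ++ (la ++ lb), key y = key x
  nx : ∀ x, x ≠ 0 → x ∉ la0 → x ∉ lb0 → h.A 19 x = h0.A 19 x
  arr : ∀ f, f ≠ 19 → h.A f = h0.A f
  reg : ∀ y, y < 8 ∨ 10 < y → h.r y = h0.r y
  io : h.io = h0.io

/-- The effect of `merge`. -/
structure MergePost (key : ℕ → ℕ ×ₗ ℕ) (la lb l : List ℕ) (h0 h : HS) : Prop where
  lst : Lst (h.A 19) (h.A 19 0) l
  srt : Srt key l
  sub : ∀ x ∈ l, x ∈ la ∨ x ∈ lb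
  cover : ∀ x, x ∈ la ∨ x ∈ lb → ∃ y ∈ l, key y = key x
  nx : ∀ x, x ≠ 0 → x ∉ la → x ∉ lb → h.A 19 x = h0.A 19 x
  arr : ∀ f, f ≠ 19 → h.A f = h0.A f
  reg : ∀ y, y < 8 ∨ 10 < y → h.r y = h0.r y
  io : h.io = h0.io

section
variable {key : ℕ → ℕ ×ₗ ℕ} {la0 lb0 ld la lb : List ℕ} {h0 h h' : HS} {a b : ℕ}

theorem MInv.tail_le (hi : MInv key la0 lb0 ld la lb h0 h) {N : ℕ}
    (hN : ∀ x, x ∈ la0 ∨ x ∈ lb0 → x ≤ N) : h.r 10 ≤ N ∧ h.r 8 ≤ N ∧ h.r 9 ≤ N := by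
  have hh : ∀ x ∈ ld ++ (la ++ lb), x ≤ N := fun x hx => hN x (hi.sub x hx)
  have lst : ∀ l x, Lst (h.A 19) x l → (∀ y ∈ l, y ≤ N) → x ≤ N := by
    intro l x hl hy
    cases l with
    | nil => rw [Lst] at hl; omega
    | cons y l => rw [hl.1]; exact hy y (by simp)
  refine ⟨?_, lst la _ hi.lst_a fun y hy => hh y (by simp [hy]),
    lst lb _ hi.lst_b fun y hy => hh y (by simp [hy])⟩
  have := hi.seg.mem
  rcases List.mem_cons.1 this with h0 | h1
  · omega
  · exact hh _ (by simp [h1])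

/-- Appending the first node of the first list. -/
theorem MInv.take_a (hi : MInv key la0 lb0 ld (a :: la) lb h0 h)
    (hlt : ∀ y ∈ lb, key a < key y) (h19 : ∀ x, h'.A 19 x = if x = h.r 10 then a else h.A 19 x)
    (harr : ∀ f, f ≠ 19 → h'.A f = h.A f) (hreg : ∀ y, y < 8 ∨ 10 < y → h'.r y = h.r y)
    (hio : h'.io = h.io) (h8 : h'.r 8 = h'.A 19 a) (h9 : h'.r 9 = h.r 9) (h10 : h'.r 10 = a) :
    MInv key la0 lb0 (ld ++ [a]) la lb h0 h' := by
  have hd := hi.nodup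
  have ht := hi.seg.mem
  have hd' : (0 :: ld).Nodup := (List.nodup_append.1 hd).1
  have hdis : ∀ x ∈ a :: la ++ lb, x ≠ h.r 10 := by
    intro x hx hxt
    exact (List.nodup_append.1 hd).2.2 _ ht x hx hxt.symm
  have perm : (0 :: (ld ++ [a]) ++ (la ++ lb)) = (0 :: ld ++ (a :: la ++ lb)) := by simp
  have perm' : (ld ++ [a]) ++ (la ++ lb) = ld ++ (a :: la ++ lb) := by simp
  have ha19 : h'.A 19 a = h.A 19 a := by
    rw [h19, if_neg (hdis a (by simp))]
  obtain ⟨-, a0, al⟩ := hi.lst_a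
  refine ⟨?_, ?_, ?_, by rw [perm]; exact hd, ?_, ?_, ?_, ?_, ?_, ?_, ?_, ?_⟩
  · rw [h10]
    exact hi.seg.snoc hd' (fun x _ hx => by rw [h19, if_neg hx]) (by rw [h19, if_pos rfl])
  · rw [h8, ha19]
    exact al.congr fun x hx => by rw [h19, if_neg (hdis x (by simp [hx]))]
  · rw [h9]
    exact hi.lst_b.congr fun x hx => by rw [h19, if_neg (hdis x (by simp [hx]))]
  · have := hi.srt_a; rwa [List.append_assoc, List.singleton_append]
  · have s1 := List.pairwise_append.1 hi.srt_a
    have s2 := List.pairwise_append.1 hi.srt_b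
    rw [List.append_assoc, List.singleton_append]
    refine List.pairwise_append.2 ⟨s1.1, List.pairwise_cons.2 ⟨hlt, s2.2.1⟩, fun x hx y hy => ?_⟩
    rcases List.mem_cons.1 hy with rfl | hy
    · exact s1.2.2 x hx y (by simp)
    · exact s2.2.2 x hx y hy
  · rw [perm']; exact hi.sub
  · rw [perm']; exact hi.cover
  · intro x x0 xa xb
    rw [h19, if_neg, hi.nx x x0 xa xb]
    rintro rfl
    rcases List.mem_cons.1 ht with hh | hh
    · exact x0 hh
    · rcases hi.sub (h.r 10) (by simp [hh]) with h1 | h1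
      · exact xa h1
      · exact xb h1
  · intro f hf; rw [harr f hf, hi.arr f hf]
  · intro y hy; rw [hreg y hy, hi.reg y hy]
  · rw [hio, hi.io]

/-- The invariant treats both inputs alike, so taking a node from the second list reduces to
`MInv.take_a`. -/
theorem MInv.symm (hi : MInv key la0 lb0 ld la lb h0 h) (h8 : h'.r 8 = h.r 9)
    (h9 : h'.r 9 = h.r 8) (h10 : h'.r 10 = h.r 10) (hA : h'.A = h.A)
    (hreg : ∀ y, y < 8 ∨ 10 < y → h'.r y = h.r y) (hio : h'.io = h.io) :
    MInv key la0 lb0 ld lb la h0 h' := by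
  have hm : ∀ x, x ∈ ld ++ (lb ++ la) ↔ x ∈ ld ++ (la ++ lb) := by
    intro x; simp only [List.mem_append]; tauto
  refine ⟨?_, ?_, ?_, ?_, hi.srt_b, hi.srt_a, ?_, ?_, ?_, ?_, ?_, ?_⟩
  · rw [h10, hA]; exact hi.seg
  · rw [h8, hA]; exact hi.lst_b
  · rw [h9, hA]; exact hi.lst_a
  · exact (List.Perm.append_left _ List.perm_append_comm).nodup_iff.1 hi.nodup
  · intro x hx; exact hi.sub x ((hm x).1 hx)
  · intro x hx
    obtain ⟨y, y1, y2⟩ := hi.cover x hx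
    exact ⟨y, (hm y).2 y1, y2⟩
  · rw [hA]; exact hi.nx
  · rw [hA]; exact hi.arr
  · intro y hy; rw [hreg y hy, hi.reg y hy]
  · rw [hio, hi.io]

/-- Dropping the first node of the second list. -/
theorem MInv.drop_b (hi : MInv key la0 lb0 ld (a :: la) (b :: lb) h0 h) (he : key a = key b) :
    MInv key la0 lb0 ld (a :: la) lb h0 (h.set 9 (h.A 19 b)) := by
  have hsl : (0 :: ld ++ (a :: la ++ lb)).Sublist (0 :: ld ++ (a :: la ++ b :: lb)) :=
    List.Sublist.append_left (List.Sublist.append_left (List.sublist_cons_self _ _) _) _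
  refine ⟨by simpa using hi.seg, by simpa using hi.lst_a, by simpa using hi.lst_b.2.2,
    hi.nodup.sublist hsl, hi.srt_a, ?_, ?_, ?_, hi.nx, hi.arr, ?_, hi.io⟩
  · exact hi.srt_b.sublist (List.Sublist.append_left (List.sublist_cons_self _ _) _)
  · intro x hx
    apply hi.sub x
    simp only [List.mem_append, List.mem_cons] at hx ⊢
    tauto
  · intro x hx
    obtain ⟨y, y1, y2⟩ := hi.cover x hx
    by_cases hy : y = b
    · exact ⟨a, by simp, by rw [he, ← hy, y2]⟩
    · refine ⟨y, ?_, y2⟩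
      simp only [List.mem_append, List.mem_cons] at y1 ⊢
      tauto
  · intro y hy
    rw [HS.set_r, if_neg (by omega)]
    exact hi.reg y hy

/-- Each round removes a node from one of the lists, in at most seven steps; of two nodes with equal
keys one is dropped. The nonempty rest is attached in one step. -/
theorem merge_wp {Γ : Cx} {raw ex : ℕ → ℕ} (hla : Lst (h.A 19) (h.r 8) la)
    (hlb : Lst (h.A 19) (h.r 9) lb) (hd : (la ++ lb).Nodup) (hsa : Srt (runKey raw ex) la)
    (hsb : Srt (runKey raw ex) lb) (hcap : ∀ x, x ∈ la ∨ x ∈ lb → x < Γ.cap) (hcap0 : 0 < Γ.cap)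
    (hB : 1 < Γ.B)
    (hraw : ∀ x, x ∈ la ∨ x ∈ lb → h.A 25 x = raw x ∧ h.A 2 x = ex x) :
    wp Γ merge h (fun h' t => t ≤ 7 * (la.length + lb.length) + 4 ∧
      ∃ l, MergePost (runKey raw ex) la lb l h h') := by
  rw [merge, wp_seq, wp_asg]
  refine ⟨by omega, by simp [HE.ok], ?_⟩
  rw [wp_seq]
  refine wp_whl (fun h1 n => ∃ ld la' lb', MInv (runKey raw ex) la lb ld la' lb' h h1 ∧
    n = 7 * (la'.length + lb'.length)) (n := 7 * (la.length + lb.length)) ?_ ?_ ?_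
  · rintro h1 n ⟨ld, la', lb', hi, rfl⟩
    obtain ⟨q1, q2, q3⟩ := hi.tail_le (N := Γ.cap - 1) (fun x hx => by have := hcap x hx; omega)
    simp only [vc, ↓reduceIte, Nat.reduceEqDiff, Nat.reduceLT]
    refine ⟨by split_ifs <;> omega, fun hv => ?_⟩
    have ha0 : h1.r 8 ≠ 0 := by
      intro h0; simp [h0] at hv
    have hb0 : h1.r 9 ≠ 0 := by
      intro h0; simp [h0] at hv
    obtain ⟨a, la', rfl⟩ : ∃ a l, la' = a :: l := by
      cases la' with
      | nil => exact absurd hi.lst_a ha0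
      | cons a l => exact ⟨a, l, rfl⟩
    obtain ⟨b, lb', rfl⟩ : ∃ a l, lb' = a :: l := by
      cases lb' with
      | nil => exact absurd hi.lst_b hb0
      | cons a l => exact ⟨a, l, rfl⟩
    have ea := hi.lst_a.1
    have eb := hi.lst_b.1
    obtain ⟨ra1, ra2⟩ := hraw a (hi.sub a (by simp))
    obtain ⟨rb1, rb2⟩ := hraw b (hi.sub b (by simp))
    have e25 := hi.arr 25 (by omega)
    have e2 := hi.arr 2 (by omega)
    have key_lt : ∀ x y, runKey raw ex x < runKey raw ex y ↔
        raw x < raw y ∨ raw x = raw y ∧ ex x < ex y := fun x y => Prod.Lex.toLex_lt_toLex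
    have dis : a ≠ h1.r 10 ∧ b ≠ h1.r 10 := by
      have hh := (List.nodup_append.1 hi.nodup).2.2 _ hi.seg.mem
      exact ⟨(hh a (by simp)).symm, (hh b (by simp)).symm⟩
    have takeA : runKey raw ex a < runKey raw ex b →
        MInv (runKey raw ex) la lb (ld ++ [a]) la' (b :: lb') h
          (((h1.st 19 (h1.r 10) a).set 10 a).set 8 (h1.A 19 a)) := by
      intro hlt
      refine hi.take_a ?_ ?_ ?_ ?_ rfl ?_ ?_ ?_
      · intro y hy
        rcases List.mem_cons.1 hy with rfl | hy
        · exact hlt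
        · exact lt_trans hlt
            ((List.pairwise_cons.1 (List.pairwise_append.1 hi.srt_b).2.1).1 y hy)
      · intro x; simp
      · intro f hf; funext j; simp [hf]
      · intro y hy
        simp only [HS.set_r, HS.st_r]
        rw [if_neg (by omega), if_neg (by omega)]
      · simp [dis.1]
      · simp
      · simp
    -- Both lists are exchanged, the first case is applied, and they are exchanged back.
    have takeB : runKey raw ex b < runKey raw ex a →
        MInv (runKey raw ex) la lb (ld ++ [b]) (a :: la') lb' h
          (((h1.st 19 (h1.r 10) b).set 10 b).set 9 (h1.A 19 b)) := by
      intro hlt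
      have hi' := hi.symm (h' := (h1.set 8 (h1.r 9)).set 9 (h1.r 8)) (by simp) (by simp) (by simp)
        rfl (fun y hy => by
          simp only [HS.set_r]
          rw [if_neg (by omega), if_neg (by omega)]) rfl
      have h2 := hi'.take_a (h' := ((((h1.set 8 (h1.r 9)).set 9 (h1.r 8)).st 19 (h1.r 10) b).set 10
        b).set 8 (h1.A 19 b)) ?_ ?_ ?_ ?_ rfl ?_ ?_ ?_
      · refine h2.symm ?_ ?_ ?_ rfl ?_ rfl
        · simp [ea]
        · simp
        · simp
        · intro y hy
          simp only [HS.set_r, HS.st_r]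
          split_ifs <;> first | rfl | omega
      · intro y hy
        rcases List.mem_cons.1 hy with rfl | hy
        · exact hlt
        · exact lt_trans hlt
            ((List.pairwise_cons.1 (List.pairwise_append.1 hi.srt_a).2.1).1 y hy)
      · intro x; simp
      · intro f hf; funext j; simp [hf]
      · intro y hy
        simp only [HS.set_r, HS.st_r]
        split_ifs <;> first | rfl | omega
      · simp [dis.2]
      · simp
      · simp
    have d1 : ¬ a = h1.r 10 := dis.1
    have d2 : ¬ b = h1.r 10 := dis.2
    rw [ea] at q2
    rw [eb] at q3
    by_cases c1 : raw a = raw b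
    · by_cases c2 : ex a = ex b
      · simp only [vc, ↓reduceIte, Nat.reduceEqDiff, Nat.reduceLT, ea, eb, e25, e2, ra1, ra2, rb1, rb2,
          c1, c2, one_ne_zero]
        refine ⟨⟨by omega, by omega⟩, ⟨by omega, by omega⟩, by omega, _, ⟨ld, _, _, hi.drop_b ?_, rfl⟩, ?_⟩
        · simp [runKey, c1, c2]
        · simp only [List.length_cons]; omega
      · by_cases c3 : ex a < ex b
        · simp only [takeNode, vc, ↓reduceIte, Nat.reduceEqDiff, Nat.reduceLT, ea, eb, e25, e2, ra1, ra2, rb1,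
            rb2, c1, c2, c3, one_ne_zero, d1, and_false]
          refine ⟨⟨by omega, by omega⟩, ⟨by omega, by omega⟩, ⟨by omega, by omega⟩, by omega, by omega, _,
            ⟨_, _, _, takeA ((key_lt _ _).2 (Or.inr ⟨c1, c3⟩)), rfl⟩, ?_⟩
          simp only [List.length_cons]; omega
        · simp only [takeNode, vc, ↓reduceIte, Nat.reduceEqDiff, Nat.reduceLT, ea, eb, e25, e2, ra1, ra2, rb1,
            rb2, c1, c2, c3, one_ne_zero, d2, and_false]
          refine ⟨⟨by omega, by omega⟩, ⟨by omega, by omega⟩, ⟨by omega, by omega⟩, by omega, by omega, _,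
            ⟨_, _, _, takeB ((key_lt _ _).2 (Or.inr ⟨c1.symm, by omega⟩)), rfl⟩, ?_⟩
          simp only [List.length_cons]; omega
    · by_cases c3 : raw a < raw b
      · simp only [takeNode, vc, ↓reduceIte, Nat.reduceEqDiff, Nat.reduceLT, ea, eb, e25, e2, ra1, ra2, rb1,
          rb2, c1, c3, one_ne_zero, d1, and_false]
        refine ⟨⟨by omega, by omega⟩, ⟨by omega, by omega⟩, by omega, by omega, _,
          ⟨_, _, _, takeA ((key_lt _ _).2 (Or.inl c3)), rfl⟩, ?_⟩
        simp only [List.length_cons]; omega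
      · simp only [takeNode, vc, ↓reduceIte, Nat.reduceEqDiff, Nat.reduceLT, ea, eb, e25, e2, ra1, ra2, rb1,
          rb2, c1, c3, one_ne_zero, d2, and_false]
        refine ⟨⟨by omega, by omega⟩, ⟨by omega, by omega⟩, by omega, by omega, _,
          ⟨_, _, _, takeB ((key_lt _ _).2 (Or.inl (by omega))), rfl⟩, ?_⟩
        simp only [List.length_cons]; omega
  · refine ⟨[], la, lb, ⟨?_, by simpa using hla, by simpa using hlb, ?_, by simpa using hsa,
      by simpa using hsb, by simp, ?_, by simp, by simp, ?_, by simp⟩, rfl⟩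
    · simp [Seg]
    · rw [List.cons_append, List.nil_append, List.nodup_cons]
      refine ⟨fun h0 => ?_, hd⟩
      rcases List.mem_append.1 h0 with h1 | h1
      · exact hla.ne_zero 0 h1 rfl
      · exact hlb.ne_zero 0 h1 rfl
    · intro x hx
      exact ⟨x, by simpa using hx, rfl⟩
    · intro y hy
      simp only [HS.set_r]
      rw [if_neg (by omega)]
  · rintro h1 t n ⟨ld, la', lb', hi, rfl⟩ hv ht
    obtain ⟨q1, q2, q3⟩ := hi.tail_le (N := Γ.cap - 1) (fun x hx => by have := hcap x hx; omega)
    simp only [vc, ↓reduceIte, Nat.reduceEqDiff, Nat.reduceLT] at hv ⊢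
    have fin : ∀ (l' : List ℕ) (x : ℕ), Lst (h1.A 19) x l' → (∀ y ∈ l', y ∈ la' ++ lb') →
        (∀ y ∈ la' ++ lb', y ∈ l') → Srt (runKey raw ex) (ld ++ l') →
        MergePost (runKey raw ex) la lb (ld ++ l') h (h1.st 19 (h1.r 10) x) := by
      intro l' x hl hsub1 hsub2 hs
      have hdis := (List.nodup_append.1 hi.nodup).2.2 _ hi.seg.mem
      have hnd : (0 :: ld).Nodup := (List.nodup_append.1 hi.nodup).1
      have hm : ∀ y, y ∈ ld ++ l' ↔ y ∈ ld ++ (la' ++ lb') := by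
        intro y
        rw [List.mem_append, List.mem_append]
        exact or_congr_right ⟨hsub1 y, hsub2 y⟩
      refine ⟨?_, hs, fun y hy => hi.sub y ((hm y).1 hy), fun y hy => ?_, fun y y0 ya yb => ?_,
        fun f hf => ?_, hi.reg, hi.io⟩
      · refine (hi.seg.congr (nx' := (h1.st 19 (h1.r 10) x).A 19) hnd (fun z _ hz => by simp [hz])).close
          ?_ ?_
        · intro z hz h0
          exact (List.nodup_cons.1 hnd).1 (h0 ▸ hz)
        · simp only [HS.st_A, and_self, if_true]
          refine hl.congr fun z hz => ?_
          have : z ≠ h1.r 10 := (hdis z (hsub1 z hz)).symm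
          simp [this]
      · obtain ⟨z, z1, z2⟩ := hi.cover y hy
        exact ⟨z, (hm z).2 z1, z2⟩
      · have : y ≠ h1.r 10 := by
          rintro rfl
          rcases List.mem_cons.1 hi.seg.mem with hh | hh
          · exact y0 hh
          · rcases hi.sub (h1.r 10) (by simp [hh]) with h1 | h1
            · exact ya h1
            · exact yb h1
        simp only [HS.st_A, this, and_false, if_false]
        exact hi.nx y y0 ya yb
      · funext j
        simp only [HS.st_A, hf, false_and, if_false]
        rw [hi.arr f hf]
    refine ⟨fun h8 => ⟨by omega, by omega, ld ++ la', fin la' _ hi.lst_a ?_ ?_ hi.srt_a⟩,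
      fun h8 => ⟨by omega, by omega, ld ++ lb', fin lb' _ hi.lst_b ?_ ?_ hi.srt_b⟩⟩
    · intro y hy; simp [hy]
    · have h9 : h1.r 9 = 0 := by
        by_contra h9
        simp [Nat.pos_of_ne_zero h8, Nat.pos_of_ne_zero h9] at hv
      cases lb' with
      | nil => simp
      | cons b l => exact absurd hi.lst_b.2.1 (by rw [← hi.lst_b.1, h9]; simp)
    · intro y hy; simp [hy]
    · cases la' with
      | nil => simp
      | cons b l => exact absurd hi.lst_a.2.1 (by rw [← hi.lst_a.1, h8]; simp)
end
end RLEMups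

/-! ### Sorting by merging a queue of lists -/


namespace RLEMups

/-- A bound for the time that merging a queue of `B` lists takes. -/
def queueCost (m s : ℕ) (B : ℕ) : ℕ :=
  if B ≤ 1 then 0 else 7 * min m (s * B) + 10 * B + queueCost m s (B - B / 2)
termination_by B
decreasing_by omega

theorem queueCost_of_two_le (m s : ℕ) {B : ℕ} (hB : 2 ≤ B) :
    queueCost m s B = 7 * min m (s * B) + 10 * B + queueCost m s (B - B / 2) := by
  rw [queueCost, if_neg (by omega)]

/-- Every pass removes at least a third of the lists, so the costs `O(s * B)` of the passes form a
geometric series. -/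
theorem queueCost_le_linear (m s B : ℕ) : queueCost m s B ≤ 3 * (7 * s + 10) * (B - 1) := by
  induction B using Nat.strong_induction_on with
  | _ B ih =>
    rcases Nat.lt_or_ge B 2 with hlt | hge
    · rw [queueCost, if_pos (by omega)]; exact Nat.zero_le _
    · rw [queueCost_of_two_le m s hge]
      have h1 := ih (B - B / 2) (by omega)
      have h2 : B - 1 = (B - B / 2 - 1) + B / 2 := by omega
      have h3 : B ≤ 3 * (B / 2) := by omega
      have h4 : (7 * s + 10) * B ≤ (7 * s + 10) * (3 * (B / 2)) := Nat.mul_le_mul_left _ h3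
      have h5 : min m (s * B) ≤ s * B := min_le_right _ _
      rw [h2, Nat.mul_add]
      nlinarith

/-- A pass at least halves `B - 1`. At most `i` passes are charged `7 * m` each; by then `s * (B -
1) ≤ m`, and the linear bound takes over. -/
theorem queueCost_le_of_le (m s i : ℕ) : ∀ B, s * (B - 1) ≤ m * 2 ^ i →
    queueCost m s B ≤ 7 * m * i + 30 * (B - 1) + 21 * m := by
  induction i with
  | zero =>
    intro B hB
    have := queueCost_le_linear m s B
    nlinarith
  | succ i ih =>
    intro B hB
    rcases Nat.lt_or_ge B 2 with hlt | hge
    · rw [queueCost, if_pos (by omega)]; exact Nat.zero_le _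
    · rw [queueCost_of_two_le m s hge]
      have h1 := ih (B - B / 2) (by
        have h2 : s * (2 * (B - B / 2 - 1)) ≤ s * (B - 1) := Nat.mul_le_mul_left _ (by omega)
        have h3 : m * 2 ^ (i + 1) = 2 * (m * 2 ^ i) := by ring
        nlinarith)
      have h2 : B - 1 = (B - B / 2 - 1) + B / 2 := by omega
      have h3 : B ≤ 3 * (B / 2) := by omega
      have h5 : min m (s * B) ≤ m := min_le_left _ _
      have h6 : 7 * m * (i + 1) = 7 * m * i + 7 * m := by ring
      omega

/-- Starting from `m` singletons, `log s + 1` passes are enough to reach the linear regime. -/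
theorem queueCost_le (m s : ℕ) : queueCost m s m ≤ 7 * m * (Nat.log 2 s + 1) + 51 * m := by
  have h := queueCost_le_of_le m s (Nat.log 2 s + 1) m (by
    have := Nat.lt_pow_succ_log_self (b := 2) (by norm_num) s
    rw [mul_comm]
    exact Nat.mul_le_mul (Nat.sub_le _ _) this.le)
  omega

/-- Read the runs: the array `25` contains the characters, `2` the exponents, `3` the positions,
`20` the queue. -/
def load : HP :=
  .asg 5 1 ;;
  .whl ((R 5).lt (R 0 + 1))
    (.sto 25 (R 5) (.io (2 * R 5 - 2)) ;; .sto 2 (R 5) (.io (2 * R 5 - 1)) ;;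
      .sto 3 (R 5 + 1) (AR 3 (R 5) + AR 2 (R 5)) ;; .sto 20 (R 5) (R 5) ;; .asg 5 (R 5 + 1)) ;;
  .asg 6 1 ;; .asg 7 (R 0 + 1)

/-- One step of the sorting. -/
def sortStep : HP :=
  .asg 8 (AR 20 (R 6)) ;; .asg 9 (AR 20 (R 6 + 1)) ;; .asg 6 (R 6 + 2) ;; merge ;;
  .sto 20 (R 7) (AR 19 0) ;; .asg 7 (R 7 + 1)

/-- Merge the first two lists of the queue until one list is left. -/
def sort : HP := .whl ((R 6 + 1).lt (R 7)) sortStep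

/-- The runs before the run `c0` have been read. -/
structure LInv (Γ : Cx) (raw ex P : ℕ → ℕ) (c0 : ℕ) (h : HS) : Prop where
  one_le : 1 ≤ c0
  le : c0 ≤ Γ.m + 1
  r0 : h.r 0 = Γ.m
  r5 : h.r 5 = c0
  raw : ∀ d, 1 ≤ d → d < c0 → h.A 25 d = raw d
  ex : ∀ d, 1 ≤ d → d < c0 → h.A 2 d = ex d
  pos : ∀ d, 1 ≤ d → d ≤ c0 → h.A 3 d = P d
  head : ∀ d, 1 ≤ d → d < c0 → h.A 20 d = d
  zero : ∀ f, f ≠ 2 → f ≠ 3 → f ≠ 20 → f ≠ 25 → ∀ j, h.A f j = 0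

/-- The state of the queue `Q`. -/
structure QInv (Γ : Cx) (key : ℕ → ℕ ×ₗ ℕ) (Q : List (List ℕ)) (h0 h : HS) : Prop where
  one_le : 1 ≤ h.r 6
  len : h.r 7 = h.r 6 + Q.length
  -- A merge advances the tail of the queue by one and shortens the queue by one. So the tail stays
  -- within `2 * m + 1`, and the queue array never wraps around.
  bound : h.r 7 + Q.length = 2 * Γ.m + 1
  head : ∀ (k : ℕ) (l : List ℕ), Q[k]? = some l → Lst (h.A 19) (h.A 20 (h.r 6 + k)) l
  srt : ∀ l ∈ Q, Srt key l
  nodup : Q.flatten.Nodup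
  mem : ∀ x ∈ Q.flatten, 1 ≤ x ∧ x ≤ Γ.m
  cover : ∀ d, 1 ≤ d → d ≤ Γ.m → ∃ y ∈ Q.flatten, key y = key d
  arr : ∀ f, f ≠ 19 → f ≠ 20 → h.A f = h0.A f
  reg : ∀ y, y < 6 ∨ 10 < y → h.r y = h0.r y

theorem Srt.nodup {key : ℕ → ℕ ×ₗ ℕ} {l : List ℕ} (h : Srt key l) : l.Nodup :=
  h.imp (by rintro x y h rfl; exact lt_irrefl _ h)

/-- A strictly sorted list repeats no key. This is where dropping duplicates gives a bound by the
number of distinct runs. -/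
theorem Srt.length_le {key : ℕ → ℕ ×ₗ ℕ} {l : List ℕ} (h : Srt key l) {m : ℕ}
    (hm : ∀ x ∈ l, 1 ≤ x ∧ x ≤ m) : l.length ≤ ((Finset.Icc 1 m).image key).card := by
  have h1 : (l.map key).Nodup :=
    List.pairwise_map.2 (h.imp fun hlt => ne_of_lt hlt)
  rw [← List.length_map (f := key), ← List.toFinset_card_of_nodup h1]
  apply Finset.card_le_card
  intro y hy
  rw [List.mem_toFinset, List.mem_map] at hy
  obtain ⟨x, hx, rfl⟩ := hy
  exact Finset.mem_image_of_mem _ (Finset.mem_Icc.2 (hm x hx))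

section
variable {Γ : Cx} {raw ex P : ℕ → ℕ} {h0 h : HS}

theorem load_wp (hcap : 4 * Γ.m + 8 ≤ Γ.cap) (hB : 2 * Γ.cap + 64 < Γ.B) (h0 : h.r 0 = Γ.m)
    (hz : ∀ f j, h.A f j = 0)
    (hio : ∀ d < Γ.m, h.io (2 * d) = raw (d + 1) ∧ h.io (2 * d + 1) = ex (d + 1)) (hP1 : P 1 = 0)
    (hP : ∀ d, 1 ≤ d → d ≤ Γ.m → P (d + 1) = P d + ex d ∧ P (d + 1) < Γ.B) :
    wp Γ load h (fun h' t => t ≤ 6 * Γ.m + 4 ∧ LInv Γ raw ex P (Γ.m + 1) h' ∧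
      h'.r 6 = 1 ∧ h'.r 7 = Γ.m + 1) := by
  simp only [load, vc, ↓reduceIte, Nat.reduceEqDiff, Nat.reduceLT]
  refine wp_whl (fun h1 n => ∃ c0, LInv Γ raw ex P c0 h1 ∧ h1.io = h.io ∧ n = (Γ.m + 1 - c0) * 6)
    (n := Γ.m * 6) ?_ ?_ ?_
  · rintro h1 n ⟨c0, hi, hio1, rfl⟩
    have l1 := hi.one_le
    simp only [vc, ↓reduceIte, Nat.reduceEqDiff, Nat.reduceLT, hi.r0, hi.r5]
    refine ⟨by omega, fun hv => ?_⟩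
    have hlt : c0 < Γ.m + 1 := by
      by_contra hcon; rw [if_neg hcon] at hv; exact hv rfl
    obtain ⟨i1, i2⟩ := hio (c0 - 1) (by omega)
    rw [show 2 * (c0 - 1) = 2 * c0 - 2 by omega, show c0 - 1 + 1 = c0 by omega] at i1
    rw [show 2 * (c0 - 1) + 1 = 2 * c0 - 1 by omega, show c0 - 1 + 1 = c0 by omega] at i2
    obtain ⟨p1, p2⟩ := hP c0 l1 (by omega)
    have p3 := hi.pos c0 l1 le_rfl
    simp only [hio1, i1, i2, and_true, p3, and_false, if_false, if_true, true_and]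
    refine ⟨by omega, by omega, by omega, by omega, by omega, by omega, by omega, by omega,
      by omega, _, ⟨c0 + 1, ⟨by omega, by omega, ?_, ?_, ?_, ?_, ?_, ?_, ?_⟩, rfl⟩, ?_⟩
    all_goals try simp only [vc, ↓reduceIte, Nat.reduceEqDiff, Nat.reduceLT, hi.r0, hi.r5]
    · intro d d1 d2
      split_ifs with hc
      · rw [hc]
      · exact hi.raw d d1 (by omega)
    · intro d d1 d2
      split_ifs with hc
      · rw [hc]
      · exact hi.ex d d1 (by omega)
    · intro d d1 d2
      split_ifs with hc
      · rw [hc, p1]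
      · exact hi.pos d d1 (by omega)
    · intro d d1 d2
      split_ifs with hc
      · rw [hc]
      · exact hi.head d d1 (by omega)
    · intro f f1 f2 f3 f4 j
      simp only [f1, f2, f3, f4, false_and, if_false]
      exact hi.zero f f1 f2 f3 f4 j
    · have : (Γ.m + 1 - c0) * 6 = (Γ.m + 1 - (c0 + 1)) * 6 + 6 := by omega
      omega
  · refine ⟨1, ⟨le_rfl, by omega, by simpa using h0, by simp, ?_, ?_, ?_, ?_, ?_⟩, rfl, by omega⟩
    · intro d d1 d2; omega
    · intro d d1 d2; omega
    · intro d d1 d2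
      rw [show d = 1 by omega, hP1]; exact hz _ _
    · intro d d1 d2; omega
    · intro f _ _ _ _ j; exact hz f j
  · rintro h1 t n ⟨c0, hi, -, rfl⟩ hv ht
    have hle := hi.le
    simp only [vc, ↓reduceIte, Nat.reduceEqDiff, Nat.reduceLT, hi.r0, hi.r5] at hv ⊢
    have hc : c0 = Γ.m + 1 := by
      by_contra hne
      rw [if_pos (by omega)] at hv
      omega
    subst hc
    refine ⟨by omega, by omega, ?_⟩
    exact ⟨hi.one_le, hi.le, by simpa using hi.r0, by simpa using hi.r5, hi.raw, hi.ex, hi.pos,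
      hi.head, hi.zero⟩

theorem LInv.qInv (hi : LInv Γ raw ex P (Γ.m + 1) h) (h6 : h.r 6 = 1) (h7 : h.r 7 = Γ.m + 1) :
    QInv Γ (runKey raw ex) ((List.range' 1 Γ.m).map fun d => [d]) h h := by
  have hfl : ((List.range' 1 Γ.m).map fun d => [d]).flatten = List.range' 1 Γ.m := by
    rw [← List.flatMap_def]; simp
  refine ⟨by omega, ?_, ?_, ?_, ?_, ?_, ?_, ?_, fun _ _ _ => rfl, fun _ _ => rfl⟩
  · simp [h6, h7]; omega
  · simp [h7]; omega
  · intro k l hk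
    simp only [List.getElem?_map, Option.map_eq_some_iff] at hk
    obtain ⟨d, hd, rfl⟩ := hk
    obtain ⟨hk, rfl⟩ := List.getElem?_eq_some_iff.1 hd
    rw [List.length_range'] at hk
    rw [List.getElem_range', h6, one_mul]
    refine ⟨hi.head _ (by omega) (by omega), by omega, ?_⟩
    exact hi.zero 19 (by omega) (by omega) (by omega) (by omega) _
  · intro l hl
    obtain ⟨d, -, rfl⟩ := List.mem_map.1 hl
    exact List.pairwise_singleton _ _
  · rw [hfl]; exact List.nodup_range'
  · rw [hfl]
    intro x hx
    rw [List.mem_range'_1] at hx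
    omega
  · rw [hfl]
    intro d d1 d2
    exact ⟨d, List.mem_range'_1.2 ⟨d1, by omega⟩, rfl⟩

theorem sortStep_wp (hcap : 4 * Γ.m + 8 ≤ Γ.cap) (hB : 2 * Γ.cap + 64 < Γ.B)
    (hraw : ∀ d, 1 ≤ d → d ≤ Γ.m → h0.A 25 d = raw d ∧ h0.A 2 d = ex d) {la lb : List ℕ}
    {Q : List (List ℕ)} (hi : QInv Γ (runKey raw ex) (la :: lb :: Q) h0 h) :
    wp Γ sortStep h (fun h' t => t ≤ 7 * (la.length + lb.length) + 9 ∧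
      ∃ l, QInv Γ (runKey raw ex) (Q ++ [l]) h0 h') := by
  have hlen := hi.len
  have hbd := hi.bound
  have h1 := hi.one_le
  simp only [List.length_cons] at hlen hbd
  have hmem := hi.mem
  have hnd := hi.nodup
  simp only [List.flatten_cons, List.mem_append] at hmem hnd
  have hnd1 : (la ++ lb).Nodup := by
    rw [← List.append_assoc] at hnd
    exact (List.nodup_append.1 hnd).1
  have hdis : ∀ x ∈ Q.flatten, x ∉ la ∧ x ∉ lb := by
    rw [← List.append_assoc] at hnd
    intro x hx
    have := (List.nodup_append.1 hnd).2.2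
    exact ⟨fun hh => this x (by simp [hh]) x hx rfl, fun hh => this x (by simp [hh]) x hx rfl⟩
  simp only [sortStep, wp_seq, wp_asg, wp_sto]
  simp only [vc, ↓reduceIte, Nat.reduceEqDiff, Nat.reduceLT]
  refine ⟨by omega, ⟨by omega, by omega⟩, by omega, ?_⟩
  refine wp_mono (merge_wp (la := la) (lb := lb) (raw := raw) (ex := ex) ?_ ?_ hnd1
    (hi.srt la (by simp)) (hi.srt lb (by simp)) ?_ (by omega) (by omega) ?_) ?_
  · simpa using hi.head 0 la (by simp)
  · simpa using hi.head 1 lb (by simp)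
  · intro x hx
    have := hmem x (by tauto)
    omega
  · intro x hx
    have := hmem x (by tauto)
    have e := hraw x this.1 this.2
    simp only [vc]
    rw [hi.arr 25 (by omega) (by omega), hi.arr 2 (by omega) (by omega)]
    exact e
  · rintro h' t ⟨ht, l, hp⟩
    have r6 := hp.reg 6 (by omega)
    have r7 := hp.reg 7 (by omega)
    have e20 := hp.arr 20 (by omega)
    simp only [vc, ↓reduceIte, Nat.reduceEqDiff, Nat.reduceLT] at r6 r7 e20
    rw [r7]
    have hsub : ∀ x ∈ l, x ∈ la ∨ x ∈ lb := hp.sub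
    refine ⟨by omega, by omega, by omega, by omega, l, ?_, ?_, ?_, ?_, ?_, ?_, ?_, ?_, ?_, ?_⟩
    all_goals simp only [vc, ↓reduceIte, Nat.reduceEqDiff, Nat.reduceLT, r6, List.length_append,
      List.length_singleton, List.flatten_append, List.flatten_singleton, List.mem_append]
    · omega
    · omega
    · omega
    · intro k l' hk
      simp only [false_and, true_and, if_false, e20]
      rcases Nat.lt_trichotomy k Q.length with hlt | heq | hgt
      · rw [List.getElem?_append_left hlt] at hk
        rw [if_neg (by omega)]
        have h3 := hi.head (k + 2) l' (by simpa using hk)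
        rw [show h.r 6 + 2 + k = h.r 6 + (k + 2) by omega]
        refine h3.congr fun x hx => hp.nx x (h3.ne_zero x hx) ?_ ?_
        · exact (hdis x (List.mem_flatten.2 ⟨l', List.mem_of_getElem? hk, hx⟩)).1
        · exact (hdis x (List.mem_flatten.2 ⟨l', List.mem_of_getElem? hk, hx⟩)).2
      · subst heq
        rw [List.getElem?_append_right le_rfl] at hk
        simp only [Nat.sub_self, List.getElem?_cons_zero, Option.some.injEq] at hk
        subst hk
        rw [if_pos (by omega)]
        exact hp.lst
      · rw [List.getElem?_eq_none (by simp; omega)] at hk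
        cases hk
    · intro l' hl
      rcases hl with hl | hl
      · exact hi.srt l' (by simp [hl])
      · rw [List.mem_singleton.1 hl]; exact hp.srt
    · rw [← List.append_assoc] at hnd
      refine List.nodup_append.2 ⟨(List.nodup_append.1 hnd).2.1, hp.srt.nodup, ?_⟩
      rintro x hx y hy rfl
      rcases hsub x hy with h1 | h1
      · exact (hdis x hx).1 h1
      · exact (hdis x hx).2 h1
    · intro x hx
      rcases hx with hx | hx
      · exact hmem x (by tauto)
      · have := hsub x hx
        exact hmem x (by tauto)
    · intro d d1 d2
      obtain ⟨y, hy, he⟩ := hi.cover d d1 d2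
      simp only [List.flatten_cons, List.mem_append] at hy
      by_cases hyQ : y ∈ Q.flatten
      · exact ⟨y, Or.inl hyQ, he⟩
      · obtain ⟨z, hz, hze⟩ := hp.cover y (by tauto)
        exact ⟨z, Or.inr hz, by rw [hze, he]⟩
    · intro f f1 f2
      funext j
      rw [HS.st_A, if_neg (by tauto), hp.arr f f1]
      exact congrFun (hi.arr f f1 f2) j
    · intro y hy
      rw [if_neg (by omega), hp.reg y (by omega)]
      rw [HS.set_r, HS.set_r, HS.set_r, if_neg (by omega), if_neg (by omega), if_neg (by omega)]
      exact hi.reg y hy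

/-- The lists are disjoint sets of runs, which gives `m`; each is as long as the number of distinct
keys at most, which gives the product. -/
theorem QInv.take_le {key : ℕ → ℕ ×ₗ ℕ} {Q : List (List ℕ)} (hi : QInv Γ key Q h0 h) (r : ℕ) :
    (Q.take r).flatten.length ≤ min Γ.m (((Finset.Icc 1 Γ.m).image key).card * r) := by
  refine le_min ?_ ?_
  · have hsl : (Q.take r).flatten.Sublist Q.flatten := (List.take_sublist r Q).flatten
    have h1 : (Q.take r).flatten.Nodup := hi.nodup.sublist hsl
    rw [← List.toFinset_card_of_nodup h1]
    have : (Q.take r).flatten.toFinset ⊆ Finset.Icc 1 Γ.m := by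
      intro x hx
      rw [List.mem_toFinset] at hx
      exact Finset.mem_Icc.2 (hi.mem x (hsl.subset hx))
    simpa using Finset.card_le_card this
  · rw [List.length_flatten]
    have h1 : ((Q.take r).map List.length).sum ≤
        ((Q.take r).map List.length).length • ((Finset.Icc 1 Γ.m).image key).card := by
      apply List.sum_le_card_nsmul
      intro x hx
      obtain ⟨l, hl, rfl⟩ := List.mem_map.1 hx
      have hl' := List.mem_of_mem_take hl
      exact (hi.srt l hl').length_le fun y hy => hi.mem y (List.mem_flatten.2 ⟨l, hl', hy⟩)
    rw [smul_eq_mul, mul_comm] at h1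
    refine h1.trans (Nat.mul_le_mul_left _ ?_)
    simp

theorem sort_wp (hcap : 4 * Γ.m + 8 ≤ Γ.cap) (hB : 2 * Γ.cap + 64 < Γ.B) (hm : 1 ≤ Γ.m)
    (hi : LInv Γ raw ex P (Γ.m + 1) h) (h6 : h.r 6 = 1) (h7 : h.r 7 = Γ.m + 1) :
    wp Γ sort h (fun h' t =>
      t ≤ queueCost Γ.m ((Finset.Icc 1 Γ.m).image (runKey raw ex)).card Γ.m + 1 ∧
      ∃ l, QInv Γ (runKey raw ex) [l] h h') := by
  have hraw : ∀ d, 1 ≤ d → d ≤ Γ.m → h.A 25 d = raw d ∧ h.A 2 d = ex d := fun d d1 d2 =>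
    ⟨hi.raw d d1 (by omega), hi.ex d d1 (by omega)⟩
  set s := ((Finset.Icc 1 Γ.m).image (runKey raw ex)).card with hs
  have hq := hi.qInv h6 h7
  -- `r` merges of the current pass are outstanding and consume the first `2 * r` lists; they are
  -- followed by passes over the `Q.length - r` lists left then.
  refine wp_whl (fun h1 n => ∃ Q r, QInv Γ (runKey raw ex) Q h h1 ∧ 2 * r ≤ Q.length ∧
    n = 7 * (Q.take (2 * r)).flatten.length + 10 * r + queueCost Γ.m s (Q.length - r))
    (n := queueCost Γ.m s Γ.m) ?_ ?_ ?_
  · rintro h1 n ⟨Q, r, hi, hr, rfl⟩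
    have hlen := hi.len
    have hbd := hi.bound
    have h1' := hi.one_le
    simp only [vc, ↓reduceIte, Nat.reduceEqDiff, Nat.reduceLT]
    refine ⟨by omega, fun hv => ?_⟩
    have hQ : 2 ≤ Q.length := by
      by_contra hcon
      rw [if_neg (by omega)] at hv
      exact hv rfl
    obtain ⟨r', r1, r2, r3⟩ : ∃ r', 2 * (r' + 1) ≤ Q.length ∧ 1 ≤ r' + 1 ∧
        7 * (Q.take (2 * (r' + 1))).flatten.length + 10 * (r' + 1) +
          queueCost Γ.m s (Q.length - (r' + 1)) ≤
        7 * (Q.take (2 * r)).flatten.length + 10 * r + queueCost Γ.m s (Q.length - r) := by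
      -- When the pass is over, one layer of `queueCost` is unfolded and a pass of `Q.length / 2`
      -- merges begins; an odd list is left to the next pass.
      rcases Nat.eq_zero_or_pos r with rfl | hpos
      · refine ⟨Q.length / 2 - 1, by omega, by omega, ?_⟩
        rw [show Q.length / 2 - 1 + 1 = Q.length / 2 by omega, Nat.sub_zero,
          queueCost_of_two_le _ _ hQ]
        have h2 := hi.take_le (2 * (Q.length / 2))
        have h3 : min Γ.m (s * (2 * (Q.length / 2))) ≤ min Γ.m (s * Q.length) :=
          min_le_min_left _ (Nat.mul_le_mul_left _ (by omega))
        rw [← hs] at h2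
        omega
      · exact ⟨r - 1, by omega, by omega, by rw [show r - 1 + 1 = r by omega]⟩
    obtain ⟨la, lb, Q', rfl⟩ : ∃ la lb Q', Q = la :: lb :: Q' := by
      match Q, hQ with
      | la :: lb :: Q', _ => exact ⟨la, lb, Q', rfl⟩
    refine wp_mono (sortStep_wp hcap hB hraw hi) ?_
    rintro h' t ⟨ht, l, hi'⟩
    simp only [List.length_cons] at r1 r3
    refine ⟨_, ⟨Q' ++ [l], r', hi', by simp; omega, rfl⟩, ?_⟩
    have e1 : (la :: lb :: Q').take (2 * (r' + 1)) = la :: lb :: Q'.take (2 * r') := by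
      rw [show 2 * (r' + 1) = 2 * r' + 1 + 1 by ring, List.take_succ_cons, List.take_succ_cons]
    have e2 : (Q' ++ [l]).take (2 * r') = Q'.take (2 * r') :=
      List.take_append_of_le_length (by omega)
    rw [e1] at r3
    rw [e2, List.length_append, List.length_singleton]
    rw [show Q'.length + 1 - r' = Q'.length + 1 + 1 - (r' + 1) by omega]
    simp only [List.flatten_cons, List.length_append] at r3
    simp only [List.length_cons]
    omega
  · refine ⟨_, 0, hq, by simp, ?_⟩
    simp
  · rintro h' t n ⟨Q, r, hi, hr, rfl⟩ hv ht
    refine ⟨by omega, ?_⟩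
    have hlen := hi.len
    have hbd := hi.bound
    simp only [vc, ↓reduceIte, Nat.reduceEqDiff, Nat.reduceLT] at hv
    obtain ⟨y, hy, -⟩ := hi.cover 1 le_rfl hm
    match Q, hi with
    | [], _ => simp at hy
    | [l], hi => exact ⟨l, hi⟩
    | la :: lb :: Q', hi =>
      simp only [List.length_cons] at hlen
      rw [if_pos (by omega)] at hv
      omega
end

end RLEMups

/-! ### Numbering the distinct runs and their characters -/


namespace RLEMups

/-- The next run of the sorted list gets the number in register `3`; its character gets the number
of the first run with this character. -/
def numberStep : HP :=
  .sto 24 (R 3) (AR 2 (R 4)) ;; .sto 27 (R 3) (AR 25 (R 4)) ;;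
  .ite (R 3)
    (.ite ((AR 27 (R 3)).eq (AR 27 (R 3 - 1))) (.sto 23 (R 3) (AR 23 (R 3 - 1)))
      (.sto 23 (R 3) (R 3)))
    (.sto 23 (R 3) (R 3)) ;;
  .asg 3 (R 3 + 1) ;; .asg 4 (AR 19 (R 4))

/-- Number the runs of the sorted list. -/
def number : HP := .asg 4 (AR 20 (R 6)) ;; .asg 3 0 ;; .whl (R 4) numberStep

/-- One step of the search for the run in register `5` among the numbered runs. -/
def searchStep : HP :=
  .asg 10 ((R 8 + R 9) / 2) ;;
  .ite ((AR 25 (R 5)).lt (AR 27 (R 10)) +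
    (AR 25 (R 5)).eq (AR 27 (R 10)) * (AR 2 (R 5)).lt (AR 24 (R 10))) (.asg 9 (R 10)) (.asg 8 (R 10))

/-- Find the numbers of the run in register `5` and of its character. -/
def locate : HP :=
  .asg 8 0 ;; .asg 9 (R 3) ;; .whl ((R 8 + 1).lt (R 9)) searchStep ;;
  .sto 0 (R 5) (R 8) ;; .sto 1 (R 5) (AR 23 (R 8)) ;; .asg 5 (R 5 + 1)

/-- Find the numbers of all runs, and put marks before the first and after the last run. -/
def rename : HP :=
  .asg 5 1 ;; .whl ((R 5).lt (R 0 + 1)) locate ;;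
  .sto 0 0 (R 3 + 1) ;; .sto 0 (R 0 + 1) (R 3) ;; .sto 1 0 (R 3 + 1) ;; .sto 1 (R 0 + 1) (R 3) ;;
  .asg 2 0

/-- The first `k` nodes of the list `l` have been numbered. -/
structure NumInv (Γ : Cx) (raw ex : ℕ → ℕ) (l : List ℕ) (k : ℕ) (h0 h : HS) : Prop where
  le : k ≤ l.length
  r3 : h.r 3 = k
  r0 : h.r 0 = Γ.m
  lst : Lst (h.A 19) (h.r 4) (l.drop k)
  exs : ∀ d < k, h.A 24 d = ex (l.getD d 0)
  raws : ∀ d < k, h.A 27 d = raw (l.getD d 0)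
  num : ∀ d < k, h.A 23 d ≤ d ∧ raw (l.getD (h.A 23 d) 0) = raw (l.getD d 0) ∧
    ∀ e < h.A 23 d, raw (l.getD e 0) ≠ raw (l.getD d 0)
  zero : ∀ d, k ≤ d → h.A 23 d = 0
  arr : ∀ f, f ≠ 23 → f ≠ 24 → f ≠ 27 → h.A f = h0.A f

/-- The runs before the run `c0` have got their numbers. -/
structure RenInv (Γ : Cx) (raw ex : ℕ → ℕ) (l : List ℕ) (c0 : ℕ) (h0 h : HS) : Prop where
  one_le : 1 ≤ c0
  le : c0 ≤ Γ.m + 1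
  r0 : h.r 0 = Γ.m
  r3 : h.r 3 = l.length
  r5 : h.r 5 = c0
  num : ∀ c, 1 ≤ c → c < c0 → h.A 0 c < l.length ∧
    runKey raw ex (l.getD (h.A 0 c) 0) = runKey raw ex c ∧ h.A 1 c = h.A 23 (h.A 0 c)
  arr : ∀ f, f ≠ 0 → f ≠ 1 → h.A f = h0.A f

/-- All runs have been renamed. -/
structure Renamed (Γ : Cx) (raw ex P : ℕ → ℕ) (s : ℕ) (h : HS) : Prop where
  r0 : h.r 0 = Γ.m
  r2 : h.r 2 = 0
  U_lt : ∀ c, 1 ≤ c → c ≤ Γ.m → h.A 0 c < s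
  U_zero : h.A 0 0 = s + 1
  U_last : h.A 0 (Γ.m + 1) = s
  U_iff : ∀ c c', 1 ≤ c → c ≤ Γ.m → 1 ≤ c' → c' ≤ Γ.m →
    (h.A 0 c = h.A 0 c' ↔ raw c = raw c' ∧ ex c = ex c')
  ch_zero : h.A 1 0 = s + 1
  ch_last : h.A 1 (Γ.m + 1) = s
  ch_iff : ∀ c c', 1 ≤ c → c ≤ Γ.m → 1 ≤ c' → c' ≤ Γ.m → (h.A 1 c = h.A 1 c' ↔ raw c = raw c')
  a2 : ∀ c, 1 ≤ c → c ≤ Γ.m → h.A 2 c = ex c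
  a3 : ∀ c, 1 ≤ c → c ≤ Γ.m + 1 → h.A 3 c = P c
  a23 : ∀ c, 1 ≤ c → c ≤ Γ.m → h.A 23 (h.A 0 c) = h.A 1 c
  a23_lt : ∀ j, h.A 23 j < s
  a24 : ∀ c, 1 ≤ c → c ≤ Γ.m → h.A 24 (h.A 0 c) = ex c
  zero : ∀ f, 4 ≤ f → f ≤ 17 → ∀ j, h.A f j = 0

section
variable {Γ : Cx} {raw ex P : ℕ → ℕ} {h0 h : HS} {l : List ℕ}

theorem runKey_lt {x y : ℕ} :
    runKey raw ex x < runKey raw ex y ↔ raw x < raw y ∨ raw x = raw y ∧ ex x < ex y :=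
  Prod.Lex.toLex_lt_toLex

theorem runKey_inj {x y : ℕ} :
    runKey raw ex x = runKey raw ex y ↔ raw x = raw y ∧ ex x = ex y := by
  simp [runKey]

theorem Srt.getD_lt {key : ℕ → ℕ ×ₗ ℕ} (hs : Srt key l) {d e : ℕ} (hde : d < e)
    (he : e < l.length) : key (l.getD d 0) < key (l.getD e 0) := by
  have := List.pairwise_iff_getElem.1 hs d e (by omega) he hde
  simpa [List.getD_eq_getElem?_getD, List.getElem?_eq_getElem he,
    List.getElem?_eq_getElem (show d < l.length by omega)] using this

theorem Srt.getD_inj {key : ℕ → ℕ ×ₗ ℕ} (hs : Srt key l) {d e : ℕ} (hd : d < l.length)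
    (he : e < l.length) (h : key (l.getD d 0) = key (l.getD e 0)) : d = e := by
  rcases Nat.lt_trichotomy d e with hlt | heq | hgt
  · exact absurd h (ne_of_lt (hs.getD_lt hlt he))
  · exact heq
  · exact absurd h.symm (ne_of_lt (hs.getD_lt hgt hd))

theorem numberStep_wp (hcap : 4 * Γ.m + 8 ≤ Γ.cap) (hB : 2 * Γ.cap + 64 < Γ.B)
    (hs : Srt (runKey raw ex) l) (hl : l.length ≤ Γ.m)
    (hm : ∀ x ∈ l, x ≤ Γ.m ∧ h0.A 25 x = raw x ∧ h0.A 2 x = ex x) {k : ℕ} (hk : k < l.length)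
    (hi : NumInv Γ raw ex l k h0 h) :
    wp Γ numberStep h (fun h' t => t ≤ 7 ∧ NumInv Γ raw ex l (k + 1) h0 h') := by
  have hlst := hi.lst
  rw [List.drop_eq_getElem_cons hk] at hlst
  obtain ⟨r4, -, lst⟩ := hlst
  have hg : l.getD k 0 = l[k] := by
    simp [List.getD_eq_getElem?_getD, List.getElem?_eq_getElem hk]
  obtain ⟨x1, x2, x3⟩ := hm l[k] (List.getElem_mem hk)
  rw [← hg] at r4 lst x1 x2 x3
  have e25 := hi.arr 25 (by omega) (by omega) (by omega)
  have e2 := hi.arr 2 (by omega) (by omega) (by omega)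
  set x := l.getD k 0 with hx
  have key : ∀ (h' : HS) (v : ℕ), h'.r 0 = h.r 0 → h'.r 3 = k + 1 → h'.r 4 = h.A 19 x →
      (∀ f j, h'.A f j = if f = 23 ∧ j = k then v else if f = 27 ∧ j = k then raw x else
        if f = 24 ∧ j = k then ex x else h.A f j) →
      v ≤ k ∧ raw (l.getD v 0) = raw x ∧ (∀ e < v, raw (l.getD e 0) ≠ raw x) →
      NumInv Γ raw ex l (k + 1) h0 h' := by
    intro h' v q0 q3 q4 qA hv
    refine ⟨hk, q3, by rw [q0, hi.r0], ?_, ?_, ?_, ?_, ?_, ?_⟩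
    · rw [q4, show h'.A 19 = h.A 19 from funext fun j => by rw [qA]; simp]
      exact lst
    · intro d hd
      rw [qA]
      by_cases hc : d = k
      · simp [hc, hx]
      · simpa [hc] using hi.exs d (by omega)
    · intro d hd
      rw [qA]
      by_cases hc : d = k
      · simp [hc, hx]
      · simpa [hc] using hi.raws d (by omega)
    · intro d hd
      by_cases hc : d = k
      · rw [hc, show h'.A 23 k = v by rw [qA]; simp]
        exact hv
      · rw [show h'.A 23 d = h.A 23 d by rw [qA]; simp [hc]]
        exact hi.num d (by omega)
    · intro d hd
      rw [qA]
      simpa [show d ≠ k by omega] using hi.zero d (by omega)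
    · intro f f1 f2 f3
      rw [← hi.arr f f1 f2 f3]
      funext j
      rw [qA]
      simp [f1, f2, f3]
  have own : (∀ e < k, raw (l.getD e 0) ≠ raw x) →
      k ≤ k ∧ raw (l.getD k 0) = raw x ∧ (∀ e < k, raw (l.getD e 0) ≠ raw x) := fun hh =>
    ⟨le_rfl, rfl, hh⟩
  simp only [numberStep, vc, ↓reduceIte, Nat.reduceEqDiff, Nat.reduceLT, hi.r3, r4, e25, e2, x2, x3,
    and_true, and_false, false_and, true_and, if_true, if_false]
  refine ⟨by omega, by omega, by omega, by omega, fun hk0 => ⟨by omega, fun heq => ?_, fun hne => ?_⟩,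
    fun hk0 => ?_⟩
  · rw [if_neg (show ¬ k - 1 = k by omega)] at heq
    have h27 := hi.raws (k - 1) (by omega)
    obtain ⟨n1, n2, n3⟩ := hi.num (k - 1) (by omega)
    have heq' : raw x = raw (l.getD (k - 1) 0) := by
      rw [← h27]
      by_contra hcon
      rw [if_neg hcon] at heq
      exact heq rfl
    refine ⟨by omega, by omega, by omega, by omega, by omega, ?_⟩
    refine key _ (h.A 23 (k - 1)) ?_ ?_ ?_ ?_ ?_
    · simp
    · simp
    · simp [r4]
    · intro f j; simp
    · exact ⟨by omega, by rw [n2, heq'], fun e he => by rw [heq']; exact n3 e he⟩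
  · rw [if_neg (show ¬ k - 1 = k by omega)] at hne
    have h27 := hi.raws (k - 1) (by omega)
    have hne' : raw x ≠ raw (l.getD (k - 1) 0) := by
      rw [← h27]
      intro hcon
      rw [if_pos hcon] at hne
      omega
    refine ⟨by omega, by omega, by omega, by omega, ?_⟩
    refine key _ k ?_ ?_ ?_ ?_ (own ?_)
    · simp
    · simp
    · simp [r4]
    · intro f j; simp
    -- Characters come first in the order, so an earlier run with the same character would force the
    -- predecessor to have it as well.
    · intro e he heq
      have h1 := runKey_lt.1 (hs.getD_lt (show k - 1 < k by omega) hk)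
      rw [← hx] at h1
      rcases Nat.eq_or_lt_of_le (show e ≤ k - 1 by omega) with h2 | h2
      · exact hne' (by rw [← heq, h2])
      · have h3 := runKey_lt.1 (hs.getD_lt h2 (by omega))
        omega
  · refine ⟨by omega, by omega, by omega, by omega, ?_⟩
    refine key _ k ?_ ?_ ?_ ?_ (own ?_)
    · simp
    · simp
    · simp [r4]
    · intro f j; simp
    · intro e he; omega

theorem number_wp (hcap : 4 * Γ.m + 8 ≤ Γ.cap) (hB : 2 * Γ.cap + 64 < Γ.B)
    (hs : Srt (runKey raw ex) l) (hl : l.length ≤ Γ.m)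
    (hm : ∀ x ∈ l, x ≤ Γ.m ∧ h.A 25 x = raw x ∧ h.A 2 x = ex x) (h0 : h.r 0 = Γ.m)
    (h6 : h.r 6 < Γ.cap) (hlst : Lst (h.A 19) (h.A 20 (h.r 6)) l) (hz : ∀ d, h.A 23 d = 0) :
    wp Γ number h (fun h' t => t ≤ 8 * Γ.m + 3 ∧ NumInv Γ raw ex l l.length h h') := by
  simp only [number, vc, ↓reduceIte, Nat.reduceEqDiff, Nat.reduceLT]
  refine ⟨h6, ?_⟩
  refine wp_whl (fun h1 n => ∃ k, NumInv Γ raw ex l k h h1 ∧ n = (l.length - k) * 8)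
    (n := l.length * 8) ?_ ?_ ?_
  · rintro h1 n ⟨k, hi, rfl⟩
    simp only [vc, ↓reduceIte, Nat.reduceEqDiff, Nat.reduceLT]
    refine fun hv => ?_
    have hk : k < l.length := by
      by_contra hcon
      have := hi.lst
      rw [List.drop_of_length_le (by omega)] at this
      exact hv this
    refine wp_mono (numberStep_wp hcap hB hs hl hm hk hi) ?_
    rintro h' t ⟨ht, hi'⟩
    refine ⟨_, ⟨k + 1, hi', rfl⟩, ?_⟩
    omega
  · refine ⟨0, ⟨by omega, by simp, by simpa using h0, ?_, by simp, by simp, by simp, ?_, ?_⟩, by simp⟩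
    · simpa using hlst
    · intro d _; exact hz d
    · intro f _ _ _; rfl
  · rintro h' t n ⟨k, hi, rfl⟩ hv ht
    have hle := hi.le
    have hk : k = l.length := by
      by_contra hcon
      have h1 := hi.lst
      rw [List.drop_eq_getElem_cons (show k < l.length by omega)] at h1
      simp only [vc] at hv
      exact h1.2.1 (by rw [← h1.1, hv])
    subst hk
    exact ⟨by omega, hi⟩

/-- Binary search in the half-open interval from register `8` to register `9`, which always contains
the place `u` of the run. No pointers to the dropped duplicates are needed. -/
theorem locate_wp (hcap : 4 * Γ.m + 8 ≤ Γ.cap) (hB : 2 * Γ.cap + 64 < Γ.B)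
    (hs : Srt (runKey raw ex) l) (hl : l.length ≤ Γ.m)
    (hraw : ∀ d, 1 ≤ d → d ≤ Γ.m → h0.A 25 d = raw d ∧ h0.A 2 d = ex d)
    (hnum : ∀ d < l.length, h0.A 24 d = ex (l.getD d 0) ∧ h0.A 27 d = raw (l.getD d 0))
    (hcov : ∀ d, 1 ≤ d → d ≤ Γ.m → ∃ y ∈ l, runKey raw ex y = runKey raw ex d) {c0 : ℕ}
    (hlt : c0 < Γ.m + 1) (hi : RenInv Γ raw ex l c0 h0 h) :
    wp Γ locate h (fun h' t => t ≤ 4 * (Nat.log 2 l.length + 1) + 6 ∧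
      RenInv Γ raw ex l (c0 + 1) h0 h') := by
  have l1 := hi.one_le
  obtain ⟨y, hy, hky⟩ := hcov c0 l1 (by omega)
  obtain ⟨u, hu, rfl⟩ := List.getElem_of_mem hy
  have hgu : l.getD u 0 = l[u] := by
    simp [List.getD_eq_getElem?_getD, List.getElem?_eq_getElem hu]
  rw [← hgu] at hky
  obtain ⟨x1, x2⟩ := hraw c0 l1 (by omega)
  have e25 := hi.arr 25 (by omega) (by omega)
  have e2 := hi.arr 2 (by omega) (by omega)
  have e24 := hi.arr 24 (by omega) (by omega)
  have e27 := hi.arr 27 (by omega) (by omega)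
  simp only [locate, wp_seq, wp_asg, wp_sto]
  simp only [vc, ↓reduceIte, Nat.reduceEqDiff, Nat.reduceLT]
  refine wp_whl (fun h1 n => ∃ i, h1.r 8 ≤ u ∧ u < h1.r 9 ∧ h1.r 9 ≤ l.length ∧
    h1.r 9 - h1.r 8 ≤ 2 ^ i ∧ h1.A = h.A ∧ (∀ x, x < 8 ∨ 10 < x → h1.r x = h.r x) ∧ n = i * 4)
    (n := (Nat.log 2 l.length + 1) * 4) ?_ ?_ ?_
  · rintro h1 n ⟨i, a1, a2, a3, a4, a5, a6, rfl⟩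
    have r5 := a6 5 (by omega)
    simp only [vc, ↓reduceIte, Nat.reduceEqDiff, Nat.reduceLT]
    refine ⟨by omega, fun hv => ?_⟩
    have hlt' : h1.r 8 + 1 < h1.r 9 := by
      by_contra hcon; rw [if_neg hcon] at hv; exact hv rfl
    obtain ⟨i, rfl⟩ : ∃ i', i = i' + 1 := by
      cases i with
      | zero => simp at a4; omega
      | succ i => exact ⟨i, rfl⟩
    rw [pow_succ] at a4
    obtain ⟨mid, hmid⟩ : ∃ mid, mid = (h1.r 8 + h1.r 9) / 2 := ⟨_, rfl⟩
    obtain ⟨n1, n2⟩ := hnum mid (by omega)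
    simp only [searchStep, vc, ↓reduceIte, Nat.reduceEqDiff, Nat.reduceLT, a5, ← hmid, r5, hi.r5, e25,
      e2, e24, e27, x1, x2, n1, n2]
    -- The sum of the two tests is nonzero exactly when the run precedes the middle one
    -- lexicographically.
    have hcmp : ((if raw c0 < raw (l.getD mid 0) then 1 else 0) +
        (if raw c0 = raw (l.getD mid 0) then 1 else 0) *
          (if ex c0 < ex (l.getD mid 0) then 1 else 0) = 0) ↔
        ¬ runKey raw ex (l.getD u 0) < runKey raw ex (l.getD mid 0) := by
      rw [hky, runKey_lt]
      split_ifs <;> first | omega | (rw [false_iff, not_not]; omega)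
    rw [hcmp, not_not]
    refine ⟨by omega, ⟨by omega, ⟨by omega, by omega, by split_ifs <;> omega⟩, by split_ifs <;> omega⟩,
      fun hlt => ⟨_, ⟨i, ?_, ?_, ?_, ?_, ?_, rfl⟩, by omega⟩,
      fun hge => ⟨_, ⟨i, ?_, ?_, ?_, ?_, ?_, rfl⟩, by omega⟩⟩
    · exact a1
    · by_contra hcon
      rcases Nat.eq_or_lt_of_le (show mid ≤ u by omega) with h2 | h2
      · rw [h2] at hlt; exact lt_irrefl _ hlt
      · exact lt_asymm hlt (hs.getD_lt h2 hu)
    · omega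
    · omega
    · intro x hx
      rw [if_neg (by omega), if_neg (by omega)]
      exact a6 x hx
    · by_contra hcon
      exact hge (hs.getD_lt (by omega) (by omega))
    · exact a2
    · exact a3
    · omega
    · intro x hx
      rw [if_neg (by omega), if_neg (by omega)]
      exact a6 x hx
  · refine ⟨Nat.log 2 l.length + 1, by simp, by simpa [hi.r3] using hu, by simp [hi.r3], ?_, rfl, ?_,
      rfl⟩
    · simpa [hi.r3] using (Nat.lt_pow_succ_log_self (b := 2) (by norm_num) l.length).le
    · intro x hx
      simp only [vc]
      rw [if_neg (by omega), if_neg (by omega)]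
  · rintro h1 t n ⟨i, a1, a2, a3, a4, a5, a6, rfl⟩ hv ht
    simp only [vc, ↓reduceIte, Nat.reduceEqDiff, Nat.reduceLT] at hv ⊢
    have hu8 : h1.r 8 = u := by
      by_contra hcon
      rw [if_pos (by omega)] at hv
      omega
    rw [a6 5 (by omega), hi.r5, hu8, a5]
    refine ⟨by omega, by omega, by omega, by omega, by omega, ⟨by omega, by omega, ?_, ?_, ?_, ?_, ?_⟩⟩
    · simp only [vc, ↓reduceIte, Nat.reduceEqDiff]
      rw [a6 0 (by omega), hi.r0]
    · simp only [vc, ↓reduceIte, Nat.reduceEqDiff]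
      rw [a6 3 (by omega), hi.r3]
    · simp
    · intro c c1 c2
      by_cases hc : c = c0
      · subst hc
        simp only [vc, ↓reduceIte, Nat.reduceEqDiff, one_ne_zero, zero_ne_one, false_and, true_and,
          if_false, and_self, if_true, a5]
        exact ⟨hu, hky⟩
      · have := hi.num c c1 (by omega)
        simpa [hc, a5] using this
    · intro f f1 f2
      rw [← hi.arr f f1 f2]
      funext j
      simp [f1, f2, a5]

/-- Numbers below `s` denote runs and characters, so `s + 1` in front and `s` behind are two
distinct sentinels for both arrays. -/
theorem rename_wp (hcap : 4 * Γ.m + 8 ≤ Γ.cap) (hB : 2 * Γ.cap + 64 < Γ.B)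
    (hs : Srt (runKey raw ex) l) (hl : l.length ≤ Γ.m) (hl0 : 1 ≤ l.length)
    (hraw : ∀ d, 1 ≤ d → d ≤ Γ.m → h.A 25 d = raw d ∧ h.A 2 d = ex d)
    (hP : ∀ d, 1 ≤ d → d ≤ Γ.m + 1 → h.A 3 d = P d)
    (hz : ∀ f, 4 ≤ f → f ≤ 17 → ∀ j, h.A f j = 0)
    (hcov : ∀ d, 1 ≤ d → d ≤ Γ.m → ∃ y ∈ l, runKey raw ex y = runKey raw ex d)
    (hn : NumInv Γ raw ex l l.length h0 h) :
    wp Γ rename h (fun h' t => t ≤ Γ.m * (4 * (Nat.log 2 l.length + 1) + 7) + 7 ∧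
      Renamed Γ raw ex P l.length h') := by
  have hnum : ∀ d < l.length, h.A 24 d = ex (l.getD d 0) ∧ h.A 27 d = raw (l.getD d 0) :=
    fun d hd => ⟨hn.exs d hd, hn.raws d hd⟩
  simp only [rename, wp_seq, wp_asg, wp_sto]
  simp only [vc, ↓reduceIte, Nat.reduceEqDiff, Nat.reduceLT]
  refine wp_whl (fun h1 n => ∃ c0, RenInv Γ raw ex l c0 h h1 ∧
    n = (Γ.m + 1 - c0) * (4 * (Nat.log 2 l.length + 1) + 7))
    (n := Γ.m * (4 * (Nat.log 2 l.length + 1) + 7)) ?_ ?_ ?_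
  · rintro h1 n ⟨c0, hi, rfl⟩
    simp only [vc, ↓reduceIte, Nat.reduceEqDiff, Nat.reduceLT, hi.r0, hi.r5]
    refine ⟨by omega, fun hv => ?_⟩
    have hlt : c0 < Γ.m + 1 := by
      by_contra hcon; rw [if_neg hcon] at hv; exact hv rfl
    refine wp_mono (locate_wp hcap hB hs hl hraw hnum hcov hlt hi) ?_
    rintro h' t ⟨ht, hi'⟩
    refine ⟨_, ⟨c0 + 1, hi', rfl⟩, ?_⟩
    rw [show Γ.m + 1 - c0 = (Γ.m + 1 - (c0 + 1)) + 1 by omega, Nat.add_mul, one_mul]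
    omega
  · refine ⟨1, ⟨le_rfl, by omega, by simpa using hn.r0, by simpa using hn.r3, by simp, ?_, ?_⟩, by simp⟩
    · intro c c1 c2; omega
    · intro f _ _; rfl
  · rintro h1 t n ⟨c0, hi, rfl⟩ hv ht
    have hle := hi.le
    simp only [vc, ↓reduceIte, Nat.reduceEqDiff, Nat.reduceLT, hi.r0, hi.r5, hi.r3] at hv ⊢
    have hc : c0 = Γ.m + 1 := by
      by_contra hne
      rw [if_pos (by omega)] at hv
      omega
    subst hc
    have num := fun c c1 (c2 : c ≤ Γ.m) => hi.num c c1 (by omega)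
    have e23 := hi.arr 23 (by omega) (by omega)
    have e24 := hi.arr 24 (by omega) (by omega)
    obtain ⟨U, hU⟩ : ∃ U, U = h1.A 0 := ⟨_, rfl⟩
    rw [← hU] at num
    refine ⟨by omega, by omega, by omega, by omega, by omega, by omega, by omega, by omega,
      by omega, ?_⟩
    have key : ∀ (h' : HS), h'.r 0 = Γ.m → h'.r 2 = 0 →
        (∀ c, 1 ≤ c → c ≤ Γ.m → h'.A 0 c = U c) → (∀ c, 1 ≤ c → c ≤ Γ.m → h'.A 1 c = h.A 23 (U c)) →
        h'.A 0 0 = l.length + 1 → h'.A 0 (Γ.m + 1) = l.length → h'.A 1 0 = l.length + 1 →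
        h'.A 1 (Γ.m + 1) = l.length → (∀ f, f ≠ 0 → f ≠ 1 → h'.A f = h.A f) →
        Renamed Γ raw ex P l.length h' := by
      intro h' q0 q2 qU qC u0 um c0 cm qA
      have a23 := qA 23 (by omega) (by omega)
      have a24 := qA 24 (by omega) (by omega)
      refine ⟨q0, q2, ?_, u0, um, ?_, c0, cm, ?_, ?_, ?_, ?_, ?_, ?_, ?_⟩
      · intro c c1 c2; rw [qU c c1 c2]; exact (num c c1 c2).1
      · intro c c' c1 c2 c1' c2'
        obtain ⟨n1, n2, -⟩ := num c c1 c2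
        obtain ⟨n1', n2', -⟩ := num c' c1' c2'
        rw [qU c c1 c2, qU c' c1' c2', ← runKey_inj, ← n2, ← n2']
        exact ⟨fun hh => by rw [hh], fun hh => hs.getD_inj n1 n1' hh⟩
      · intro c c' c1 c2 c1' c2'
        obtain ⟨n1, n2, -⟩ := num c c1 c2
        obtain ⟨n1', n2', -⟩ := num c' c1' c2'
        rw [qC c c1 c2, qC c' c1' c2', ← (runKey_inj.1 n2).1, ← (runKey_inj.1 n2').1]
        obtain ⟨-, m2, m3⟩ := hn.num _ n1
        obtain ⟨-, m2', m3'⟩ := hn.num _ n1'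
        constructor
        · intro hh; rw [← m2, ← m2', hh]
        -- Each character number is the least place in the sorted list with this character, so runs
        -- with the same character get the same number.
        · intro hh
          rcases Nat.lt_trichotomy (h.A 23 (U c)) (h.A 23 (U c')) with h2 | h2 | h2
          · exact absurd (by rw [m2, hh]) (m3' _ h2)
          · exact h2
          · exact absurd (by rw [m2', hh]) (m3 _ h2)
      · intro c c1 c2; rw [qA 2 (by omega) (by omega)]; exact (hraw c c1 c2).2
      · intro c c1 c2; rw [qA 3 (by omega) (by omega)]; exact hP c c1 c2
      · intro c c1 c2; rw [qU c c1 c2, qC c c1 c2, a23]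
      · intro j
        rw [a23]
        rcases Nat.lt_or_ge j l.length with hj | hj
        · exact lt_of_le_of_lt (hn.num j hj).1 hj
        · rw [hn.zero j hj]; exact hl0
      · intro c c1 c2
        obtain ⟨n1, n2, -⟩ := num c c1 c2
        rw [qU c c1 c2, a24, hn.exs _ n1]
        exact (runKey_inj.1 n2).2
      · intro f f1 f2 j; rw [qA f (by omega) (by omega)]; exact hz f f1 f2 j
    refine key _ ?_ ?_ ?_ ?_ ?_ ?_ ?_ ?_ ?_
    · simpa using hi.r0
    · simp
    · intro c c1 c2; simp [show c ≠ 0 by omega, show c ≠ Γ.m + 1 by omega, hU]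
    · intro c c1 c2
      have := (num c c1 c2).2.2
      simp [show c ≠ 0 by omega, show c ≠ Γ.m + 1 by omega, this, e23]
    · simp
    · simp
    · simp
    · simp
    · intro f f1 f2
      funext j
      rw [← hi.arr f f1 f2]
      simp [f1, f2]

end

end RLEMups

/-! ### The whole program -/

namespace RLEMups

/-- The program. -/
def mups : HP :=
  load ;; sort ;; number ;; rename ;; eer ;; .asg 3 (AR 0 (R 0 + 1)) ;; centres ;; nodes ;; firsts ;;
  outputs

section
variable {Γ : Cx} {raw ex P : ℕ → ℕ} {n s b : ℕ} {a : ℕ → ℕ} {h h' : HS}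

theorem Renamed.ectx (hr : Renamed Γ raw ex P s h) (hcap : 4 * Γ.m + 8 ≤ Γ.cap)
    (hB : 2 * Γ.cap + 64 < Γ.B) (hb : 2 * s + 2 ≤ 2 ^ b) (hs : s ≤ Γ.m) : ECtx Γ (h.A 0) b := by
  have le : ∀ j, j ≤ Γ.m + 1 → h.A 0 j ≤ s + 1 := by
    intro j hj
    rcases Nat.eq_zero_or_pos j with rfl | hpos
    · exact hr.U_zero.le
    · rcases Nat.eq_or_lt_of_le hj with rfl | hlt
      · rw [hr.U_last]; omega
      · have := hr.U_lt j hpos (by omega); omega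
  refine ⟨hcap, hB, ?_, ?_, ?_, ?_⟩
  · intro j j1 j2
    rw [hr.U_zero]
    rcases Nat.eq_or_lt_of_le j2 with rfl | hlt
    · rw [hr.U_last]; omega
    · have := hr.U_lt j j1 (by omega); omega
  · intro j j1 j2
    rw [hr.U_last]
    exact (hr.U_lt j j1 j2).ne
  · intro j hj; have := le j hj; omega
  · intro j hj; have := le j hj; omega

theorem Renamed.base (hr : Renamed Γ raw ex P s h) (hE : ECtx Γ (h.A 0) b)
    (hb : 2 * s + 2 ≤ 2 ^ b) (hs : s ≤ Γ.m) (hn : n + 1 < Γ.B)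
    (hrd : RD n Γ.m a (h.A 1) ex P (h.A 0)) {hw : ℕ → List ℕ}
    (hi : EInv Γ (h.A 0) b (Γ.m + 2) hw h h') (h10 : h'.A 10 (h'.r 6) = 1) :
    Base Γ n a (h.A 0) (h.A 1) ex P b s (h'.r 2) hw h'.A := by
  have e : ∀ f, f < 4 ∨ 11 < f → h'.A f = h.A f := hi.arr
  have hcard := hi.card
  have ch_lt : ∀ c, 1 ≤ c → c ≤ Γ.m → h.A 1 c < s := fun c c1 c2 => by
    rw [← hr.a23 c c1 c2]; exact hr.a23_lt _
  refine ⟨hE, hrd, hi.eer, hi.dict, by omega, ?_, hr.U_lt, hr.U_last, ch_lt, hr.ch_zero, hr.ch_last,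
    ?_, ?_, ?_, ?_, ?_, ?_, hb, hs, ?_, hn⟩
  · intro c c1 c2
    exact hi.nod c c1 (by omega)
  · intro c _; rw [e 1 (by omega)]
  · intro c c1 c2; rw [e 2 (by omega)]; exact hr.a2 c c1 c2
  · intro c c1 c2; rw [e 3 (by omega)]; exact hr.a3 c c1 c2
  · intro c c1 c2; rw [e 23 (by omega)]; exact hr.a23 c c1 c2
  · intro j; rw [e 23 (by omega)]; exact hr.a23_lt j
  · intro c c1 c2; rw [e 24 (by omega)]; exact hr.a24 c c1 c2
  · intro f f1 f2 j; rw [e f (by omega)]; exact hr.zero f (by omega) f2 j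

/-- The tree and everything after it. -/
theorem tree_wp (hr : Renamed Γ raw ex P s h) (hcap : 4 * Γ.m + 8 ≤ Γ.cap)
    (hB : 2 * Γ.cap + 64 < Γ.B) (hb : 2 * s + 2 ≤ 2 ^ b) (hs : s ≤ Γ.m) (hn : n + 1 < Γ.B)
    (hrd : RD n Γ.m a (h.A 1) ex P (h.A 0)) :
    wp Γ (eer ;; .asg 3 (AR 0 (R 0 + 1)) ;; centres ;; nodes ;; firsts ;; outputs) h (fun h' t =>
      t ≤ (Γ.m + 1) * (16 * b + 200) + 18 ∧ ∃ L : List (ℕ × ℕ),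
        h'.r 10 = L.length ∧ L.length ≤ Γ.m ∧
        (∀ t (ht : t < L.length), h'.io (2 * t) = L[t].1 ∧ h'.io (2 * t + 1) = L[t].2) ∧
        L.Pairwise (fun p q => p.1 < q.1) ∧ ∀ i j, (i, j) ∈ L ↔ MUPS n a i j) := by
  have hE := hr.ectx hcap hB hb hs
  rw [wp_seq]
  refine wp_mono (eer_wp hE hr.r0 hr.r2 (fun _ _ => rfl)
    (fun f f1 f2 => hr.zero f f1 (by omega))) ?_
  rintro h1 t1 ⟨⟨hw, hi, h10⟩, ht1⟩
  have H := hr.base hE hb hs hn hrd hi h10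
  have hN := H.N_le
  have e0 := hi.arr 0 (by omega)
  rw [wp_seq, wp_asg]
  simp only [vc, Nat.reduceEqDiff, Nat.reduceLT, hi.r0, e0, hr.U_last]
  refine ⟨by omega, ?_⟩
  refine wp_mono (centres_wp H (h := h1.set 3 s) rfl (by simpa using hi.r0) (by simp) (by simp)) ?_
  rintro h2 t2 ⟨ht2, hc⟩
  refine wp_mono (nodes_wp H hc) ?_
  rintro h3 t3 ⟨ht3, hnv⟩
  refine wp_mono (firsts_wp H (hnv.gInv H) ?_ hnv.io) ?_
  · intro v
    rw [hnv.arr 16 (by omega) (by omega) (by omega) (by omega) (by omega) (by omega)]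
    exact H.zero 16 (by omega) (by omega) v
  rintro h4 t4 ⟨ht4, hf⟩
  refine wp_mono (outputs_wp H hf) ?_
  rintro h5 t5 ⟨ht5, L, hL⟩
  have hlen := hL.len
  refine ⟨?_, L, hL.r10, by omega, hL.out, hL.sorted, hL.mem_iff H⟩
  have q3 : h1.r 2 * (4 * b + 32) ≤ (Γ.m + 1) * (4 * b + 32) := Nat.mul_le_mul_right _ hN
  have q1 : (Γ.m + 1) * (8 * b + 92) + Γ.m * (4 * b + 39) + (Γ.m + 1) * (4 * b + 32) +
      22 * (Γ.m + 1) ≤ (Γ.m + 1) * (16 * b + 200) := by nlinarith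
  omega

theorem preLen_le {α : Type*} {R : List (α × ℕ)} {S : List α} (h : IsRLE R S) (c : ℕ) :
    preLen R c ≤ S.length := by
  rw [← h.expand, List.length_flatMap]
  have : (R.map fun r => (List.replicate r.2 r.1).length) = R.map Prod.snd := by
    apply List.map_congr_left; intro r _; simp
  rw [this, preLen]
  exact ((List.take_sublist c R).map Prod.snd).sum_le_sum fun _ _ => Nat.zero_le _

theorem IsRLE.length_le {α : Type*} {R : List (α × ℕ)} {S : List α} (h : IsRLE R S) :
    R.length ≤ S.length := by
  rw [← h.expand, List.length_flatMap]
  have := List.length_le_sum_of_one_le (R.map fun r => (List.replicate r.2 r.1).length) (by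
    intro i hi
    obtain ⟨r, hr, rfl⟩ := List.mem_map.1 hi
    simpa using h.pos r hr)
  simpa using this

theorem mups_wp {σ : ℕ} {S : List (Fin σ)} {R : List (Fin σ × ℕ)} (hS : S ≠ []) (hR : IsRLE R S)
    (hm : Γ.m = R.length) (hcap : 4 * Γ.m + 8 ≤ Γ.cap) (hB : 2 * Γ.cap + 64 < Γ.B)
    (hn : S.length + 1 < Γ.B) (h0 : h.r 0 = Γ.m) (hz : ∀ f j, h.A f j = 0)
    (hio : ∀ d r, R[d]? = some r → h.io (2 * d) = (r.1 : ℕ) ∧ h.io (2 * d + 1) = r.2) :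
    wp Γ mups h (fun h' t => t ≤ 1000 * Γ.m * (Nat.log 2 R.toFinset.card + 1) ∧
      ∃ L : List (ℕ × ℕ), IsMUPSList S L ∧ h'.r 10 = L.length ∧ L.length ≤ Γ.m ∧
        ∀ t (ht : t < L.length), h'.io (2 * t) = L[t].1 ∧ h'.io (2 * t + 1) = L[t].2) := by
  obtain ⟨raw, hraw⟩ : ∃ raw : ℕ → ℕ, ∀ c r, R[c]? = some r → raw (c + 1) = (r.1 : ℕ) :=
    ⟨fun d => R[d - 1]?.elim 0 fun r => (r.1 : ℕ), fun c r hc => by simp [hc]⟩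
  obtain ⟨ex, hex⟩ : ∃ ex : ℕ → ℕ, ∀ c r, R[c]? = some r → ex (c + 1) = r.2 :=
    ⟨fun d => R[d - 1]?.elim 0 fun r => r.2, fun c r hc => by simp [hc]⟩
  have get : ∀ d, 1 ≤ d → d ≤ Γ.m → ∃ c r, d = c + 1 ∧ R[c]? = some r := fun d d1 d2 =>
    ⟨d - 1, R[d - 1], by omega, List.getElem?_eq_getElem (by omega)⟩
  have hm1 : 1 ≤ Γ.m := by
    rw [hm]
    rcases List.eq_nil_or_concat R with rfl | ⟨R', r, rfl⟩
    · exact absurd hR.expand.symm hS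
    · simp
  have hcard : ((Finset.Icc 1 Γ.m).image (runKey raw ex)).card = R.toFinset.card := by
    -- The sorting bound counts keys of positions, the theorem counts distinct pairs of the
    -- encoding; the passage from pairs to keys is injective.
    have hinj : Function.Injective (fun r : Fin σ × ℕ => toLex ((r.1 : ℕ), r.2)) := by
      rintro ⟨r1, r2⟩ ⟨r1', r2'⟩ hh
      simp only [EmbeddingLike.apply_eq_iff_eq, Prod.mk.injEq] at hh
      rw [Prod.mk.injEq]
      exact ⟨Fin.ext hh.1, hh.2⟩
    rw [← Finset.card_image_of_injective R.toFinset hinj]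
    congr 1
    ext y
    simp only [Finset.mem_image, Finset.mem_Icc, List.mem_toFinset]
    constructor
    · rintro ⟨d, ⟨d1, d2⟩, rfl⟩
      obtain ⟨c, r, rfl, hc⟩ := get d d1 d2
      exact ⟨r, List.mem_of_getElem? hc, by rw [runKey, hraw c r hc, hex c r hc]⟩
    · rintro ⟨r, hr, rfl⟩
      obtain ⟨c, hc, rfl⟩ := List.getElem_of_mem hr
      have hc' : R[c]? = some R[c] := List.getElem?_eq_getElem hc
      exact ⟨c + 1, ⟨by omega, by omega⟩, by rw [runKey, hraw c _ hc', hex c _ hc']⟩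
  rw [mups, wp_seq]
  refine wp_mono (load_wp (raw := raw) (ex := ex) (P := fun c => preLen R (c - 1)) hcap hB h0 hz ?_ ?_
    ?_) ?_
  · intro d hd
    have hc : R[d]? = some R[d] := List.getElem?_eq_getElem (by omega)
    rw [hraw d _ hc, hex d _ hc]
    exact hio d _ hc
  · simp [preLen]
  · intro d d1 d2
    obtain ⟨c, r, rfl, hc⟩ := get d d1 d2
    have := preLen_le hR (c + 1)
    refine ⟨?_, by simp only [Nat.add_sub_cancel]; omega⟩
    rw [hex c r hc]
    exact preLen_succ hc
  rintro h1 t1 ⟨ht1, hl, h6, h7⟩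
  rw [wp_seq]
  refine wp_mono (sort_wp hcap hB hm1 hl h6 h7) ?_
  rintro h2 t2 ⟨ht2, l, hq⟩
  have hsrt := hq.srt l (by simp)
  have hmem : ∀ x ∈ l, 1 ≤ x ∧ x ≤ Γ.m := fun x hx => hq.mem x (by simpa using hx)
  have hs := hsrt.length_le hmem
  have hsm : l.length ≤ Γ.m := hs.trans (Finset.card_image_le.trans (by simp))
  rw [hcard] at hs ht2
  have hcov : ∀ d, 1 ≤ d → d ≤ Γ.m → ∃ y ∈ l, runKey raw ex y = runKey raw ex d := fun d d1 d2 => by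
    simpa using hq.cover d d1 d2
  have hl1 : 1 ≤ l.length := by
    obtain ⟨y, hy, -⟩ := hcov 1 le_rfl hm1
    exact List.length_pos_of_mem hy
  have hkeys : ∀ d, 1 ≤ d → d ≤ Γ.m → h2.A 25 d = raw d ∧ h2.A 2 d = ex d := fun d d1 d2 => by
    rw [hq.arr 25 (by omega) (by omega), hq.arr 2 (by omega) (by omega)]
    exact ⟨hl.raw d d1 (by omega), hl.ex d d1 (by omega)⟩
  have hzero : ∀ f, f ≠ 2 → f ≠ 3 → f ≠ 19 → f ≠ 20 → f ≠ 25 → ∀ j, h2.A f j = 0 :=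
    fun f f1 f2 f3 f4 f5 j => by
      rw [hq.arr f f3 f4]; exact hl.zero f f1 f2 f4 f5 j
  rw [wp_seq]
  have hlen := hq.len
  have hbd := hq.bound
  simp only [List.length_singleton] at hlen hbd
  refine wp_mono (number_wp hcap hB hsrt hsm
    (fun x hx => ⟨(hmem x hx).2, hkeys x (hmem x hx).1 (hmem x hx).2⟩)
    (by rw [hq.reg 0 (by omega), hl.r0]) (by omega) (by simpa using hq.head 0 l (by simp))
    (hzero 23 (by omega) (by omega) (by omega) (by omega) (by omega))) ?_
  rintro h3 t3 ⟨ht3, hnum⟩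
  rw [wp_seq]
  refine wp_mono (rename_wp (P := fun c => preLen R (c - 1)) hcap hB hsrt hsm hl1 ?_ ?_ ?_ hcov hnum) ?_
  · intro d d1 d2
    rw [hnum.arr 25 (by omega) (by omega) (by omega), hnum.arr 2 (by omega) (by omega) (by omega)]
    exact hkeys d d1 d2
  · intro d d1 d2
    rw [hnum.arr 3 (by omega) (by omega) (by omega), hq.arr 3 (by omega) (by omega)]
    exact hl.pos d d1 d2
  · intro f f1 f2 j
    rw [hnum.arr f (by omega) (by omega) (by omega)]
    exact hzero f (by omega) (by omega) (by omega) (by omega) (by omega) j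
  rintro h4 t4 ⟨ht4, hr⟩
  have bnd : ∀ c r, R[c]? = some r → c + 1 ≤ Γ.m := fun c r hc => by
    have := (List.getElem?_eq_some_iff.1 hc).1
    omega
  obtain ⟨a, hrd, ha⟩ := IsRLE.exists_rd hR hm.symm (ch := h4.A 1) (U := h4.A 0)
    (P := fun c => preLen R (c - 1)) hex (fun _ _ => rfl)
    (fun c c' r r' hc hc' => by
      rw [hr.ch_iff _ _ (by omega) (bnd c r hc) (by omega) (bnd c' r' hc'), hraw c r hc,
        hraw c' r' hc', Fin.val_inj])
    (fun c c' r r' hc hc' => by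
      rw [hr.U_iff _ _ (by omega) (bnd c r hc) (by omega) (bnd c' r' hc'), hraw c r hc,
        hraw c' r' hc', hex c r hc, hex c' r' hc', Fin.val_inj, Prod.ext_iff])
  have hpow := Nat.lt_pow_succ_log_self (b := 2) (by norm_num) l.length
  have hlog : Nat.log 2 l.length ≤ Nat.log 2 R.toFinset.card := Nat.log_mono_right hs
  -- The keys are below `2 * s + 2`: run numbers and sentinels up to `s + 1`, and group keys from `s
  -- + 2` on. So `log s + 2` bits suffice.
  refine wp_mono (tree_wp (b := Nat.log 2 l.length + 2) hr hcap hB ?_ hsm hn hrd) ?_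
  · rw [show Nat.log 2 l.length + 2 = Nat.log 2 l.length + 1 + 1 by ring, pow_succ]
    omega
  rintro h5 t5 ⟨ht5, L, q1, q2, q3, q4, q5⟩
  refine ⟨?_, L, ⟨q4, fun i j => by rw [q5, ha.isMUPS_iff]⟩, q1, q2, q3⟩
  have hqc := queueCost_le Γ.m R.toFinset.card
  generalize Nat.log 2 R.toFinset.card = lg at *
  generalize Nat.log 2 l.length = lg' at *
  have e1 : Γ.m * (4 * (lg' + 1) + 7) ≤ Γ.m * (4 * (lg + 1) + 7) := Nat.mul_le_mul_left _ (by omega)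
  have e2 : (Γ.m + 1) * (16 * (lg' + 2) + 200) ≤ (2 * Γ.m) * (16 * (lg + 2) + 200) :=
    Nat.mul_le_mul (by omega) (by omega)
  have : t1 + (t2 + (t3 + (t4 + t5))) ≤ 6 * Γ.m + 4 + (7 * Γ.m * (lg + 1) + 51 * Γ.m + 1) +
    (8 * Γ.m + 3) + (Γ.m * (4 * (lg + 1) + 7) + 7) + ((2 * Γ.m) * (16 * (lg + 2) + 200) + 18) := by
    omega
  nlinarith [Nat.zero_le (Γ.m * lg)]

end

end RLEMups

/-! ### The word-RAM program and its constant -/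

namespace RLEMups

open WordRAM

/-- The word-RAM program. -/
def prog : Prog := .seq mups.comp (.seq (.assign 0 (.reg 10)) (.assign 1 (.lit 0)))

theorem flatMap_getD {α : Type*} (f g : α → ℕ) : ∀ (R : List α) (d : ℕ) (r : α), R[d]? = some r →
    (R.flatMap fun r => [f r, g r]).getD (2 * d) 0 = f r ∧
    (R.flatMap fun r => [f r, g r]).getD (2 * d + 1) 0 = g r
  | [], d, r, h => by simp at h
  | x :: R, 0, r, h => by
    simp only [List.getElem?_cons_zero, Option.some.injEq] at h
    subst h
    simp
  | x :: R, d + 1, r, h => by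
    have := flatMap_getD f g R d r (by simpa using h)
    simpa [Nat.mul_add] using this

end RLEMups

open RLEMups in
theorem mainTheorem6 :
    ∃ (p : WordRAM.Prog) (C : ℕ),
      ∀ (σ : ℕ) (S : List (Fin σ)) (R : List (Fin σ × ℕ)) (w : ℕ),
        S ≠ [] → IsRLE R S → σ ≤ 2 ^ w → C * S.length < 2 ^ w →
          ∃ (L : List (ℕ × ℕ)) (s : WordRAM.State) (t : ℕ),
            IsMUPSList S L ∧
            WordRAM.Exec w (C * R.length) p (WordRAM.input R) s t ∧
            WordRAM.IsOutput (C * R.length) s L ∧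
            (t : ℝ) ≤ C * (R.length * max 1 (Real.logb 2 R.toFinset.card)) := by
  obtain ⟨K, hK⟩ : ∃ K, mups.stepCost = K := ⟨_, rfl⟩
  -- For time, `1000 * K` is doubled when the rounded logarithm plus one is replaced by `max 1 (logb
  -- 2 _)`. For space, `2 * m + 32 * (4 * m + 8)` is at most `386 * m`; the summand `1000` covers
  -- this, the final assignments and the bounds on the word size.
  obtain ⟨C, hC⟩ : ∃ C, C = 2000 * K + 1000 := ⟨_, rfl⟩
  refine ⟨prog, C, fun σ S R w hS hR _ hw => ?_⟩
  have hmn : R.length ≤ S.length := RLEMups.IsRLE.length_le hR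
  have hm1 : 1 ≤ R.length := by
    rcases List.eq_nil_or_concat R with rfl | ⟨R', r, rfl⟩
    · exact absurd hR.expand.symm hS
    · simp
  have hc : 1000 ≤ C := by omega
  have hw1 : 1000 * S.length < 2 ^ w := lt_of_le_of_lt (Nat.mul_le_mul_right _ hc) hw
  have hM : C * R.length < 2 ^ w := lt_of_le_of_lt (Nat.mul_le_mul_left _ hmn) hw
  have hM1 : 1000 * R.length ≤ C * R.length := Nat.mul_le_mul_right _ hc
  have hsp : 2 * R.length + 32 * (4 * R.length + 8) ≤ C * R.length := by linarith
  have h64 : 64 < 2 ^ w := by linarith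
  -- The tree has at most `m + 1` nodes, and each node and each centre creates at most one group; so
  -- `3 * m + 2` entries and the queue of `2 * m` places fit.
  let Γ : Cx := ⟨R.length, 2 ^ w, 4 * R.length + 8⟩
  let io : ℕ → ℕ := fun i => (R.flatMap fun r => [(r.1 : ℕ), r.2]).getD i 0
  let h : HS := ⟨fun x => if x = 0 then R.length else 0, fun _ _ => 0, io⟩
  have hlen : (R.flatMap fun r => [(r.1 : ℕ), r.2]).length = 2 * R.length := by
    simp [List.length_flatMap, mul_comm]
  have hrep : Rep Γ h (WordRAM.input R) := by
    refine ⟨rfl, rfl, fun _ _ => rfl, fun f hf j hj => ?_⟩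
    show (R.flatMap fun r => [(r.1 : ℕ), r.2]).getD (2 * R.length + 32 * j + f) 0 = 0
    rw [List.getD_eq_getElem?_getD, List.getElem?_eq_none (by rw [hlen]; omega), Option.getD_none]
  obtain ⟨h', t, hex, ht, L, hL, q1, q2, q3⟩ := mups_wp (Γ := Γ) (h := h) hS hR rfl le_rfl
    (show 2 * (4 * R.length + 8) + 64 < 2 ^ w by omega) (show S.length + 1 < 2 ^ w by omega) rfl
    (fun _ _ => rfl) (fun d r hd => flatMap_getD (fun r : Fin σ × ℕ => (r.1 : ℕ)) Prod.snd R d r hd)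
  obtain ⟨s, t', hs, ht', hr⟩ := hex.comp (w := w) (M := C * R.length) rfl
    hsp hM h64 hrep
  change L.length ≤ R.length at q2
  rw [hK] at ht'
  -- Register `0` must keep `m` as long as array addresses are computed; only at the end does it
  -- receive the length of the list, and register `1` the address `0` of the output.
  refine ⟨L, _, _, hL, .seq _ _ _ _ _ _ _ hs (.seq _ _ _ _ _ _ _ (.assign s 0 (.reg 10) _ rfl)
    (.assign _ 1 (.lit 0) _ rfl)), ⟨?_, ?_, ?_⟩, ?_⟩
  · simp [hr.reg, q1]
  · simp; omega
  · intro u hu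
    simp only [Function.update_self, Nat.zero_mod, zero_add]
    rw [hr.io _ (show 2 * u < 2 * R.length by omega), hr.io _ (show 2 * u + 1 < 2 * R.length by omega)]
    exact q3 u hu
  · have hx : ((Nat.log 2 R.toFinset.card : ℕ) : ℝ) ≤ Real.logb 2 R.toFinset.card :=
      Real.natLog_le_logb _ _
    set X := max 1 (Real.logb 2 R.toFinset.card) with hX
    have h1 : (1 : ℝ) ≤ X := le_max_left _ _
    have h2 : Real.logb 2 R.toFinset.card ≤ X := le_max_right _ _
    -- Both the rounded logarithm and the extra `1` are at most `X`; the latter also makes the bound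
    -- valid for a single run, where the logarithm vanishes.
    have h3 : ((Nat.log 2 R.toFinset.card + 1 : ℕ) : ℝ) ≤ 2 * X := by push_cast; linarith
    have h4 : (t' : ℝ) ≤ K * (1000 * R.length * (2 * X)) := by
      have h5 : (t' : ℝ) ≤ ((K * (1000 * R.length * (Nat.log 2 R.toFinset.card + 1)) : ℕ) : ℝ) := by
        exact_mod_cast ht'.trans (Nat.mul_le_mul_left _ ht)
      refine h5.trans ?_
      rw [Nat.cast_mul, Nat.cast_mul, Nat.cast_mul]
      gcongr
      norm_num
    have h5 : (1 : ℝ) ≤ R.length * X := by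
      have : (1 : ℝ) ≤ R.length := by exact_mod_cast hm1
      nlinarith
    simp only [WordRAM.Exp.cost, hC]
    push_cast
    nlinarith
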